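/- Let $\mathbb T=\mathbb R/2\pi\mathbb Z$, $\langle x\rangle=(1+x^2)^{1/2}$, $f_k=\int_{\mathbb T}f(x)e^{-ikx}dx$, let $D^s$ be the Fourier multiplier with symbol $|k|^s$, and for $g\in C^\infty(\mathbb T;\mathbb R)$ with $g\ge 0$ and $\int_{\mathbb T}g=1$ put $Gh=g\,\bigl(h-\int_{\mathbb T}gh\bigr)$. For $u\in L^2(\mathbb R\times\mathbb T)$ with $\int_{\mathbb T}u(t,x)\,dx=0$ for a.e. $t$, let $\hat u_k(\tau)=\int_{\mathbb R}u_k(t)e^{-it\tau}dt$ (in the $L^2$ sense), and for $b>\tfrac12$ let $$\|u\|_{Z^b}=\Bigl\|\langle k\rangle^{\beta/2}\Bigl\langle\frac{\tau+k|k|^\alpha}{\langle k\rangle^\beta}\Bigr\rangle^{b}\hat u_k(\tau)\Bigr\|_{L^2_\tau\ell^2_k(\mathbb R\times(\mathbb Z\setminus\{0\}))},$$ $$\|v\|_{Z^b_T}=\inf\{\|u\|_{Z^b}:u=v\text{ a.e. on }[0,T]\}.$$ Let $Z^b_T$ be the space of those $v$ with $\|v\|_{Z^b_T}<\infty$. **Theorem.**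 Let $\alpha\in(1,2]$ and $2-\alpha<\beta<\alpha$. There is $b_0>\tfrac12$, depending only on $\alpha$ and $\beta$, such that for every $b\in(\tfrac12,b_0)$ the following holds. (i) $Z^b_T$ embeds continuously in $C([0,T];L^2(\mathbb T))$ for every $T>0$: every $v\in Z^b_T$ agrees a.e. on $[0,T]$ with a function continuous into $L^2(\mathbb T)$, whose supremum norm on $[0,T]$ is at most $C\|v\|_{Z^b_T}$, with $C$ independent of $T$ and $v$. (ii) For every $g$ as above, every $T>0$ and every real-valued $v_0\in L^2(\mathbb T)$ with $\int_{\mathbb T}v_0=0$, the problem $$\partial_tv+D^\alpha\partial_xv+GD^\beta Gv=\partial_x(v^2),\qquad v|_{t=0}=v_0,$$ has exactly one solution $v\in Z^b_T\subset C([0,T];L^2(\mathbb T))$ on $[0,T]$, and $v$ is real-valued. Here a solution is a $v$ such that for all $\varphi\in C^\infty(\mathbb T;\mathbb C)$ and $t\in[0,T]$ $$\int_{\mathbb T}v(t)\varphi=\int_{\mathbb T}v_0\varphi+\int_0^t\!\int_{\mathbb T}\bigl(v\,D^\alpha\partial_x\varphi-v\,GD^\beta G\varphi-v^2\,\partial_x\varphi\bigr)\,dx\,ds,$$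 with $v|_{t=0}=v_0$. (iii) For all such $g$ and $T$, the solution map $v_0\mapsto v$ is uniformly continuous, from every bounded subset of the real-valued mean-zero functions in $L^2(\mathbb T)$ to $C([0,T];L^2(\mathbb T))$. -/

import Mathlib

open MeasureTheory Set
open scoped ContDiff FourierTransform

noncomputable section

namespace DGBO

instance factTwoPiPos : Fact (0 < 2 * Real.pi) := ⟨Real.two_pi_pos⟩

/-- The torus `ℝ / 2πℤ`; its `volume` is the Lebesgue measure of total mass `2π`. -/
abbrev Torus : Type := AddCircle (2 * Real.pi)

/-- The Hilbert space `L²(𝕋; ℂ)`. -/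
abbrev L2T : Type := Lp ℂ 2 (volume : Measure Torus)

/-- The Hilbert space `L²(ℝ; L²(𝕋))`, that is, `L²(ℝ × 𝕋)`. -/
abbrev L2L2 : Type := Lp L2T 2 (volume : Measure ℝ)

/-- Fourier coefficient `f_k = ∫_𝕋 f(x) e^{-ikx} dx` (not normalised). -/
def fc (f : Torus → ℂ) (k : ℤ) : ℂ := ∫ x : Torus, f x * fourier (-k) x

/-- Smoothness of a function on the torus, as smoothness of its `2π`-periodic lift. -/
def SmoothT {E : Type*} [NormedAddCommGroup E] [NormedSpace ℝ E] (φ : Torus → E) : Prop :=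
  ContDiff ℝ ∞ (fun x : ℝ => φ (x : Torus))

/-- The Fourier multiplier with symbol `m` (used on smooth functions and symbols of polynomial
growth): `φ ↦ (1/2π) ∑ₖ m(k) φ_k e^{ikx}`. -/
def fourierMult (m : ℤ → ℂ) (φ : Torus → ℂ) (x : Torus) : ℂ :=
  (2 * Real.pi : ℂ)⁻¹ * ∑' k : ℤ, m k * fc φ k * fourier k x

/-- The symbol `|k|^s` of `D^s`. -/
def absSymbol (s : ℝ) (k : ℤ) : ℂ := ((|(k : ℝ)| ^ s : ℝ) : ℂ)

/-- The symbol `ik` of `∂ₓ`. -/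
def derivSymbol (k : ℤ) : ℂ := Complex.I * (k : ℂ)

/-- The localisation operator `G h = g (h - ∫ g h)`. -/
def opG (g : Torus → ℝ) (h : Torus → ℂ) (x : Torus) : ℂ :=
  (g x : ℂ) * (h x - ∫ y : Torus, (g y : ℂ) * h y)

/-- The operator `∂ₓ` on smooth functions. -/
def dx (φ : Torus → ℂ) : Torus → ℂ := fourierMult derivSymbol φ

/-- The operator `D^s` on smooth functions. -/
def fracD (s : ℝ) (φ : Torus → ℂ) : Torus → ℂ := fourierMult (absSymbol s) φ

/-- The operator `D^α ∂ₓ` on smooth functions. -/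
def fracDdx (α : ℝ) (φ : Torus → ℂ) : Torus → ℂ :=
  fourierMult (fun k => absSymbol α k * derivSymbol k) φ

/-- The Japanese bracket `⟨x⟩ = (1 + x²)^{1/2}`. -/
def bracket (x : ℝ) : ℝ := Real.sqrt (1 + x ^ 2)

/-- The dispersion symbol `L_k = k |k|^α`; `D^α ∂ₓ` has symbol `i L_k`. -/
def dispSymbol (α : ℝ) (k : ℤ) : ℝ := (k : ℝ) * |(k : ℝ)| ^ α

/-- The dissipation-normalised Bourgain weight. The free evolution is `e^{-i L_k t}`; with the
convention `û(τ) = ∫ u(t) e^{-itτ} dt` it has the time frequency `τ = -L_k`, whence `τ + L_k`. -/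
def zWeight (α β b : ℝ) (k : ℤ) (τ : ℝ) : ℝ :=
  bracket k ^ (if |b| < 1 / 2 then b * β else Real.sign b * (β / 2)) *
    bracket ((τ + dispSymbol α k) / bracket k ^ β) ^ b

/-- The space-time Fourier transform `û_k(τ) = ∫_ℝ ∫_𝕋 u(t,x) e^{-i(kx + tτ)} dx dt`. Mathlib's `𝓕`
has the kernel `e^{-2πi tξ}`, so that `ξ = τ / 2π`. -/
def stFourier (u : L2L2) (k : ℤ) (τ : ℝ) : ℂ :=
  fc ((𝓕 u : L2L2) (τ / (2 * Real.pi))) k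

/-- The norm of `Z^b` (possibly infinite), of a function in `L²(ℝ × 𝕋)`; for `b ≥ 0` every
element of `Z^b` is such a function. -/
def zNorm (α β b : ℝ) (u : L2L2) : ENNReal :=
  (∑' k : {k : ℤ // k ≠ 0}, ∫⁻ τ : ℝ,
    (ENNReal.ofReal (zWeight α β b k τ) * ‖stFourier u k τ‖ₑ) ^ 2) ^ (1 / 2 : ℝ)

/-- `u` has zero mean in space at almost every time; the norm of `Z^b` only sees the
frequencies `k ≠ 0`, and `Z^b` consists of such functions. -/
def MeanZeroAE (u : L2L2) : Prop := ∀ᵐ t : ℝ, fc (u t) 0 = 0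

/-- The norm of the restriction space `Z^b_T`: the infimum of the `Z^b` norms of all
extensions of `v|_[0,T]` (infinite if there is no extension in `Z^b`). -/
def zTNorm (α β b T : ℝ) (v : ℝ → L2T) : ENNReal :=
  ⨅ u ∈ {u : L2L2 | MeanZeroAE u ∧ ∀ᵐ t ∂(volume.restrict (Icc 0 T)), u t = v t}, zNorm α β b u

/-- Membership of `v|_[0,T]` in `Z^b_T`. -/
def MemZT (α β b T : ℝ) (v : ℝ → L2T) : Prop := zTNorm α β b T v < ⊤

/-- `f` is real-valued. -/
def IsRealValued (f : L2T) : Prop := ∀ᵐ x : Torus, (f x).im = 0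

/-- `f` has zero mean. -/
def IsMeanZero (f : L2T) : Prop := ∫ x : Torus, f x = 0

/-- `v ∈ C([0,T]; L²)` is a (weak) solution on `[0,T]` of
`∂ₜ v + D^α ∂ₓ v + G D^β G v = ∂ₓ (v²)`, `v(0) = v₀`: the equation is tested against all smooth
functions on the torus; `D^α ∂ₓ` and `∂ₓ` are antisymmetric and `G`, `D^β` symmetric for the
bilinear pairing. -/
structure IsSolution (α β : ℝ) (g : Torus → ℝ) (T : ℝ) (v₀ : L2T) (v : ℝ → L2T) : Prop where
  continuousOn : ContinuousOn v (Icc 0 T)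
  initial : v 0 = v₀
  weak : ∀ φ : Torus → ℂ, SmoothT φ → ∀ t ∈ Icc 0 T,
    ∫ x : Torus, v t x * φ x = (∫ x : Torus, v₀ x * φ x) +
      ∫ s in (0 : ℝ)..t,
        ((∫ x : Torus, v s x * fracDdx α φ x)
          - (∫ x : Torus, v s x * opG g (fracD β (opG g φ)) x)
          - ∫ x : Torus, (v s x) ^ 2 * dx φ x)

end DGBO

end

open MeasureTheory Set
open scoped ContDiff FourierTransform

noncomputable section

namespace DGBO

/-! The proof takes place on the Fourier side. A function in `Z^b` is represented by the sequence of
its weighted transforms `h_k = w_k û_k`, an element of `ℓ²(L²(ℝ))`, where `w_k(τ) = √λ ⟨(τ +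
L_k)/λ⟩^b`, `λ = ⟨k⟩^β` and `L_k = k|k|^α`. Since `b > 1/2`, `1/w_k` lies in `L²` with a norm that
does not depend on `λ` (`lintegral_inv_wt`). Hence `û_k` is integrable and the coefficient at each
time is bounded by `‖h_k‖`, uniformly in `k`; this is the embedding into `C([0,T]; L²)`.

In Fourier coefficients `G D^β G` is a positive semidefinite matrix with rapid decay away from the
diagonal and a real diagonal of size `|k|^β`, up to a bounded defect. The diagonal joins the linear
flow, together with an artificial damping `M`: with `v = e^{Mt} x`, the function `x` solves an
equation with the resolvent `(i(τ + L_k) + λ_k)⁻¹`, where `λ_k = M + a_kk`. Because `b > 1/2`, each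
Duhamel term gains a factor `M^{-(b-1/2)}`. A large `M` therefore replaces a short time, and the
fixed point equation is a contraction for data of any size.

Two estimates carry the contraction. Away from the diagonal, `|L_k - L_j|` is at least `K^α` with `K
= max(|k|,|j|)`, so one of the two modulations is at least `K^α/2`. It gains almost `K^{-α/2}`, the
width of the other weight gains almost `K^{-β/2}`, and the coefficient `K^β` is beaten because `β <
α` (`linBound_of_separation`). In the quadratic term the resonance function is at least `K^α κ/2`,
with `K` the largest and `κ` the smallest of the three frequencies. The largest modulation and the
width of a weight at a high frequency beat the derivative because `α + β > 2`, and a power of `κ`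
slightly below `-1/2` is left (`bilBound_of_resonance`). This power is square summable, so
Cauchy–Schwarz and Young bound the bilinear operator on `ℓ²(L²)`.

For real data the `L²` norm does not increase: the cubic term of the energy identity cancels by
symmetry and the dissipation has a sign. This is proved for Galerkin truncations of the fixed point
equation and passes to the limit. The local time depends only on the size of the data, so solutions
on overlapping intervals are glued to global ones.

For uniqueness, the difference of two solutions solves a linear equation whose coefficient is their
sum, a fixed element of `Z^b`. With `M` large depending on its norm, the Duhamel map halves norms
while it reproduces the damped difference on all of `[0,T]`; iteration shows that the difference
vanishes. Lipschitz bounds on the local intervals compose to the Lipschitz bound on `[0,T]`.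
Finally, the orthonormal basis of exponentials, the inversion formula in time and rapid decay of the
coefficients of test functions identify the system of coefficients with the weak formulation. -/

/-! ### Young's inequality `L¹ * L² ⊂ L²` -/

lemma sq_lintegral_mul_le {X : Type*} [MeasurableSpace X] (μ : Measure X) {f g : X → ENNReal}
    (hf : AEMeasurable f μ) (hg : AEMeasurable g μ) :
    (∫⁻ x, f x * g x ∂μ) ^ 2 ≤ (∫⁻ x, f x ^ 2 ∂μ) * ∫⁻ x, g x ^ 2 ∂μ := by
  have h := ENNReal.lintegral_mul_le_Lp_mul_Lq μ Real.HolderConjugate.two_two hf hg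
  have e : ∀ a : ENNReal, (a ^ (1 / 2 : ℝ)) ^ 2 = a := fun a => by
    rw [← ENNReal.rpow_natCast, ← ENNReal.rpow_mul]; norm_num
  calc (∫⁻ x, f x * g x ∂μ) ^ 2
      ≤ ((∫⁻ x, f x ^ (2 : ℝ) ∂μ) ^ (1 / 2 : ℝ) * (∫⁻ x, g x ^ (2 : ℝ) ∂μ) ^ (1 / 2 : ℝ)) ^ 2 := by
        gcongr; exact h
    _ = _ := by rw [mul_pow, e, e]; simp

/-- Split `f g` as `f^{1/2} · f^{1/2} g`, apply Cauchy–Schwarz in `s`, then Tonelli and translation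
invariance. The group is general because both Lebesgue measure on `ℝ` (time frequencies) and
counting measure on `ℤ` (space frequencies) are needed. -/
lemma lintegral_sq_conv_le {G : Type*} [AddCommGroup G] [MeasurableSpace G] [MeasurableAdd₂ G]
    [MeasurableNeg G] (μ : Measure G) [SFinite μ] [μ.IsAddRightInvariant] {f g : G → ENNReal}
    (hf : Measurable f) (hg : Measurable g) :
    ∫⁻ t, (∫⁻ s, f s * g (t - s) ∂μ) ^ 2 ∂μ ≤ (∫⁻ s, f s ∂μ) ^ 2 * ∫⁻ s, g s ^ 2 ∂μ := by
  have e : ∀ a : ENNReal, (a ^ (1 / 2 : ℝ)) ^ 2 = a := fun a => by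
    rw [← ENNReal.rpow_natCast, ← ENNReal.rpow_mul]; norm_num
  have hgm : Measurable fun p : G × G => g (p.1 - p.2) := hg.comp measurable_sub
  have h1 : ∀ t, (∫⁻ s, f s * g (t - s) ∂μ) ^ 2 ≤
      (∫⁻ s, f s ∂μ) * ∫⁻ s, f s * g (t - s) ^ 2 ∂μ := by
    intro t
    have hgt : Measurable fun s => g (t - s) := hg.comp (measurable_const.sub measurable_id)
    have := sq_lintegral_mul_le μ (f := fun s => f s ^ (1 / 2 : ℝ))
      (g := fun s => f s ^ (1 / 2 : ℝ) * g (t - s)) (hf.pow_const _).aemeasurable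
      ((hf.pow_const _).mul hgt).aemeasurable
    simp only [← mul_assoc, mul_pow, e] at this
    simpa only [← sq, e] using this
  calc ∫⁻ t, (∫⁻ s, f s * g (t - s) ∂μ) ^ 2 ∂μ
      ≤ ∫⁻ t, (∫⁻ s, f s ∂μ) * ∫⁻ s, f s * g (t - s) ^ 2 ∂μ ∂μ := lintegral_mono h1
    _ = (∫⁻ s, f s ∂μ) * ∫⁻ t, ∫⁻ s, f s * g (t - s) ^ 2 ∂μ ∂μ := by
        rw [lintegral_const_mul]
        exact Measurable.lintegral_prod_right'
          (f := fun p : G × G => f p.2 * g (p.1 - p.2) ^ 2)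
          ((hf.comp measurable_snd).mul (hgm.pow_const 2))
    _ = (∫⁻ s, f s ∂μ) * ∫⁻ s, ∫⁻ t, f s * g (t - s) ^ 2 ∂μ ∂μ := by
        rw [lintegral_lintegral_swap]
        exact ((hf.comp measurable_snd).mul (hgm.pow_const 2)).aemeasurable
    _ = (∫⁻ s, f s ∂μ) * ∫⁻ s, f s * ∫⁻ t, g t ^ 2 ∂μ ∂μ := by
        congr 2 with s
        rw [lintegral_const_mul, lintegral_sub_right_eq_self (fun t => g t ^ 2)]
        exact (hg.comp (measurable_id.sub_const s)).pow_const 2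
    _ = _ := by rw [lintegral_mul_const _ hf]; ring

/-! ### Operators on `L²(ℝ)` -/

lemma enorm_ofReal (x : ℝ) : ‖(x : ℂ)‖ₑ = ‖x‖ₑ := by
  rw [← ofReal_norm, ← ofReal_norm, Complex.norm_real]

/-- The space `L²(ℝ; ℂ)`. -/
abbrev L2R : Type := Lp ℂ 2 (volume : Measure ℝ)

lemma enorm_sq_L2R (h : L2R) : ‖h‖ₑ ^ 2 = ∫⁻ s, ‖h s‖ₑ ^ 2 := by
  rw [Lp.enorm_def, eLpNorm_eq_lintegral_rpow_enorm_toReal (by norm_num) (by norm_num),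
    ← ENNReal.rpow_natCast, ← ENNReal.rpow_mul]
  simp

lemma measurable_L2R (h : L2R) : Measurable h := (Lp.stronglyMeasurable h).measurable

lemma enorm_toLp_sq {f : ℝ → ℂ} (hf : MemLp f 2) : ‖hf.toLp f‖ₑ ^ 2 = ∫⁻ s, ‖f s‖ₑ ^ 2 := by
  rw [enorm_sq_L2R]
  refine lintegral_congr_ae ?_
  filter_upwards [hf.coeFn_toLp] with s hs
  rw [hs]

lemma memLp_two_of_lintegral {f : ℝ → ℂ} (hf : AEStronglyMeasurable f)
    (h : ∫⁻ s, ‖f s‖ₑ ^ 2 < ⊤) : MemLp f 2 := by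
  refine ⟨hf, ?_⟩
  rw [eLpNorm_eq_lintegral_rpow_enorm_toReal (by norm_num) (by norm_num)]
  refine ENNReal.rpow_lt_top_of_nonneg (by norm_num) ?_
  simpa using h.ne

lemma norm_le_of_enorm_sq_le {E : Type*} [NormedAddCommGroup E] {x : E} {C : ℝ} (hC : 0 ≤ C)
    (h : ‖x‖ₑ ^ 2 ≤ ENNReal.ofReal C ^ 2) : ‖x‖ ≤ C := by
  have h2 : ‖x‖ₑ ≤ ENNReal.ofReal C := (ENNReal.pow_le_pow_left_iff two_ne_zero).1 h
  rw [← ofReal_norm] at h2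
  exact (ENNReal.ofReal_le_ofReal_iff hC).1 h2

lemma memLp_bdd_mul {m : ℝ → ℂ} (hm : Measurable m) {C : ℝ} (hC : ∀ s, ‖m s‖ ≤ C) (h : L2R) :
    MemLp (fun s => m s * h s) 2 := by
  refine (Lp.memLp h).of_le_mul (c := C) (hm.mul (measurable_L2R h)).aestronglyMeasurable ?_
  filter_upwards with s
  rw [norm_mul]
  exact mul_le_mul_of_nonneg_right (hC s) (norm_nonneg _)

/-- Multiplication by a bounded measurable function, on `L²(ℝ)`. -/
def mulOp (m : ℝ → ℂ) (hm : Measurable m) (C : ℝ) (hC : ∀ s, ‖m s‖ ≤ C) : L2R →L[ℂ] L2R :=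
  LinearMap.mkContinuous
    { toFun := fun h => (memLp_bdd_mul hm hC h).toLp _
      map_add' := fun h h' => by
        rw [← MemLp.toLp_add, MemLp.toLp_eq_toLp_iff]
        filter_upwards [Lp.coeFn_add h h'] with s hs
        rw [hs, Pi.add_apply, Pi.add_apply, mul_add]
      map_smul' := fun c h => by
        rw [RingHom.id_apply, ← MemLp.toLp_const_smul, MemLp.toLp_eq_toLp_iff]
        filter_upwards [Lp.coeFn_smul c h] with s hs
        rw [hs, Pi.smul_apply, Pi.smul_apply, smul_eq_mul, smul_eq_mul, mul_left_comm] } C (fun h => by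
      refine Lp.norm_le_mul_norm_of_ae_le_mul ?_
      filter_upwards [(memLp_bdd_mul hm hC h).coeFn_toLp] with s hs
      simp only [LinearMap.coe_mk, AddHom.coe_mk, hs, norm_mul]
      exact mul_le_mul_of_nonneg_right (hC s) (norm_nonneg _))

lemma mulOp_ae (m : ℝ → ℂ) (hm : Measurable m) (C : ℝ) (hC : ∀ s, ‖m s‖ ≤ C) (h : L2R) :
    mulOp m hm C hC h =ᵐ[volume] fun s => m s * h s :=
  (memLp_bdd_mul hm hC h).coeFn_toLp

lemma mulOp_norm_le (m : ℝ → ℂ) (hm : Measurable m) (C : ℝ) (hC : ∀ s, ‖m s‖ ≤ C) (h : L2R) :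
    ‖mulOp m hm C hC h‖ ≤ C * ‖h‖ := by
  refine Lp.norm_le_mul_norm_of_ae_le_mul ?_
  filter_upwards [mulOp_ae m hm C hC h] with s hs
  rw [hs, norm_mul]
  exact mul_le_mul_of_nonneg_right (hC s) (norm_nonneg _)

/-- Convolution of complex functions on the line. -/
def conv (f g : ℝ → ℂ) (t : ℝ) : ℂ := ∫ s, f s * g (t - s)

lemma conv_eq (f g : ℝ → ℂ) : conv f g = convolution f g (ContinuousLinearMap.mul ℂ ℂ) volume := by
  ext t; rfl

lemma integrable_conv {f g : ℝ → ℂ} (hf : Integrable f) (hg : Integrable g) :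
    Integrable (conv f g) := by
  rw [conv_eq]; exact hf.integrable_convolution _ hg

lemma ae_integrable_conv {f g : ℝ → ℂ} (hf : Integrable f) (hg : Integrable g) :
    ∀ᵐ t, Integrable fun s => f s * g (t - s) :=
  hf.ae_convolution_exists (ContinuousLinearMap.mul ℂ ℂ) hg

lemma integral_conv {f g : ℝ → ℂ} (hf : Integrable f) (hg : Integrable g) :
    ∫ t, conv f g t = (∫ t, f t) * ∫ t, g t := by
  rw [conv_eq]; exact integral_convolution _ hf hg

lemma conv_congr_ae {f g f' g' : ℝ → ℂ} (hf : f =ᵐ[volume] f') (hg : g =ᵐ[volume] g') :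
    conv f g = conv f' g' := by
  ext t
  refine integral_congr_ae ?_
  have : ∀ᵐ s, g (t - s) = g' (t - s) :=
    (quasiMeasurePreserving_sub_left volume t).ae hg
  filter_upwards [hf, this] with s h1 h2
  rw [h1, h2]

/-- A kernel `q(t) r₁(s) r₂(t - s)` that is dominated by `m (p₁(s) + p₂(t - s))` with `p₁` and `p₂`
in `L²`: it defines a bounded bilinear map on `L²(ℝ)`. -/
structure ConvKernel where
  q : ℝ → ℂ
  r₁ : ℝ → ℝ
  r₂ : ℝ → ℝ
  p₁ : ℝ → ℝ
  p₂ : ℝ → ℝ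
  m : ℝ
  P : ℝ
  q_meas : Measurable q
  r₁_mem : MemLp r₁ 2
  r₂_mem : MemLp r₂ 2
  p₁_meas : Measurable p₁
  p₂_meas : Measurable p₂
  m_nonneg : 0 ≤ m
  P_nonneg : 0 ≤ P
  p₁_nonneg : ∀ s, 0 ≤ p₁ s
  p₂_nonneg : ∀ s, 0 ≤ p₂ s
  p₁_le : ∫⁻ s, ENNReal.ofReal (p₁ s) ^ 2 ≤ ENNReal.ofReal P ^ 2
  p₂_le : ∫⁻ s, ENNReal.ofReal (p₂ s) ^ 2 ≤ ENNReal.ofReal P ^ 2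
  bound : ∀ t s, ‖q t‖ * |r₁ s| * |r₂ (t - s)| ≤ m * (p₁ s + p₂ (t - s))

namespace ConvKernel

lemma integrable_mul (r : ℝ → ℝ) (hr : MemLp r 2) (h : L2R) :
    Integrable fun s => (r s : ℂ) * h s :=
  MemLp.integrable_mul (p := 2) (q := 2) hr.ofReal (Lp.memLp h)

variable (K : ConvKernel)

/-- The integral operator of the kernel. -/
def fn (h₁ h₂ : L2R) (t : ℝ) : ℂ :=
  K.q t * conv (fun s => (K.r₁ s : ℂ) * h₁ s) (fun s => (K.r₂ s : ℂ) * h₂ s) t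

lemma fn_aesm (h₁ h₂ : L2R) : AEStronglyMeasurable (K.fn h₁ h₂) :=
  K.q_meas.aestronglyMeasurable.mul
    (integrable_conv (integrable_mul _ K.r₁_mem h₁) (integrable_mul _ K.r₂_mem h₂)).1

lemma lintegral_mul_le (p : ℝ → ℝ) (hp : Measurable p) {P : ℝ}
    (hP : ∫⁻ s, ENNReal.ofReal (p s) ^ 2 ≤ ENNReal.ofReal P ^ 2) (h : L2R) :
    (∫⁻ s, ENNReal.ofReal (p s) * ‖h s‖ₑ) ^ 2 ≤ ENNReal.ofReal P ^ 2 * ‖h‖ₑ ^ 2 := by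
  refine (sq_lintegral_mul_le _ hp.ennreal_ofReal.aemeasurable
    (measurable_L2R h).enorm.aemeasurable).trans ?_
  rw [← enorm_sq_L2R]
  gcongr

/-- The two terms of the kernel bound give two convolutions. In the first `p₁ h₁` is integrable by
Cauchy–Schwarz and `h₂` is square integrable; in the second the roles are exchanged. Young's
inequality bounds both. -/
lemma lintegral_fn_le (h₁ h₂ : L2R) :
    ∫⁻ t, ‖K.fn h₁ h₂ t‖ₑ ^ 2 ≤ ENNReal.ofReal (2 * K.m * K.P * ‖h₁‖ * ‖h₂‖) ^ 2 := by
  have m1 := measurable_L2R h₁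
  have m2 := measurable_L2R h₂
  set A : ℝ → ENNReal := fun s => ENNReal.ofReal (K.p₁ s) * ‖h₁ s‖ₑ with hA
  set B : ℝ → ENNReal := fun s => ENNReal.ofReal (K.p₂ s) * ‖h₂ s‖ₑ with hB
  have mA : Measurable A := K.p₁_meas.ennreal_ofReal.mul m1.enorm
  have mB : Measurable B := K.p₂_meas.ennreal_ofReal.mul m2.enorm
  set c1 : ℝ → ENNReal := fun t => ∫⁻ s, A s * ‖h₂ (t - s)‖ₑ
  set c2 : ℝ → ENNReal := fun t => ∫⁻ s, B s * ‖h₁ (t - s)‖ₑ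
  have hpt : ∀ t, ‖K.fn h₁ h₂ t‖ₑ ≤ ENNReal.ofReal K.m * (c1 t + c2 t) := by
    intro t
    have e2 : c2 t = ∫⁻ s, ‖h₁ s‖ₑ * B (t - s) := by
      simp only [c2]
      rw [← lintegral_sub_left_eq_self _ t]
      simp [mul_comm]
    have mt : Measurable fun s => h₂ (t - s) := m2.comp (measurable_const.sub measurable_id)
    calc ‖K.fn h₁ h₂ t‖ₑ
        ≤ ‖K.q t‖ₑ * ∫⁻ s, ‖((K.r₁ s : ℂ) * h₁ s) * ((K.r₂ (t - s) : ℂ) * h₂ (t - s))‖ₑ := by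
          rw [fn, enorm_mul]
          gcongr
          exact enorm_integral_le_lintegral_enorm _
      _ = ∫⁻ s, ENNReal.ofReal (‖K.q t‖ * |K.r₁ s| * |K.r₂ (t - s)|) * (‖h₁ s‖ₑ * ‖h₂ (t - s)‖ₑ) := by
          rw [← lintegral_const_mul']
          · congr 1 with s
            simp only [enorm_mul]
            rw [ENNReal.ofReal_mul (by positivity), ENNReal.ofReal_mul (by positivity),
              ofReal_norm, ← Real.enorm_eq_ofReal_abs, ← Real.enorm_eq_ofReal_abs,
              ← enorm_ofReal, ← enorm_ofReal]
            ring
          · exact enorm_ne_top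
      _ ≤ ∫⁻ s, ENNReal.ofReal K.m * (A s * ‖h₂ (t - s)‖ₑ + ‖h₁ s‖ₑ * B (t - s)) := by
          refine lintegral_mono fun s => ?_
          calc _ ≤ ENNReal.ofReal (K.m * (K.p₁ s + K.p₂ (t - s))) * (‖h₁ s‖ₑ * ‖h₂ (t - s)‖ₑ) := by
                exact mul_le_mul_left (ENNReal.ofReal_le_ofReal (K.bound t s)) _
            _ = _ := by
                rw [ENNReal.ofReal_mul K.m_nonneg,
                  ENNReal.ofReal_add (K.p₁_nonneg _) (K.p₂_nonneg _)]
                simp only [hA, hB]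
                ring
      _ = ENNReal.ofReal K.m * (c1 t + c2 t) := by
          rw [lintegral_const_mul' _ _ ENNReal.ofReal_ne_top, lintegral_add_left, e2]
          exact mA.mul mt.enorm
  have mc1 : Measurable c1 := Measurable.lintegral_prod_right'
    (f := fun p : ℝ × ℝ => A p.2 * ‖h₂ (p.1 - p.2)‖ₑ)
    ((mA.comp measurable_snd).mul (m2.comp measurable_sub).enorm)
  have b1 : ∫⁻ t, c1 t ^ 2 ≤ ENNReal.ofReal (K.P * ‖h₁‖ * ‖h₂‖) ^ 2 := by
    refine (lintegral_sq_conv_le volume mA m2.enorm).trans ?_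
    rw [← enorm_sq_L2R, ENNReal.ofReal_mul (by have := K.P_nonneg; positivity),
      ENNReal.ofReal_mul K.P_nonneg, ofReal_norm, ofReal_norm, mul_pow, mul_pow]
    gcongr
    exact lintegral_mul_le _ K.p₁_meas K.p₁_le h₁
  have b2 : ∫⁻ t, c2 t ^ 2 ≤ ENNReal.ofReal (K.P * ‖h₁‖ * ‖h₂‖) ^ 2 := by
    refine (lintegral_sq_conv_le volume mB m1.enorm).trans ?_
    rw [← enorm_sq_L2R, ENNReal.ofReal_mul (by have := K.P_nonneg; positivity),
      ENNReal.ofReal_mul K.P_nonneg, ofReal_norm, ofReal_norm, mul_pow, mul_pow,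
      mul_right_comm]
    gcongr
    exact lintegral_mul_le _ K.p₂_meas K.p₂_le h₂
  calc ∫⁻ t, ‖K.fn h₁ h₂ t‖ₑ ^ 2
      ≤ ∫⁻ t, ENNReal.ofReal K.m ^ 2 * (2 * (c1 t ^ 2 + c2 t ^ 2)) := by
        refine lintegral_mono fun t => ?_
        refine (pow_le_pow_left' (hpt t) 2).trans ?_
        rw [mul_pow]
        gcongr
        have := ENNReal.rpow_add_le_mul_rpow_add_rpow (c1 t) (c2 t) (p := 2) (by norm_num)
        norm_num at this
        exact this
    _ = ENNReal.ofReal K.m ^ 2 * (2 * ((∫⁻ t, c1 t ^ 2) + ∫⁻ t, c2 t ^ 2)) := by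
        rw [lintegral_const_mul' _ _ (by simp), lintegral_const_mul' _ _ (by simp),
          lintegral_add_left (mc1.pow_const 2)]
    _ ≤ ENNReal.ofReal K.m ^ 2 * (2 * (ENNReal.ofReal (K.P * ‖h₁‖ * ‖h₂‖) ^ 2 +
          ENNReal.ofReal (K.P * ‖h₁‖ * ‖h₂‖) ^ 2)) := by gcongr
    -- The factor two is the root of four: `(x + y)² ≤ 2(x² + y²)` and both squares have the same
    -- bound.
    _ = ENNReal.ofReal (2 * K.m * K.P * ‖h₁‖ * ‖h₂‖) ^ 2 := by
        have hm := K.m_nonneg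
        have : 2 * K.m * K.P * ‖h₁‖ * ‖h₂‖ = 2 * (K.m * (K.P * ‖h₁‖ * ‖h₂‖)) := by ring
        rw [this, ENNReal.ofReal_mul (p := 2) (by norm_num), ENNReal.ofReal_mul hm]
        simp only [ENNReal.ofReal_ofNat]
        ring

lemma fn_memLp (h₁ h₂ : L2R) : MemLp (K.fn h₁ h₂) 2 :=
  memLp_two_of_lintegral (K.fn_aesm h₁ h₂) ((K.lintegral_fn_le h₁ h₂).trans_lt (by simp))

lemma conv_add_left {f f' g : ℝ → ℂ} (hf : Integrable f) (hf' : Integrable f')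
    (hg : Integrable g) :
    conv (fun s => f s + f' s) g =ᵐ[volume] fun t => conv f g t + conv f' g t := by
  filter_upwards [ae_integrable_conv hf hg, ae_integrable_conv hf' hg] with t h1 h2
  simp only [conv, add_mul]
  exact integral_add h1 h2

lemma conv_add_right {f g g' : ℝ → ℂ} (hf : Integrable f) (hg : Integrable g)
    (hg' : Integrable g') :
    conv f (fun s => g s + g' s) =ᵐ[volume] fun t => conv f g t + conv f g' t := by
  filter_upwards [ae_integrable_conv hf hg, ae_integrable_conv hf hg'] with t h1 h2
  simp only [conv, mul_add]
  exact integral_add h1 h2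

/-- The bilinear map on `L²(ℝ)` defined by a kernel. -/
def op : L2R →L[ℂ] L2R →L[ℂ] L2R :=
  LinearMap.mkContinuous₂
    (LinearMap.mk₂ ℂ (fun h₁ h₂ => (K.fn_memLp h₁ h₂).toLp _)
      (fun h h' g => by
        rw [← MemLp.toLp_add, MemLp.toLp_eq_toLp_iff]
        have e : conv (fun s => (K.r₁ s : ℂ) * (h + h' : L2R) s) (fun s => (K.r₂ s : ℂ) * g s)
            = conv (fun s => (K.r₁ s : ℂ) * h s + (K.r₁ s : ℂ) * h' s)
              (fun s => (K.r₂ s : ℂ) * g s) := by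
          refine conv_congr_ae ?_ (Filter.EventuallyEq.refl _ _)
          filter_upwards [Lp.coeFn_add h h'] with s hs
          rw [hs, Pi.add_apply, mul_add]
        filter_upwards [conv_add_left (integrable_mul _ K.r₁_mem h) (integrable_mul _ K.r₁_mem h')
          (integrable_mul _ K.r₂_mem g)] with t ht
        simp only [fn, Pi.add_apply]
        rw [e, ht, mul_add])
      (fun c h g => by
        rw [← MemLp.toLp_const_smul, MemLp.toLp_eq_toLp_iff]
        have e : conv (fun s => (K.r₁ s : ℂ) * (c • h : L2R) s) (fun s => (K.r₂ s : ℂ) * g s)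
            = conv (fun s => c * ((K.r₁ s : ℂ) * h s)) (fun s => (K.r₂ s : ℂ) * g s) := by
          refine conv_congr_ae ?_ (Filter.EventuallyEq.refl _ _)
          filter_upwards [Lp.coeFn_smul c h] with s hs
          rw [hs, Pi.smul_apply, smul_eq_mul, mul_left_comm]
        filter_upwards with t
        simp only [fn, Pi.smul_apply, smul_eq_mul]
        rw [e]
        simp only [conv, mul_assoc]
        rw [integral_const_mul]
        ring)
      (fun h g g' => by
        rw [← MemLp.toLp_add, MemLp.toLp_eq_toLp_iff]
        have e : conv (fun s => (K.r₁ s : ℂ) * h s) (fun s => (K.r₂ s : ℂ) * (g + g' : L2R) s)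
            = conv (fun s => (K.r₁ s : ℂ) * h s)
              (fun s => (K.r₂ s : ℂ) * g s + (K.r₂ s : ℂ) * g' s) := by
          refine conv_congr_ae (Filter.EventuallyEq.refl _ _) ?_
          filter_upwards [Lp.coeFn_add g g'] with s hs
          rw [hs, Pi.add_apply, mul_add]
        filter_upwards [conv_add_right (integrable_mul _ K.r₁_mem h) (integrable_mul _ K.r₂_mem g)
          (integrable_mul _ K.r₂_mem g')] with t ht
        simp only [fn, Pi.add_apply]
        rw [e, ht, mul_add])
      (fun c h g => by
        rw [← MemLp.toLp_const_smul, MemLp.toLp_eq_toLp_iff]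
        have e : conv (fun s => (K.r₁ s : ℂ) * h s) (fun s => (K.r₂ s : ℂ) * (c • g : L2R) s)
            = conv (fun s => (K.r₁ s : ℂ) * h s) (fun s => c * ((K.r₂ s : ℂ) * g s)) := by
          refine conv_congr_ae (Filter.EventuallyEq.refl _ _) ?_
          filter_upwards [Lp.coeFn_smul c g] with s hs
          rw [hs, Pi.smul_apply, smul_eq_mul, mul_left_comm]
        filter_upwards with t
        simp only [fn, Pi.smul_apply, smul_eq_mul]
        rw [e]
        simp only [conv, mul_left_comm _ c]
        rw [integral_const_mul]
        ring)) (2 * K.m * K.P) (fun h₁ h₂ => by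
      refine norm_le_of_enorm_sq_le ?_ ?_
      · have := K.m_nonneg; have := K.P_nonneg; positivity
      · rw [LinearMap.mk₂_apply, enorm_toLp_sq]
        exact K.lintegral_fn_le h₁ h₂)

lemma op_ae (h₁ h₂ : L2R) : K.op h₁ h₂ =ᵐ[volume] K.fn h₁ h₂ := (K.fn_memLp h₁ h₂).coeFn_toLp

lemma op_norm_le (h₁ h₂ : L2R) : ‖K.op h₁ h₂‖ ≤ 2 * K.m * K.P * ‖h₁‖ * ‖h₂‖ := by
  refine norm_le_of_enorm_sq_le ?_ ?_
  · have := K.m_nonneg; have := K.P_nonneg; positivity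
  · rw [enorm_sq_L2R, lintegral_congr_ae (g := fun t => ‖K.fn h₁ h₂ t‖ₑ ^ 2)]
    · exact K.lintegral_fn_le h₁ h₂
    · filter_upwards [K.op_ae h₁ h₂] with t ht
      rw [ht]

end ConvKernel

/-! ### The Japanese bracket -/

lemma one_le_bracket (x : ℝ) : 1 ≤ bracket x :=
  Real.one_le_sqrt.2 (by nlinarith [sq_nonneg x])

lemma bracket_pos (x : ℝ) : 0 < bracket x := one_pos.trans_le (one_le_bracket x)

lemma abs_le_bracket (x : ℝ) : |x| ≤ bracket x :=
  Real.abs_le_sqrt (by linarith)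

lemma bracket_le (x : ℝ) : bracket x ≤ 1 + |x| :=
  Real.sqrt_le_iff.2 ⟨by positivity, by nlinarith [sq_abs x, abs_nonneg x]⟩

lemma bracket_sq (x : ℝ) : bracket x ^ 2 = 1 + x ^ 2 := Real.sq_sqrt (by positivity)

lemma continuous_bracket : Continuous bracket := by unfold bracket; fun_prop

lemma bracket_add_le (x y : ℝ) : bracket (x + y) ≤ 2 * (bracket x * bracket y) := by
  refine abs_le_of_sq_le_sq' ?_ (by have := bracket_pos x; have := bracket_pos y; positivity) |>.2
  rw [mul_pow, mul_pow, bracket_sq, bracket_sq, bracket_sq]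
  nlinarith [sq_nonneg (x - y), sq_nonneg (x * y), sq_nonneg x, sq_nonneg y]

lemma continuous_bracket_rpow (r : ℝ) : Continuous fun x => bracket x ^ r :=
  continuous_bracket.rpow_const fun x => Or.inl (bracket_pos x).ne'

lemma bracket_rpow_le {r s : ℝ} (h : r ≤ s) (x : ℝ) : bracket x ^ r ≤ bracket x ^ s :=
  Real.rpow_le_rpow_of_exponent_le (one_le_bracket x) h

lemma integrable_bracket_rpow_sq {r : ℝ} (hr : r < -1 / 2) :
    Integrable fun x => (bracket x ^ r) ^ 2 := by
  have h := integrable_rpow_neg_one_add_norm_sq (E := ℝ) (μ := volume) (r := -2 * r) (by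
    simp; linarith)
  convert h using 2 with x
  rw [bracket, Real.sqrt_eq_rpow, ← Real.rpow_natCast, ← Real.rpow_mul (by positivity),
    ← Real.rpow_mul (by positivity), Real.norm_eq_abs, sq_abs]
  congr 1
  push_cast; ring

/-! ### `L²`-normalised scaling -/

/-- `L²`-normalised scaling and translation. -/
def scl (lam ℓ : ℝ) (φ : ℝ → ℝ) (τ : ℝ) : ℝ := (√lam)⁻¹ * φ ((τ + ℓ) / lam)

lemma continuous_scl {lam ℓ : ℝ} {φ : ℝ → ℝ} (hφ : Continuous φ) : Continuous (scl lam ℓ φ) := by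
  unfold scl; fun_prop

/-- A change of variables. That the value does not involve `lam` and `ℓ` makes all later constants
uniform in the spatial frequency. -/
lemma lintegral_scl {lam ℓ : ℝ} (hlam : 0 < lam) {φ : ℝ → ℝ} (h0 : ∀ x, 0 ≤ φ x)
    (hφ : Integrable fun x => φ x ^ 2) :
    ∫⁻ τ, ENNReal.ofReal (scl lam ℓ φ τ) ^ 2 = ENNReal.ofReal √(∫ x, φ x ^ 2) ^ 2 := by
  have hn : ∀ τ, 0 ≤ scl lam ℓ φ τ := fun τ => mul_nonneg (by positivity) (h0 _)
  have e : ∀ τ, scl lam ℓ φ τ ^ 2 = lam⁻¹ * φ ((τ + ℓ) / lam) ^ 2 := fun τ => by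
    rw [scl, mul_pow, inv_pow, Real.sq_sqrt hlam.le]
  have hi : Integrable fun τ => scl lam ℓ φ τ ^ 2 := by
    simp_rw [e]
    exact ((hφ.comp_div hlam.ne').comp_add_right ℓ).const_mul _
  simp_rw [← ENNReal.ofReal_pow (hn _)]
  rw [← ofReal_integral_eq_lintegral_ofReal hi (ae_of_all _ fun τ => sq_nonneg _),
    ← ENNReal.ofReal_pow (Real.sqrt_nonneg _),
    Real.sq_sqrt (integral_nonneg fun x => sq_nonneg _)]
  simp_rw [e]
  rw [integral_const_mul, integral_add_right_eq_self (fun τ => φ (τ / lam) ^ 2),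
    Measure.integral_comp_div (fun x => φ x ^ 2), abs_of_pos hlam, smul_eq_mul,
    inv_mul_cancel_left₀ hlam.ne']

lemma memLp_scl {lam ℓ : ℝ} (hlam : 0 < lam) {φ : ℝ → ℝ} (hc : Continuous φ) (h0 : ∀ x, 0 ≤ φ x)
    (hφ : Integrable fun x => φ x ^ 2) : MemLp (scl lam ℓ φ) 2 := by
  have h := memLp_two_of_lintegral (f := fun τ => ((scl lam ℓ φ τ : ℝ) : ℂ))
    (Complex.continuous_ofReal.comp (continuous_scl hc)).aestronglyMeasurable (by
      have hn : ∀ τ, 0 ≤ scl lam ℓ φ τ := fun τ => mul_nonneg (by positivity) (h0 _)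
      have : ∀ τ, ‖((scl lam ℓ φ τ : ℝ) : ℂ)‖ₑ = ENNReal.ofReal (scl lam ℓ φ τ) := fun τ => by
        rw [enorm_ofReal, Real.enorm_of_nonneg (hn τ)]
      simp_rw [this]
      rw [lintegral_scl hlam h0 hφ]
      simp)
  exact h.re

/-! ### The weights -/

/-- The weight of the time frequency `τ`, with width `lam` around `-ℓ`. -/
def wt (b lam ℓ τ : ℝ) : ℝ := √lam * bracket ((τ + ℓ) / lam) ^ b

section wt

variable {b lam ℓ : ℝ}

lemma wt_pos (hlam : 0 < lam) (τ : ℝ) : 0 < wt b lam ℓ τ :=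
  mul_pos (Real.sqrt_pos.2 hlam) (Real.rpow_pos_of_pos (bracket_pos _) _)

lemma continuous_wt : Continuous (wt b lam ℓ) := by
  unfold wt
  exact continuous_const.mul ((continuous_bracket_rpow b).comp (by fun_prop))

lemma sqrt_le_wt (hb : 0 ≤ b) (τ : ℝ) : √lam ≤ wt b lam ℓ τ :=
  le_mul_of_one_le_right (Real.sqrt_nonneg _) (Real.one_le_rpow (one_le_bracket _) hb)

/-- Half a power of the modulation is available since `b ≥ 1/2`. Together with the bound by the root
of the width, this is how the weights of the inputs produce gains. -/
lemma sqrt_abs_le_wt (hlam : 0 < lam) (hb : 1 / 2 ≤ b) (τ : ℝ) : √|τ + ℓ| ≤ wt b lam ℓ τ := by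
  have h1 : √|(τ + ℓ) / lam| ≤ bracket ((τ + ℓ) / lam) ^ b := by
    calc √|(τ + ℓ) / lam| ≤ √(bracket ((τ + ℓ) / lam)) := Real.sqrt_le_sqrt (abs_le_bracket _)
      _ = bracket ((τ + ℓ) / lam) ^ (1 / 2 : ℝ) := Real.sqrt_eq_rpow _
      _ ≤ _ := bracket_rpow_le hb _
  calc √|τ + ℓ| = √lam * √|(τ + ℓ) / lam| := by
        rw [← Real.sqrt_mul hlam.le, abs_div, abs_of_pos hlam, mul_div_cancel₀ _ hlam.ne']
    _ ≤ _ := mul_le_mul_of_nonneg_left h1 (Real.sqrt_nonneg _)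

lemma inv_wt_eq : (fun τ => (wt b lam ℓ τ)⁻¹) = scl lam ℓ fun x => bracket x ^ (-b) := by
  ext τ
  rw [wt, scl, mul_inv, Real.rpow_neg (bracket_pos _).le]

/-- The norm of `⟨x⟩^r` in `L²(ℝ)`. -/
def bracketNorm (r : ℝ) : ℝ := √(∫ x, (bracket x ^ r) ^ 2)

/-- `⟨x⟩^{-b}` is square integrable exactly because `b > 1/2`, and the inverse weight is its
`L²`-normalised rescaling. -/
lemma lintegral_inv_wt (hlam : 0 < lam) (hb : 1 / 2 < b) :
    ∫⁻ τ, ENNReal.ofReal (wt b lam ℓ τ)⁻¹ ^ 2 = ENNReal.ofReal (bracketNorm (-b)) ^ 2 := by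
  have := lintegral_scl (ℓ := ℓ) hlam (φ := fun x => bracket x ^ (-b))
    (fun x => (Real.rpow_pos_of_pos (bracket_pos _) _).le)
    (integrable_bracket_rpow_sq (r := -b) (by linarith))
  rw [← inv_wt_eq] at this
  exact this

lemma memLp_inv_wt (hlam : 0 < lam) (hb : 1 / 2 < b) :
    MemLp (fun τ => (wt b lam ℓ τ)⁻¹) 2 := by
  rw [inv_wt_eq]
  exact memLp_scl hlam (continuous_bracket_rpow _)
    (fun x => (Real.rpow_pos_of_pos (bracket_pos _) _).le)
    (integrable_bracket_rpow_sq (r := -b) (by linarith))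

lemma continuous_inv_wt (hlam : 0 < lam) : Continuous fun τ => (wt b lam ℓ τ)⁻¹ :=
  continuous_wt.inv₀ fun τ => (wt_pos hlam τ).ne'

/-- Comparable widths give comparable weights. -/
lemma wt_le_of_comparable {lam' C : ℝ} (hlam : 0 < lam) (hlam' : 0 < lam') (hb : 0 ≤ b)
    (hC : 1 ≤ C) (h1 : lam' ≤ C * lam) (h2 : lam ≤ C * lam') (τ : ℝ) :
    wt b lam' ℓ τ ≤ √C * C ^ b * wt b lam ℓ τ := by
  have e1 : √lam' ≤ √C * √lam := by
    rw [← Real.sqrt_mul (by linarith)]; exact Real.sqrt_le_sqrt h1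
  have e2 : bracket ((τ + ℓ) / lam') ≤ C * bracket ((τ + ℓ) / lam) := by
    refine abs_le_of_sq_le_sq' ?_ (by have := bracket_pos ((τ + ℓ) / lam); positivity) |>.2
    rw [mul_pow, bracket_sq, bracket_sq, mul_add, ← mul_pow]
    have : (τ + ℓ) ^ 2 / lam' ^ 2 ≤ C ^ 2 * ((τ + ℓ) ^ 2 / lam ^ 2) := by
      rw [div_le_iff₀ (by positivity)]
      have : lam ^ 2 ≤ C ^ 2 * lam' ^ 2 := by
        rw [← mul_pow]; exact pow_le_pow_left₀ hlam.le h2 2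
      calc (τ + ℓ) ^ 2 = (τ + ℓ) ^ 2 / lam ^ 2 * lam ^ 2 := by field_simp
        _ ≤ (τ + ℓ) ^ 2 / lam ^ 2 * (C ^ 2 * lam' ^ 2) := by gcongr
        _ = _ := by ring
    rw [mul_pow, div_pow, div_pow]
    nlinarith
  calc wt b lam' ℓ τ ≤ (√C * √lam) * (C * bracket ((τ + ℓ) / lam)) ^ b := by
        unfold wt
        refine mul_le_mul e1 (Real.rpow_le_rpow (bracket_pos _).le e2 hb)
          (Real.rpow_nonneg (bracket_pos _).le _) (by positivity)
    _ = _ := by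
        rw [Real.mul_rpow (by linarith) (bracket_pos _).le, wt]; ring

/-- Peetre's inequality for the weights. -/
lemma wt_add_le (hb : 0 ≤ b) (τ s : ℝ) :
    wt b lam ℓ (τ + s) ≤ 2 ^ b * bracket (s / lam) ^ b * wt b lam ℓ τ := by
  have h := bracket_add_le ((τ + ℓ) / lam) (s / lam)
  have : bracket ((τ + s + ℓ) / lam) ^ b ≤
      2 ^ b * (bracket ((τ + ℓ) / lam) ^ b * bracket (s / lam) ^ b) := by
    rw [← Real.mul_rpow (bracket_pos _).le (bracket_pos _).le, ← Real.mul_rpow (by norm_num)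
      (mul_nonneg (bracket_pos _).le (bracket_pos _).le)]
    refine Real.rpow_le_rpow (bracket_pos _).le ?_ hb
    rwa [← add_div, add_right_comm] at h
  calc wt b lam ℓ (τ + s) ≤ √lam * (2 ^ b * (bracket ((τ + ℓ) / lam) ^ b * bracket (s / lam) ^ b)) :=
        mul_le_mul_of_nonneg_left this (Real.sqrt_nonneg _)
    _ = _ := by rw [wt]; ring

/-- The resolvent of the damped free evolution. -/
def res (lam ℓ τ : ℝ) : ℂ := (Complex.I * ((τ + ℓ : ℝ) : ℂ) + (lam : ℂ))⁻¹

lemma norm_res (hlam : 0 < lam) (τ : ℝ) : ‖res lam ℓ τ‖ = (lam * bracket ((τ + ℓ) / lam))⁻¹ := by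
  rw [res, norm_inv]
  congr 1
  rw [bracket, add_comm, mul_comm Complex.I, Complex.norm_add_mul_I]
  have : (lam : ℝ) ^ 2 + (τ + ℓ) ^ 2 = lam ^ 2 * (1 + ((τ + ℓ) / lam) ^ 2) := by field_simp
  rw [this, Real.sqrt_mul (by positivity), Real.sqrt_sq hlam.le]

lemma res_denom_ne (hlam : 0 < lam) (τ : ℝ) :
    Complex.I * ((τ + ℓ : ℝ) : ℂ) + (lam : ℂ) ≠ 0 := by
  intro h
  have := congrArg Complex.re h
  simp at this
  exact hlam.ne' this

lemma continuous_res (hlam : 0 < lam) : Continuous (res lam ℓ) := by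
  unfold res
  exact Continuous.inv₀ (by fun_prop) (res_denom_ne hlam)

/-- The weight of the source terms, dual in strength to `wt`. -/
lemma wt_mul_norm_res (hlam : 0 < lam) (τ : ℝ) :
    wt b lam ℓ τ * ‖res lam ℓ τ‖ = (√lam)⁻¹ * bracket ((τ + ℓ) / lam) ^ (b - 1) := by
  rw [norm_res hlam, wt, Real.rpow_sub_one (bracket_pos _).ne', mul_inv]
  have := Real.mul_self_sqrt hlam.le
  have h2 := (Real.sqrt_pos.2 hlam).ne'
  have h3 := (bracket_pos ((τ + ℓ) / lam)).ne'
  field_simp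
  rw [sq, this]

lemma wt_mul_norm_res_le (hlam : 0 < lam) (hb : b ≤ 1) (τ : ℝ) :
    wt b lam ℓ τ * ‖res lam ℓ τ‖ ≤ (√lam)⁻¹ := by
  rw [wt_mul_norm_res hlam]
  exact mul_le_of_le_one_right (by positivity)
    (Real.rpow_le_one_of_one_le_of_nonpos (one_le_bracket _) (by linarith))

/-- The gain from a large modulation of the output. -/
lemma wt_mul_norm_res_le_modulation (hlam : 0 < lam) (hb : b ≤ 1) {A τ : ℝ} (hA : 0 < A)
    (h : A ≤ |τ + ℓ|) :
    wt b lam ℓ τ * ‖res lam ℓ τ‖ ≤ lam ^ (-(b - 1 / 2)) * A ^ (-(1 - b)) := by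
  rw [wt_mul_norm_res hlam]
  have h1 : A / lam ≤ bracket ((τ + ℓ) / lam) := by
    refine le_trans ?_ (abs_le_bracket _)
    rw [abs_div, abs_of_pos hlam]
    gcongr
  calc (√lam)⁻¹ * bracket ((τ + ℓ) / lam) ^ (b - 1)
      ≤ (√lam)⁻¹ * (A / lam) ^ (b - 1) :=
        mul_le_mul_of_nonneg_left
          (Real.rpow_le_rpow_of_nonpos (by positivity) h1 (by linarith)) (by positivity)
    _ = _ := by
        have e1 : (√lam)⁻¹ = lam ^ (-(1 / 2 : ℝ)) := by
          rw [Real.sqrt_eq_rpow, Real.rpow_neg hlam.le]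
        have e2 : (A / lam) ^ (b - 1) = A ^ (-(1 - b)) * lam ^ (1 - b) := by
          rw [Real.div_rpow hA.le hlam.le, div_eq_mul_inv, ← Real.rpow_neg hlam.le, neg_sub,
            neg_sub]
        rw [e1, e2, mul_left_comm, ← Real.rpow_add hlam, mul_comm]
        congr 2
        ring

end wt

/-! ### The inverse Fourier transform in time -/

/-- The inverse Fourier transform of an integrable function. -/
def ift (f : ℝ → ℂ) (t : ℝ) : ℂ :=
  (2 * Real.pi : ℂ)⁻¹ * ∫ τ, Complex.exp ((t * τ : ℝ) * Complex.I) * f τ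

lemma norm_exp_mul (t τ : ℝ) (z : ℂ) : ‖Complex.exp ((t * τ : ℝ) * Complex.I) * z‖ = ‖z‖ := by
  rw [norm_mul, Complex.norm_exp_ofReal_mul_I, one_mul]

lemma integrable_exp_mul {f : ℝ → ℂ} (hf : Integrable f) (t : ℝ) :
    Integrable fun τ => Complex.exp ((t * τ : ℝ) * Complex.I) * f τ := by
  refine hf.mono (Continuous.aestronglyMeasurable (by fun_prop) |>.mul hf.1) ?_
  exact ae_of_all _ fun τ => (norm_exp_mul t τ _).le

lemma continuous_ift {f : ℝ → ℂ} (hf : Integrable f) : Continuous (ift f) := by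
  unfold ift
  refine continuous_const.mul ?_
  refine continuous_of_dominated (bound := fun τ => ‖f τ‖)
    (fun t => (integrable_exp_mul hf t).1) (fun t => ae_of_all _ fun τ => (norm_exp_mul t τ _).le)
    hf.norm (ae_of_all _ fun τ => by fun_prop)

lemma ift_congr_ae {f g : ℝ → ℂ} (h : f =ᵐ[volume] g) (t : ℝ) : ift f t = ift g t := by
  unfold ift
  congr 1
  refine integral_congr_ae ?_
  filter_upwards [h] with τ hτ
  rw [hτ]

lemma ift_add {f g : ℝ → ℂ} (hf : Integrable f) (hg : Integrable g) (t : ℝ) :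
    ift (fun τ => f τ + g τ) t = ift f t + ift g t := by
  simp only [ift, mul_add]
  rw [integral_add (integrable_exp_mul hf t) (integrable_exp_mul hg t), mul_add]

lemma ift_const_mul (c : ℂ) (f : ℝ → ℂ) (t : ℝ) : ift (fun τ => c * f τ) t = c * ift f t := by
  simp only [ift, mul_left_comm _ c]
  rw [integral_const_mul]
  ring

lemma ift_conv {f g : ℝ → ℂ} (hf : Integrable f) (hg : Integrable g) (t : ℝ) :
    ift (conv f g) t = 2 * Real.pi * (ift f t * ift g t) := by
  have e : (fun τ => Complex.exp ((t * τ : ℝ) * Complex.I) * conv f g τ) =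
      conv (fun τ => Complex.exp ((t * τ : ℝ) * Complex.I) * f τ)
        (fun τ => Complex.exp ((t * τ : ℝ) * Complex.I) * g τ) := by
    ext τ
    simp only [conv]
    rw [← integral_const_mul]
    congr 1 with s
    have : Complex.exp ((t * τ : ℝ) * Complex.I) =
        Complex.exp ((t * s : ℝ) * Complex.I) * Complex.exp ((t * (τ - s) : ℝ) * Complex.I) := by
      rw [← Complex.exp_add]
      congr 1
      push_cast; ring
    rw [this]; ring
  simp only [ift]
  rw [e, integral_conv (integrable_exp_mul hf t) (integrable_exp_mul hg t)]
  have h : (Real.pi : ℂ) ≠ 0 := by exact_mod_cast Real.pi_ne_zero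
  have aux : ∀ x y : ℂ, (2 * Real.pi : ℂ)⁻¹ * (x * y) =
      2 * Real.pi * ((2 * Real.pi : ℂ)⁻¹ * x * ((2 * Real.pi : ℂ)⁻¹ * y)) := by
    intro x y; field_simp
  exact aux _ _

lemma ift_shift (f : ℝ → ℂ) (ℓ t : ℝ) :
    ift (fun τ => f (τ + ℓ)) t = Complex.exp (-(ℓ * t : ℝ) * Complex.I) * ift f t := by
  simp only [ift]
  rw [← integral_add_right_eq_self (fun τ => Complex.exp ((t * τ : ℝ) * Complex.I) * f τ) ℓ,
    mul_left_comm]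
  congr 1
  rw [← integral_const_mul]
  congr 1 with τ
  rw [← mul_assoc, ← Complex.exp_add]
  congr 2
  push_cast; ring

lemma integrable_res_mul {lam ℓ : ℝ} (hlam : 0 < lam) {f : ℝ → ℂ} (hf : Integrable f) :
    Integrable fun τ => res lam ℓ τ * f τ := by
  refine hf.bdd_mul (c := lam⁻¹) (continuous_res hlam).aestronglyMeasurable ?_
  refine ae_of_all _ fun τ => ?_
  rw [norm_res hlam]
  exact inv_anti₀ hlam (le_mul_of_one_le_right hlam.le (one_le_bracket _))

/-- The inverse Fourier transform of `f / (i(τ + ℓ) + λ)` solves the damped equation with the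
source term `ift f`. -/
lemma hasDerivAt_ift_res {lam ℓ : ℝ} (hlam : 0 < lam) {f : ℝ → ℂ} (hf : Integrable f) (t : ℝ) :
    HasDerivAt (ift fun τ => res lam ℓ τ * f τ)
      (-(Complex.I * ℓ + lam) * ift (fun τ => res lam ℓ τ * f τ) t + ift f t) t := by
  have hr := integrable_res_mul (ℓ := ℓ) hlam hf
  -- Multiplication by `iτ` is the time derivative. The identity turns it into integrable terms,
  -- which justifies differentiation under the integral sign.
  have key : ∀ τ : ℝ, (τ * Complex.I) * (res lam ℓ τ * f τ) =
      f τ + -(Complex.I * ℓ + lam) * (res lam ℓ τ * f τ) := by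
    intro τ
    have h := mul_inv_cancel₀ (res_denom_ne (ℓ := ℓ) hlam τ)
    have : (τ * Complex.I) * res lam ℓ τ = 1 - (Complex.I * ℓ + lam) * res lam ℓ τ := by
      rw [← h, res]; push_cast; ring
    rw [← mul_assoc, this]; ring
  have hi : Integrable fun τ : ℝ => (τ * Complex.I) * (res lam ℓ τ * f τ) := by
    simp_rw [key]
    exact hf.add (hr.const_mul _)
  have h := (hasDerivAt_integral_of_dominated_loc_of_deriv_le (μ := volume) (𝕜 := ℝ)
    (F := fun t τ => Complex.exp ((t * τ : ℝ) * Complex.I) * (res lam ℓ τ * f τ))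
    (F' := fun t τ => Complex.exp ((t * τ : ℝ) * Complex.I) *
      ((τ * Complex.I) * (res lam ℓ τ * f τ)))
    (x₀ := t) (s := univ) (bound := fun τ => ‖(τ * Complex.I) * (res lam ℓ τ * f τ)‖)
    Filter.univ_mem (Filter.Eventually.of_forall fun t => (integrable_exp_mul hr t).1)
    (integrable_exp_mul hr t) (integrable_exp_mul hi t).1
    (ae_of_all _ fun τ x _ => (norm_exp_mul x τ _).le) hi.norm
    (ae_of_all _ fun τ x _ => by
      rw [← mul_assoc]
      refine HasDerivAt.mul_const ?_ _
      refine HasDerivAt.cexp ?_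
      refine HasDerivAt.mul_const ?_ _
      have : HasDerivAt (fun x : ℝ => x * τ) τ x := hasDerivAt_mul_const τ
      exact this.ofReal_comp)).2
  have h2 := h.const_mul (2 * Real.pi : ℂ)⁻¹
  have h3 : ift f t + -(Complex.I * ℓ + lam) * ift (fun τ => res lam ℓ τ * f τ) t =
      (2 * Real.pi : ℂ)⁻¹ * ∫ τ, Complex.exp ((t * τ : ℝ) * Complex.I) *
        ((τ * Complex.I) * (res lam ℓ τ * f τ)) := by
    rw [← ift_const_mul, ← ift_add hf (hr.const_mul _)]
    simp_rw [key]
    rfl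
  rw [add_comm, h3]
  exact h2

lemma fourier_exp_neg_abs {lam : ℝ} (hlam : 0 < lam) (ξ : ℝ) :
    𝓕 (fun x : ℝ => ((Real.exp (-lam * |x|) : ℝ) : ℂ)) ξ =
      ((2 * lam / (lam ^ 2 + (2 * Real.pi * ξ) ^ 2) : ℝ) : ℂ) := by
  have i1 : IntegrableOn (fun x : ℝ => Complex.exp ((-(2 * Real.pi * ξ * Complex.I) - lam) * x))
      (Ioi 0) := integrableOn_exp_mul_complex_Ioi (by simp [hlam]) 0
  have i2 : IntegrableOn (fun x : ℝ => Complex.exp ((-(2 * Real.pi * ξ * Complex.I) + lam) * x))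
      (Iic 0) := integrableOn_exp_mul_complex_Iic (by simp [hlam]) 0
  have e1 : ∀ x ∈ Ioi (0 : ℝ), Complex.exp (↑(-2 * Real.pi * x * ξ) * Complex.I) •
      ((Real.exp (-lam * |x|) : ℝ) : ℂ) =
      Complex.exp ((-(2 * Real.pi * ξ * Complex.I) - lam) * x) := by
    intro x hx
    rw [abs_of_pos hx, Complex.ofReal_exp, smul_eq_mul, ← Complex.exp_add]
    congr 1; push_cast; ring
  have e2 : ∀ x ∈ Iic (0 : ℝ), Complex.exp (↑(-2 * Real.pi * x * ξ) * Complex.I) •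
      ((Real.exp (-lam * |x|) : ℝ) : ℂ) =
      Complex.exp ((-(2 * Real.pi * ξ * Complex.I) + lam) * x) := by
    intro x hx
    rw [abs_of_nonpos hx, Complex.ofReal_exp, smul_eq_mul, ← Complex.exp_add]
    congr 1; push_cast; ring
  rw [Real.fourier_real_eq_integral_exp_smul, ← intervalIntegral.integral_Iic_add_Ioi (b := 0)
    (i2.congr_fun (fun x hx => (e2 x hx).symm) measurableSet_Iic)
    (i1.congr_fun (fun x hx => (e1 x hx).symm) measurableSet_Ioi),
    setIntegral_congr_fun measurableSet_Ioi e1, setIntegral_congr_fun measurableSet_Iic e2,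
    integral_exp_mul_complex_Ioi (by simp [hlam]), integral_exp_mul_complex_Iic (by simp [hlam])]
  have n1 : (-(2 * Real.pi * ξ * Complex.I) - lam : ℂ) ≠ 0 := fun h => by
    have := congrArg Complex.re h; simp at this; exact hlam.ne' this
  have n2 : (-(2 * Real.pi * ξ * Complex.I) + lam : ℂ) ≠ 0 := fun h => by
    have := congrArg Complex.re h; simp at this; exact hlam.ne' this
  have n3 : (lam ^ 2 + (2 * Real.pi * ξ) ^ 2 : ℂ) ≠ 0 := by
    have : (lam ^ 2 + (2 * Real.pi * ξ) ^ 2 : ℝ) ≠ 0 := by positivity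
    exact_mod_cast this
  push_cast
  simp only [mul_zero, Complex.exp_zero]
  rw [div_add_div _ _ n2 n1, div_eq_div_iff (mul_ne_zero n2 n1) n3]
  linear_combination (-2 * lam * (2 * Real.pi * ξ) ^ 2 : ℂ) * Complex.I_sq

lemma integrable_exp_neg_abs {lam : ℝ} (hlam : 0 < lam) :
    Integrable fun x : ℝ => ((Real.exp (-lam * |x|) : ℝ) : ℂ) := by
  suffices h : Integrable fun x : ℝ => Real.exp (-lam * |x|) from h.ofReal
  rw [← integrableOn_univ, ← Iic_union_Ioi (a := (0 : ℝ))]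
  refine IntegrableOn.union ?_ ?_
  · refine (integrableOn_exp_mul_Iic hlam 0).congr_fun (fun x hx => ?_) measurableSet_Iic
    simp only [abs_of_nonpos (show x ≤ 0 from hx)]; ring_nf
  · refine (integrableOn_exp_mul_Ioi (neg_lt_zero.2 hlam) 0).congr_fun
      (fun x hx => ?_) measurableSet_Ioi
    simp only [abs_of_pos (show 0 < x from hx)]

lemma integrable_lorentz {lam : ℝ} (hlam : 0 < lam) :
    Integrable fun x : ℝ => ((2 * lam / (lam ^ 2 + x ^ 2) : ℝ) : ℂ) := by
  suffices h : Integrable fun x : ℝ => 2 * lam / (lam ^ 2 + x ^ 2) from h.ofReal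
  have := (integrable_inv_one_add_sq.comp_div hlam.ne').const_mul (2 * lam⁻¹)
  refine this.congr (ae_of_all _ fun x => ?_)
  have : lam ^ 2 + x ^ 2 ≠ 0 := by positivity
  simp only
  field_simp

/-- The Lorentzian is the transform of `e^{-λ|t|}`, and the shift by `ℓ` becomes a modulation. For
`t ≥ 0` the absolute value disappears; for negative times the function decays, so that the damped
wave belongs to the weighted space without any cutoff. -/
lemma ift_lorentz {lam ℓ : ℝ} (hlam : 0 < lam) {t : ℝ} (ht : 0 ≤ t) :
    ift (fun τ => ((2 * lam / (lam ^ 2 + (τ + ℓ) ^ 2) : ℝ) : ℂ)) t =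
      Complex.exp (-(Complex.I * ℓ + lam) * t) := by
  have h := Continuous.fourierInv_fourier_eq (f := fun x : ℝ => ((Real.exp (-lam * |x|) : ℝ) : ℂ))
    (by fun_prop) (integrable_exp_neg_abs hlam) (by
      have : (fun ξ : ℝ => ((2 * lam / (lam ^ 2 + (2 * Real.pi * ξ) ^ 2) : ℝ) : ℂ)) =
          𝓕 (fun x : ℝ => ((Real.exp (-lam * |x|) : ℝ) : ℂ)) := by
        ext ξ; rw [fourier_exp_neg_abs hlam]
      rw [← this]
      exact (integrable_lorentz hlam).comp_mul_left' (by positivity))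
  have h2 := congrFun h t
  rw [Real.fourierInv_eq_fourier_neg, Real.fourier_real_eq_integral_exp_smul] at h2
  simp_rw [fourier_exp_neg_abs hlam] at h2
  rw [ift_shift (fun τ => ((2 * lam / (lam ^ 2 + τ ^ 2) : ℝ) : ℂ)) ℓ t]
  have h3 : ift (fun τ => ((2 * lam / (lam ^ 2 + τ ^ 2) : ℝ) : ℂ)) t =
      ((Real.exp (-lam * |t|) : ℝ) : ℂ) := by
    rw [← h2, ift]
    have := Measure.integral_comp_mul_left
      (fun τ => Complex.exp ((t * τ : ℝ) * Complex.I) *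
        ((2 * lam / (lam ^ 2 + τ ^ 2) : ℝ) : ℂ)) (2 * Real.pi)
    rw [abs_of_pos (by positivity), Complex.real_smul] at this
    push_cast at this ⊢
    rw [← this]
    congr 1 with ξ
    rw [smul_eq_mul]
    congr 2
    ring
  rw [h3, abs_of_nonneg ht, Complex.ofReal_exp, ← Complex.exp_add]
  congr 1
  push_cast; ring

/-! ### Weighted Fourier transforms at one spatial frequency -/

/-- The parameters of the weight of one spatial frequency: the regularity `b`, the width `lam` and
the dispersion `ℓ`. -/
structure Wgt where
  b : ℝ
  lam : ℝ
  ℓ : ℝ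
  hb : 1 / 2 < b
  hb1 : b ≤ 1
  hlam : 0 < lam

namespace Wgt

variable (W : Wgt)

/-- The weight. -/
def w (τ : ℝ) : ℝ := wt W.b W.lam W.ℓ τ

lemma w_pos (τ : ℝ) : 0 < W.w τ := wt_pos W.hlam τ

lemma continuous_w : Continuous W.w := continuous_wt

lemma continuous_inv_w : Continuous fun τ => (W.w τ)⁻¹ := continuous_inv_wt W.hlam

lemma b_nonneg : 0 ≤ W.b := by linarith [W.hb]

/-- The resolvent. -/
def r (τ : ℝ) : ℂ := res W.lam W.ℓ τ

lemma continuous_r : Continuous W.r := continuous_res W.hlam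

/-- The exponent `iℓ + λ` of the damped free evolution. -/
def μ : ℂ := Complex.I * W.ℓ + W.lam

lemma memLp_inv_w : MemLp (fun τ => (W.w τ)⁻¹) 2 := memLp_inv_wt W.hlam W.hb

/-- The space-time Fourier transform that a weighted function stands for. -/
def raw (h : L2R) (τ : ℝ) : ℂ := ((W.w τ)⁻¹ : ℝ) * h τ

lemma integrable_raw (h : L2R) : Integrable (W.raw h) :=
  ConvKernel.integrable_mul _ W.memLp_inv_w h

/-- The sign of the exponent is opposite to that in `ift`, because the inner product that defines
`ev` is conjugate-linear in its first argument. -/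
lemma memLp_ev (t : ℝ) : MemLp (fun τ : ℝ => (2 * Real.pi : ℂ)⁻¹ *
    (Complex.exp ((-(t * τ) : ℝ) * Complex.I) * ((W.w τ)⁻¹ : ℝ))) 2 := by
  have h : MemLp (fun τ => (((W.w τ)⁻¹ : ℝ) : ℂ)) 2 := W.memLp_inv_w.ofReal
  refine MemLp.const_mul (h.of_le ?_ ?_) _
  · exact (Continuous.mul (by fun_prop)
      (Complex.continuous_ofReal.comp W.continuous_inv_w)).aestronglyMeasurable
  · refine ae_of_all _ fun τ => ?_
    rw [norm_mul, Complex.norm_exp_ofReal_mul_I, one_mul]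

/-- The value at time `t` of the function with the given weighted Fourier transform. -/
def ev (t : ℝ) : L2R →L[ℂ] ℂ := innerSL ℂ ((W.memLp_ev t).toLp _)

lemma ev_eq (t : ℝ) (h : L2R) : W.ev t h = ift (W.raw h) t := by
  rw [ev, innerSL_apply_apply, L2.inner_def, ift, ← integral_const_mul]
  refine integral_congr_ae ?_
  filter_upwards [(W.memLp_ev t).coeFn_toLp] with τ hτ
  have hpi : (starRingEnd ℂ) ((2 * Real.pi : ℂ)⁻¹) = (2 * Real.pi : ℂ)⁻¹ := by
    have : ((2 * Real.pi : ℂ)⁻¹) = (((2 * Real.pi)⁻¹ : ℝ) : ℂ) := by push_cast; rfl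
    rw [this, Complex.conj_ofReal]
  simp only [hτ, raw, RCLike.inner_apply, map_mul, hpi, Complex.conj_ofReal, ← Complex.exp_conj,
    Complex.conj_I]
  have : (((-(t * τ) : ℝ) : ℂ) * -Complex.I) = ((t * τ : ℝ) : ℂ) * Complex.I := by
    push_cast; ring
  rw [this]
  ring

lemma continuous_ev (h : L2R) : Continuous fun t => W.ev t h := by
  simp_rw [ev_eq]
  exact continuous_ift (W.integrable_raw h)

/-- Cauchy–Schwarz against the inverse weight. The constant does not depend on the width, so the
bound holds uniformly for all spatial frequencies and times. -/
lemma norm_ev_le (t : ℝ) (h : L2R) : ‖W.ev t h‖ ≤ bracketNorm (-W.b) * ‖h‖ := by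
  rw [ev_eq, ift, norm_mul]
  have h0 : 0 ≤ bracketNorm (-W.b) := Real.sqrt_nonneg _
  have h1 : ‖(2 * Real.pi : ℂ)⁻¹‖ ≤ 1 := by
    have : ((2 * Real.pi : ℂ)⁻¹) = (((2 * Real.pi)⁻¹ : ℝ) : ℂ) := by push_cast; rfl
    rw [this, Complex.norm_real, Real.norm_of_nonneg (by positivity)]
    exact inv_le_one_of_one_le₀ (by linarith [Real.pi_gt_three])
  have h2 : ‖∫ τ, Complex.exp ((t * τ : ℝ) * Complex.I) * W.raw h τ‖ ≤
      bracketNorm (-W.b) * ‖h‖ := by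
    refine norm_le_of_enorm_sq_le (by positivity) ?_
    refine (pow_le_pow_left' (enorm_integral_le_lintegral_enorm _) 2).trans ?_
    rw [ENNReal.ofReal_mul h0, mul_pow, ofReal_norm]
    refine le_trans (le_of_eq ?_) (ConvKernel.lintegral_mul_le (fun τ => (W.w τ)⁻¹)
      W.continuous_inv_w.measurable (lintegral_inv_wt W.hlam W.hb).le h)
    congr 2 with τ
    rw [← ofReal_norm, norm_exp_mul, raw, norm_mul, Complex.norm_real,
      Real.norm_of_nonneg (inv_nonneg.2 (W.w_pos τ).le), ENNReal.ofReal_mul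
      (inv_nonneg.2 (W.w_pos τ).le), ofReal_norm]
  calc _ ≤ 1 * (bracketNorm (-W.b) * ‖h‖) := by gcongr
    _ = _ := one_mul _

/-! #### The damped free wave -/

/-- The profile of the weighted Fourier transform of the damped free wave. -/
def waveFn (τ : ℝ) : ℝ := W.w τ * (2 * W.lam / (W.lam ^ 2 + (τ + W.ℓ) ^ 2))

lemma waveFn_eq : W.waveFn = fun τ => 2 * scl W.lam W.ℓ (fun x => bracket x ^ (W.b - 2)) τ := by
  ext τ
  have hl := W.hlam
  have h1 : W.lam ^ 2 + (τ + W.ℓ) ^ 2 = W.lam ^ 2 * bracket ((τ + W.ℓ) / W.lam) ^ 2 := by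
    rw [bracket_sq]; field_simp
  have h2 := bracket_pos ((τ + W.ℓ) / W.lam)
  have h3 : bracket ((τ + W.ℓ) / W.lam) ^ (W.b - 2) =
      bracket ((τ + W.ℓ) / W.lam) ^ W.b / bracket ((τ + W.ℓ) / W.lam) ^ 2 := by
    rw [Real.rpow_sub h2]; norm_num
  rw [waveFn, w, wt, h1, scl, h3]
  have h4 := Real.mul_self_sqrt hl.le
  have h5 := (Real.sqrt_pos.2 hl).ne'
  field_simp
  rw [sq, h4]

lemma integrable_wave_aux : Integrable fun x => (bracket x ^ (W.b - 2)) ^ 2 :=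
  integrable_bracket_rpow_sq (by linarith [W.hb1])

lemma bracket_rpow_nonneg (r x : ℝ) : 0 ≤ bracket x ^ r :=
  (Real.rpow_pos_of_pos (bracket_pos _) _).le

lemma memLp_waveFn : MemLp (fun τ => ((W.waveFn τ : ℝ) : ℂ)) 2 := by
  have : MemLp W.waveFn 2 := by
    rw [waveFn_eq]
    exact (memLp_scl W.hlam (continuous_bracket_rpow _) (bracket_rpow_nonneg _)
      W.integrable_wave_aux).const_mul 2
  exact this.ofReal

/-- The weighted Fourier transform of the damped free wave `e^{-iℓt-λ|t|}`. -/
def wave : L2R := W.memLp_waveFn.toLp _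

/-- By `waveFn_eq` the profile is twice a rescaling of `⟨x⟩^{b-2}`, which is square integrable for
`b ≤ 1`. Hence the free evolution is bounded uniformly in the frequency and in the damping. -/
lemma norm_wave_le : ‖W.wave‖ ≤ 2 * bracketNorm (W.b - 2) := by
  refine norm_le_of_enorm_sq_le (mul_nonneg zero_le_two (Real.sqrt_nonneg _)) ?_
  rw [wave, enorm_toLp_sq]
  have hn : ∀ τ, 0 ≤ scl W.lam W.ℓ (fun x => bracket x ^ (W.b - 2)) τ := fun τ =>
    mul_nonneg (by positivity) (bracket_rpow_nonneg _ _)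
  have : ∀ τ, ‖((W.waveFn τ : ℝ) : ℂ)‖ₑ ^ 2 =
      ENNReal.ofReal 2 ^ 2 *
        ENNReal.ofReal (scl W.lam W.ℓ (fun x => bracket x ^ (W.b - 2)) τ) ^ 2 := fun τ => by
    rw [waveFn_eq, enorm_ofReal, Real.enorm_of_nonneg (mul_nonneg zero_le_two (hn τ)),
      ENNReal.ofReal_mul zero_le_two, mul_pow]
  simp_rw [this]
  rw [lintegral_const_mul' _ _ (by simp), lintegral_scl W.hlam (bracket_rpow_nonneg _)
    W.integrable_wave_aux, ← mul_pow, ← ENNReal.ofReal_mul zero_le_two]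
  rfl

lemma ev_wave {t : ℝ} (ht : 0 ≤ t) : W.ev t W.wave = Complex.exp (-W.μ * t) := by
  rw [ev_eq, μ, ← ift_lorentz W.hlam ht]
  refine ift_congr_ae ?_ t
  filter_upwards [W.memLp_waveFn.coeFn_toLp] with τ hτ
  have h := (W.w_pos τ).ne'
  rw [raw, wave, hτ, waveFn, ← Complex.ofReal_mul, inv_mul_cancel_left₀ h]

/-- Subtract the damped free wave with the same value at time `0`. -/
def Q : L2R →L[ℂ] L2R := ContinuousLinearMap.id ℂ L2R - (W.ev 0).smulRight W.wave

lemma Q_apply (h : L2R) : W.Q h = h - W.ev 0 h • W.wave := rfl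

/-- The bound for the operators `Q`. -/
def Qnorm (b : ℝ) : ℝ := 1 + bracketNorm (-b) * (2 * bracketNorm (b - 2))

lemma Qnorm_nonneg (b : ℝ) : 0 ≤ Qnorm b := by
  have h1 : 0 ≤ bracketNorm (-b) := Real.sqrt_nonneg _
  have h2 : 0 ≤ bracketNorm (b - 2) := Real.sqrt_nonneg _
  unfold Qnorm; positivity

lemma norm_Q_le (h : L2R) : ‖W.Q h‖ ≤ Qnorm W.b * ‖h‖ := by
  rw [Q_apply]
  refine (norm_sub_le _ _).trans ?_
  rw [norm_smul, Qnorm, add_mul, one_mul, mul_right_comm]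
  refine add_le_add le_rfl (mul_le_mul (W.norm_ev_le 0 h) W.norm_wave_le (norm_nonneg _) ?_)
  exact mul_nonneg (Real.sqrt_nonneg _) (norm_nonneg _)

lemma ev_Q {t : ℝ} (ht : 0 ≤ t) (h : L2R) :
    W.ev t (W.Q h) = W.ev t h - W.ev 0 h * Complex.exp (-W.μ * t) := by
  rw [Q_apply, map_sub, map_smul, W.ev_wave ht, smul_eq_mul]

lemma integral_of_hasDerivAt {z F : ℝ → ℂ} {ν : ℂ} (hF : Continuous F)
    (hz : ∀ t, HasDerivAt z (-ν * z t + F t) t) {t : ℝ} :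
    z t = z 0 + ∫ s in (0 : ℝ)..t, (-ν * z s + F s) := by
  have hc : Continuous z := continuous_iff_continuousAt.2 fun t => (hz t).continuousAt
  rw [intervalIntegral.integral_eq_sub_of_hasDerivAt (fun s _ => hz s)
    (Continuous.intervalIntegrable (by fun_prop) _ _)]
  ring

lemma hasDerivAt_exp (ν : ℂ) (t : ℝ) :
    HasDerivAt (fun t : ℝ => Complex.exp (-ν * t)) (-ν * Complex.exp (-ν * t)) t := by
  have h := ((hasDerivAt_id t).ofReal_comp.const_mul (-ν)).cexp
  simp only [id, Complex.ofReal_one, mul_one] at h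
  rw [mul_comm]
  exact h

/-- If the value function of `h` solves the damped equation with source `F`, then the one of `Q h`
solves it with zero initial value. -/
lemma ev_Q_integral {h : L2R} {F : ℝ → ℂ} (hF : Continuous F)
    (hz : ∀ t, HasDerivAt (fun t => W.ev t h) (-W.μ * W.ev t h + F t) t) {t : ℝ} (ht : 0 ≤ t) :
    W.ev t (W.Q h) = ∫ s in (0 : ℝ)..t, (-W.μ * W.ev s (W.Q h) + F s) := by
  have h1 := integral_of_hasDerivAt (z := fun t => W.ev t h - W.ev 0 h * Complex.exp (-W.μ * t))
    (F := F) (ν := W.μ) hF (fun t => by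
      have := (hz t).sub ((hasDerivAt_exp W.μ t).const_mul (W.ev 0 h))
      refine this.congr_deriv ?_
      ring) (t := t)
  simp only [Complex.ofReal_zero, mul_zero, Complex.exp_zero, mul_one, sub_self, zero_add] at h1
  rw [W.ev_Q ht, h1]
  refine intervalIntegral.integral_congr fun s hs => ?_
  rw [uIcc_of_le ht] at hs
  simp only [W.ev_Q hs.1]

/-! #### Duhamel operators -/

lemma hasDerivAt_ev {h : L2R} {f : ℝ → ℂ} (hf : Integrable f)
    (hr : W.raw h =ᵐ[volume] fun τ => W.r τ * f τ) (t : ℝ) :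
    HasDerivAt (fun t => W.ev t h) (-W.μ * W.ev t h + ift f t) t := by
  have e : ∀ t, W.ev t h = ift (fun τ => W.r τ * f τ) t := fun t => by
    rw [ev_eq, ift_congr_ae hr]
  simp_rw [e]
  exact hasDerivAt_ift_res W.hlam hf t

lemma raw_eq_of_ae {h : L2R} {g : ℝ → ℂ} (hg : h =ᵐ[volume] fun τ => (W.w τ : ℂ) * g τ) :
    W.raw h =ᵐ[volume] g := by
  filter_upwards [hg] with τ hτ
  have h := (W.w_pos τ).ne'
  rw [raw, hτ, ← mul_assoc, ← Complex.ofReal_mul, inv_mul_cancel₀ h, Complex.ofReal_one, one_mul]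

/-- The kernel bound for the linear Duhamel operator from the weight `W₁` to `W`, with the
coefficient `c`. -/
def LinBound (W W₁ : Wgt) (c : ℂ) (m : ℝ) : Prop :=
  ∀ τ, ‖c‖ * (W.w τ * ‖W.r τ‖) * (W₁.w τ)⁻¹ ≤ m

/-- The symbol of the linear Duhamel operator. -/
def linFn (W W₁ : Wgt) (c : ℂ) (τ : ℝ) : ℂ := c * ((W.w τ : ℂ) * W.r τ) * ((W₁.w τ)⁻¹ : ℝ)

lemma measurable_linFn (W W₁ : Wgt) (c : ℂ) : Measurable (linFn W W₁ c) := by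
  have h1 := W.continuous_r
  have h2 := Complex.continuous_ofReal.comp W.continuous_w
  have h3 := Complex.continuous_ofReal.comp W₁.continuous_inv_w
  exact ((continuous_const.mul (h2.mul h1)).mul h3).measurable

lemma LinBound.norm_le {W W₁ : Wgt} {c : ℂ} {m : ℝ} (H : LinBound W W₁ c m) (τ : ℝ) :
    ‖linFn W W₁ c τ‖ ≤ m := by
  have := H τ
  rwa [linFn, norm_mul, norm_mul, norm_mul, Complex.norm_real, Complex.norm_real,
    Real.norm_of_nonneg (W.w_pos τ).le, Real.norm_of_nonneg (inv_nonneg.2 (W₁.w_pos τ).le)]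

/-- The linear Duhamel operator. -/
def linOp (W W₁ : Wgt) (c : ℂ) (m : ℝ) (H : LinBound W W₁ c m) : L2R →L[ℂ] L2R :=
  W.Q ∘L mulOp (linFn W W₁ c) (measurable_linFn W W₁ c) m H.norm_le

lemma norm_linOp_le {W W₁ : Wgt} {c : ℂ} {m : ℝ} (H : LinBound W W₁ c m) (h : L2R) :
    ‖linOp W W₁ c m H h‖ ≤ Qnorm W.b * m * ‖h‖ := by
  refine (W.norm_Q_le _).trans ?_
  rw [mul_assoc]
  exact mul_le_mul_of_nonneg_left (mulOp_norm_le _ _ _ _ h) (Qnorm_nonneg _)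

/-- The transform of the output before `Q` is the resolvent times `c` times that of the input, so it
solves the damped equation on the whole line. Then `Q` resets the initial value. This is Duhamel's
formula for `t ≥ 0` without a cutoff in time. -/
lemma ev_linOp {W W₁ : Wgt} {c : ℂ} {m : ℝ} (H : LinBound W W₁ c m) (h : L2R) {t : ℝ}
    (ht : 0 ≤ t) :
    W.ev t (linOp W W₁ c m H h) =
      ∫ s in (0 : ℝ)..t, (-W.μ * W.ev s (linOp W W₁ c m H h) + c * W₁.ev s h) := by
  refine W.ev_Q_integral (continuous_const.mul (W₁.continuous_ev h)) (fun t => ?_) ht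
  have h0 : W.raw (mulOp (linFn W W₁ c) (measurable_linFn W W₁ c) m H.norm_le h) =ᵐ[volume]
      fun τ => W.r τ * (c * W₁.raw h τ) := by
    refine W.raw_eq_of_ae ?_
    filter_upwards [mulOp_ae (linFn W W₁ c) (measurable_linFn W W₁ c) m H.norm_le h] with τ hτ
    rw [hτ, linFn, raw]
    ring
  have h1 := W.hasDerivAt_ev (f := fun τ => c * W₁.raw h τ)
    ((W₁.integrable_raw h).const_mul c) h0 t
  rwa [ift_const_mul, ← W₁.ev_eq] at h1

/-- The kernel bound for the bilinear Duhamel operator from the weights `W₁`, `W₂` to `W`, with the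
coefficient `c`. -/
def BilBound (W W₁ W₂ : Wgt) (c : ℂ) (m : ℝ) : Prop :=
  0 ≤ m ∧ ∀ τ s, ‖c‖ * (W.w τ * ‖W.r τ‖) * (W₁.w s)⁻¹ * (W₂.w (τ - s))⁻¹ ≤
    m * ((W₁.w s)⁻¹ + (W₂.w (τ - s))⁻¹)

/-- The kernel of the bilinear Duhamel operator. -/
def bilKernel (W W₁ W₂ : Wgt) (c : ℂ) (m : ℝ) (H : BilBound W W₁ W₂ c m) : ConvKernel where
  q τ := c * ((W.w τ : ℂ) * W.r τ)
  r₁ s := (W₁.w s)⁻¹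
  r₂ s := (W₂.w s)⁻¹
  -- The majorants are the inverse weights themselves: `BilBound` trades one of the two factors for
  -- the constant `m`, and the other one remains as the square integrable factor.
  p₁ s := (W₁.w s)⁻¹
  p₂ s := (W₂.w s)⁻¹
  m := m
  P := max (bracketNorm (-W₁.b)) (bracketNorm (-W₂.b))
  q_meas := Continuous.measurable (by
    have h1 := W.continuous_r
    have h2 := Complex.continuous_ofReal.comp W.continuous_w
    exact (continuous_const.mul (h2.mul h1)))
  r₁_mem := W₁.memLp_inv_w
  r₂_mem := W₂.memLp_inv_w
  p₁_meas := W₁.continuous_inv_w.measurable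
  p₂_meas := W₂.continuous_inv_w.measurable
  m_nonneg := H.1
  P_nonneg := le_max_of_le_left (Real.sqrt_nonneg _)
  p₁_nonneg s := inv_nonneg.2 (W₁.w_pos s).le
  p₂_nonneg s := inv_nonneg.2 (W₂.w_pos s).le
  p₁_le := (lintegral_inv_wt W₁.hlam W₁.hb).le.trans
    (pow_le_pow_left' (ENNReal.ofReal_le_ofReal (le_max_left _ _)) 2)
  p₂_le := (lintegral_inv_wt W₂.hlam W₂.hb).le.trans
    (pow_le_pow_left' (ENNReal.ofReal_le_ofReal (le_max_right _ _)) 2)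
  bound τ s := by
    have := H.2 τ s
    rwa [norm_mul, norm_mul, Complex.norm_real, Real.norm_of_nonneg (W.w_pos τ).le,
      abs_of_pos (inv_pos.2 (W₁.w_pos s)), abs_of_pos (inv_pos.2 (W₂.w_pos _))]

/-- The bilinear Duhamel operator. -/
def bilOp (W W₁ W₂ : Wgt) (c : ℂ) (m : ℝ) (H : BilBound W W₁ W₂ c m) : L2R →L[ℂ] L2R →L[ℂ] L2R :=
  (ContinuousLinearMap.compL ℂ L2R L2R L2R W.Q) ∘L (bilKernel W W₁ W₂ c m H).op

lemma bilOp_apply {W W₁ W₂ : Wgt} {c : ℂ} {m : ℝ} (H : BilBound W W₁ W₂ c m) (h₁ h₂ : L2R) :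
    bilOp W W₁ W₂ c m H h₁ h₂ = W.Q ((bilKernel W W₁ W₂ c m H).op h₁ h₂) := rfl

lemma norm_bilOp_le {W W₁ W₂ : Wgt} {c : ℂ} {m : ℝ} (H : BilBound W W₁ W₂ c m) (h₁ h₂ : L2R) :
    ‖bilOp W W₁ W₂ c m H h₁ h₂‖ ≤ Qnorm W.b * (2 * m *
      max (bracketNorm (-W₁.b)) (bracketNorm (-W₂.b))) * ‖h₁‖ * ‖h₂‖ := by
  rw [bilOp_apply]
  refine (W.norm_Q_le _).trans ?_
  rw [mul_assoc (Qnorm _ * _), mul_assoc (Qnorm _), ← mul_assoc _ ‖h₁‖]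
  exact mul_le_mul_of_nonneg_left ((bilKernel W W₁ W₂ c m H).op_norm_le h₁ h₂) (Qnorm_nonneg _)

/-- As in the linear case, with the source given by a convolution in `τ`. It corresponds to the
product of the values, times `2π` in the normalisation of `ift`. -/
lemma ev_bilOp {W W₁ W₂ : Wgt} {c : ℂ} {m : ℝ} (H : BilBound W W₁ W₂ c m) (h₁ h₂ : L2R) {t : ℝ}
    (ht : 0 ≤ t) :
    W.ev t (bilOp W W₁ W₂ c m H h₁ h₂) =
      ∫ s in (0 : ℝ)..t, (-W.μ * W.ev s (bilOp W W₁ W₂ c m H h₁ h₂) +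
        c * (2 * Real.pi) * (W₁.ev s h₁ * W₂.ev s h₂)) := by
  rw [bilOp_apply]
  refine W.ev_Q_integral (continuous_const.mul ((W₁.continuous_ev h₁).mul (W₂.continuous_ev h₂)))
    (fun t => ?_) ht
  have h0 : W.raw ((bilKernel W W₁ W₂ c m H).op h₁ h₂) =ᵐ[volume]
      fun τ => W.r τ * (c * conv (W₁.raw h₁) (W₂.raw h₂) τ) := by
    refine W.raw_eq_of_ae ?_
    filter_upwards [(bilKernel W W₁ W₂ c m H).op_ae h₁ h₂] with τ hτ
    have e : conv (fun s => ((bilKernel W W₁ W₂ c m H).r₁ s : ℂ) * h₁ s)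
      (fun s => ((bilKernel W W₁ W₂ c m H).r₂ s : ℂ) * h₂ s) τ =
        conv (W₁.raw h₁) (W₂.raw h₂) τ := rfl
    rw [hτ, ConvKernel.fn, e]
    simp only [bilKernel]
    ring
  have h1 := W.hasDerivAt_ev (f := fun τ => c * conv (W₁.raw h₁) (W₂.raw h₂) τ)
    ((integrable_conv (W₁.integrable_raw h₁) (W₂.integrable_raw h₂)).const_mul c) h0 t
  rwa [ift_const_mul, ift_conv (W₁.integrable_raw h₁) (W₂.integrable_raw h₂), ← W₁.ev_eq,
    ← W₂.ev_eq, ← mul_assoc] at h1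

/-! #### Translation in time -/

/-- Translation in time. -/
def shiftOp (t₀ : ℝ) : L2R →L[ℂ] L2R :=
  mulOp (fun τ => Complex.exp ((t₀ * τ : ℝ) * Complex.I)) (Continuous.measurable (by fun_prop)) 1
    (fun τ => (Complex.norm_exp_ofReal_mul_I _).le)

lemma norm_shiftOp_le (t₀ : ℝ) (h : L2R) : ‖shiftOp t₀ h‖ ≤ ‖h‖ := by
  have := mulOp_norm_le (fun τ => Complex.exp ((t₀ * τ : ℝ) * Complex.I))
    (Continuous.measurable (by fun_prop)) 1 (fun τ => (Complex.norm_exp_ofReal_mul_I _).le) h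
  rwa [one_mul] at this

lemma ev_shiftOp (t₀ t : ℝ) (h : L2R) : W.ev t (shiftOp t₀ h) = W.ev (t + t₀) h := by
  rw [ev_eq, ev_eq, ift, ift]
  congr 1
  refine integral_congr_ae ?_
  filter_upwards [mulOp_ae (fun τ => Complex.exp ((t₀ * τ : ℝ) * Complex.I))
    (Continuous.measurable (by fun_prop)) 1 (fun τ => (Complex.norm_exp_ofReal_mul_I _).le) h]
    with τ hτ
  rw [raw, shiftOp, hτ, raw, mul_left_comm _ (Complex.exp _), ← mul_assoc, ← Complex.exp_add]
  congr 2
  push_cast; ring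

end Wgt

/-! ### Time multipliers at one spatial frequency -/

/-- A function of time given by its Fourier transform, with decay. -/
structure TimeMult where
  κ : ℝ → ℂ
  cont : Continuous κ
  decay : Integrable fun s => (‖κ s‖ * bracket s ^ 2) ^ 2

namespace TimeMult

variable (K : TimeMult)

/-- The function of time. -/
def χ (t : ℝ) : ℂ := ∫ τ, Complex.exp ((t * τ : ℝ) * Complex.I) * K.κ τ

/-- The size of a multiplier. -/
def size : ℝ := √(∫ s, (‖K.κ s‖ * bracket s ^ 2) ^ 2)

lemma size_nonneg : 0 ≤ K.size := Real.sqrt_nonneg _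

/-- The rescaled profile. -/
def elFn (M s : ℝ) : ℂ := ((√M)⁻¹ : ℝ) * (K.κ (s / M) * ((bracket (s / M) ^ 2 : ℝ) : ℂ))

lemma enorm_elFn (M s : ℝ) :
    ‖K.elFn M s‖ₑ = ENNReal.ofReal (scl M 0 (fun x => ‖K.κ x‖ * bracket x ^ 2) s) := by
  rw [← ofReal_norm, elFn, scl, add_zero, norm_mul, norm_mul, Complex.norm_real, Complex.norm_real,
    Real.norm_of_nonneg (by positivity), Real.norm_of_nonneg (by positivity)]

lemma lintegral_elFn {M : ℝ} (hM : 0 < M) :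
    ∫⁻ s, ‖K.elFn M s‖ₑ ^ 2 = ENNReal.ofReal K.size ^ 2 := by
  simp_rw [enorm_elFn]
  exact lintegral_scl hM (fun x => by positivity) K.decay

lemma memLp_elFn {M : ℝ} (hM : 0 < M) : MemLp (K.elFn M) 2 := by
  refine memLp_two_of_lintegral ?_ (by rw [K.lintegral_elFn hM]; simp)
  have h1 : Continuous fun s => K.κ (s / M) := K.cont.comp (by fun_prop)
  have h2 : Continuous fun s => ((bracket (s / M) ^ 2 : ℝ) : ℂ) :=
    Complex.continuous_ofReal.comp ((continuous_bracket.comp (by fun_prop)).pow 2)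
  exact (continuous_const.mul (h1.mul h2)).aestronglyMeasurable

/-- The rescaled profile in `L²`. -/
def el {M : ℝ} (hM : 0 < M) : L2R := (K.memLp_elFn hM).toLp _

lemma norm_el_le {M : ℝ} (hM : 0 < M) : ‖K.el hM‖ ≤ K.size := by
  refine norm_le_of_enorm_sq_le K.size_nonneg ?_
  rw [el, enorm_toLp_sq, K.lintegral_elFn hM]

end TimeMult

lemma bracket_mono {x y : ℝ} (h : |x| ≤ |y|) : bracket x ≤ bracket y :=
  Real.sqrt_le_sqrt (by have := sq_le_sq.2 h; linarith)

/-- Weights that allow multiplication by a function of `M t`, uniformly. -/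
structure TimeCompat (W W' : Wgt) (C M : ℝ) : Prop where
  hM : 0 < M
  le : M ≤ W.lam
  hC : 0 ≤ C
  w_le : ∀ τ, W'.w τ ≤ C * W.w τ

/-- The kernel of multiplication by a function of time. -/
def timeKernel {W W' : Wgt} {C M : ℝ} (H : TimeCompat W W' C M) : ConvKernel where
  q τ := (W'.w τ : ℂ)
  -- The rescaled profile `elFn` carries an extra factor `⟨s/M⟩²`, which `r₁` removes. Peetre's
  -- inequality costs at most one factor `⟨s/M⟩`, since `b ≤ 1` and `M ≤ λ`, and `⟨s/M⟩⁻¹` is left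
  -- as the square integrable majorant `p₁`.
  r₁ := scl M 0 fun x => bracket x ^ (-2 : ℝ)
  r₂ s := (W.w s)⁻¹
  p₁ := scl M 0 fun x => bracket x ^ (-1 : ℝ)
  p₂ _ := 0
  m := C * 2 ^ W.b
  P := bracketNorm (-1)
  q_meas := (Complex.continuous_ofReal.comp W'.continuous_w).measurable
  r₁_mem := memLp_scl H.hM (continuous_bracket_rpow _) (Wgt.bracket_rpow_nonneg _)
    (integrable_bracket_rpow_sq (by norm_num))
  r₂_mem := W.memLp_inv_w
  p₁_meas := (continuous_scl (continuous_bracket_rpow _)).measurable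
  p₂_meas := measurable_const
  m_nonneg := mul_nonneg H.hC (by positivity)
  P_nonneg := Real.sqrt_nonneg _
  p₁_nonneg s := mul_nonneg (by positivity) (Wgt.bracket_rpow_nonneg _ _)
  p₂_nonneg _ := le_rfl
  p₁_le := (lintegral_scl H.hM (Wgt.bracket_rpow_nonneg _)
    (integrable_bracket_rpow_sq (by norm_num))).le
  p₂_le := by simp
  bound t s := by
    have h1 : W'.w t ≤ C * (2 ^ W.b * bracket (s / M) * W.w (t - s)) := by
      refine (H.w_le t).trans (mul_le_mul_of_nonneg_left ?_ H.hC)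
      have h := wt_add_le (b := W.b) (lam := W.lam) (ℓ := W.ℓ) W.b_nonneg (t - s) s
      rw [sub_add_cancel] at h
      refine h.trans (mul_le_mul_of_nonneg_right ?_ (W.w_pos _).le)
      refine mul_le_mul_of_nonneg_left ?_ (by positivity)
      calc bracket (s / W.lam) ^ W.b ≤ bracket (s / W.lam) ^ (1 : ℝ) := bracket_rpow_le W.hb1 _
        _ = bracket (s / W.lam) := Real.rpow_one _
        _ ≤ bracket (s / M) := bracket_mono (by
          rw [abs_div, abs_div, abs_of_pos W.hlam, abs_of_pos H.hM]
          exact div_le_div_of_nonneg_left (abs_nonneg _) H.hM H.le)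
    have hw := W.w_pos (t - s)
    have hb := bracket_pos (s / M)
    have e : bracket (s / M) ^ (-2 : ℝ) = (bracket (s / M) ^ 2)⁻¹ := by
      rw [Real.rpow_neg hb.le]; norm_num
    have hM := Real.sqrt_pos.2 H.hM
    rw [Complex.norm_real, Real.norm_of_nonneg (W'.w_pos t).le, abs_of_pos (inv_pos.2 hw)]
    simp only [scl, add_zero, e]
    rw [Real.rpow_neg_one, abs_of_pos (by positivity)]
    calc W'.w t * ((√M)⁻¹ * (bracket (s / M) ^ 2)⁻¹) * (W.w (t - s))⁻¹
        ≤ C * (2 ^ W.b * bracket (s / M) * W.w (t - s)) * ((√M)⁻¹ * (bracket (s / M) ^ 2)⁻¹) *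
          (W.w (t - s))⁻¹ := by gcongr
      _ = _ := by field_simp

/-- Multiplication by `χ(M t)`, from the weight `W` to `W'`. -/
def timeOp (K : TimeMult) {W W' : Wgt} {C M : ℝ} (H : TimeCompat W W' C M) : L2R →L[ℂ] L2R :=
  (timeKernel H).op (K.el H.hM)

/-- The bound for the multiplication operators. -/
def timeBound (K : TimeMult) (b C : ℝ) : ℝ := 2 * (C * 2 ^ b) * bracketNorm (-1) * K.size

lemma norm_timeOp_le (K : TimeMult) {W W' : Wgt} {C M : ℝ} (H : TimeCompat W W' C M) (h : L2R) :
    ‖timeOp K H h‖ ≤ timeBound K W.b C * ‖h‖ := by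
  refine ((timeKernel H).op_norm_le _ h).trans ?_
  refine mul_le_mul_of_nonneg_right ?_ (norm_nonneg _)
  refine mul_le_mul_of_nonneg_left (K.norm_el_le H.hM) ?_
  have := (timeKernel H).m_nonneg
  have := (timeKernel H).P_nonneg
  positivity

lemma ev_timeOp (K : TimeMult) {W W' : Wgt} {C M : ℝ} (H : TimeCompat W W' C M) (h : L2R) (t : ℝ) :
    W'.ev t (timeOp K H h) = K.χ (M * t) * W.ev t h := by
  have hM := H.hM
  set f : ℝ → ℂ := fun s => ((timeKernel H).r₁ s : ℂ) * K.el hM s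
  have hf : Integrable f := ConvKernel.integrable_mul _ (timeKernel H).r₁_mem _
  have e1 : W'.ev t (timeOp K H h) = ift (conv f (W.raw h)) t := by
    rw [W'.ev_eq]
    exact ift_congr_ae (W'.raw_eq_of_ae ((timeKernel H).op_ae _ h)) t
  have e2 : f =ᵐ[volume] fun s => ((M⁻¹ : ℝ) : ℂ) * K.κ (s / M) := by
    filter_upwards [(K.memLp_elFn hM).coeFn_toLp] with s hs
    simp only [f]
    rw [TimeMult.el, hs, TimeMult.elFn]
    simp only [timeKernel, scl, add_zero]
    have hb := bracket_pos (s / M)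
    have e : bracket (s / M) ^ (-2 : ℝ) = (bracket (s / M) ^ 2)⁻¹ := by
      rw [Real.rpow_neg hb.le]; norm_num
    have e3 : (√M)⁻¹ * (bracket (s / M) ^ 2)⁻¹ * ((√M)⁻¹ * (bracket (s / M) ^ 2)) = M⁻¹ := by
      have := Real.mul_self_sqrt hM.le
      have h2 := Real.sqrt_pos.2 hM
      field_simp
      rw [sq, this]
    rw [e, ← e3]
    push_cast
    ring
  rw [e1, ift_conv hf (W.integrable_raw h), ← W.ev_eq, ← mul_assoc, ift_congr_ae e2, ift]
  congr 1
  have e4 := Measure.integral_comp_div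
    (fun s => Complex.exp ((M * t * s : ℝ) * Complex.I) * K.κ s) M
  rw [abs_of_pos hM] at e4
  have e5 : ∀ τ : ℝ, Complex.exp ((t * τ : ℝ) * Complex.I) * (((M⁻¹ : ℝ) : ℂ) * K.κ (τ / M)) =
      ((M⁻¹ : ℝ) : ℂ) * (Complex.exp ((M * t * (τ / M) : ℝ) * Complex.I) * K.κ (τ / M)) := by
    intro τ
    have : M * t * (τ / M) = t * τ := by field_simp
    rw [this]; ring
  simp_rw [e5]
  rw [integral_const_mul, e4, Complex.real_smul, TimeMult.χ, ← mul_assoc (((M⁻¹ : ℝ) : ℂ)),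
    ← Complex.ofReal_mul, inv_mul_cancel₀ hM.ne', Complex.ofReal_one, one_mul, ← mul_assoc]
  rw [mul_inv_cancel₀ (by simp), one_mul]

/-- Every smooth function of time agrees with a multiplier on a given bounded interval. -/
lemma exists_timeMult {f : ℝ → ℂ} (hf : ContDiff ℝ ∞ f) (R : ℝ) :
    ∃ K : TimeMult, ∀ t, |t| ≤ R → K.χ t = f t := by
  -- The absolute values make the bump admissible for every real `R`. It equals one wherever `|t| ≤
  -- R`.
  let φ : ContDiffBump (0 : ℝ) := ⟨|R| + 1, |R| + 2, by positivity, by linarith⟩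
  have hcs : HasCompactSupport fun t => (φ t : ℂ) * f t := by
    have : HasCompactSupport fun t => (φ t : ℂ) :=
      φ.hasCompactSupport.comp_left (g := fun x : ℝ => (x : ℂ)) Complex.ofReal_zero
    exact this.mul_right
  have hsm : ContDiff ℝ ∞ fun t => (φ t : ℂ) * f t :=
    (Complex.ofRealCLM.contDiff.comp φ.contDiff).mul hf
  set F : SchwartzMap ℝ ℂ := hcs.toSchwartzMap hsm with hF
  set G : SchwartzMap ℝ ℂ := 𝓕 F
  have h2pi : (0 : ℝ) < 2 * Real.pi := by positivity
  have hcont : Continuous fun τ : ℝ => ((2 * Real.pi : ℂ)⁻¹ * G (τ / (2 * Real.pi))) :=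
    continuous_const.mul (G.continuous.comp (by fun_prop))
  obtain ⟨C, hC⟩ : ∃ C : ℝ, ∀ x, (1 + |x|) ^ 3 * ‖G x‖ ≤ C := by
    have := G.one_add_le_sup_seminorm_apply (𝕜 := ℝ) (m := (3, 0)) (k := 3) (n := 0) le_rfl le_rfl
    simp only [norm_iteratedFDeriv_zero, Real.norm_eq_abs] at this
    exact ⟨_, this⟩
  -- Three powers of decay are used: two against `⟨τ⟩²` in `TimeMult.decay`, and one for square
  -- integrability. The number `7` bounds `2π`.
  have hb : ∀ τ, (‖(2 * Real.pi : ℂ)⁻¹ * G (τ / (2 * Real.pi))‖ * bracket τ ^ 2) ≤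
      (7 ^ 3 * C) * (bracket τ ^ (-1 : ℝ)) := by
    intro τ
    have hpi : ‖(2 * Real.pi : ℂ)⁻¹‖ ≤ 1 := by
      have : ((2 * Real.pi : ℂ)⁻¹) = (((2 * Real.pi)⁻¹ : ℝ) : ℂ) := by push_cast; rfl
      rw [this, Complex.norm_real, Real.norm_of_nonneg (by positivity)]
      exact inv_le_one_of_one_le₀ (by linarith [Real.pi_gt_three])
    have h1 : bracket τ ≤ 7 * (1 + |τ / (2 * Real.pi)|) := by
      refine (bracket_le τ).trans ?_
      rw [abs_div, abs_of_pos h2pi]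
      have : |τ| = (2 * Real.pi) * (|τ| / (2 * Real.pi)) := by field_simp
      have h4 : 0 ≤ |τ| / (2 * Real.pi) := by positivity
      nlinarith [Real.pi_lt_d2]
    have h2 : bracket τ ^ 3 * ‖G (τ / (2 * Real.pi))‖ ≤ 7 ^ 3 * C := by
      calc _ ≤ (7 * (1 + |τ / (2 * Real.pi)|)) ^ 3 * ‖G (τ / (2 * Real.pi))‖ := by
            have := bracket_pos τ
            gcongr
        _ = 7 ^ 3 * ((1 + |τ / (2 * Real.pi)|) ^ 3 * ‖G (τ / (2 * Real.pi))‖) := by ring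
        _ ≤ _ := by gcongr; exact hC _
    have h3 := bracket_pos τ
    rw [norm_mul, Real.rpow_neg_one, ← div_eq_mul_inv, le_div_iff₀ h3]
    calc _ ≤ 1 * ‖G (τ / (2 * Real.pi))‖ * bracket τ ^ 2 * bracket τ := by gcongr
      _ = bracket τ ^ 3 * ‖G (τ / (2 * Real.pi))‖ := by ring
      _ ≤ _ := h2
  refine ⟨⟨fun τ => (2 * Real.pi : ℂ)⁻¹ * G (τ / (2 * Real.pi)), hcont, ?_⟩, fun t ht => ?_⟩
  · refine ((integrable_bracket_rpow_sq (r := -1) (by norm_num)).const_mul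
      ((7 ^ 3 * C) ^ 2)).mono' ?_ ?_
    · exact ((hcont.norm.mul (continuous_bracket.pow 2)).pow 2).aestronglyMeasurable
    · refine ae_of_all _ fun τ => ?_
      rw [Real.norm_of_nonneg (by positivity), ← mul_pow]
      exact pow_le_pow_left₀ (by positivity) (hb τ) 2
  · have h1 : (𝓕⁻ (𝓕 F)) t = f t := by
      rw [FourierTransform.fourierInv_fourier_eq]
      have : φ t = 1 := φ.one_of_mem_closedBall (by
        rw [mem_closedBall_zero_iff, Real.norm_eq_abs]
        show |t| ≤ |R| + 1
        linarith [le_abs_self R])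
      simp [hF, this]
    rw [← h1, TimeMult.χ]
    have h2 : (𝓕⁻ (𝓕 F)) t = (𝓕⁻ (⇑G)) t := by
      rw [SchwartzMap.fourierInv_coe]
    rw [h2, Real.fourierInv_eq_fourier_neg, Real.fourier_real_eq_integral_exp_smul]
    have h3 := Measure.integral_comp_div
      (fun ξ => Complex.exp ((-2 * Real.pi * ξ * -t : ℝ) * Complex.I) • G ξ) (2 * Real.pi)
    rw [abs_of_pos h2pi, Complex.real_smul] at h3
    have h4 : ∀ τ : ℝ, Complex.exp ((t * τ : ℝ) * Complex.I) *
        ((2 * Real.pi : ℂ)⁻¹ * G (τ / (2 * Real.pi))) = (2 * Real.pi : ℂ)⁻¹ *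
        (Complex.exp ((-2 * Real.pi * (τ / (2 * Real.pi)) * -t : ℝ) * Complex.I) •
          G (τ / (2 * Real.pi))) := by
      intro τ
      have : -2 * Real.pi * (τ / (2 * Real.pi)) * -t = t * τ := by field_simp
      rw [this, smul_eq_mul]; ring
    simp_rw [h4]
    rw [integral_const_mul, h3, ← mul_assoc]
    push_cast
    rw [inv_mul_cancel₀ (by simp), one_mul]

/-! ### Resonance -/

/-- The dispersion relation on the reals. -/
def disp (α x : ℝ) : ℝ := x * |x| ^ α

lemma disp_neg (α x : ℝ) : disp α (-x) = -disp α x := by simp [disp]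

lemma dispSymbol_eq (α : ℝ) (k : ℤ) : dispSymbol α k = disp α k := rfl

/-- Write the difference as `x((x+y)^α - x^α) + y((x+y)^α - y^α)`. The first term is nonnegative. In
the second, `y ≤ (x+y)/2` and `α ≥ 1` give `y^α ≤ (x+y)^α/2`. -/
lemma disp_add_ge_aux {α x y : ℝ} (hα : 1 ≤ α) (hy : 0 < y) (hxy : y ≤ x) :
    1 / 2 * ((x + y) ^ α * y) ≤ disp α (x + y) - disp α x - disp α y := by
  have hx : 0 < x := hy.trans_le hxy
  have hz : 0 < x + y := by positivity
  rw [disp, disp, disp, abs_of_pos hx, abs_of_pos hy, abs_of_pos hz]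
  have h1 : x ^ α ≤ (x + y) ^ α := Real.rpow_le_rpow hx.le (by linarith) (by linarith)
  have h2 : y ^ α ≤ 1 / 2 * (x + y) ^ α := by
    calc y ^ α ≤ (1 / 2 * (x + y)) ^ α := Real.rpow_le_rpow hy.le (by linarith) (by linarith)
      _ = (1 / 2) ^ α * (x + y) ^ α := Real.mul_rpow (by norm_num) hz.le
      _ ≤ (1 / 2) ^ (1 : ℝ) * (x + y) ^ α := by
          refine mul_le_mul_of_nonneg_right ?_ (by positivity)
          exact Real.rpow_le_rpow_of_exponent_ge (by norm_num) (by norm_num) hα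
      _ = _ := by rw [Real.rpow_one]
  nlinarith [mul_nonneg hx.le (sub_nonneg.2 h1), mul_nonneg hy.le (sub_nonneg.2 h2)]

lemma disp_add_ge {α x y : ℝ} (hα : 1 ≤ α) (hx : 0 < x) (hy : 0 < y) :
    1 / 2 * ((x + y) ^ α * min x y) ≤ disp α (x + y) - disp α x - disp α y := by
  rcases le_total y x with h | h
  · rw [min_eq_right h]; exact disp_add_ge_aux hα hy h
  · rw [min_eq_left h]
    have := disp_add_ge_aux hα hx h
    rw [add_comm y x] at this
    linarith

/-- The resonance function of the quadratic interaction. -/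
lemma exists_resonance {α : ℝ} (hα : 1 ≤ α) {k₁ k₂ : ℤ} (h1 : k₁ ≠ 0) (h2 : k₂ ≠ 0)
    (h : k₁ + k₂ ≠ 0) :
    ∃ K κ : ℝ, 1 ≤ κ ∧ κ ≤ K ∧ |((k₁ + k₂ : ℤ) : ℝ)| ≤ K ∧
      (K / 2 ≤ |(k₁ : ℝ)| ∨ K / 2 ≤ |(k₂ : ℝ)|) ∧
      (κ = |((k₁ + k₂ : ℤ) : ℝ)| ∨ κ = |(k₁ : ℝ)| ∨ κ = |(k₂ : ℝ)|) ∧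
      1 / 2 * (K ^ α * κ) ≤
        |dispSymbol α (k₁ + k₂) - dispSymbol α k₁ - dispSymbol α k₂| := by
  have one_le : ∀ {n : ℤ}, n ≠ 0 → 1 ≤ |(n : ℝ)| := fun {n} hn => by
    have : (1 : ℤ) ≤ |n| := Int.one_le_abs hn
    exact_mod_cast this
  have key : ∀ {x y : ℝ}, 1 ≤ |x| → 1 ≤ |y| → 0 < x → 0 < y →
      1 ≤ min x y ∧ min x y ≤ x + y ∧ ((x + y) / 2 ≤ x ∨ (x + y) / 2 ≤ y) := by
    intro x y hx hy hx0 hy0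
    rw [abs_of_pos hx0] at hx
    rw [abs_of_pos hy0] at hy
    refine ⟨le_min hx hy, (min_le_left _ _).trans (by linarith), ?_⟩
    rcases le_total x y with h | h
    · right; linarith
    · left; linarith
  have o1 := one_le h1
  have o2 := one_le h2
  have o := one_le h
  simp only [dispSymbol_eq]
  set x : ℝ := (k₁ : ℝ)
  set y : ℝ := (k₂ : ℝ)
  have hxy : ((k₁ + k₂ : ℤ) : ℝ) = x + y := by push_cast; rfl
  rw [hxy] at o ⊢
  have x0 : x ≠ 0 := abs_pos.1 (one_pos.trans_le o1)
  have y0 : y ≠ 0 := abs_pos.1 (one_pos.trans_le o2)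
  have z0 : x + y ≠ 0 := abs_pos.1 (one_pos.trans_le o)
  -- In every sign pattern one of the numbers `|k₁|`, `|k₂|`, `|k₁ + k₂|` is the sum of the other
  -- two. It is `K`, and `κ` is the smaller of those two. As the dispersion is odd, the resonance
  -- function is, up to sign, the one of two positive frequencies with sum `K`.
  rcases x0.lt_or_gt with hx | hx <;> rcases y0.lt_or_gt with hy | hy
  · -- both negative
    obtain ⟨a1, a2, a3⟩ := key (x := -x) (y := -y) (by rwa [abs_neg]) (by rwa [abs_neg])
      (by linarith) (by linarith)
    refine ⟨-x + -y, min (-x) (-y), a1, a2, ?_, ?_, ?_, ?_⟩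
    · rw [abs_of_neg (by linarith)]; linarith
    · rw [abs_of_neg hx, abs_of_neg hy]; exact a3
    · rw [abs_of_neg hx, abs_of_neg hy]; exact Or.inr (min_choice _ _)
    · refine (disp_add_ge hα (by linarith) (by linarith)).trans ?_
      rw [← neg_add, disp_neg, disp_neg, disp_neg, ← abs_neg]
      refine le_trans (le_of_eq ?_) (le_abs_self _)
      ring
  · rcases z0.lt_or_gt with hz | hz
    · -- `-x = y + -(x + y)`
      obtain ⟨a1, a2, a3⟩ := key (x := y) (y := -(x + y)) o2 (by rwa [abs_neg])
        (by linarith) (by linarith)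
      refine ⟨y + -(x + y), min y (-(x + y)), a1, a2, ?_, ?_, ?_, ?_⟩
      · rw [abs_of_neg hz]; linarith
      · left; rw [abs_of_neg hx]; linarith
      · rw [abs_of_pos hy, abs_of_neg hz]
        rcases min_choice y (-(x + y)) with e | e
        · exact Or.inr (Or.inr e)
        · exact Or.inl e
      · refine (disp_add_ge hα (by linarith) (by linarith)).trans ?_
        rw [show y + -(x + y) = -x by ring, disp_neg, disp_neg]
        refine le_trans (le_of_eq ?_) (le_abs_self _)
        ring
    · -- `y = -x + (x + y)`
      obtain ⟨a1, a2, a3⟩ := key (x := -x) (y := x + y) (by rwa [abs_neg]) o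
        (by linarith) (by linarith)
      refine ⟨-x + (x + y), min (-x) (x + y), a1, a2, ?_, ?_, ?_, ?_⟩
      · rw [abs_of_pos hz]; linarith
      · right; rw [abs_of_pos hy]; linarith
      · rw [abs_of_neg hx, abs_of_pos hz]
        rcases min_choice (-x) (x + y) with e | e
        · exact Or.inr (Or.inl e)
        · exact Or.inl e
      · refine (disp_add_ge hα (by linarith) (by linarith)).trans ?_
        rw [show -x + (x + y) = y by ring, disp_neg, ← abs_neg]
        refine le_trans (le_of_eq ?_) (le_abs_self _)
        ring
  · rcases z0.lt_or_gt with hz | hz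
    · -- `-y = x + -(x + y)`
      obtain ⟨a1, a2, a3⟩ := key (x := x) (y := -(x + y)) o1 (by rwa [abs_neg])
        (by linarith) (by linarith)
      refine ⟨x + -(x + y), min x (-(x + y)), a1, a2, ?_, ?_, ?_, ?_⟩
      · rw [abs_of_neg hz]; linarith
      · right; rw [abs_of_neg hy]; linarith
      · rw [abs_of_pos hx, abs_of_neg hz]
        rcases min_choice x (-(x + y)) with e | e
        · exact Or.inr (Or.inl e)
        · exact Or.inl e
      · refine (disp_add_ge hα (by linarith) (by linarith)).trans ?_
        rw [show x + -(x + y) = -y by ring, disp_neg, disp_neg]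
        refine le_trans (le_of_eq ?_) (le_abs_self _)
        ring
    · -- `x = -y + (x + y)`
      obtain ⟨a1, a2, a3⟩ := key (x := -y) (y := x + y) (by rwa [abs_neg]) o
        (by linarith) (by linarith)
      refine ⟨-y + (x + y), min (-y) (x + y), a1, a2, ?_, ?_, ?_, ?_⟩
      · rw [abs_of_pos hz]; linarith
      · left; rw [abs_of_pos hx]; linarith
      · rw [abs_of_neg hy, abs_of_pos hz]
        rcases min_choice (-y) (x + y) with e | e
        · exact Or.inr (Or.inr e)
        · exact Or.inl e
      · refine (disp_add_ge hα (by linarith) (by linarith)).trans ?_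
        rw [show -y + (x + y) = x by ring, disp_neg, ← abs_neg]
        refine le_trans (le_of_eq ?_) (le_abs_self _)
        ring
  · -- both positive
    obtain ⟨a1, a2, a3⟩ := key o1 o2 hx hy
    refine ⟨x + y, min x y, a1, a2, ?_, ?_, ?_, ?_⟩
    · rw [abs_of_pos (by linarith)]
    · rw [abs_of_pos hx, abs_of_pos hy]; exact a3
    · rw [abs_of_pos hx, abs_of_pos hy]; exact Or.inr (min_choice _ _)
    · exact (disp_add_ge hα hx hy).trans (le_abs_self _)

/-- The dispersion relation separates the frequencies. -/
lemma dispSymbol_sub_ge {α : ℝ} (hα : 0 ≤ α) {k j : ℤ} (hkj : k ≠ j) :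
    max |(k : ℝ)| |(j : ℝ)| ^ α ≤ |dispSymbol α k - dispSymbol α j| := by
  -- With equal signs the difference is `(x - y)|x|^α + y(|x|^α - |y|^α)`, and the second term has
  -- the sign of the first. With opposite signs the two symbols add up, and `|x| ≥ 1`.
  have aux : ∀ x y : ℝ, |y| ≤ |x| → 1 ≤ |x - y| → 1 ≤ |x| → |x| ^ α ≤ |disp α x - disp α y| := by
    intro x y hyx h1 h2
    have hy : |y| ^ α ≤ |x| ^ α := Real.rpow_le_rpow (abs_nonneg _) hyx hα
    have hp : 0 ≤ |x| ^ α := by positivity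
    have hq : 0 ≤ |y| ^ α := by positivity
    simp only [disp]
    rcases le_total 0 x with hx | hx
    · rw [abs_of_nonneg hx] at *
      have h3 : y ≤ x := (le_abs_self y).trans hyx
      rw [abs_of_nonneg (sub_nonneg.2 h3)] at h1
      refine le_trans ?_ (le_abs_self _)
      rcases le_total 0 y with h4 | h4
      · nlinarith [mul_nonneg h4 (sub_nonneg.2 hy)]
      · nlinarith [mul_nonneg (neg_nonneg.2 h4) hq]
    · rw [abs_of_nonpos hx] at *
      have h3 : x ≤ y := by linarith [neg_abs_le y]
      rw [abs_of_nonpos (by linarith)] at h1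
      rw [← abs_neg]
      refine le_trans ?_ (le_abs_self _)
      rcases le_total 0 y with h4 | h4
      · nlinarith [mul_nonneg h4 hq]
      · nlinarith [mul_nonneg (neg_nonneg.2 h4) (sub_nonneg.2 hy)]
  have hd : (1 : ℝ) ≤ |(k : ℝ) - j| := by
    have : (1 : ℤ) ≤ |k - j| := Int.one_le_abs (sub_ne_zero.2 hkj)
    exact_mod_cast this
  have ho : ∀ m n : ℤ, m ≠ n → |(n : ℝ)| ≤ |(m : ℝ)| → 1 ≤ |(m : ℝ)| := by
    intro m n hmn h
    have h' : |n| ≤ |m| := by exact_mod_cast h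
    have : m ≠ 0 := by
      rintro rfl
      simp at h'
      exact hmn h'.symm
    have : (1 : ℤ) ≤ |m| := Int.one_le_abs this
    exact_mod_cast this
  simp only [dispSymbol_eq]
  rcases le_total |(j : ℝ)| |(k : ℝ)| with h | h
  · rw [max_eq_left h]
    exact aux _ _ h hd (ho k j hkj h)
  · rw [max_eq_right h, abs_sub_comm]
    exact aux _ _ h (by rwa [abs_sub_comm]) (ho j k hkj.symm h)

/-! ### Kernel bounds -/

/-- A negative power of the large frequency is only worth the same power of the small one; this
suffices, because the gain has to be summed in the small frequency. -/
lemma rpow_gain {K κ e f s : ℝ} (h1 : 1 ≤ κ) (h2 : κ ≤ K) (he : e ≤ 0) (hs : e + f ≤ -s) :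
    K ^ e * κ ^ f ≤ κ ^ (-s) := by
  have hκ : 0 < κ := one_pos.trans_le h1
  calc K ^ e * κ ^ f ≤ κ ^ e * κ ^ f :=
        mul_le_mul_of_nonneg_right (Real.rpow_le_rpow_of_nonpos hκ h2 he) (by positivity)
    _ = κ ^ (e + f) := (Real.rpow_add hκ _ _).symm
    _ ≤ κ ^ (-s) := Real.rpow_le_rpow_of_exponent_le h1 hs

/-- The case of a large output modulation: derivative `K`, modulation gain with exponent `1/2 - η`,
and the width of an input of frequency at least `K/2`. The total power of `K` is `-δ + αη`. The loss
`(α + 1)η` in the sum of the exponents is at most `3η ≤ δ/2`, which is where `δ/6` comes from. -/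
lemma gain_output {α β η δ K κ : ℝ} (hα : α ≤ 2) (hβ : β ≤ 2)
    (hδ : δ = (α + β) / 2 - 1) (hη0 : 0 ≤ η) (hη : η ≤ δ / 6) (h1 : 1 ≤ κ)
    (h2 : κ ≤ K) :
    K * (1 / 6 * (K ^ α * κ)) ^ (-(1 / 2 - η)) * (K / 2) ^ (-(β / 2)) ≤
      12 * κ ^ (-(1 / 2 + δ / 2)) := by
  have hκ : 0 < κ := one_pos.trans_le h1
  have hK : 0 < K := hκ.trans_le h2
  have e1 : (1 / 6 * (K ^ α * κ)) ^ (-(1 / 2 - η)) =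
      6 ^ (1 / 2 - η) * (K ^ (-(α * (1 / 2 - η))) * κ ^ (-(1 / 2 - η))) := by
    rw [Real.mul_rpow (by norm_num) (by positivity), Real.mul_rpow (by positivity) hκ.le,
      ← Real.rpow_mul hK.le, mul_neg, one_div, Real.inv_rpow (by norm_num), Real.rpow_neg
      (by norm_num), inv_inv]
  have e2 : (K / 2) ^ (-(β / 2)) = 2 ^ (β / 2) * K ^ (-(β / 2)) := by
    rw [Real.div_rpow hK.le (by norm_num), Real.rpow_neg (by norm_num : (0:ℝ) ≤ 2), div_inv_eq_mul,
      mul_comm]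
  have b1 : (6 : ℝ) ^ (1 / 2 - η) ≤ 6 := by
    calc (6 : ℝ) ^ (1 / 2 - η) ≤ 6 ^ (1 : ℝ) :=
          Real.rpow_le_rpow_of_exponent_le (by norm_num) (by linarith)
      _ = 6 := Real.rpow_one _
  have b2 : (2 : ℝ) ^ (β / 2) ≤ 2 := by
    calc (2 : ℝ) ^ (β / 2) ≤ 2 ^ (1 : ℝ) :=
          Real.rpow_le_rpow_of_exponent_le (by norm_num) (by linarith)
      _ = 2 := Real.rpow_one _
  have e3 : K * K ^ (-(α * (1 / 2 - η))) * K ^ (-(β / 2)) = K ^ (-δ + α * η) := by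
    nth_rewrite 1 [← Real.rpow_one K]
    rw [← Real.rpow_add hK, ← Real.rpow_add hK]
    congr 1; rw [hδ]; ring
  rw [e1, e2]
  calc K * (6 ^ (1 / 2 - η) * (K ^ (-(α * (1 / 2 - η))) * κ ^ (-(1 / 2 - η)))) *
        (2 ^ (β / 2) * K ^ (-(β / 2)))
      = (6 ^ (1 / 2 - η) * 2 ^ (β / 2)) * (K * K ^ (-(α * (1 / 2 - η))) * K ^ (-(β / 2)) *
          κ ^ (-(1 / 2 - η))) := by ring
    _ ≤ (6 * 2) * κ ^ (-(1 / 2 + δ / 2)) := by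
        rw [e3]
        refine mul_le_mul (mul_le_mul b1 b2 (by positivity) (by norm_num)) ?_ (by positivity)
          (by norm_num)
        refine rpow_gain h1 h2 ?_ ?_ <;> nlinarith
    _ = _ := by norm_num

/-- The case of a large input modulation: the full exponent `1/2` is available for the modulation,
and the loss `η` sits in the width of the output. The total power of `K` is `-δ + βη`. -/
lemma gain_input {α β η δ K κ : ℝ} (hβ : β ≤ 2)
    (hδ : δ = (α + β) / 2 - 1) (hη0 : 0 ≤ η) (hη : η ≤ δ / 6) (h1 : 1 ≤ κ) (h2 : κ ≤ K) :
    K ^ (1 - β * (1 / 2 - η)) * (1 / 6 * (K ^ α * κ)) ^ (-(1 / 2) : ℝ) ≤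
      12 * κ ^ (-(1 / 2 + δ / 2)) := by
  have hκ : 0 < κ := one_pos.trans_le h1
  have hK : 0 < K := hκ.trans_le h2
  have e1 : (1 / 6 * (K ^ α * κ)) ^ (-(1 / 2) : ℝ) =
      6 ^ (1 / 2 : ℝ) * (K ^ (-(α * (1 / 2))) * κ ^ (-(1 / 2) : ℝ)) := by
    rw [Real.mul_rpow (by norm_num) (by positivity), Real.mul_rpow (by positivity) hκ.le,
      ← Real.rpow_mul hK.le, mul_neg, one_div, Real.inv_rpow (by norm_num), Real.rpow_neg
      (by norm_num), inv_inv, one_div]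
  have b1 : (6 : ℝ) ^ (1 / 2 : ℝ) ≤ 6 := by
    calc (6 : ℝ) ^ (1 / 2 : ℝ) ≤ 6 ^ (1 : ℝ) :=
          Real.rpow_le_rpow_of_exponent_le (by norm_num) (by norm_num)
      _ = 6 := Real.rpow_one _
  have e3 : K ^ (1 - β * (1 / 2 - η)) * K ^ (-(α * (1 / 2))) = K ^ (-δ + β * η) := by
    rw [← Real.rpow_add hK]
    congr 1; rw [hδ]; ring
  rw [e1]
  calc K ^ (1 - β * (1 / 2 - η)) * (6 ^ (1 / 2 : ℝ) * (K ^ (-(α * (1 / 2))) * κ ^ (-(1 / 2) : ℝ)))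
      = 6 ^ (1 / 2 : ℝ) * (K ^ (1 - β * (1 / 2 - η)) * K ^ (-(α * (1 / 2))) *
          κ ^ (-(1 / 2) : ℝ)) := by ring
    _ ≤ 12 * κ ^ (-(1 / 2 + δ / 2)) := by
        rw [e3]
        refine mul_le_mul (b1.trans (by norm_num)) ?_ (by positivity) (by norm_num)
        refine rpow_gain h1 h2 ?_ ?_ <;> nlinarith

namespace Wgt

lemma inv_w_le_sqrt (W : Wgt) {A : ℝ} (hA : 0 < A) (h : A ≤ W.lam) (τ : ℝ) :
    (W.w τ)⁻¹ ≤ A ^ (-(1 / 2) : ℝ) := by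
  rw [Real.rpow_neg hA.le, ← Real.sqrt_eq_rpow]
  exact inv_anti₀ (Real.sqrt_pos.2 hA) ((Real.sqrt_le_sqrt h).trans
    (sqrt_le_wt W.b_nonneg τ))

lemma inv_w_le_modulation (W : Wgt) {A τ : ℝ} (hA : 0 < A) (h : A ≤ |τ + W.ℓ|) :
    (W.w τ)⁻¹ ≤ A ^ (-(1 / 2) : ℝ) := by
  rw [Real.rpow_neg hA.le, ← Real.sqrt_eq_rpow]
  exact inv_anti₀ (Real.sqrt_pos.2 hA) ((Real.sqrt_le_sqrt h).trans
    (sqrt_abs_le_wt W.hlam W.hb.le τ))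

/-- The gain from a large width of the output. -/
lemma w_mul_r_le (W : Wgt) {A M : ℝ} (hM : 0 < M) (hMl : M ≤ W.lam) (hA : 0 < A)
    (h : A ≤ W.lam) (τ : ℝ) :
    W.w τ * ‖W.r τ‖ ≤ M ^ (-(W.b - 1 / 2)) * A ^ (-(1 - W.b)) := by
  have hl := W.hlam
  refine (wt_mul_norm_res_le W.hlam W.hb1 τ).trans ?_
  -- The half power of the width is split: the exponent `b - 1/2` is spent on the smallness in `M`,
  -- the exponent `1 - b` on the gain in the frequency.
  have e : (√W.lam)⁻¹ = W.lam ^ (-(W.b - 1 / 2)) * W.lam ^ (-(1 - W.b)) := by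
    rw [← Real.rpow_add hl, Real.sqrt_eq_rpow, ← Real.rpow_neg hl.le]
    congr 1; ring
  rw [e]
  exact mul_le_mul (Real.rpow_le_rpow_of_nonpos hM hMl (by linarith [W.hb]))
    (Real.rpow_le_rpow_of_nonpos hA h (by linarith [W.hb1])) (by positivity) (by positivity)

lemma w_mul_r_le_modulation (W : Wgt) {A M τ : ℝ} (hM : 0 < M) (hMl : M ≤ W.lam) (hA : 0 < A)
    (h : A ≤ |τ + W.ℓ|) :
    W.w τ * ‖W.r τ‖ ≤ M ^ (-(W.b - 1 / 2)) * A ^ (-(1 - W.b)) := by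
  refine (wt_mul_norm_res_le_modulation W.hlam W.hb1 hA h).trans ?_
  exact mul_le_mul_of_nonneg_right (Real.rpow_le_rpow_of_nonpos hM hMl (by linarith [W.hb]))
    (by positivity)

lemma mul_c_rpow {c x β e : ℝ} (hc : 0 < c) (hc1 : c ≤ 1) (hx : 0 < x) (he : e ≤ 1 / 2) :
    (c * x ^ β) ^ (-e) ≤ (√c)⁻¹ * x ^ (-(β * e)) := by
  rw [Real.mul_rpow hc.le (by positivity), ← Real.rpow_mul hx.le, mul_neg]
  refine mul_le_mul_of_nonneg_right ?_ (by positivity)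
  rw [Real.sqrt_eq_rpow, ← Real.rpow_neg hc.le]
  exact Real.rpow_le_rpow_of_exponent_ge hc hc1 (by linarith)

set_option maxHeartbeats 400000 in
/-- The bound of the quadratic Duhamel operator. -/
theorem bilBound_of_resonance {α β c M : ℝ} {k₁ k₂ : ℤ} (h1 : k₁ ≠ 0) (h2 : k₂ ≠ 0)
    (h : k₁ + k₂ ≠ 0) (hα1 : 1 ≤ α) (hα2 : α ≤ 2) (hβ2 : β ≤ 2)
    (W W₁ W₂ : Wgt) (hM : 0 < M) (hMW : M ≤ W.lam) (hc : 0 < c) (hc1 : c ≤ 1)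
    (hη : W.b - 1 / 2 ≤ ((α + β) / 2 - 1) / 6)
    (hW : c * |((k₁ + k₂ : ℤ) : ℝ)| ^ β ≤ W.lam) (hW₁ : c * |(k₁ : ℝ)| ^ β ≤ W₁.lam)
    (hW₂ : c * |(k₂ : ℝ)| ^ β ≤ W₂.lam) (hℓ : W.ℓ = dispSymbol α (k₁ + k₂))
    (hℓ₁ : W₁.ℓ = dispSymbol α k₁) (hℓ₂ : W₂.ℓ = dispSymbol α k₂) (a : ℂ)
    (ha : ‖a‖ ≤ |((k₁ + k₂ : ℤ) : ℝ)|) :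
    ∃ κ : ℝ, (κ = |((k₁ + k₂ : ℤ) : ℝ)| ∨ κ = |(k₁ : ℝ)| ∨ κ = |(k₂ : ℝ)|) ∧
      BilBound W W₁ W₂ a (12 * (√c)⁻¹ * M ^ (-(W.b - 1 / 2)) *
        κ ^ (-(1 / 2 + ((α + β) / 2 - 1) / 2))) := by
  obtain ⟨K, κ, hκ1, hκK, hkK, hK2, hκ, hΩ⟩ := exists_resonance hα1 h1 h2 h
  refine ⟨κ, hκ, ?_, fun τ s => ?_⟩
  · have : 0 < κ := one_pos.trans_le hκ1
    positivity
  have hb := W.hb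
  have hb1 := W.hb1
  set η := W.b - 1 / 2 with hηdef
  set δ := (α + β) / 2 - 1 with hδ
  have hη0 : 0 ≤ η := by linarith
  have he12 : 1 / 2 - η ≤ 1 / 2 := by linarith
  have hκ0 : 0 < κ := one_pos.trans_le hκ1
  have hK0 : 0 < K := hκ0.trans_le hκK
  set X : ℝ := |((k₁ + k₂ : ℤ) : ℝ)| with hX
  have hX1 : 1 ≤ X := by
    have : (1 : ℤ) ≤ |k₁ + k₂| := Int.one_le_abs h
    rw [hX]; exact_mod_cast this
  have hX0 : 0 < X := one_pos.trans_le hX1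
  -- One third of the lower bound of the resonance function: that function is a signed sum of the
  -- three modulations, so one of them is at least `A`.
  set A : ℝ := 1 / 6 * (K ^ α * κ) with hA
  have hA0 : 0 < A := by positivity
  set w₁ := (W₁.w s)⁻¹ with hw₁
  set w₂ := (W₂.w (τ - s))⁻¹ with hw₂
  have p1 : 0 < w₁ := inv_pos.2 (W₁.w_pos _)
  have p2 : 0 < w₂ := inv_pos.2 (W₂.w_pos _)
  have pw : 0 ≤ W.w τ * ‖W.r τ‖ := mul_nonneg (W.w_pos τ).le (norm_nonneg _)
  have hm0 : 0 ≤ M ^ (-η) := by positivity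
  have eb : 1 - W.b = 1 / 2 - η := by rw [hηdef]; ring
  set m := 12 * (√c)⁻¹ * M ^ (-η) * κ ^ (-(1 / 2 + δ / 2)) with hm
  have hm_nonneg : 0 ≤ m := by positivity
  -- it is enough to bound by one of the two terms
  suffices H : ‖a‖ * (W.w τ * ‖W.r τ‖) * w₁ ≤ m ∨ ‖a‖ * (W.w τ * ‖W.r τ‖) * w₂ ≤ m by
    rcases H with H | H
    · exact (mul_le_mul_of_nonneg_right H p2.le).trans
        (mul_le_mul_of_nonneg_left (le_add_of_nonneg_left p1.le) hm_nonneg)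
    · rw [mul_right_comm]
      exact (mul_le_mul_of_nonneg_right H p1.le).trans
        (mul_le_mul_of_nonneg_left (le_add_of_nonneg_right p2.le) hm_nonneg)
  -- the largest modulation
  have hmod : A ≤ |τ + W.ℓ| ∨ A ≤ |s + W₁.ℓ| ∨ A ≤ |(τ - s) + W₂.ℓ| := by
    by_contra hcon
    push Not at hcon
    obtain ⟨c1, c2, c3⟩ := hcon
    have e : dispSymbol α (k₁ + k₂) - dispSymbol α k₁ - dispSymbol α k₂ =
        (τ + W.ℓ) - (s + W₁.ℓ) - ((τ - s) + W₂.ℓ) := by rw [hℓ, hℓ₁, hℓ₂]; ring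
    rw [e] at hΩ
    have t1 := abs_sub ((τ + W.ℓ) - (s + W₁.ℓ)) ((τ - s) + W₂.ℓ)
    have t2 := abs_sub (τ + W.ℓ) (s + W₁.ℓ)
    have : 1 / 2 * (K ^ α * κ) = 3 * A := by rw [hA]; ring
    linarith
  have hexp : 0 ≤ 1 - β * (1 / 2 - η) := by
    have := mul_le_mul hβ2 (show 1 / 2 - η ≤ 1 / 2 by linarith) (by linarith) zero_le_two
    linarith
  -- An input with large modulation contributes `A^{-1/2}`. The output contributes only its width at
  -- the frequency `X`, and `X ≤ K` may be replaced by `K` because the combined exponent is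
  -- nonnegative.
  have input : ∀ v : ℝ, 0 ≤ v → v ≤ A ^ (-(1 / 2) : ℝ) → ‖a‖ * (W.w τ * ‖W.r τ‖) * v ≤ m := by
    intro v hv0 hv
    have g := gain_input (α := α) (η := η) hβ2 hδ hη0 hη hκ1 hκK
    have g1 : W.w τ * ‖W.r τ‖ ≤ M ^ (-η) * ((√c)⁻¹ * X ^ (-(β * (1 / 2 - η)))) := by
      refine (W.w_mul_r_le hM hMW (by positivity) hW τ).trans ?_
      rw [eb]
      exact mul_le_mul_of_nonneg_left (mul_c_rpow hc hc1 hX0 he12) hm0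
    have g2 : X * X ^ (-(β * (1 / 2 - η))) ≤ K ^ (1 - β * (1 / 2 - η)) := by
      have : X * X ^ (-(β * (1 / 2 - η))) = X ^ (1 - β * (1 / 2 - η)) := by
        nth_rewrite 1 [← Real.rpow_one X]
        rw [← Real.rpow_add hX0]
        congr 1
      rw [this]
      exact Real.rpow_le_rpow hX0.le hkK hexp
    calc ‖a‖ * (W.w τ * ‖W.r τ‖) * v
        ≤ X * (M ^ (-η) * ((√c)⁻¹ * X ^ (-(β * (1 / 2 - η))))) * A ^ (-(1 / 2) : ℝ) := by
          gcongr
      _ = M ^ (-η) * (√c)⁻¹ * ((X * X ^ (-(β * (1 / 2 - η)))) * A ^ (-(1 / 2) : ℝ)) := by ring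
      _ ≤ M ^ (-η) * (√c)⁻¹ * (K ^ (1 - β * (1 / 2 - η)) * A ^ (-(1 / 2) : ℝ)) := by gcongr
      _ ≤ M ^ (-η) * (√c)⁻¹ * (12 * κ ^ (-(1 / 2 + δ / 2))) := by gcongr
      _ = m := by rw [hm]; ring
  -- A large output modulation pays for most of the derivative; the rest comes from the width of an
  -- input, one of which has frequency at least `K/2`.
  have output : A ≤ |τ + W.ℓ| → ∀ v : ℝ, 0 ≤ v → v ≤ (√c)⁻¹ * (K / 2) ^ (-(β / 2)) →
      ‖a‖ * (W.w τ * ‖W.r τ‖) * v ≤ m := by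
    intro hmo v hv0 hv
    have g := gain_output (η := η) hα2 hβ2 hδ hη0 hη hκ1 hκK
    have g1 := W.w_mul_r_le_modulation hM hMW hA0 hmo
    rw [eb] at g1
    calc ‖a‖ * (W.w τ * ‖W.r τ‖) * v
        ≤ K * (M ^ (-η) * A ^ (-(1 / 2 - η))) * ((√c)⁻¹ * (K / 2) ^ (-(β / 2))) := by
          gcongr
          exact ha.trans hkK
      _ = M ^ (-η) * (√c)⁻¹ * (K * A ^ (-(1 / 2 - η)) * (K / 2) ^ (-(β / 2))) := by ring
      _ ≤ M ^ (-η) * (√c)⁻¹ * (12 * κ ^ (-(1 / 2 + δ / 2))) := by gcongr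
      _ = m := by rw [hm]; ring
  have width : ∀ (W' : Wgt) (x σ : ℝ), K / 2 ≤ x → c * x ^ β ≤ W'.lam →
      (W'.w σ)⁻¹ ≤ (√c)⁻¹ * (K / 2) ^ (-(β / 2)) := by
    intro W' x σ hx hW'
    have hx0 : 0 < x := by linarith
    refine (W'.inv_w_le_sqrt (by positivity) hW' σ).trans ?_
    refine (mul_c_rpow hc hc1 hx0 le_rfl).trans ?_
    refine mul_le_mul_of_nonneg_left ?_ (by positivity)
    rw [show β * (1 / 2) = β / 2 by ring]
    exact Real.rpow_le_rpow_of_nonpos (by positivity) hx (by linarith)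
  rcases hmod with h3 | h3 | h3
  · rcases hK2 with h4 | h4
    · exact Or.inl (output h3 _ p1.le (width W₁ _ s h4 hW₁))
    · exact Or.inr (output h3 _ p2.le (width W₂ _ _ h4 hW₂))
  · exact Or.inl (input _ p1.le (W₁.inv_w_le_modulation hA0 h3))
  · exact Or.inr (input _ p2.le (W₂.inv_w_le_modulation hA0 h3))

set_option maxHeartbeats 400000 in
/-- The bound of the linear Duhamel operator of an off-diagonal coefficient. -/
theorem linBound_of_separation {α β c M C : ℝ} {k j : ℤ} (hk : k ≠ 0) (hj : j ≠ 0) (hkj : k ≠ j)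
    (hα2 : α ≤ 2) (hβ0 : 0 ≤ β) (hβ2 : β ≤ 2)
    (W W₁ : Wgt) (hM : 0 < M) (hMW : M ≤ W.lam) (hc : 0 < c) (hc1 : c ≤ 1)
    (hη : W.b - 1 / 2 ≤ (α - β) / 4)
    (hW : c * |(k : ℝ)| ^ β ≤ W.lam) (hW₁ : c * |(j : ℝ)| ^ β ≤ W₁.lam)
    (hℓ : W.ℓ = dispSymbol α k) (hℓ₁ : W₁.ℓ = dispSymbol α j) (a : ℂ) (hC : 0 ≤ C)
    (ha : ‖a‖ ≤ C * max |(k : ℝ)| |(j : ℝ)| ^ β * (1 + |(k : ℝ) - j|) ^ (-4 : ℝ)) :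
    LinBound W W₁ a (2 * C * (√c)⁻¹ * M ^ (-(W.b - 1 / 2)) * (1 + |(k : ℝ) - j|) ^ (-3 : ℝ)) := by
  intro τ
  have hb := W.hb
  have hb1 := W.hb1
  set η := W.b - 1 / 2 with hηdef
  set K := max |(k : ℝ)| |(j : ℝ)| with hK
  set d := 1 + |(k : ℝ) - j| with hd
  have hd1 : 1 ≤ d := by rw [hd]; linarith [abs_nonneg ((k : ℝ) - j)]
  have hd0 : 0 < d := by linarith
  have one_le : ∀ {n : ℤ}, n ≠ 0 → 1 ≤ |(n : ℝ)| := fun {n} hn => by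
    have : (1 : ℤ) ≤ |n| := Int.one_le_abs hn
    exact_mod_cast this
  have ok := one_le hk
  have oj := one_le hj
  have hK1 : 1 ≤ K := ok.trans (le_max_left _ _)
  have hK0 : 0 < K := by linarith
  -- Both frequencies are comparable to the larger one up to the factor `d`. This costs one of the
  -- four powers of off-diagonal decay; the remaining three are summable.
  have near : K / d ≤ |(k : ℝ)| ∧ K / d ≤ |(j : ℝ)| := by
    have t1 : |(k : ℝ)| ≤ |(j : ℝ)| + |(k : ℝ) - j| := by
      have := abs_add_le (j : ℝ) ((k : ℝ) - j); rwa [add_sub_cancel] at this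
    have t2 : |(j : ℝ)| ≤ |(k : ℝ)| + |(k : ℝ) - j| := by
      have := abs_add_le (k : ℝ) ((j : ℝ) - k); rwa [add_sub_cancel, abs_sub_comm (j : ℝ)] at this
    have n := abs_nonneg ((k : ℝ) - j)
    have t3 := le_mul_of_one_le_left n ok
    have t4 := le_mul_of_one_le_left n oj
    have t5 := mul_nonneg (abs_nonneg (k : ℝ)) n
    have t6 := mul_nonneg (abs_nonneg (j : ℝ)) n
    constructor
    · rw [div_le_iff₀ hd0, hK, hd, mul_add, mul_one]
      exact max_le (by linarith) (by linarith)
    · rw [div_le_iff₀ hd0, hK, hd, mul_add, mul_one]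
      exact max_le (by linarith) (by linarith)
  have eb : 1 - W.b = 1 / 2 - η := by rw [hηdef]; ring
  have hη0 : 0 ≤ η := by linarith
  have hαη : α * η ≤ 2 * η := mul_le_mul_of_nonneg_right hα2 hη0
  have hβη : β * η ≤ 2 * η := mul_le_mul_of_nonneg_right hβ2 hη0
  have hm0 : 0 ≤ M ^ (-η) := by positivity
  set A : ℝ := 1 / 2 * K ^ α with hA
  have hA0 : 0 < A := by positivity
  have hmod : A ≤ |τ + W.ℓ| ∨ A ≤ |τ + W₁.ℓ| := by
    by_contra hcon
    push Not at hcon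
    obtain ⟨c1, c2⟩ := hcon
    have hΩ := dispSymbol_sub_ge (α := α) (by linarith) hkj
    have e : dispSymbol α k - dispSymbol α j = (τ + W.ℓ) - (τ + W₁.ℓ) := by rw [hℓ, hℓ₁]; ring
    rw [e] at hΩ
    have t2 := abs_sub (τ + W.ℓ) (τ + W₁.ℓ)
    have : K ^ α = 2 * A := by rw [hA]; ring
    linarith
  have p1 : 0 < (W₁.w τ)⁻¹ := inv_pos.2 (W₁.w_pos _)
  have pw : 0 ≤ W.w τ * ‖W.r τ‖ := mul_nonneg (W.w_pos τ).le (norm_nonneg _)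
  have eA : ∀ e : ℝ, 0 ≤ e → e ≤ 1 → A ^ (-e) ≤ 2 * K ^ (-(α * e)) := by
    intro e he0 he
    rw [hA, Real.mul_rpow (by norm_num) (by positivity), ← Real.rpow_mul hK0.le, mul_neg]
    refine mul_le_mul_of_nonneg_right ?_ (by positivity)
    rw [one_div, Real.inv_rpow (by norm_num), Real.rpow_neg (by norm_num), inv_inv]
    calc (2 : ℝ) ^ e ≤ 2 ^ (1 : ℝ) := Real.rpow_le_rpow_of_exponent_le (by norm_num) he
      _ = 2 := Real.rpow_one _
  have eX : ∀ x e : ℝ, K / d ≤ x → 0 ≤ e → e ≤ 1 / 2 → x ^ (-(β * e)) ≤ K ^ (-(β * e)) * d := by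
    intro x e hx he0 he
    have hKd : 0 < K / d := by positivity
    calc x ^ (-(β * e)) ≤ (K / d) ^ (-(β * e)) :=
          Real.rpow_le_rpow_of_nonpos hKd hx (neg_nonpos.2 (mul_nonneg hβ0 he0))
      _ = K ^ (-(β * e)) * d ^ (β * e) := by
          rw [Real.div_rpow hK0.le hd0.le, Real.rpow_neg hd0.le, div_inv_eq_mul]
      _ ≤ K ^ (-(β * e)) * d ^ (1 : ℝ) := by
          refine mul_le_mul_of_nonneg_left ?_ (by positivity)
          have := mul_le_mul hβ2 he he0 zero_le_two
          exact Real.rpow_le_rpow_of_exponent_le hd1 (by linarith)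
      _ = _ := by rw [Real.rpow_one]
  have ed : d ^ (-4 : ℝ) * d = d ^ (-3 : ℝ) := by
    nth_rewrite 2 [← Real.rpow_one d]
    rw [← Real.rpow_add hd0]; norm_num
  have final : ∀ e f : ℝ, e + f ≤ -β → K ^ β * K ^ e * K ^ f ≤ 1 := by
    intro e f hef
    rw [← Real.rpow_add hK0, ← Real.rpow_add hK0]
    exact Real.rpow_le_one_of_one_le_of_nonpos hK1 (by linarith)
  -- the product of the two remaining factors
  have main : ∀ u v e f : ℝ, 0 ≤ u → 0 ≤ v → u ≤ M ^ (-η) * (2 * K ^ (-(α * e))) →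
      v ≤ (√c)⁻¹ * (K ^ (-(β * f)) * d) → -(α * e) + -(β * f) ≤ -β → ‖a‖ * (u * v) ≤
      2 * C * (√c)⁻¹ * M ^ (-η) * d ^ (-3 : ℝ) := by
    intro u v e f hu0 hv0 hu hv hef
    calc ‖a‖ * (u * v) ≤ (C * K ^ β * d ^ (-4 : ℝ)) * ((M ^ (-η) * (2 * K ^ (-(α * e)))) *
          ((√c)⁻¹ * (K ^ (-(β * f)) * d))) := by gcongr
      _ = 2 * C * (√c)⁻¹ * M ^ (-η) * (d ^ (-4 : ℝ) * d) *
          (K ^ β * K ^ (-(α * e)) * K ^ (-(β * f))) := by ring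
      _ ≤ 2 * C * (√c)⁻¹ * M ^ (-η) * (d ^ (-4 : ℝ) * d) * 1 := by
          gcongr
          exact final _ _ hef
      _ = _ := by rw [ed, mul_one]
  -- The exponents close because `αη` and `βη` are at most `2η ≤ (α - β)/2`, so that the gains with
  -- exponents close to `α/2` and `β/2` absorb the power `β` of the coefficient.
  rcases hmod with h3 | h3
  · have g1 := W.w_mul_r_le_modulation hM hMW hA0 h3
    rw [eb] at g1
    rw [mul_assoc]
    refine main _ _ (1 / 2 - η) (1 / 2) pw p1.le ?_ ?_ ?_
    · exact g1.trans (mul_le_mul_of_nonneg_left (eA _ (by linarith) (by linarith)) hm0)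
    · refine (W₁.inv_w_le_sqrt (by positivity) hW₁ τ).trans ?_
      refine (mul_c_rpow hc hc1 (by linarith) le_rfl).trans ?_
      exact mul_le_mul_of_nonneg_left (eX _ _ near.2 (by norm_num) le_rfl) (by positivity)
    · linarith
  -- The factor `M^{-η}` comes from the output here; it is moved to the other factor so that `main`
  -- applies with the roles exchanged.
  · rw [mul_assoc, show W.w τ * ‖W.r τ‖ * (W₁.w τ)⁻¹ =
      (M ^ (-η) * (W₁.w τ)⁻¹) * ((M ^ (-η))⁻¹ * (W.w τ * ‖W.r τ‖)) by
        have : M ^ (-η) ≠ 0 := (Real.rpow_pos_of_pos hM _).ne'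
        field_simp]
    refine main _ _ (1 / 2) (1 / 2 - η) (by positivity) (by positivity) ?_ ?_ ?_
    · exact mul_le_mul_of_nonneg_left ((W₁.inv_w_le_modulation hA0 h3).trans
        (eA _ (by norm_num) (by norm_num))) hm0
    · have g1 := W.w_mul_r_le hM hMW (by positivity) hW τ
      rw [eb] at g1
      rw [inv_mul_le_iff₀ (Real.rpow_pos_of_pos hM _)]
      refine g1.trans (mul_le_mul_of_nonneg_left ?_ hm0)
      refine (mul_c_rpow hc hc1 (by linarith) (by linarith)).trans ?_
      exact mul_le_mul_of_nonneg_left (eX _ _ near.1 (by linarith) (by linarith)) (by positivity)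
    · linarith

end Wgt

/-! ### Square-summable sequences -/

section lp2

variable {V : Type*} [NormedAddCommGroup V]

/-- Square-summable sequences in `V`. -/
abbrev SqSum (V : Type*) [NormedAddCommGroup V] : Type _ := lp (fun _ : ℤ => V) 2

lemma enorm_sq_sqSum (h : SqSum V) : ‖h‖ₑ ^ 2 = ∑' k, ‖h k‖ₑ ^ 2 := by
  have h1 := lp.norm_rpow_eq_tsum (p := 2) (by norm_num) h
  have h2 := (lp.memℓp h).summable (p := 2) (by norm_num)
  simp only [ENNReal.toReal_ofNat, Real.rpow_ofNat] at h1 h2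
  have : ∀ k, ‖h k‖ₑ ^ 2 = ENNReal.ofReal (‖h k‖ ^ 2) := fun k => by
    rw [ENNReal.ofReal_pow (norm_nonneg _), ofReal_norm]
  simp_rw [this]
  rw [← ENNReal.ofReal_tsum_of_nonneg (fun k => by positivity) h2, ← h1,
    ENNReal.ofReal_pow (norm_nonneg _), ofReal_norm]

lemma memℓp_two_of_tsum {f : ℤ → V} (h : ∑' k, ‖f k‖ₑ ^ 2 < ⊤) : Memℓp f 2 := by
  refine memℓp_gen ?_
  simp only [ENNReal.toReal_ofNat, Real.rpow_ofNat]
  have h2 := ENNReal.summable_toReal h.ne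
  refine h2.congr fun k => ?_
  rw [ENNReal.toReal_pow, toReal_enorm]

lemma norm_sq_sqSum (h : SqSum V) : ‖h‖ ^ 2 = ∑' k, ‖h k‖ ^ 2 := by
  simpa using lp.norm_rpow_eq_tsum (p := 2) (by norm_num) h

lemma summable_norm_sq (h : SqSum V) : Summable fun k => ‖h k‖ ^ 2 := by
  simpa using (lp.memℓp h).summable (p := 2) (by norm_num)

lemma norm_apply_le (h : SqSum V) (k : ℤ) : ‖h k‖ ≤ ‖h‖ :=
  lp.norm_apply_le_norm (by norm_num) h k

end lp2

lemma tsum_conv_sq_le (a b : ℤ → ENNReal) :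
    ∑' k, (∑' j, a j * b (k - j)) ^ 2 ≤ (∑' j, a j) ^ 2 * ∑' j, b j ^ 2 := by
  have := lintegral_sq_conv_le (Measure.count : Measure ℤ) (f := a) (g := b)
    (measurable_of_countable _) (measurable_of_countable _)
  simpa only [lintegral_count] using this

lemma tsum_mul_sq_le (a b : ℤ → ENNReal) :
    (∑' j, a j * b j) ^ 2 ≤ (∑' j, a j ^ 2) * ∑' j, b j ^ 2 := by
  have := sq_lintegral_mul_le (Measure.count : Measure ℤ) (f := a) (g := b)
    (measurable_of_countable _).aemeasurable (measurable_of_countable _).aemeasurable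
  simpa only [lintegral_count] using this

lemma tsum_sub_left (f : ℤ → ENNReal) (k : ℤ) : ∑' j, f (k - j) = ∑' j, f j :=
  (Equiv.subLeft k).tsum_eq f

section families

variable {V V' : Type*} [NormedAddCommGroup V] [NormedSpace ℂ V] [NormedAddCommGroup V']
  [NormedSpace ℂ V']

/-! #### Diagonal operators -/

lemma diag_bound {C : ℝ} (D : ℤ → V →L[ℂ] V') (hC : 0 ≤ C)
    (hD : ∀ k v, ‖D k v‖ ≤ C * ‖v‖) (h : SqSum V) :
    ∑' k, ‖D k (h k)‖ₑ ^ 2 ≤ ENNReal.ofReal (C * ‖h‖) ^ 2 := by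
  rw [ENNReal.ofReal_mul hC, mul_pow, ofReal_norm, enorm_sq_sqSum, ← ENNReal.tsum_mul_left]
  refine ENNReal.tsum_le_tsum fun k => ?_
  rw [← mul_pow, ← ofReal_norm, ← ofReal_norm, ← ENNReal.ofReal_mul hC]
  exact pow_le_pow_left' (ENNReal.ofReal_le_ofReal (hD k _)) 2

/-- The diagonal operator of a bounded family. -/
def diagOp (D : ℤ → V →L[ℂ] V') (C : ℝ) (hC : 0 ≤ C) (hD : ∀ k v, ‖D k v‖ ≤ C * ‖v‖) :
    SqSum V →L[ℂ] SqSum V' :=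
  LinearMap.mkContinuous
    { toFun := fun h => ⟨fun k => D k (h k),
        memℓp_two_of_tsum ((diag_bound D hC hD h).trans_lt (by simp))⟩
      map_add' := fun h h' => by refine lp.ext (funext fun k => ?_); exact map_add (D k) _ _
      map_smul' := fun c h => by refine lp.ext (funext fun k => ?_); exact map_smul (D k) c _ } C (fun h => by
      refine norm_le_of_enorm_sq_le (by positivity) ?_
      rw [enorm_sq_sqSum]
      exact diag_bound D hC hD h)

lemma diagOp_apply (D : ℤ → V →L[ℂ] V') (C : ℝ) (hC : 0 ≤ C) (hD : ∀ k v, ‖D k v‖ ≤ C * ‖v‖)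
    (h : SqSum V) (k : ℤ) : diagOp D C hC hD h k = D k (h k) := rfl

lemma norm_diagOp_le (D : ℤ → V →L[ℂ] V') (C : ℝ) (hC : 0 ≤ C) (hD : ∀ k v, ‖D k v‖ ≤ C * ‖v‖)
    (h : SqSum V) : ‖diagOp D C hC hD h‖ ≤ C * ‖h‖ := by
  refine norm_le_of_enorm_sq_le (by positivity) ?_
  rw [enorm_sq_sqSum]
  exact diag_bound D hC hD h

/-! #### Matrices of operators -/

/-- A matrix of operators with summable off-diagonal decay. -/
structure LinFamily (V : Type*) [NormedAddCommGroup V] [NormedSpace ℂ V] where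
  S : ℤ → ℤ → V →L[ℂ] V
  q : ℤ → ℝ
  q_nonneg : ∀ n, 0 ≤ q n
  q_summable : Summable q
  bound : ∀ k j v, ‖S k j v‖ ≤ q (k - j) * ‖v‖

namespace LinFamily

variable (F : LinFamily V)

lemma enorm_le (k j : ℤ) (v : V) : ‖F.S k j v‖ₑ ≤ ENNReal.ofReal (F.q (k - j)) * ‖v‖ₑ := by
  rw [← ofReal_norm, ← ofReal_norm v, ← ENNReal.ofReal_mul (F.q_nonneg _)]
  exact ENNReal.ofReal_le_ofReal (F.bound k j v)

/-- The bound of the operator. -/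
def B : ℝ := ∑' n, F.q n

lemma B_nonneg : 0 ≤ F.B := tsum_nonneg F.q_nonneg

/-- Schur's test in convolution form: the entries are dominated by a summable function of `k - j`,
and Young's inequality applies on `ℤ`. -/
lemma tsum_le (h : SqSum V) :
    ∑' k, (∑' j, ‖F.S k j (h j)‖ₑ) ^ 2 ≤ ENNReal.ofReal (F.B * ‖h‖) ^ 2 := by
  calc ∑' k, (∑' j, ‖F.S k j (h j)‖ₑ) ^ 2
      ≤ ∑' k, (∑' j, ENNReal.ofReal (F.q j) * ‖h (k - j)‖ₑ) ^ 2 := by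
        refine ENNReal.tsum_le_tsum fun k => pow_le_pow_left' ?_ 2
        rw [← tsum_sub_left _ k]
        refine ENNReal.tsum_le_tsum fun j => ?_
        have := F.enorm_le k (k - j) (h (k - j))
        rwa [sub_sub_cancel] at this
    _ ≤ (∑' j, ENNReal.ofReal (F.q j)) ^ 2 * ∑' j, ‖h j‖ₑ ^ 2 :=
        tsum_conv_sq_le (fun j => ENNReal.ofReal (F.q j)) (fun j => ‖h j‖ₑ)
    _ = _ := by
        rw [← ENNReal.ofReal_tsum_of_nonneg F.q_nonneg F.q_summable, ← enorm_sq_sqSum,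
          ENNReal.ofReal_mul F.B_nonneg, mul_pow, ofReal_norm, B]

lemma summable_norm (h : SqSum V) (k : ℤ) : Summable fun j => ‖F.S k j (h j)‖ := by
  have h1 : (∑' j, ‖F.S k j (h j)‖ₑ) ^ 2 < ⊤ :=
    (ENNReal.le_tsum k).trans_lt ((F.tsum_le h).trans_lt (by simp))
  have h2 : ∑' j, ‖F.S k j (h j)‖ₑ ≠ ⊤ := fun h => by simp [h] at h1
  simpa using ENNReal.summable_toReal h2

lemma tsum_sq_le (h : SqSum V) :
    ∑' k, ‖∑' j, F.S k j (h j)‖ₑ ^ 2 ≤ ENNReal.ofReal (F.B * ‖h‖) ^ 2 := by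
  refine le_trans (ENNReal.tsum_le_tsum fun k => pow_le_pow_left' ?_ 2) (F.tsum_le h)
  exact enorm_tsum_le_tsum_enorm

variable [CompleteSpace V]

lemma summable (h : SqSum V) (k : ℤ) : Summable fun j => F.S k j (h j) :=
  (F.summable_norm h k).of_norm

/-- The operator of the matrix. -/
def op : SqSum V →L[ℂ] SqSum V :=
  LinearMap.mkContinuous
    { toFun := fun h => ⟨fun k => ∑' j, F.S k j (h j),
        memℓp_two_of_tsum ((F.tsum_sq_le h).trans_lt (by simp))⟩
      map_add' := fun h h' => by
        refine lp.ext (funext fun k => ?_)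
        show ∑' j, F.S k j ((h + h') j) = ∑' j, F.S k j (h j) + ∑' j, F.S k j (h' j)
        rw [← (F.summable h k).tsum_add (F.summable h' k)]
        congr 1 with j
        exact map_add (F.S k j) _ _
      map_smul' := fun c h => by
        refine lp.ext (funext fun k => ?_)
        show ∑' j, F.S k j ((c • h) j) = c • ∑' j, F.S k j (h j)
        rw [← (F.summable h k).tsum_const_smul]
        congr 1 with j
        exact map_smul (F.S k j) c _ } F.B (fun h => by
      refine norm_le_of_enorm_sq_le (mul_nonneg F.B_nonneg (norm_nonneg _)) ?_
      rw [enorm_sq_sqSum]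
      exact F.tsum_sq_le h)

lemma op_apply (h : SqSum V) (k : ℤ) : F.op h k = ∑' j, F.S k j (h j) := rfl

lemma norm_op_le (h : SqSum V) : ‖F.op h‖ ≤ F.B * ‖h‖ := by
  refine norm_le_of_enorm_sq_le (mul_nonneg F.B_nonneg (norm_nonneg _)) ?_
  rw [enorm_sq_sqSum]
  exact F.tsum_sq_le h

end LinFamily

/-! #### Quadratic interactions -/

/-- A family of bilinear interactions `(j, l) ↦ j + l`, with a gain in one of the frequencies. -/
structure BilFamily (V : Type*) [NormedAddCommGroup V] [NormedSpace ℂ V] where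
  T : ℤ → ℤ → V →L[ℂ] V →L[ℂ] V
  C : ℝ
  ρ : ℤ → ℝ
  C_nonneg : 0 ≤ C
  ρ_nonneg : ∀ n, 0 ≤ ρ n
  ρ_summable : Summable fun n => ρ n ^ 2
  bound : ∀ j l v w, ‖T j l v w‖ ≤ C * (ρ (j + l) + ρ j + ρ l) * (‖v‖ * ‖w‖)

namespace BilFamily

variable (F : BilFamily V)

/-- The norm of the gain. -/
def R : ℝ := √(∑' n, F.ρ n ^ 2)

lemma R_nonneg : 0 ≤ F.R := Real.sqrt_nonneg _

lemma tsum_ρ : ∑' n, ENNReal.ofReal (F.ρ n) ^ 2 = ENNReal.ofReal F.R ^ 2 := by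
  rw [← ENNReal.ofReal_pow F.R_nonneg, R, Real.sq_sqrt (tsum_nonneg fun n => sq_nonneg _),
    ENNReal.ofReal_tsum_of_nonneg (fun n => sq_nonneg _) F.ρ_summable]
  congr 1 with n
  rw [ENNReal.ofReal_pow (F.ρ_nonneg n)]

lemma enorm_le (j l : ℤ) (v w : V) : ‖F.T j l v w‖ₑ ≤ ENNReal.ofReal F.C *
    (ENNReal.ofReal (F.ρ (j + l)) + ENNReal.ofReal (F.ρ j) + ENNReal.ofReal (F.ρ l)) *
      (‖v‖ₑ * ‖w‖ₑ) := by
  have h1 := F.ρ_nonneg (j + l)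
  have h2 := F.ρ_nonneg j
  have h3 := F.ρ_nonneg l
  rw [← ofReal_norm, ← ofReal_norm v, ← ofReal_norm w, ← ENNReal.ofReal_add h1 h2,
    ← ENNReal.ofReal_add (by positivity) h3, ← ENNReal.ofReal_mul F.C_nonneg,
    ← ENNReal.ofReal_mul (norm_nonneg _),
    ← ENNReal.ofReal_mul (mul_nonneg F.C_nonneg (by positivity))]
  exact ENNReal.ofReal_le_ofReal (F.bound j l v w)

lemma three_sq (x y z : ENNReal) : (x + y + z) ^ 2 ≤ 3 * (x ^ 2 + y ^ 2 + z ^ 2) := by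
  rcases eq_or_ne x ⊤ with rfl | hx
  · simp
  rcases eq_or_ne y ⊤ with rfl | hy
  · simp
  rcases eq_or_ne z ⊤ with rfl | hz
  · simp
  lift x to NNReal using hx
  lift y to NNReal using hy
  lift z to NNReal using hz
  norm_cast
  rw [← NNReal.coe_le_coe]
  push_cast
  nlinarith [sq_nonneg ((x : ℝ) - y), sq_nonneg ((y : ℝ) - z), sq_nonneg ((x : ℝ) - z)]

/-- If the gain falls on the output, the inner sum is bounded uniformly in `k` by Cauchy–Schwarz and
`ρ` is summed in `ℓ²`. If it falls on an input, `ρ` times that input is in `ℓ¹` and Young's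
inequality applies. So square summability of `ρ` suffices, with no loss of regularity. -/
lemma tsum_le (h h' : SqSum V) :
    ∑' k, (∑' j, ‖F.T j (k - j) (h j) (h' (k - j))‖ₑ) ^ 2 ≤
      ENNReal.ofReal (3 * F.C * F.R * ‖h‖ * ‖h'‖) ^ 2 := by
  set A : ℤ → ENNReal := fun j => ‖h j‖ₑ with hA
  set B : ℤ → ENNReal := fun j => ‖h' j‖ₑ with hB
  set r : ℤ → ENNReal := fun j => ENNReal.ofReal (F.ρ j) with hr
  set c := ENNReal.ofReal F.C
  have sA : ∑' j, A j ^ 2 = ‖h‖ₑ ^ 2 := (enorm_sq_sqSum h).symm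
  have sB : ∑' j, B j ^ 2 = ‖h'‖ₑ ^ 2 := (enorm_sq_sqSum h').symm
  have sr : ∑' j, r j ^ 2 = ENNReal.ofReal F.R ^ 2 := F.tsum_ρ
  set N : ENNReal := ENNReal.ofReal F.R ^ 2 * ‖h‖ₑ ^ 2 * ‖h'‖ₑ ^ 2 with hN
  have b1 : ∑' k, (r k * ∑' j, A j * B (k - j)) ^ 2 ≤ N := by
    calc ∑' k, (r k * ∑' j, A j * B (k - j)) ^ 2
        ≤ ∑' k, r k ^ 2 * (‖h‖ₑ ^ 2 * ‖h'‖ₑ ^ 2) := by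
          refine ENNReal.tsum_le_tsum fun k => ?_
          rw [mul_pow]
          gcongr
          refine (tsum_mul_sq_le _ _).trans ?_
          rw [sA, tsum_sub_left (fun j => B j ^ 2), sB]
      _ = N := by rw [ENNReal.tsum_mul_right, sr, hN, mul_assoc]
  have b2 : ∑' k, (∑' j, (r j * A j) * B (k - j)) ^ 2 ≤ N := by
    refine (tsum_conv_sq_le _ _).trans ?_
    rw [sB, hN, ← sr, ← sA]
    gcongr
    exact tsum_mul_sq_le _ _
  have b3 : ∑' k, (∑' j, (r j * B j) * A (k - j)) ^ 2 ≤ N := by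
    refine (tsum_conv_sq_le _ _).trans ?_
    rw [sA, hN, ← sr, ← sB, mul_right_comm]
    gcongr
    exact tsum_mul_sq_le _ _
  calc ∑' k, (∑' j, ‖F.T j (k - j) (h j) (h' (k - j))‖ₑ) ^ 2
      ≤ ∑' k, (c * ((r k * ∑' j, A j * B (k - j)) + (∑' j, (r j * A j) * B (k - j)) +
          (∑' j, (r j * B j) * A (k - j)))) ^ 2 := by
        refine ENNReal.tsum_le_tsum fun k => pow_le_pow_left' ?_ 2
        rw [← tsum_sub_left (fun j => (r j * B j) * A (k - j)) k]
        simp only [sub_sub_cancel]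
        rw [← ENNReal.tsum_mul_left, ← ENNReal.tsum_add, ← ENNReal.tsum_add,
          ← ENNReal.tsum_mul_left]
        refine ENNReal.tsum_le_tsum fun j => ?_
        refine (F.enorm_le j (k - j) _ _).trans (le_of_eq ?_)
        rw [add_sub_cancel]
        simp only [hA, hB, hr]
        ring
    _ ≤ ∑' k, c ^ 2 * (3 * ((r k * ∑' j, A j * B (k - j)) ^ 2 +
          (∑' j, (r j * A j) * B (k - j)) ^ 2 + (∑' j, (r j * B j) * A (k - j)) ^ 2)) := by
        refine ENNReal.tsum_le_tsum fun k => ?_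
        rw [mul_pow]
        gcongr
        exact three_sq _ _ _
    _ = c ^ 2 * (3 * (∑' k, (r k * ∑' j, A j * B (k - j)) ^ 2 +
          ∑' k, (∑' j, (r j * A j) * B (k - j)) ^ 2 +
          ∑' k, (∑' j, (r j * B j) * A (k - j)) ^ 2)) := by
        rw [ENNReal.tsum_mul_left, ENNReal.tsum_mul_left, ENNReal.tsum_add, ENNReal.tsum_add]
    _ ≤ c ^ 2 * (3 * (N + N + N)) := by gcongr
    _ = _ := by
        have e : 3 * F.C * F.R * ‖h‖ * ‖h'‖ = 3 * (F.C * (F.R * (‖h‖ * ‖h'‖))) := by ring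
        have := F.C_nonneg
        have := F.R_nonneg
        rw [e, ENNReal.ofReal_mul (by norm_num), ENNReal.ofReal_mul F.C_nonneg,
          ENNReal.ofReal_mul F.R_nonneg, ENNReal.ofReal_mul (norm_nonneg _), ofReal_norm,
          ofReal_norm, hN]
        simp only [ENNReal.ofReal_ofNat, c]
        ring

lemma summable_norm (h h' : SqSum V) (k : ℤ) :
    Summable fun j => ‖F.T j (k - j) (h j) (h' (k - j))‖ := by
  have h1 : (∑' j, ‖F.T j (k - j) (h j) (h' (k - j))‖ₑ) ^ 2 < ⊤ :=
    (ENNReal.le_tsum k).trans_lt ((F.tsum_le h h').trans_lt (by simp))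
  have h2 : ∑' j, ‖F.T j (k - j) (h j) (h' (k - j))‖ₑ ≠ ⊤ := fun h => by simp [h] at h1
  simpa using ENNReal.summable_toReal h2

lemma tsum_sq_le (h h' : SqSum V) :
    ∑' k, ‖∑' j, F.T j (k - j) (h j) (h' (k - j))‖ₑ ^ 2 ≤
      ENNReal.ofReal (3 * F.C * F.R * ‖h‖ * ‖h'‖) ^ 2 := by
  refine le_trans (ENNReal.tsum_le_tsum fun k => pow_le_pow_left' ?_ 2) (F.tsum_le h h')
  exact enorm_tsum_le_tsum_enorm

/-- The underlying function of the bilinear operator. -/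
def fn (h h' : SqSum V) : SqSum V :=
  ⟨fun k => ∑' j, F.T j (k - j) (h j) (h' (k - j)),
    memℓp_two_of_tsum ((F.tsum_sq_le h h').trans_lt (by simp))⟩

lemma norm_fn_le (h h' : SqSum V) : ‖F.fn h h'‖ ≤ 3 * F.C * F.R * ‖h‖ * ‖h'‖ := by
  have := F.C_nonneg
  have := F.R_nonneg
  refine norm_le_of_enorm_sq_le (by positivity) ?_
  rw [enorm_sq_sqSum]
  exact F.tsum_sq_le h h'

variable [CompleteSpace V]

lemma summable (h h' : SqSum V) (k : ℤ) :
    Summable fun j => F.T j (k - j) (h j) (h' (k - j)) :=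
  (F.summable_norm h h' k).of_norm

/-- The bilinear operator of the family. -/
def op : SqSum V →L[ℂ] SqSum V →L[ℂ] SqSum V :=
  LinearMap.mkContinuous₂
    (LinearMap.mk₂ ℂ F.fn
      (fun h h' g => by
        refine lp.ext (funext fun k => ?_)
        show ∑' j, F.T j (k - j) ((h + h') j) (g (k - j)) =
          ∑' j, F.T j (k - j) (h j) (g (k - j)) + ∑' j, F.T j (k - j) (h' j) (g (k - j))
        rw [← (F.summable h g k).tsum_add (F.summable h' g k)]
        congr 1 with j
        rw [lp.coeFn_add, Pi.add_apply, map_add, add_apply])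
      (fun c h g => by
        refine lp.ext (funext fun k => ?_)
        show ∑' j, F.T j (k - j) ((c • h) j) (g (k - j)) =
          c • ∑' j, F.T j (k - j) (h j) (g (k - j))
        rw [← (F.summable h g k).tsum_const_smul]
        congr 1 with j
        rw [lp.coeFn_smul, Pi.smul_apply, map_smul, smul_apply])
      (fun h g g' => by
        refine lp.ext (funext fun k => ?_)
        show ∑' j, F.T j (k - j) (h j) ((g + g') (k - j)) =
          ∑' j, F.T j (k - j) (h j) (g (k - j)) + ∑' j, F.T j (k - j) (h j) (g' (k - j))
        rw [← (F.summable h g k).tsum_add (F.summable h g' k)]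
        congr 1 with j
        rw [lp.coeFn_add, Pi.add_apply, map_add])
      (fun c h g => by
        refine lp.ext (funext fun k => ?_)
        show ∑' j, F.T j (k - j) (h j) ((c • g) (k - j)) =
          c • ∑' j, F.T j (k - j) (h j) (g (k - j))
        rw [← (F.summable h g k).tsum_const_smul]
        congr 1 with j
        rw [lp.coeFn_smul, Pi.smul_apply, map_smul])) (3 * F.C * F.R) F.norm_fn_le

lemma op_apply (h h' : SqSum V) (k : ℤ) :
    F.op h h' k = ∑' j, F.T j (k - j) (h j) (h' (k - j)) := rfl

lemma norm_op_le (h h' : SqSum V) : ‖F.op h h'‖ ≤ 3 * F.C * F.R * ‖h‖ * ‖h'‖ :=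
  F.norm_fn_le h h'

end BilFamily

end families

/-! ### The abstract dissipation and the damped Duhamel operators -/

/-- Admissible exponents. -/
structure Exps where
  α : ℝ
  β : ℝ
  b : ℝ
  hα1 : 1 ≤ α
  hα2 : α ≤ 2
  hβ1 : 2 - α < β
  hβ2 : β < α
  hb : 1 / 2 < b
  hb1 : b ≤ 1
  hη1 : b - 1 / 2 ≤ ((α + β) / 2 - 1) / 6
  hη2 : b - 1 / 2 ≤ (α - β) / 4

namespace Exps

variable (E : Exps)

lemma β_pos : 0 < E.β := by linarith [E.hα2, E.hβ1]

lemma β_le : E.β ≤ 2 := by linarith [E.hα2, E.hβ2]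

/-- The weights of the spaces `Z^b`. -/
def W₀ (k : ℤ) : Wgt :=
  ⟨E.b, bracket k ^ E.β, dispSymbol E.α k, E.hb, E.hb1, Real.rpow_pos_of_pos (bracket_pos _) _⟩

lemma one_le_lam (k : ℤ) : 1 ≤ (E.W₀ k).lam :=
  Real.one_le_rpow (one_le_bracket _) E.β_pos.le

lemma abs_rpow_le_lam (k : ℤ) : |(k : ℝ)| ^ E.β ≤ (E.W₀ k).lam :=
  Real.rpow_le_rpow (abs_nonneg _) (abs_le_bracket _) E.β_pos.le

end Exps

/-- Exponents together with the matrix of a dissipation. -/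
structure Setting extends Exps where
  a : ℤ → ℤ → ℂ
  C : ℝ
  c : ℝ
  D : ℝ
  hC : 0 ≤ C
  hc : 0 < c
  hc1 : c ≤ 1
  zero_left : ∀ j, a 0 j = 0
  zero_right : ∀ k, a k 0 = 0
  norm_le : ∀ k j : ℤ, ‖a k j‖ ≤ C * |(k : ℝ)| ^ β * (1 + |(k : ℝ) - j|) ^ (-4 : ℝ)
  conj_neg : ∀ k j, a (-k) (-j) = starRingEnd ℂ (a k j)
  diag_im : ∀ k, (a k k).im = 0
  diag_ge : ∀ k : ℤ, c * |(k : ℝ)| ^ β ≤ (a k k).re + D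
  re_nonneg : ∀ (s : Finset ℤ) (v : ℤ → ℂ),
    0 ≤ (∑ k ∈ s, ∑ j ∈ s, a k j * v j * starRingEnd ℂ (v k)).re

/-- A setting with a damping parameter. -/
structure Damped extends Setting where
  M : ℝ
  hM : 1 ≤ M
  hD : D ≤ M

/-- The `k`-th coefficient at time `t` of the function with weighted Fourier transform `h`. -/
def val (U : ℤ → Wgt) (h : SqSum L2R) (k : ℤ) (t : ℝ) : ℂ := (U k).ev t (h k)

/-- The bound of the evaluations. -/
def evBound (b : ℝ) : ℝ := bracketNorm (-b)

lemma evBound_nonneg (b : ℝ) : 0 ≤ evBound b := Real.sqrt_nonneg _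

lemma norm_val_le {U : ℤ → Wgt} {b : ℝ} (hU : ∀ k, (U k).b = b) (h : SqSum L2R) (k : ℤ) (t : ℝ) :
    ‖val U h k t‖ ≤ evBound b * ‖h k‖ := by
  rw [← hU k]; exact (U k).norm_ev_le t (h k)

lemma continuous_val (U : ℤ → Wgt) (h : SqSum L2R) (k : ℤ) : Continuous (val U h k) :=
  (U k).continuous_ev (h k)

lemma summable_mul_sqSum {V V' : Type*} [NormedAddCommGroup V] [NormedAddCommGroup V']
    (h : SqSum V) (h' : SqSum V') (k : ℤ) : Summable fun j => ‖h j‖ * ‖h' (k - j)‖ := by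
  have s2 := (Equiv.subLeft k).summable_iff.2 (summable_norm_sq h')
  refine ((summable_norm_sq h).add s2).of_nonneg_of_le (fun j => by positivity) fun j => ?_
  simp only [Function.comp, Equiv.subLeft_apply]
  nlinarith [sq_nonneg (‖h j‖ - ‖h' (k - j)‖), norm_nonneg (h j), norm_nonneg (h' (k - j))]

lemma summable_one_add_abs_rpow {r : ℝ} (hr : 1 < r) :
    Summable fun n : ℤ => (1 + |(n : ℝ)|) ^ (-r) := by
  refine ((Real.summable_abs_int_rpow hr).add (hasSum_ite_eq (0 : ℤ) (1 : ℝ)).summable).of_nonneg_of_le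
    (fun n => by positivity) fun n => ?_
  rcases eq_or_ne n 0 with rfl | hn
  · simp only [Int.cast_zero, abs_zero, add_zero, Real.one_rpow, if_true]
    have : (0 : ℝ) ≤ 0 ^ (-r) := Real.rpow_nonneg le_rfl _
    linarith
  · have h0 : 0 < |(n : ℝ)| := abs_pos.2 (by exact_mod_cast hn)
    rw [if_neg hn, add_zero]
    exact Real.rpow_le_rpow_of_nonpos h0 (by linarith) (by linarith)

/-- Sums of solutions of damped equations. -/
lemma integral_tsum {μ : ℂ} {z f : ℤ → ℝ → ℂ} {Z F : ℤ → ℝ} (hz : ∀ j, Continuous (z j))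
    (hf : ∀ j, Continuous (f j)) (hZ : Summable Z) (hF : Summable F)
    (hzZ : ∀ j t, ‖z j t‖ ≤ Z j) (hfF : ∀ j t, ‖f j t‖ ≤ F j)
    {t : ℝ} (h : ∀ j, z j t = ∫ s in (0 : ℝ)..t, (-μ * z j s + f j s)) :
    ∑' j, z j t = ∫ s in (0 : ℝ)..t, (-μ * ∑' j, z j s + ∑' j, f j s) := by
  have h1 : ∀ s, Summable fun j => z j s := fun s => hZ.of_norm_bounded fun j => hzZ j s
  have h2 : ∀ s, Summable fun j => f j s := fun s => hF.of_norm_bounded fun j => hfF j s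
  have h3 : HasSum (fun j => ∫ s in (0 : ℝ)..t, (-μ * z j s + f j s))
      (∫ s in (0 : ℝ)..t, ∑' j, (-μ * z j s + f j s)) := by
    refine intervalIntegral.hasSum_integral_of_dominated_convergence
      (fun j _ => ‖μ‖ * Z j + F j) (fun j => ?_) (fun j => ?_) ?_ ?_ ?_
    · exact ((continuous_const.mul (hz j)).add (hf j)).aestronglyMeasurable
    · refine ae_of_all _ fun s _ => (norm_add_le _ _).trans ?_
      rw [norm_mul, norm_neg]
      exact add_le_add (mul_le_mul_of_nonneg_left (hzZ j s) (norm_nonneg _)) (hfF j s)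
    · exact ae_of_all _ fun s _ => (hZ.mul_left _).add hF
    · exact intervalIntegrable_const
    · exact ae_of_all _ fun s _ => (((h1 s).mul_left (-μ)).add (h2 s)).hasSum
  rw [tsum_congr h, h3.tsum_eq]
  refine intervalIntegral.integral_congr fun s _ => ?_
  rw [((h1 s).mul_left (-μ)).tsum_add (h2 s), tsum_mul_left]

namespace Setting

variable (S : Setting)

lemma diag_re_nonneg (k : ℤ) : 0 ≤ (S.a k k).re := by
  have := S.re_nonneg {k} (fun _ => 1)
  simpa using this

lemma summable_coeff (k : ℤ) : Summable fun j => ‖S.a k j‖ := by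
  have h := (Equiv.subLeft k).summable_iff.2
    (summable_one_add_abs_rpow (r := 4) (by norm_num))
  refine (h.mul_left (S.C * |(k : ℝ)| ^ S.β)).of_nonneg_of_le (fun j => norm_nonneg _) fun j => ?_
  have := S.norm_le k j
  simpa using this

/-- The off-diagonal part of the matrix. -/
def off (k j : ℤ) : ℂ := if k = j then 0 else S.a k j

lemma norm_off_le (k j : ℤ) : ‖S.off k j‖ ≤ ‖S.a k j‖ := by
  unfold off; split_ifs <;> simp

end Setting

namespace Damped

variable (X : Damped)

lemma M_pos : 0 < X.M := one_pos.trans_le X.hM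

/-- The damped weights. -/
def W (k : ℤ) : Wgt :=
  ⟨X.b, X.M + (X.a k k).re, dispSymbol X.α k, X.hb, X.hb1,
    add_pos_of_pos_of_nonneg X.M_pos (X.diag_re_nonneg k)⟩

lemma M_le (k : ℤ) : X.M ≤ (X.W k).lam := le_add_of_nonneg_right (X.diag_re_nonneg k)

/-- The damping `M ≥ D` absorbs the bounded defect in the lower bound of the diagonal. -/
lemma rpow_le_lam (k : ℤ) : X.c * |(k : ℝ)| ^ X.β ≤ (X.W k).lam :=
  (X.diag_ge k).trans (by rw [add_comm]; exact add_le_add X.hD le_rfl)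

/-- The gain of a power of the damping parameter. -/
def gain : ℝ := (√X.c)⁻¹ * X.M ^ (-(X.b - 1 / 2))

lemma gain_nonneg : 0 ≤ X.gain :=
  mul_nonneg (inv_nonneg.2 (Real.sqrt_nonneg _)) (Real.rpow_nonneg X.M_pos.le _)

/-! #### The off-diagonal part of the dissipation -/

lemma linBound {k j : ℤ} (h : k ≠ 0 ∧ j ≠ 0 ∧ k ≠ j) :
    (X.W k).LinBound (X.W j) (-X.a k j)
      (2 * X.C * (√X.c)⁻¹ * X.M ^ (-(X.b - 1 / 2)) * (1 + |(k : ℝ) - j|) ^ (-3 : ℝ)) := by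
  refine Wgt.linBound_of_separation h.1 h.2.1 h.2.2 X.hα2 X.β_pos.le X.β_le (X.W k) (X.W j)
    X.M_pos (X.M_le k) X.hc X.hc1 X.hη2 (X.rpow_le_lam k) (X.rpow_le_lam j) rfl rfl _ X.hC ?_
  rw [norm_neg]
  refine (X.norm_le k j).trans ?_
  have := X.hC
  have h1 : |(k : ℝ)| ^ X.β ≤ max |(k : ℝ)| |(j : ℝ)| ^ X.β :=
    Real.rpow_le_rpow (abs_nonneg _) (le_max_left _ _) X.β_pos.le
  gcongr

open Classical in
/-- The family of Duhamel operators of the off-diagonal part. -/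
def linFam : LinFamily L2R where
  S k j := if h : k ≠ 0 ∧ j ≠ 0 ∧ k ≠ j then Wgt.linOp _ _ _ _ (X.linBound h) else 0
  q n := Wgt.Qnorm X.b * (2 * X.C) * X.gain * (1 + |(n : ℝ)|) ^ (-3 : ℝ)
  q_nonneg n := by
    have := X.gain_nonneg
    have := X.hC
    have := Wgt.Qnorm_nonneg X.b
    positivity
  q_summable := (summable_one_add_abs_rpow (by norm_num)).mul_left _
  bound k j v := by
    have h1 := X.gain_nonneg
    have h2 := X.hC
    have h3 := Wgt.Qnorm_nonneg X.b
    split_ifs with h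
    · refine (Wgt.norm_linOp_le _ v).trans (le_of_eq ?_)
      have : (X.W k).b = X.b := rfl
      rw [this, gain]
      push_cast
      ring
    · simp only [zero_apply, norm_zero]
      positivity

lemma linFam_B : X.linFam.B =
    Wgt.Qnorm X.b * (2 * X.C) * X.gain * ∑' n : ℤ, (1 + |(n : ℝ)|) ^ (-3 : ℝ) := by
  rw [LinFamily.B, ← tsum_mul_left]; rfl

lemma linFam_op_zero (h : SqSum L2R) : X.linFam.op h 0 = 0 := by
  rw [LinFamily.op_apply]
  simp [linFam]

lemma norm_val_W_le (h : SqSum L2R) (k : ℤ) (t : ℝ) :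
    ‖val X.W h k t‖ ≤ evBound X.b * ‖h k‖ := norm_val_le (fun _ => rfl) h k t

lemma val_linFam (h : SqSum L2R) (k : ℤ) {t : ℝ} (ht : 0 ≤ t) :
    val X.W (X.linFam.op h) k t = ∫ s in (0 : ℝ)..t, (-(X.W k).μ * val X.W (X.linFam.op h) k s +
      ∑' j, -X.off k j * val X.W h j s) := by
  have e : ∀ s, val X.W (X.linFam.op h) k s = ∑' j, (X.W k).ev s (X.linFam.S k j (h j)) := fun s => by
    rw [val, LinFamily.op_apply, ContinuousLinearMap.map_tsum _ (X.linFam.summable h k)]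
  simp_rw [e]
  refine integral_tsum (f := fun j s => -X.off k j * val X.W h j s)
    (Z := fun j => evBound X.b * ‖X.linFam.S k j (h j)‖)
    (F := fun j => ‖X.a k j‖ * (evBound X.b * ‖h‖))
    (fun j => (X.W k).continuous_ev _) (fun j => continuous_const.mul (continuous_val _ _ _))
    ((X.linFam.summable_norm h k).mul_left _) ((X.summable_coeff k).mul_right _)
    (fun j s => (X.W k).norm_ev_le s _) (fun j s => ?_) fun j => ?_
  · rw [norm_mul, norm_neg]
    refine mul_le_mul (X.norm_off_le k j) ((X.norm_val_W_le h j s).trans ?_) (norm_nonneg _)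
      (norm_nonneg _)
    exact mul_le_mul_of_nonneg_left (norm_apply_le h j) (evBound_nonneg _)
  · by_cases hkj : k ≠ 0 ∧ j ≠ 0 ∧ k ≠ j
    · have e2 : X.off k j = X.a k j := if_neg hkj.2.2
      have e1 : X.linFam.S k j = Wgt.linOp _ _ _ _ (X.linBound hkj) := dif_pos hkj
      rw [e1, e2]
      exact Wgt.ev_linOp (X.linBound hkj) (h j) ht
    · have e1 : X.linFam.S k j = 0 := dif_neg hkj
      have e2 : X.off k j = 0 := by
        by_cases h1 : k = 0
        · subst h1; unfold Setting.off; split_ifs; exacts [rfl, X.zero_left j]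
        by_cases h2 : j = 0
        · subst h2; unfold Setting.off; split_ifs; exact X.zero_right k
        · rw [Setting.off, if_pos]
          by_contra h3
          exact hkj ⟨h1, h2, h3⟩
      simp [e1, e2]

/-! #### The quadratic interaction -/

/-- Weights admissible for the first factor of the interaction. -/
structure Adm (U : ℤ → Wgt) : Prop where
  b_eq : ∀ k, (U k).b = X.b
  le_lam : ∀ k : ℤ, X.c * |(k : ℝ)| ^ X.β ≤ (U k).lam
  ℓ_eq : ∀ k, (U k).ℓ = dispSymbol X.α k

lemma adm_W : X.Adm X.W := ⟨fun _ => rfl, X.rpow_le_lam, fun _ => rfl⟩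

/-- Needed for uniqueness: there the first factor is a fixed element of `Z^b`, and its norm must not
depend on the damping, which is chosen afterwards. -/
lemma adm_W₀ : X.Adm X.W₀ := ⟨fun _ => rfl, fun k => by
  refine le_trans ?_ (X.abs_rpow_le_lam k)
  exact mul_le_of_le_one_left (by positivity) X.hc1, fun _ => rfl⟩

/-- The gain in one of the frequencies. -/
def ρ (n : ℤ) : ℝ := |(n : ℝ)| ^ (-(1 / 2 + ((X.α + X.β) / 2 - 1) / 2))

lemma ρ_nonneg (n : ℤ) : 0 ≤ X.ρ n := by unfold ρ; positivity

lemma ρ_sq (n : ℤ) : X.ρ n ^ 2 = |(n : ℝ)| ^ (-(1 + ((X.α + X.β) / 2 - 1))) := by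
  rw [ρ, ← Real.rpow_natCast, ← Real.rpow_mul (abs_nonneg _)]
  congr 1
  push_cast; ring

/-- The exponent is below `-1` precisely because `α + β > 2`. -/
lemma summable_ρ : Summable fun n => X.ρ n ^ 2 := by
  simp_rw [ρ_sq]
  exact Real.summable_abs_int_rpow (by linarith [X.hβ1])

/-- The coefficient of the interaction. -/
def bilCoeff (k : ℤ) : ℂ := Complex.I * k * (4 * Real.pi ^ 2 : ℂ)⁻¹

lemma norm_bilCoeff_le (k : ℤ) : ‖bilCoeff k‖ ≤ |(k : ℝ)| := by
  have h1 : ((4 * Real.pi ^ 2 : ℂ)⁻¹) = (((4 * Real.pi ^ 2)⁻¹ : ℝ) : ℂ) := by push_cast; rfl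
  have h2 : ((k : ℤ) : ℂ) = ((k : ℝ) : ℂ) := by push_cast; rfl
  rw [bilCoeff, h1, h2, norm_mul, norm_mul, Complex.norm_I, one_mul, Complex.norm_real,
    Complex.norm_real, Real.norm_eq_abs, Real.norm_of_nonneg (by positivity)]
  refine mul_le_of_le_one_right (abs_nonneg _) (inv_le_one_of_one_le₀ ?_)
  nlinarith [Real.pi_gt_three]

variable {X}

/-- The resonance estimate does not say which frequency is the smallest; the sum of the three
possible gains covers all cases. -/
lemma bilBound {U : ℤ → Wgt} (hU : X.Adm U) {j l : ℤ} (h : j ≠ 0 ∧ l ≠ 0 ∧ j + l ≠ 0) :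
    (X.W (j + l)).BilBound (U j) (X.W l) (bilCoeff (j + l))
      (12 * X.gain * (X.ρ (j + l) + X.ρ j + X.ρ l)) := by
  obtain ⟨κ, hκ, H⟩ := Wgt.bilBound_of_resonance h.1 h.2.1 h.2.2 X.hα1 X.hα2 X.β_le (X.W (j + l))
    (U j) (X.W l) X.M_pos (X.M_le _) X.hc X.hc1 X.hη1 (X.rpow_le_lam _) (hU.le_lam _)
    (X.rpow_le_lam _) rfl (hU.ℓ_eq _) rfl _ (norm_bilCoeff_le _)
  have h1 := X.ρ_nonneg (j + l)
  have h2 := X.ρ_nonneg j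
  have h3 := X.ρ_nonneg l
  have hg := X.gain_nonneg
  have hle : 12 * (√X.c)⁻¹ * X.M ^ (-((X.W (j + l)).b - 1 / 2)) *
      κ ^ (-(1 / 2 + ((X.α + X.β) / 2 - 1) / 2)) ≤ 12 * X.gain * (X.ρ (j + l) + X.ρ j + X.ρ l) := by
    have e : 12 * (√X.c)⁻¹ * X.M ^ (-((X.W (j + l)).b - 1 / 2)) = 12 * X.gain := by
      rw [gain, mul_assoc]; rfl
    rw [e]
    refine mul_le_mul_of_nonneg_left ?_ (by positivity)
    rcases hκ with rfl | rfl | rfl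
    · show X.ρ (j + l) ≤ _; linarith
    · show X.ρ j ≤ _; linarith
    · show X.ρ l ≤ _; linarith
  refine ⟨by positivity, fun τ s => (H.2 τ s).trans (mul_le_mul_of_nonneg_right hle ?_)⟩
  exact add_nonneg (inv_nonneg.2 ((U j).w_pos _).le) (inv_nonneg.2 ((X.W l).w_pos _).le)

open Classical in
/-- The family of Duhamel operators of the quadratic interaction. -/
def bilFam {U : ℤ → Wgt} (hU : X.Adm U) : BilFamily L2R where
  T j l := if h : j ≠ 0 ∧ l ≠ 0 ∧ j + l ≠ 0 then Wgt.bilOp _ _ _ _ _ (bilBound hU h) else 0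
  -- Here `24 = 2 · 12`: the two of the convolution kernels and the twelve of `bilBound`.
  C := Wgt.Qnorm X.b * 24 * evBound X.b * X.gain
  ρ := X.ρ
  C_nonneg := by
    have := X.gain_nonneg
    have := Wgt.Qnorm_nonneg X.b
    have := evBound_nonneg X.b
    positivity
  ρ_nonneg := X.ρ_nonneg
  ρ_summable := X.summable_ρ
  bound j l v w := by
    have h1 := X.gain_nonneg
    have h2 := Wgt.Qnorm_nonneg X.b
    have h3 := evBound_nonneg X.b
    have h4 := X.ρ_nonneg (j + l)
    have h5 := X.ρ_nonneg j
    have h6 := X.ρ_nonneg l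
    split_ifs with h
    · refine (Wgt.norm_bilOp_le _ v w).trans (le_of_eq ?_)
      have e1 : (X.W (j + l)).b = X.b := rfl
      have e2 : (X.W l).b = X.b := rfl
      rw [e1, e2, hU.b_eq, max_self, evBound]
      ring
    · simp only [zero_apply, norm_zero]
      positivity

lemma bilFam_op_zero {U : ℤ → Wgt} (hU : X.Adm U) (h h' : SqSum L2R) :
    (bilFam hU).op h h' 0 = 0 := by
  rw [BilFamily.op_apply]
  simp [bilFam]

/-- The interactions left out of the family vanish in the equation as well: those with an input of
frequency zero since both factors have zero mean, those with output zero because of the derivative.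
-/
lemma val_bilFam {U : ℤ → Wgt} (hU : X.Adm U) {h h' : SqSum L2R} (h0 : h 0 = 0) (h0' : h' 0 = 0)
    (k : ℤ) {t : ℝ} (ht : 0 ≤ t) :
    val X.W ((bilFam hU).op h h') k t =
      ∫ s in (0 : ℝ)..t, (-(X.W k).μ * val X.W ((bilFam hU).op h h') k s +
        ∑' j, Complex.I * k * (2 * Real.pi : ℂ)⁻¹ * (val U h j s * val X.W h' (k - j) s)) := by
  have e : ∀ s, val X.W ((bilFam hU).op h h') k s =
      ∑' j, (X.W k).ev s ((bilFam hU).T j (k - j) (h j) (h' (k - j))) := fun s => by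
    rw [val, BilFamily.op_apply, ContinuousLinearMap.map_tsum _ ((bilFam hU).summable h h' k)]
  have hB := evBound_nonneg X.b
  simp_rw [e]
  refine integral_tsum
    (f := fun j s => Complex.I * k * (2 * Real.pi : ℂ)⁻¹ * (val U h j s * val X.W h' (k - j) s))
    (Z := fun j => evBound X.b * ‖(bilFam hU).T j (k - j) (h j) (h' (k - j))‖)
    (F := fun j => ‖Complex.I * k * (2 * Real.pi : ℂ)⁻¹‖ *
      (evBound X.b ^ 2 * (‖h j‖ * ‖h' (k - j)‖)))
    (fun j => (X.W k).continuous_ev _)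
    (fun j => continuous_const.mul ((continuous_val _ _ _).mul (continuous_val _ _ _)))
    (((bilFam hU).summable_norm h h' k).mul_left _)
    (((summable_mul_sqSum h h' k).mul_left _).mul_left _)
    (fun j s => (X.W k).norm_ev_le s _) (fun j s => ?_) fun j => ?_
  · rw [norm_mul, norm_mul (val _ _ _ _)]
    refine mul_le_mul_of_nonneg_left ?_ (norm_nonneg _)
    calc _ ≤ (evBound X.b * ‖h j‖) * (evBound X.b * ‖h' (k - j)‖) :=
          mul_le_mul (norm_val_le hU.b_eq h j s) (X.norm_val_W_le h' _ s) (norm_nonneg _)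
            (by positivity)
      _ = _ := by ring
  · by_cases hj : j ≠ 0 ∧ k - j ≠ 0 ∧ j + (k - j) ≠ 0
    · have e1 : (bilFam hU).T j (k - j) = Wgt.bilOp _ _ _ _ _ (bilBound hU hj) := dif_pos hj
      have := Wgt.ev_bilOp (bilBound hU hj) (h j) (h' (k - j)) ht
      rw [e1]
      have ek : j + (k - j) = k := by ring
      -- The product of two values carries a factor `2π` in `ev_bilOp`; it turns `1/(4π²)` into the
      -- `1/(2π)` of the coefficients of a square.
      have ec : bilCoeff (j + (k - j)) * (2 * Real.pi) = Complex.I * k * (2 * Real.pi : ℂ)⁻¹ := by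
        rw [ek, bilCoeff]
        have : (Real.pi : ℂ) ≠ 0 := by exact_mod_cast Real.pi_ne_zero
        field_simp
        ring
      rw [ec] at this
      have eW : X.W (j + (k - j)) = X.W k := by rw [ek]
      -- The operator has `j + (k - j)` in its type-level data; abstracting its value allows the
      -- rewriting of this index to `k`.
      generalize Wgt.bilOp _ _ _ _ _ (bilBound hU hj) (h j) (h' (k - j)) = x at this ⊢
      rw [eW] at this
      exact this
    · have e1 : (bilFam hU).T j (k - j) = 0 := dif_neg hj
      have e2 : ∀ s, Complex.I * k * (2 * Real.pi : ℂ)⁻¹ *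
          (val U h j s * val X.W h' (k - j) s) = 0 := fun s => by
        by_cases h1 : j = 0
        · subst h1; simp [val, h0]
        by_cases h2 : k - j = 0
        · rw [h2]; simp [val, h0']
        by_cases h3 : k = 0
        · simp [h3]
        · exact absurd ⟨h1, h2, by rwa [add_sub_cancel]⟩ hj
      simp_rw [e2]
      simp [e1]

end Damped

/-! ### Quadratic fixed point equations -/

section fixedPoint

open Filter Topology

variable {E : Type*} [NormedAddCommGroup E] [NormedSpace ℂ E]

/-- A contractive projected quadratic equation. -/
structure QuadEq (E : Type*) [NormedAddCommGroup E] [NormedSpace ℂ E] where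
  A : E →L[ℂ] E
  B : E →L[ℂ] E →L[ℂ] E
  K : ℝ
  r : ℝ
  hK : 0 ≤ K
  hr : 0 ≤ r
  hA : ∀ x, ‖A x‖ ≤ 1 / 4 * ‖x‖
  hB : ∀ x y, ‖B x y‖ ≤ K * ‖x‖ * ‖y‖
  hKr : K * r ≤ 1 / 8

namespace QuadEq

variable (q : QuadEq E)

/-- The right-hand side of the equation. -/
def rhs (x₀ x : E) : E := x₀ + q.A x + q.B x x

/-- The Lipschitz constant is `1/4` from the linear part and twice `1/8` from the two halves of the
quadratic difference. -/
lemma norm_rhs_sub_le {x₀ y₀ x y : E} (hx : ‖x‖ ≤ q.r) (hy : ‖y‖ ≤ q.r) :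
    ‖q.rhs x₀ x - q.rhs y₀ y‖ ≤ ‖x₀ - y₀‖ + 1 / 2 * ‖x - y‖ := by
  have e : q.rhs x₀ x - q.rhs y₀ y =
      (x₀ - y₀) + q.A (x - y) + (q.B (x - y) x + q.B y (x - y)) := by
    simp only [rhs, map_sub, sub_apply]
    abel
  have h1 := q.hB (x - y) x
  have h2 := q.hB y (x - y)
  have h3 : q.K * ‖x - y‖ * ‖x‖ ≤ 1 / 8 * ‖x - y‖ := by
    calc _ ≤ q.K * ‖x - y‖ * q.r :=
          mul_le_mul_of_nonneg_left hx (mul_nonneg q.hK (norm_nonneg _))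
      _ = q.K * q.r * ‖x - y‖ := by ring
      _ ≤ _ := mul_le_mul_of_nonneg_right q.hKr (norm_nonneg _)
  have h4 : q.K * ‖y‖ * ‖x - y‖ ≤ 1 / 8 * ‖x - y‖ :=
    mul_le_mul_of_nonneg_right ((mul_le_mul_of_nonneg_left hy q.hK).trans q.hKr) (norm_nonneg _)
  rw [e]
  refine (norm_add₃_le).trans ?_
  have h5 := norm_add_le (q.B (x - y) x) (q.B y (x - y))
  have h6 := q.hA (x - y)
  linarith

lemma norm_rhs_le {x₀ x : E} (h0 : ‖x₀‖ ≤ q.r / 2) (hx : ‖x‖ ≤ q.r) : ‖q.rhs x₀ x‖ ≤ q.r := by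
  have := q.norm_rhs_sub_le (x₀ := x₀) (y₀ := 0) hx (y := 0) (by simpa using q.hr)
  simp only [rhs, map_zero, add_zero, sub_zero] at this
  rw [rhs]
  linarith

/-- Solutions of the projected equation, in a closed invariant set. -/
lemma exists_fixed [CompleteSpace E] {P : E →L[ℂ] E} (hP : ∀ x, ‖P x‖ ≤ ‖x‖) {x₀ : E}
    (h0 : ‖x₀‖ ≤ q.r / 2) {s : Set E} (hs : IsClosed s) (h0s : (0 : E) ∈ s)
    (hsP : ∀ x ∈ s, P (q.rhs x₀ x) ∈ s) :
    ∃ x ∈ s, ‖x‖ ≤ q.r ∧ x = P (q.rhs x₀ x) := by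
  set t : Set E := s ∩ Metric.closedBall 0 q.r
  have ht : IsComplete t := (hs.inter Metric.isClosed_closedBall).isComplete
  have hmap : MapsTo (fun x => P (q.rhs x₀ x)) t t := fun x hx => ⟨hsP x hx.1, by
    have := mem_closedBall_zero_iff.1 hx.2
    exact mem_closedBall_zero_iff.2 ((hP _).trans (q.norm_rhs_le h0 this))⟩
  have hc : ContractingWith (1 / 2) (hmap.restrict _ t t) := by
    refine ⟨by rw [← NNReal.coe_lt_coe]; norm_num, LipschitzWith.of_dist_le_mul fun x y => ?_⟩
    have := q.norm_rhs_sub_le (x₀ := x₀) (y₀ := x₀) (mem_closedBall_zero_iff.1 x.2.2)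
      (mem_closedBall_zero_iff.1 y.2.2)
    rw [Subtype.dist_eq, Subtype.dist_eq, dist_eq_norm, dist_eq_norm]
    simp only [MapsTo.val_restrict_apply]
    rw [← map_sub]
    refine (hP _).trans (this.trans ?_)
    simp
  obtain ⟨x, hx, hfix, -⟩ := hc.exists_fixedPoint' (hsc := ht) (hsf := hmap) (x := 0)
    ⟨h0s, by simpa using q.hr⟩ (edist_ne_top _ _)
  exact ⟨x, hx.1, mem_closedBall_zero_iff.1 hx.2, hfix.symm⟩

lemma dist_fixed_le {P : E →L[ℂ] E} (hP : ∀ x, ‖P x‖ ≤ ‖x‖) {x₀ y₀ x y : E} (hx : ‖x‖ ≤ q.r)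
    (hy : ‖y‖ ≤ q.r) (hfx : x = P (q.rhs x₀ x)) (hfy : y = P (q.rhs y₀ y)) :
    ‖x - y‖ ≤ 2 * ‖x₀ - y₀‖ := by
  have h1 := q.norm_rhs_sub_le (x₀ := x₀) (y₀ := y₀) hx hy
  have h2 := hP (q.rhs x₀ x - q.rhs y₀ y)
  rw [map_sub, ← hfx, ← hfy] at h2
  linarith

/-- The Galerkin error. Since `y - P x` is the projection of a difference of right-hand sides, it is
at most `‖y - x‖/2`, and what remains is the error of projecting `x`. -/
lemma dist_projected_le {P : E →L[ℂ] E} (hP : ∀ x, ‖P x‖ ≤ ‖x‖) {x₀ x y : E} (hx : ‖x‖ ≤ q.r)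
    (hy : ‖y‖ ≤ q.r) (hfx : x = q.rhs x₀ x) (hfy : y = P (q.rhs x₀ y)) :
    ‖y - x‖ ≤ 2 * ‖P x - x‖ := by
  have h1 := q.norm_rhs_sub_le (x₀ := x₀) (y₀ := x₀) hy hx
  have h2 := hP (q.rhs x₀ y - q.rhs x₀ x)
  rw [map_sub, ← hfx, ← hfy] at h2
  rw [← hfx] at h1
  have h3 := norm_add_le (y - P x) (P x - x)
  rw [sub_add_sub_cancel] at h3
  rw [sub_self, norm_zero, zero_add] at h1
  linarith

end QuadEq

end fixedPoint

/-! ### Scalar linear equations -/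

lemma hasDerivAt_primitive {f : ℝ → ℂ} (hf : Continuous f) (u : ℂ) (t : ℝ) :
    HasDerivAt (fun t => u + ∫ s in (0 : ℝ)..t, f s) (f t) t :=
  (intervalIntegral.integral_hasDerivAt_right (hf.intervalIntegrable _ _)
    (hf.stronglyMeasurableAtFilter _ _) hf.continuousAt).const_add u

/-- Multiplication of a linear equation by an exponential. -/
lemma exp_mul_integral_eq {Z G : ℝ → ℂ} (hZ : Continuous Z) (hG : Continuous G) {u μ : ℂ} (ν : ℂ)
    {τ : ℝ} (h : ∀ t ∈ Icc 0 τ, Z t = u + ∫ s in (0 : ℝ)..t, (-μ * Z s + G s)) {t : ℝ}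
    (ht : t ∈ Icc 0 τ) :
    Complex.exp (ν * t) * Z t = u + ∫ s in (0 : ℝ)..t,
      (-(μ - ν) * (Complex.exp (ν * s) * Z s) + Complex.exp (ν * s) * G s) := by
  have hf : Continuous fun s => -μ * Z s + G s := by fun_prop
  -- `Z` satisfies the equation only on the interval, so its differentiability is not available at
  -- the end points. The primitive `F` is differentiable everywhere and agrees with `Z` there.
  set F : ℝ → ℂ := fun t => u + ∫ s in (0 : ℝ)..t, (-μ * Z s + G s)
  have hF : ∀ t, HasDerivAt F (-μ * Z t + G t) t := hasDerivAt_primitive hf u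
  have hFc : Continuous F := continuous_iff_continuousAt.2 fun t => (hF t).continuousAt
  have hexp : ∀ t : ℝ, HasDerivAt (fun t : ℝ => Complex.exp (ν * t)) (ν * Complex.exp (ν * t)) t := by
    intro t
    simpa using Wgt.hasDerivAt_exp (-ν) t
  have hd : ∀ s ∈ uIcc 0 t, HasDerivAt (fun t : ℝ => Complex.exp (ν * t) * F t)
      (ν * Complex.exp (ν * s) * F s + Complex.exp (ν * s) * (-μ * Z s + G s)) s :=
    fun s _ => (hexp s).mul (hF s)
  have hi := intervalIntegral.integral_eq_sub_of_hasDerivAt hd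
    (Continuous.intervalIntegrable (by fun_prop) _ _)
  have hF0 : F 0 = u := by simp [F]
  rw [hF0] at hi
  simp only [Complex.ofReal_zero, mul_zero, Complex.exp_zero, one_mul] at hi
  have e : ∫ s in (0 : ℝ)..t, (-(μ - ν) * (Complex.exp (ν * s) * Z s) + Complex.exp (ν * s) * G s) =
      ∫ s in (0 : ℝ)..t, (ν * Complex.exp (ν * s) * F s +
        Complex.exp (ν * s) * (-μ * Z s + G s)) := by
    refine intervalIntegral.integral_congr fun s hs => ?_
    rw [uIcc_of_le ht.1] at hs
    have : F s = Z s := (h s ⟨hs.1, hs.2.trans ht.2⟩).symm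
    simp only [this]
    ring
  have : F t = Z t := (h t ht).symm
  rw [e, hi, this]
  ring

/-- Linear scalar equations have at most one solution. -/
lemma eq_of_integral_eq {Z Z' G G' : ℝ → ℂ} (hZ : Continuous Z) (hZ' : Continuous Z')
    (hG : Continuous G) (hG' : Continuous G') {u μ : ℂ} {τ : ℝ} (hGG : ∀ t ∈ Icc 0 τ, G t = G' t)
    (h : ∀ t ∈ Icc 0 τ, Z t = u + ∫ s in (0 : ℝ)..t, (-μ * Z s + G s))
    (h' : ∀ t ∈ Icc 0 τ, Z' t = u + ∫ s in (0 : ℝ)..t, (-μ * Z' s + G' s)) :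
    ∀ t ∈ Icc 0 τ, Z t = Z' t := by
  intro t ht
  have e1 := exp_mul_integral_eq hZ hG μ h ht
  have e2 := exp_mul_integral_eq hZ' hG' μ h' ht
  have e3 : Complex.exp (μ * t) * Z t = Complex.exp (μ * t) * Z' t := by
    rw [e1, e2]
    congr 1
    refine intervalIntegral.integral_congr fun s hs => ?_
    rw [uIcc_of_le ht.1] at hs
    simp only [sub_self, neg_zero, zero_mul, zero_add, hGG s ⟨hs.1, hs.2.trans ht.2⟩]
  exact mul_left_cancel₀ (Complex.exp_ne_zero _) e3

/-! ### The system of Fourier coefficients -/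

namespace Setting

variable (S : Setting)

/-- The time derivative of the `k`-th Fourier coefficient of a solution. -/
def rhs (y : ℤ → ℂ) (k : ℤ) : ℂ :=
  -(Complex.I * dispSymbol S.α k) * y k - ∑' j, S.a k j * y j +
    Complex.I * k * (2 * Real.pi : ℂ)⁻¹ * ∑' j, y j * y (k - j)

/-- A family of functions of time solves the system of Fourier coefficients. -/
def Solves (T : ℝ) (u : ℤ → ℂ) (Y : ℤ → ℝ → ℂ) : Prop :=
  ∀ k, ∀ t ∈ Icc 0 T, Y k t = u k + ∫ s in (0 : ℝ)..t, S.rhs (fun j => Y j s) k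

/-- This is `∫ v² ∂ₓv = 0`. The product is symmetric in the three frequencies `p₁`, `p₂`, `-p₁ -
p₂`, so weighting by any of them gives the same sum `A`. The frequencies add up to zero, hence `3A =
0`. -/
lemma sum_rotate_eq_zero (f : ℤ → ℂ) (s : Finset ℤ) (hf : ∀ k ∉ s, f k = 0) :
    ∑' p : ℤ × ℤ, (p.1 : ℂ) * (f p.1 * f p.2 * f (-p.1 - p.2)) = 0 := by
  have hfin : ∀ g : ℤ × ℤ → ℂ, Summable fun p : ℤ × ℤ => g p * (f p.1 * f p.2 * f (-p.1 - p.2)) := by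
    intro g
    refine summable_of_ne_finset_zero (s := s ×ˢ s) fun p hp => ?_
    rw [Finset.mem_product, not_and_or] at hp
    rcases hp with h | h <;> simp [hf _ h]
  set A := ∑' p : ℤ × ℤ, (p.1 : ℂ) * (f p.1 * f p.2 * f (-p.1 - p.2)) with hA
  have h1 : ∑' p : ℤ × ℤ, (p.2 : ℂ) * (f p.1 * f p.2 * f (-p.1 - p.2)) = A := by
    rw [hA, ← (Equiv.prodComm ℤ ℤ).tsum_eq]
    refine tsum_congr fun p => ?_
    simp only [Equiv.prodComm_apply, Prod.fst_swap, Prod.snd_swap]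
    rw [show -p.2 - p.1 = -p.1 - p.2 by ring]
    ring
  let e : ℤ × ℤ ≃ ℤ × ℤ :=
    { toFun := fun p => (-p.1 - p.2, p.2)
      invFun := fun p => (-p.1 - p.2, p.2)
      left_inv := fun p => by ext <;> simp
      right_inv := fun p => by ext <;> simp }
  have h2 : ∑' p : ℤ × ℤ, ((-p.1 - p.2 : ℤ) : ℂ) * (f p.1 * f p.2 * f (-p.1 - p.2)) = A := by
    rw [hA, ← e.tsum_eq]
    refine tsum_congr fun p => ?_
    simp only [e, Equiv.coe_fn_mk]
    rw [show -(-p.1 - p.2) - p.2 = p.1 by ring]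
    ring
  have h3 : ∑' p : ℤ × ℤ, ((-p.1 - p.2 : ℤ) : ℂ) * (f p.1 * f p.2 * f (-p.1 - p.2)) =
      -(A + A) := by
    rw [← h1]
    nth_rewrite 1 [h1]
    rw [hA, ← (hfin fun p => (p.1 : ℂ)).tsum_add (hfin fun p => (p.2 : ℂ)), ← tsum_neg]
    refine tsum_congr fun p => ?_
    push_cast
    ring
  rw [h2] at h3
  have : 3 * A = 0 := by linear_combination h3
  simpa using this

/-- The energy identity for finite real sums. -/
lemma re_sum_rhs_nonpos (y : ℤ → ℂ) (s : Finset ℤ) (hs : ∀ k ∉ s, y k = 0)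
    (hy : ∀ k, y (-k) = starRingEnd ℂ (y k)) :
    (∑ k ∈ s, S.rhs y k * starRingEnd ℂ (y k)).re ≤ 0 := by
  have e1 : ∀ k, S.rhs y k * starRingEnd ℂ (y k) =
      -(Complex.I * dispSymbol S.α k) * (y k * starRingEnd ℂ (y k)) -
      ∑ j ∈ s, S.a k j * y j * starRingEnd ℂ (y k) +
      Complex.I * (2 * Real.pi : ℂ)⁻¹ * (k * ((∑' j, y j * y (k - j)) * starRingEnd ℂ (y k))) := by
    intro k
    rw [rhs, tsum_eq_sum (s := s) (fun j hj => by rw [hs j hj, mul_zero]), ← Finset.sum_mul]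
    ring
  have e2 : ∑ k ∈ s, (k : ℂ) * ((∑' j, y j * y (k - j)) * starRingEnd ℂ (y k)) = 0 := by
    have h := sum_rotate_eq_zero y s hs
    have hsum : Summable fun p : ℤ × ℤ => (p.1 : ℂ) * (y p.1 * y p.2 * y (-p.1 - p.2)) := by
      refine summable_of_ne_finset_zero (s := s ×ˢ s) fun p hp => ?_
      rw [Finset.mem_product, not_and_or] at hp
      rcases hp with h | h <;> simp [hs _ h]
    rw [hsum.tsum_prod] at h
    have h4 : ∑' k : ℤ, (k : ℂ) * ((∑' j, y j * y (k - j)) * starRingEnd ℂ (y k)) = 0 := by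
      rw [← (Equiv.neg ℤ).tsum_eq, ← neg_zero, ← h, ← tsum_neg]
      refine tsum_congr fun k => ?_
      simp only [Equiv.neg_apply]
      rw [← hy (-k), neg_neg, ← tsum_mul_right, ← tsum_mul_left, ← tsum_neg]
      refine tsum_congr fun j => ?_
      push_cast
      ring
    rwa [tsum_eq_sum (s := s) (fun k hk => by simp [hs k hk])] at h4
  simp_rw [e1]
  rw [Finset.sum_add_distrib, ← Finset.mul_sum, e2, mul_zero, add_zero, Finset.sum_sub_distrib,
    Complex.sub_re, Complex.re_sum]
  have h1 : ∑ k ∈ s, (-(Complex.I * (dispSymbol S.α k : ℂ)) * (y k * starRingEnd ℂ (y k))).re = 0 := by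
    refine Finset.sum_eq_zero fun k _ => ?_
    rw [Complex.mul_conj]
    simp
  rw [h1]
  have := S.re_nonneg s y
  linarith

/-- The energy inequality for finite real systems. -/
lemma energy_le {T : ℝ} {u : ℤ → ℂ} {Y : ℤ → ℝ → ℂ} (s : Finset ℤ) (hs : ∀ k ∉ s, ∀ t, Y k t = 0)
    (hc : ∀ k, Continuous (Y k))
    (hy : ∀ t ∈ Icc 0 T, ∀ k, Y (-k) t = starRingEnd ℂ (Y k t))
    (h : ∀ k ∈ s, ∀ t ∈ Icc 0 T, Y k t = u k + ∫ s in (0 : ℝ)..t, S.rhs (fun j => Y j s) k)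
    {t : ℝ} (ht : t ∈ Icc 0 T) : ∑ k ∈ s, ‖Y k t‖ ^ 2 ≤ ∑ k ∈ s, ‖u k‖ ^ 2 := by
  have hT : 0 ≤ T := ht.1.trans ht.2
  have hr : ∀ k, Continuous fun t => S.rhs (fun j => Y j t) k := fun k => by
    have e : ∀ t, S.rhs (fun j => Y j t) k = -(Complex.I * dispSymbol S.α k) * Y k t -
        ∑ j ∈ s, S.a k j * Y j t +
        Complex.I * k * (2 * Real.pi : ℂ)⁻¹ * ∑ j ∈ s, Y j t * Y (k - j) t := fun t => by
      rw [rhs, tsum_eq_sum (s := s) (fun j hj => by rw [hs j hj, mul_zero]),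
        tsum_eq_sum (s := s) (fun j hj => by rw [hs j hj, zero_mul])]
    simp_rw [e]
    fun_prop
  have hd : ∀ k ∈ s, ∀ t ∈ Ioo 0 T, HasDerivAt (fun t => ‖Y k t‖ ^ 2)
      (2 * (S.rhs (fun j => Y j t) k * starRingEnd ℂ (Y k t)).re) t := by
    intro k hk t ht
    have h1 : HasDerivAt (Y k) (S.rhs (fun j => Y j t) k) t := by
      refine (hasDerivAt_primitive (hr k) (u k) t).congr_of_eventuallyEq ?_
      filter_upwards [Ioo_mem_nhds ht.1 ht.2] with t ht
      exact h k hk t ⟨ht.1.le, ht.2.le⟩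
    have h2 := h1.norm_sq
    refine h2.congr_deriv ?_
    rw [Complex.inner]
  have hanti : AntitoneOn (fun t => ∑ k ∈ s, ‖Y k t‖ ^ 2) (Icc 0 T) := by
    refine antitoneOn_of_hasDerivWithinAt_nonpos (convex_Icc 0 T)
      (f' := fun t => ∑ k ∈ s, 2 * (S.rhs (fun j => Y j t) k * starRingEnd ℂ (Y k t)).re)
      ?_ (fun t ht => ?_) (fun t ht => ?_)
    · exact (continuous_finsetSum _ fun k _ => ((hc k).norm.pow 2)).continuousOn
    · rw [interior_Icc] at ht
      exact (HasDerivAt.fun_sum fun k hk => hd k hk t ht).hasDerivWithinAt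
    · rw [interior_Icc] at ht
      rw [← Finset.mul_sum, ← Complex.re_sum]
      have := S.re_sum_rhs_nonpos (fun j => Y j t) s (fun k hk => hs k hk t)
        (hy t ⟨ht.1.le, ht.2.le⟩)
      linarith
  have h0 : ∀ k ∈ s, Y k 0 = u k := fun k hk => by
    rw [h k hk 0 ⟨le_rfl, hT⟩]; simp
  refine (hanti ⟨le_rfl, hT⟩ ht ht.1).trans (le_of_eq ?_)
  exact Finset.sum_congr rfl fun k hk => by simp only [h0 k hk]

end Setting

/-! ### Truncation -/

section trunc

variable {V : Type*} [NormedAddCommGroup V] [NormedSpace ℂ V]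

open Classical in
/-- Restriction to a set of frequencies. -/
def trunc (s : Set ℤ) : SqSum V →L[ℂ] SqSum V :=
  diagOp (fun k => if k ∈ s then ContinuousLinearMap.id ℂ V else 0) 1 zero_le_one fun k v => by
    split_ifs <;> simp

lemma trunc_apply_mem {s : Set ℤ} {k : ℤ} (hk : k ∈ s) (x : SqSum V) : trunc s x k = x k := by
  rw [trunc, diagOp_apply, if_pos hk]; rfl

lemma trunc_apply_not_mem {s : Set ℤ} {k : ℤ} (hk : k ∉ s) (x : SqSum V) : trunc s x k = 0 := by
  rw [trunc, diagOp_apply, if_neg hk]; rfl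

lemma norm_trunc_le (s : Set ℤ) (x : SqSum V) : ‖trunc s x‖ ≤ ‖x‖ :=
  (norm_diagOp_le _ _ _ _ x).trans_eq (one_mul _)

/-- The set is made symmetric under `k ↦ -k`, so that truncation preserves real-valuedness, on which
the energy identity depends. -/
lemma exists_norm_trunc_sub_lt (x : SqSum V) {ε : ℝ} (hε : 0 < ε) :
    ∃ s : Finset ℤ, (∀ k, -k ∈ s ↔ k ∈ s) ∧ ‖trunc (s : Set ℤ) x - x‖ < ε := by
  have h := (lp.hasSum_single (p := 2) (by norm_num) x)
  obtain ⟨s₀, hs₀⟩ := Filter.eventually_atTop.1 ((Metric.tendsto_nhds.1 h) ε hε)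
  refine ⟨s₀ ∪ s₀.image Neg.neg, fun k => ?_, ?_⟩
  · simp only [Finset.mem_union, Finset.mem_image]
    constructor
    · rintro (h | ⟨j, hj, hjk⟩)
      · exact Or.inr ⟨-k, h, neg_neg k⟩
      · exact Or.inl (by rwa [← neg_injective hjk])
    · rintro (h | ⟨j, hj, rfl⟩)
      · exact Or.inr ⟨k, h, rfl⟩
      · exact Or.inl (by rwa [neg_neg])
  · have := hs₀ (s₀ ∪ s₀.image Neg.neg) Finset.subset_union_left
    rw [dist_eq_norm] at this
    refine lt_of_eq_of_lt ?_ this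
    congr 2
    refine lp.ext (funext fun k => ?_)
    rw [lp.coeFn_sum, Finset.sum_apply]
    by_cases hk : k ∈ s₀ ∪ s₀.image Neg.neg
    · rw [trunc_apply_mem (by exact_mod_cast hk), Finset.sum_eq_single k]
      · rw [lp.single_apply_self]
      · intro j _ hjk
        exact lp.single_apply_ne _ _ _ hjk.symm
      · exact fun h => absurd hk h
    · rw [trunc_apply_not_mem (by exact_mod_cast hk), Finset.sum_eq_zero]
      intro j hj
      exact lp.single_apply_ne _ _ _ (by rintro rfl; exact hk hj)

end trunc

/-! ### Evaluation of sequences -/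

/-- The coefficients at time `t`, as a square-summable sequence. -/
def evSeq (U : ℤ → Wgt) {b : ℝ} (hU : ∀ k, (U k).b = b) (t : ℝ) : SqSum L2R →L[ℂ] SqSum ℂ :=
  diagOp (fun k => (U k).ev t) (evBound b) (evBound_nonneg b) fun k v => by
    rw [← hU k]; exact (U k).norm_ev_le t v

lemma evSeq_apply (U : ℤ → Wgt) {b : ℝ} (hU : ∀ k, (U k).b = b) (t : ℝ) (h : SqSum L2R) (k : ℤ) :
    evSeq U hU t h k = val U h k t := rfl

lemma norm_evSeq_le (U : ℤ → Wgt) {b : ℝ} (hU : ∀ k, (U k).b = b) (t : ℝ) (h : SqSum L2R) :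
    ‖evSeq U hU t h‖ ≤ evBound b * ‖h‖ := norm_diagOp_le _ _ _ _ h

lemma continuous_val_left (U : ℤ → Wgt) (k : ℤ) (t : ℝ) :
    Continuous fun h : SqSum L2R => val U h k t :=
  ((U k).ev t).continuous.comp (lp.evalCLM ℂ (fun _ : ℤ => L2R) 2 k).continuous

lemma val_add (U : ℤ → Wgt) (h h' : SqSum L2R) (k : ℤ) (t : ℝ) :
    val U (h + h') k t = val U h k t + val U h' k t := map_add ((U k).ev t) _ _

lemma val_sub (U : ℤ → Wgt) (h h' : SqSum L2R) (k : ℤ) (t : ℝ) :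
    val U (h - h') k t = val U h k t - val U h' k t := map_sub ((U k).ev t) _ _

/-! ### Multiplication by functions of time -/

/-- Multiplication by a function of time, for sequences. -/
def timeSeq (K : TimeMult) {U U' : ℤ → Wgt} {b C M : ℝ} (hU : ∀ k, (U k).b = b)
    (H : ∀ k, TimeCompat (U k) (U' k) C M) : SqSum L2R →L[ℂ] SqSum L2R :=
  diagOp (fun k => timeOp K (H k)) (timeBound K b C)
    (by
      have := (H 0).hC
      have := K.size_nonneg
      have : 0 ≤ bracketNorm (-1) := Real.sqrt_nonneg _
      unfold timeBound
      positivity)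
    fun k v => by rw [← hU k]; exact norm_timeOp_le K (H k) v

lemma val_timeSeq (K : TimeMult) {U U' : ℤ → Wgt} {b C M : ℝ} (hU : ∀ k, (U k).b = b)
    (H : ∀ k, TimeCompat (U k) (U' k) C M) (h : SqSum L2R) (k : ℤ) (t : ℝ) :
    val U' (timeSeq K hU H h) k t = K.χ (M * t) * val U h k t := ev_timeOp K (H k) (h k) t

lemma norm_timeSeq_le (K : TimeMult) {U U' : ℤ → Wgt} {b C M : ℝ} (hU : ∀ k, (U k).b = b)
    (H : ∀ k, TimeCompat (U k) (U' k) C M) (h : SqSum L2R) :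
    ‖timeSeq K hU H h‖ ≤ timeBound K b C * ‖h‖ := norm_diagOp_le _ _ _ _ h

lemma timeSeq_apply_eq_zero (K : TimeMult) {U U' : ℤ → Wgt} {b C M : ℝ} (hU : ∀ k, (U k).b = b)
    (H : ∀ k, TimeCompat (U k) (U' k) C M) {h : SqSum L2R} {k : ℤ} (hk : h k = 0) :
    timeSeq K hU H h k = 0 := by
  rw [timeSeq, diagOp_apply, hk, map_zero]

lemma exists_expMult : ∃ K : TimeMult, ∀ t, |t| ≤ 1 → K.χ t = Complex.exp t :=
  exists_timeMult (f := fun t : ℝ => Complex.exp t)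
    (Complex.contDiff_exp.comp Complex.ofRealCLM.contDiff) 1

/-- A multiplier that equals the exponential on the unit interval. -/
def expMult : TimeMult := exists_expMult.choose

lemma expMult_eq {t : ℝ} (ht : |t| ≤ 1) : expMult.χ t = Complex.exp t :=
  exists_expMult.choose_spec t ht

/-! ### The damped evolution -/

namespace Setting

variable (S : Setting)

/-- The linearised source of the `k`-th coefficient, without the diagonal part. -/
def src (z x : ℤ → ℂ) (k : ℤ) : ℂ :=
  (∑' j, -S.off k j * x j) + ∑' j, Complex.I * k * (2 * Real.pi : ℂ)⁻¹ * (z j * x (k - j))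

lemma src_conj {z x : ℤ → ℂ} (hz : ∀ k, z (-k) = starRingEnd ℂ (z k))
    (hx : ∀ k, x (-k) = starRingEnd ℂ (x k)) (k : ℤ) :
    S.src z x (-k) = starRingEnd ℂ (S.src z x k) := by
  rw [src, src, map_add, Complex.conj_tsum, Complex.conj_tsum, ← (Equiv.neg ℤ).tsum_eq,
    ← (Equiv.neg ℤ).tsum_eq (fun j => Complex.I * ((-k : ℤ) : ℂ) * (2 * Real.pi : ℂ)⁻¹ *
      (z j * x (-k - j)))]
  congr 1
  · refine tsum_congr fun j => ?_
    have e : S.off (-k) (-j) = starRingEnd ℂ (S.off k j) := by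
      unfold off
      by_cases h : k = j
      · simp [h]
      · rw [if_neg h, if_neg (by simpa using h), S.conj_neg]
    simp only [Equiv.neg_apply, e, hx, map_mul, map_neg]
  · refine tsum_congr fun j => ?_
    have e : -k - -j = -(k - j) := by ring
    have hpi : (starRingEnd ℂ) ((2 * Real.pi : ℂ)⁻¹) = (2 * Real.pi : ℂ)⁻¹ := by
      have : ((2 * Real.pi : ℂ)⁻¹) = (((2 * Real.pi)⁻¹ : ℝ) : ℂ) := by push_cast; rfl
      rw [this, Complex.conj_ofReal]
    simp only [Equiv.neg_apply, e, hz, hx, map_mul, Complex.conj_I, hpi]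
    rw [map_intCast]
    push_cast
    ring

lemma rhs_eq_src {y : ℤ → ℂ} {B : ℝ} (hB : ∀ j, ‖y j‖ ≤ B) (k : ℤ) :
    S.rhs y k = -(Complex.I * dispSymbol S.α k) * y k - S.a k k * y k + S.src y y k := by
  have hs : Summable fun j => S.a k j * y j := by
    refine ((S.summable_coeff k).mul_right B).of_norm_bounded fun j => ?_
    rw [norm_mul]
    exact mul_le_mul_of_nonneg_left (hB j) (norm_nonneg _)
  have e : ∑' j, -S.off k j * y j = -∑' j, (if j = k then 0 else S.a k j * y j) := by
    rw [← tsum_neg]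
    refine tsum_congr fun j => ?_
    unfold off
    by_cases h : j = k
    · simp [h]
    · rw [if_neg h, if_neg (Ne.symm h), neg_mul]
  rw [rhs, src, hs.tsum_eq_add_tsum_ite k, e, tsum_mul_left]
  ring

/-- Linearity in the second argument. It is what removes the damping: `e^{Mt}` times the source of
`(e^{Mt}x, x)` is the source of `(e^{Mt}x, e^{Mt}x)`. -/
lemma smul_src (c : ℂ) (z x : ℤ → ℂ) (k : ℤ) : c * S.src z x k = S.src z (fun j => c * x j) k := by
  rw [src, src, mul_add, ← tsum_mul_left, ← tsum_mul_left]
  congr 1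
  · exact tsum_congr fun j => by ring
  · exact tsum_congr fun j => by ring

lemma continuous_src {z x : ℤ → ℝ → ℂ} {Z X : SqSum L2R} {B : ℝ} (hz : ∀ k, Continuous (z k))
    (hx : ∀ k, Continuous (x k)) (hB : 0 ≤ B) (hZ : ∀ k t, ‖z k t‖ ≤ B * ‖Z k‖)
    (hX : ∀ k t, ‖x k t‖ ≤ B * ‖X k‖) (k : ℤ) :
    Continuous fun t => S.src (fun j => z j t) (fun j => x j t) k := by
  refine Continuous.add ?_ ?_
  · refine continuous_tsum (fun j => continuous_const.mul (hx j))
      ((S.summable_coeff k).mul_right (B * ‖X‖)) fun j t => ?_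
    rw [norm_mul, norm_neg]
    exact mul_le_mul (S.norm_off_le k j) ((hX j t).trans
      (mul_le_mul_of_nonneg_left (norm_apply_le X j) hB)) (norm_nonneg _) (norm_nonneg _)
  · refine continuous_tsum (fun j => continuous_const.mul ((hz j).mul (hx (k - j))))
      ((summable_mul_sqSum Z X k).mul_left (‖Complex.I * k * (2 * Real.pi : ℂ)⁻¹‖ * B ^ 2))
      fun j t => ?_
    have h : ‖z j t‖ * ‖x (k - j) t‖ ≤ B ^ 2 * (‖Z j‖ * ‖X (k - j)‖) := by
      calc _ ≤ (B * ‖Z j‖) * (B * ‖X (k - j)‖) :=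
            mul_le_mul (hZ j t) (hX _ t) (norm_nonneg _) (mul_nonneg hB (norm_nonneg (Z j)))
        _ = _ := by ring
    rw [norm_mul, norm_mul (z j t)]
    exact (mul_le_mul_of_nonneg_left h (norm_nonneg _)).trans_eq (by ring)

end Setting

namespace Damped

variable (X : Damped)

/-- The free part of the damped evolution. -/
def dataOp : SqSum ℂ →L[ℂ] SqSum L2R :=
  diagOp (fun k => (ContinuousLinearMap.id ℂ ℂ).smulRight (X.W k).wave) (2 * bracketNorm (X.b - 2))
    (mul_nonneg zero_le_two (Real.sqrt_nonneg _)) fun k v => by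
      rw [ContinuousLinearMap.smulRight_apply, norm_smul, mul_comm]
      exact mul_le_mul_of_nonneg_right (X.W k).norm_wave_le (norm_nonneg _)

lemma norm_dataOp_le (u : SqSum ℂ) : ‖X.dataOp u‖ ≤ 2 * bracketNorm (X.b - 2) * ‖u‖ :=
  norm_diagOp_le _ _ _ _ u

lemma dataOp_zero {u : SqSum ℂ} (hu : u 0 = 0) : X.dataOp u 0 = 0 := by
  rw [dataOp, diagOp_apply, hu, map_zero]

lemma val_dataOp (u : SqSum ℂ) (k : ℤ) {t : ℝ} (ht : 0 ≤ t) :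
    val X.W (X.dataOp u) k t = u k + ∫ s in (0 : ℝ)..t, -(X.W k).μ * val X.W (X.dataOp u) k s := by
  have e : ∀ s, 0 ≤ s → val X.W (X.dataOp u) k s = u k * Complex.exp (-(X.W k).μ * s) :=
    fun s hs => by
      rw [val, dataOp, diagOp_apply, ContinuousLinearMap.smulRight_apply, map_smul,
        (X.W k).ev_wave hs, smul_eq_mul]
      rfl
  have h := Wgt.integral_of_hasDerivAt (z := fun t => u k * Complex.exp (-(X.W k).μ * t))
    (F := fun _ => 0) (ν := (X.W k).μ) continuous_const (fun t => by
      refine ((Wgt.hasDerivAt_exp (X.W k).μ t).const_mul (u k)).congr_deriv ?_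
      ring) (t := t)
  simp only [Complex.ofReal_zero, mul_zero, Complex.exp_zero, mul_one, add_zero] at h
  rw [e t ht, h]
  congr 1
  refine intervalIntegral.integral_congr fun s hs => ?_
  rw [uIcc_of_le ht] at hs
  simp only [e s hs.1]

variable {X}

/-- The right-hand side of the damped evolution. -/
def evo {U : ℤ → Wgt} (hU : X.Adm U) (u : SqSum ℂ) (z x : SqSum L2R) : SqSum L2R :=
  X.dataOp u + X.linFam.op x + (bilFam hU).op z x

lemma continuous_src_val {U : ℤ → Wgt} (hU : X.Adm U) (z x : SqSum L2R) (k : ℤ) :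
    Continuous fun t => X.src (fun j => val U z j t) (fun j => val X.W x j t) k :=
  X.continuous_src (continuous_val U z) (continuous_val X.W x) (evBound_nonneg X.b)
    (fun k t => norm_val_le hU.b_eq z k t) (fun k t => X.norm_val_W_le x k t) k

lemma val_evo {U : ℤ → Wgt} (hU : X.Adm U) (u : SqSum ℂ) {z x : SqSum L2R} (hz : z 0 = 0)
    (hx : x 0 = 0) (k : ℤ) {t : ℝ} (ht : 0 ≤ t) :
    val X.W (evo hU u z x) k t = u k + ∫ s in (0 : ℝ)..t, (-(X.W k).μ * val X.W (evo hU u z x) k s +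
      X.src (fun j => val U z j s) (fun j => val X.W x j s) k) := by
  have c1 := continuous_val X.W (X.dataOp u) k
  have c2 := continuous_val X.W (X.linFam.op x) k
  have c3 := continuous_val X.W ((bilFam hU).op z x) k
  have c4 : Continuous fun s => ∑' j, -X.off k j * val X.W x j s := by
    have := continuous_src_val hU 0 x k
    simpa [Setting.src, val] using this
  have c5 : Continuous fun s =>
      ∑' j, Complex.I * k * (2 * Real.pi : ℂ)⁻¹ * (val U z j s * val X.W x (k - j) s) := by
    refine ((continuous_src_val hU z x k).sub c4).congr fun s => ?_
    simp only [Setting.src, Pi.sub_apply, add_sub_cancel_left]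
  have e : ∀ s, val X.W (evo hU u z x) k s = val X.W (X.dataOp u) k s +
      val X.W (X.linFam.op x) k s + val X.W ((bilFam hU).op z x) k s := fun s => by
    rw [evo, val_add, val_add]
  rw [e, X.val_dataOp u k ht, X.val_linFam x k ht, val_bilFam hU hz hx k ht, add_assoc, add_assoc,
    ← intervalIntegral.integral_add, ← intervalIntegral.integral_add]
  · congr 1
    refine intervalIntegral.integral_congr fun s _ => ?_
    simp only [e, Setting.src]
    ring
  all_goals exact Continuous.intervalIntegrable (by fun_prop) _ _

lemma evo_zero {U : ℤ → Wgt} (hU : X.Adm U) {u : SqSum ℂ} (hu : u 0 = 0) (z x : SqSum L2R) :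
    evo hU u z x 0 = 0 := by
  rw [evo, lp.coeFn_add, lp.coeFn_add, Pi.add_apply, Pi.add_apply, X.dataOp_zero hu,
    X.linFam_op_zero, bilFam_op_zero, add_zero, add_zero]

end Damped

/-! ### The fixed point equation of the local problem -/

/-- The constant of the quadratic interaction. -/
def Exps.bilConst (E : Exps) : ℝ :=
  3 * (Wgt.Qnorm E.b * 24 * evBound E.b) *
    √(∑' n : ℤ, |(n : ℝ)| ^ (-(1 + ((E.α + E.β) / 2 - 1))))

lemma Exps.bilConst_nonneg (E : Exps) : 0 ≤ E.bilConst := by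
  have := Wgt.Qnorm_nonneg E.b
  have := evBound_nonneg E.b
  unfold bilConst
  positivity

/-- The constant of the off-diagonal dissipation. -/
def Setting.linConst (S : Setting) : ℝ :=
  Wgt.Qnorm S.b * (2 * S.C) * ∑' n : ℤ, (1 + |(n : ℝ)|) ^ (-3 : ℝ)

lemma conj_intervalIntegral (f : ℝ → ℂ) (a b : ℝ) :
    starRingEnd ℂ (∫ s in a..b, f s) = ∫ s in a..b, starRingEnd ℂ (f s) := by
  simp only [intervalIntegral, map_sub, integral_conj]

lemma val_eq_zero (U : ℤ → Wgt) {h : SqSum L2R} {k : ℤ} (hk : h k = 0) (t : ℝ) :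
    val U h k t = 0 := by
  rw [val, hk, map_zero]

/-- Mean-zero data of a real function. -/
structure RealSeq (u : SqSum ℂ) : Prop where
  zero : u 0 = 0
  conj : ∀ k, u (-k) = starRingEnd ℂ (u k)

/-- An element of `Z^b` whose restriction to `[0,T]` solves the equation. -/
structure Setting.Sol (S : Setting) (T : ℝ) (u : ℤ → ℂ) (h : SqSum L2R) : Prop where
  zero : h 0 = 0
  solves : S.Solves T u (val S.W₀ h)

lemma Exps.W₀_b (E : Exps) (k : ℤ) : (E.W₀ k).b = E.b := rfl

/-- Evaluation in the weights of `Z^b`. -/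
def Exps.ev (E : Exps) (t : ℝ) : SqSum L2R →L[ℂ] SqSum ℂ := evSeq E.W₀ E.W₀_b t

lemma Exps.ev_apply (E : Exps) (t : ℝ) (h : SqSum L2R) (k : ℤ) : E.ev t h k = val E.W₀ h k t := rfl

namespace Damped

variable (X : Damped)

lemma W_b (k : ℤ) : (X.W k).b = X.b := rfl

lemma linFam_B_eq : X.linFam.B = X.linConst * X.gain := by
  rw [linFam_B, Setting.linConst]; ring

variable {X} in
lemma norm_bilFam_le {U : ℤ → Wgt} (hU : X.Adm U) (z x : SqSum L2R) :
    ‖(bilFam hU).op z x‖ ≤ X.bilConst * X.gain * ‖z‖ * ‖x‖ := by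
  refine ((bilFam hU).norm_op_le z x).trans (le_of_eq ?_)
  have e : (bilFam hU).R = √(∑' n : ℤ, |(n : ℝ)| ^ (-(1 + ((X.α + X.β) / 2 - 1)))) := by
    rw [BilFamily.R]
    congr 1
    exact tsum_congr fun n => X.ρ_sq n
  rw [e, Exps.bilConst]
  simp only [bilFam]
  ring

/-- The damping is strong enough for data of a given size. -/
structure Small (r : ℝ) : Prop where
  nonneg : 0 ≤ r
  lin : X.linConst * X.gain ≤ 1 / 4
  bil : X.bilConst * X.gain * timeBound expMult X.b 1 * r ≤ 1 / 8

lemma compat_self (k : ℤ) : TimeCompat (X.W k) (X.W k) 1 X.M :=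
  ⟨X.M_pos, X.M_le k, zero_le_one, fun _ => (one_mul _).ge⟩

/-- Multiplication by the exponential that removes the damping. -/
def theta : SqSum L2R →L[ℂ] SqSum L2R := timeSeq expMult X.W_b X.compat_self

/-- The time of existence. -/
def time : ℝ := X.M⁻¹

lemma time_pos : 0 < X.time := inv_pos.2 X.M_pos

lemma abs_mul_time_le {t : ℝ} (ht : t ∈ Icc 0 X.time) : |X.M * t| ≤ 1 := by
  have h := X.M_pos
  rw [abs_of_nonneg (mul_nonneg h.le ht.1)]
  calc X.M * t ≤ X.M * X.M⁻¹ := mul_le_mul_of_nonneg_left ht.2 h.le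
    _ = 1 := mul_inv_cancel₀ h.ne'

lemma val_theta (x : SqSum L2R) (k : ℤ) {t : ℝ} (ht : t ∈ Icc 0 X.time) :
    val X.W (X.theta x) k t = Complex.exp (X.M * t) * val X.W x k t := by
  rw [theta, val_timeSeq, expMult_eq (X.abs_mul_time_le ht)]
  push_cast; rfl

variable {X} in
/-- The fixed point equation of the local problem. -/
def Small.quad {r : ℝ} (hs : X.Small r) : QuadEq (SqSum L2R) where
  A := X.linFam.op
  B := (bilFam X.adm_W).op ∘L X.theta
  K := X.bilConst * X.gain * timeBound expMult X.b 1
  r := r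
  hK := by
    have h1 := X.bilConst_nonneg
    have h2 := X.gain_nonneg
    have h3 := expMult.size_nonneg
    have : 0 ≤ bracketNorm (-1) := Real.sqrt_nonneg _
    unfold timeBound
    positivity
  hr := hs.nonneg
  hA x := (X.linFam.norm_op_le x).trans
    (mul_le_mul_of_nonneg_right (by rw [X.linFam_B_eq]; exact hs.lin) (norm_nonneg _))
  hB x y := by
    refine (norm_bilFam_le X.adm_W _ y).trans ?_
    have h1 := mul_nonneg X.bilConst_nonneg X.gain_nonneg
    have h2 := norm_timeSeq_le expMult X.W_b X.compat_self x
    calc _ ≤ X.bilConst * X.gain * (timeBound expMult X.b 1 * ‖x‖) * ‖y‖ :=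
          mul_le_mul_of_nonneg_right (mul_le_mul_of_nonneg_left h2 h1) (norm_nonneg _)
      _ = _ := by ring
  hKr := hs.bil

variable {X} in
/-- The mean-zero elements with real values on the time interval. -/
def realSet : Set (SqSum L2R) :=
  {x | x 0 = 0 ∧ ∀ k, ∀ t ∈ Icc 0 X.time, val X.W x (-k) t = starRingEnd ℂ (val X.W x k t)}

lemma isClosed_realSet : IsClosed X.realSet := by
  have h1 : IsClosed {x : SqSum L2R | x 0 = 0} :=
    isClosed_eq (lp.evalCLM ℂ (fun _ : ℤ => L2R) 2 0).continuous continuous_const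
  have h2 : IsClosed {x : SqSum L2R | ∀ k, ∀ t ∈ Icc 0 X.time,
      val X.W x (-k) t = starRingEnd ℂ (val X.W x k t)} := by
    simp only [ofPred_forall]
    refine isClosed_iInter fun k => isClosed_iInter fun t => isClosed_iInter fun _ => ?_
    exact isClosed_eq (continuous_val_left X.W (-k) t)
      (Complex.continuous_conj.comp (continuous_val_left X.W k t))
  exact h1.inter h2

lemma zero_mem_realSet : (0 : SqSum L2R) ∈ X.realSet :=
  ⟨rfl, fun k t _ => by simp [val]⟩

lemma trunc_mem_realSet {s : Set ℤ} (hs : ∀ k, -k ∈ s ↔ k ∈ s) {x : SqSum L2R}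
    (hx : x ∈ X.realSet) : trunc s x ∈ X.realSet := by
  have e : ∀ k t, val X.W (trunc s x) k t = open Classical in if k ∈ s then val X.W x k t else 0 :=
    fun k t => by
      by_cases hk : k ∈ s
      · rw [if_pos hk, val, trunc_apply_mem hk]; rfl
      · rw [if_neg hk, val, trunc_apply_not_mem hk, map_zero]
  refine ⟨?_, fun k t ht => ?_⟩
  · by_cases hk : (0 : ℤ) ∈ s
    · rw [trunc_apply_mem hk, hx.1]
    · exact trunc_apply_not_mem hk x
  · rw [e, e]
    by_cases hk : k ∈ s
    · rw [if_pos hk, if_pos ((hs k).2 hk), hx.2 k t ht]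
    · rw [if_neg hk, if_neg (fun h => hk ((hs k).1 h)), map_zero]

lemma μ_neg (k : ℤ) : (X.W (-k)).μ = starRingEnd ℂ (X.W k).μ := by
  have h1 : (X.W (-k)).ℓ = -(X.W k).ℓ := by
    show dispSymbol X.α (-k) = -dispSymbol X.α k
    simp [dispSymbol]
  have h2 : (X.W (-k)).lam = (X.W k).lam := by
    show X.M + (X.a (-k) (-k)).re = X.M + (X.a k k).re
    rw [X.conj_neg, Complex.conj_re]
  rw [Wgt.μ, Wgt.μ, h1, h2]
  simp

/-- The coefficient at `-k` and the conjugate of the one at `k` solve the same scalar linear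
equation, which has a unique solution. Reality is asked for on `[0, 1/M]` only, where `theta` is
known to multiply by the real function `e^{Mt}`. -/
lemma evo_mem_realSet {u : SqSum ℂ} (hu : RealSeq u) {x : SqSum L2R} (hx : x ∈ X.realSet) :
    evo X.adm_W u (X.theta x) x ∈ X.realSet := by
  have hθ0 : X.theta x 0 = 0 := timeSeq_apply_eq_zero _ _ _ hx.1
  refine ⟨evo_zero _ hu.zero _ _, fun k t ht => ?_⟩
  set y := evo X.adm_W u (X.theta x) x
  have hc := continuous_src_val X.adm_W (X.theta x) x
  refine eq_of_integral_eq (u := starRingEnd ℂ (u k)) (μ := starRingEnd ℂ (X.W k).μ)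
    (Z := fun t => val X.W y (-k) t) (Z' := fun t => starRingEnd ℂ (val X.W y k t))
    (continuous_val _ _ _) (Complex.continuous_conj.comp (continuous_val _ _ _))
    (hc (-k)) (Complex.continuous_conj.comp (hc k)) (fun t ht => ?_) (fun t ht => ?_)
    (fun t ht => ?_) t ht
  · refine X.src_conj (fun k => ?_) (fun k => hx.2 k t ht) k
    rw [X.val_theta x _ ht, X.val_theta x _ ht, hx.2 k t ht, map_mul, ← Complex.exp_conj]
    simp
  · have := val_evo X.adm_W u hθ0 hx.1 (-k) ht.1
    rwa [hu.conj, X.μ_neg] at this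
  · have := val_evo X.adm_W u hθ0 hx.1 k ht.1
    simp only
    rw [this, map_add]
    congr 1
    rw [conj_intervalIntegral]
    refine intervalIntegral.integral_congr fun s _ => ?_
    simp only [map_add, map_mul, map_neg, Function.comp]
    rfl

/-- Removing the damping. -/
lemma exp_mul_val_eq {u : SqSum ℂ} {x : SqSum L2R} (hx0 : x 0 = 0) {k : ℤ}
    (hx : x k = evo X.adm_W u (X.theta x) x k) {t : ℝ} (ht : t ∈ Icc 0 X.time) :
    Complex.exp (X.M * t) * val X.W x k t = u k + ∫ s in (0 : ℝ)..t,
      X.rhs (fun j => Complex.exp (X.M * s) * val X.W x j s) k := by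
  have hθ0 : X.theta x 0 = 0 := timeSeq_apply_eq_zero _ _ _ hx0
  have ev : ∀ s, val X.W x k s = val X.W (evo X.adm_W u (X.theta x) x) k s := fun s => by
    rw [val, hx]; rfl
  have h1 : ∀ t ∈ Icc 0 X.time, val X.W x k t = u k + ∫ s in (0 : ℝ)..t,
      (-(X.W k).μ * val X.W x k s +
        X.src (fun j => val X.W (X.theta x) j s) (fun j => val X.W x j s) k) := by
    intro t ht
    rw [ev, val_evo X.adm_W u hθ0 hx0 k ht.1]
    simp_rw [← ev]
  -- With the exponent `ν = M` the equation for `e^{Mt} x` has the linear coefficient `μ - M`, which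
  -- is the undamped one.
  have h2 := exp_mul_integral_eq (continuous_val _ _ _)
    (continuous_src_val X.adm_W (X.theta x) x k) (X.M : ℂ) h1 ht
  rw [h2]
  congr 1
  refine intervalIntegral.integral_congr fun s hs => ?_
  rw [uIcc_of_le ht.1] at hs
  have hs' : s ∈ Icc 0 X.time := ⟨hs.1, hs.2.trans ht.2⟩
  have hb : ∀ j, ‖Complex.exp (X.M * s) * val X.W x j s‖ ≤
      ‖Complex.exp (X.M * s)‖ * (evBound X.b * ‖x‖) := fun j => by
    rw [norm_mul]
    refine mul_le_mul_of_nonneg_left ((X.norm_val_W_le x j s).trans ?_) (norm_nonneg _)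
    exact mul_le_mul_of_nonneg_left (norm_apply_le x j) (evBound_nonneg _)
  rw [X.rhs_eq_src hb, X.smul_src]
  have e1 : (fun j => val X.W (X.theta x) j s) = fun j => Complex.exp (X.M * s) * val X.W x j s :=
    funext fun j => X.val_theta x j hs'
  have e2 : (X.W k).μ = Complex.I * dispSymbol X.α k + (X.M + X.a k k) := by
    have : X.a k k = ((X.a k k).re : ℂ) := by
      apply Complex.ext <;> simp [X.diag_im k]
    rw [Wgt.μ, this]
    show Complex.I * (dispSymbol X.α k : ℂ) + ((X.M + (X.a k k).re : ℝ) : ℂ) = _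
    push_cast
    simp
  rw [e1, e2]
  ring

/-! #### Comparison with the weights of `Z^b` -/

/-- The comparison constant of the widths. -/
def cmp : ℝ := X.M + X.C + 2 / X.c

lemma one_le_cmp : 1 ≤ X.cmp := by
  have := X.hM
  have := X.hC
  have : 0 ≤ 2 / X.c := div_nonneg zero_le_two X.hc.le
  unfold cmp; linarith

lemma lam_le (k : ℤ) : (X.W k).lam ≤ X.cmp * (X.W₀ k).lam := by
  have h1 : (X.a k k).re ≤ X.C * (X.W₀ k).lam := by
    refine (Complex.re_le_norm _).trans ((X.norm_le k k).trans ?_)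
    simp only [sub_self, abs_zero, add_zero, Real.one_rpow, mul_one]
    exact mul_le_mul_of_nonneg_left (X.abs_rpow_le_lam k) X.hC
  have h2 := X.one_le_lam k
  have h3 : X.M ≤ X.M * (X.W₀ k).lam := le_mul_of_one_le_right X.M_pos.le h2
  have h4 : 0 ≤ 2 / X.c * (X.W₀ k).lam :=
    mul_nonneg (div_nonneg zero_le_two X.hc.le) (by linarith)
  show X.M + (X.a k k).re ≤ _
  rw [cmp, add_mul, add_mul]
  linarith

lemma lam₀_le (k : ℤ) : (X.W₀ k).lam ≤ X.cmp * (X.W k).lam := by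
  have hM := X.M_le k
  have hlam := (X.W k).hlam
  rcases eq_or_ne k 0 with rfl | hk
  · have : (X.W₀ 0).lam = 1 := by
      show bracket ((0 : ℤ) : ℝ) ^ X.β = 1
      simp [bracket]
    rw [this]
    calc (1 : ℝ) ≤ 1 * (X.W 0).lam := by rw [one_mul]; exact X.hM.trans hM
      _ ≤ _ := mul_le_mul_of_nonneg_right X.one_le_cmp hlam.le
  · have h1 : (1 : ℝ) ≤ |(k : ℝ)| := by
      have : (1 : ℤ) ≤ |k| := Int.one_le_abs hk
      exact_mod_cast this
    have h2 : bracket k ≤ √2 * |(k : ℝ)| := by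
      refine Real.sqrt_le_iff.2 ⟨by positivity, ?_⟩
      rw [mul_pow, Real.sq_sqrt zero_le_two, sq_abs]
      nlinarith [sq_abs (k : ℝ)]
    have h3 : bracket k ^ X.β ≤ 2 * |(k : ℝ)| ^ X.β := by
      calc bracket k ^ X.β ≤ (√2 * |(k : ℝ)|) ^ X.β :=
            Real.rpow_le_rpow (bracket_pos _).le h2 X.β_pos.le
        _ = √2 ^ X.β * |(k : ℝ)| ^ X.β := Real.mul_rpow (by positivity) (by positivity)
        _ ≤ √2 ^ (2 : ℝ) * |(k : ℝ)| ^ X.β := by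
            refine mul_le_mul_of_nonneg_right ?_ (by positivity)
            exact Real.rpow_le_rpow_of_exponent_le (Real.one_le_sqrt.2 one_le_two) X.β_le
        _ = _ := by norm_num
    have hc := X.hc
    calc bracket k ^ X.β ≤ 2 / X.c * (X.c * |(k : ℝ)| ^ X.β) := by
          refine h3.trans_eq ?_
          field_simp
      _ ≤ 2 / X.c * (X.W k).lam := mul_le_mul_of_nonneg_left (X.rpow_le_lam k) (by positivity)
      _ ≤ _ := by
          refine mul_le_mul_of_nonneg_right ?_ hlam.le
          have := X.M_pos
          have := X.hC
          unfold cmp; linarith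

/-- The comparison constant of the weights. -/
def cmpW : ℝ := √X.cmp * X.cmp ^ X.b

lemma cmpW_nonneg : 0 ≤ X.cmpW :=
  mul_nonneg (Real.sqrt_nonneg _) (Real.rpow_nonneg (zero_le_one.trans X.one_le_cmp) _)

/-- The constant depends on `M`. This is harmless, since the comparison of the weights only serves
after `M` has been fixed and does not enter the contraction. -/
lemma compat_W_W₀ (k : ℤ) : TimeCompat (X.W k) (X.W₀ k) X.cmpW X.M :=
  ⟨X.M_pos, X.M_le k, X.cmpW_nonneg, fun τ => wt_le_of_comparable (X.W k).hlam (X.W₀ k).hlam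
    (X.W k).b_nonneg X.one_le_cmp (X.lam₀_le k) (X.lam_le k) τ⟩

lemma compat_W₀_W (k : ℤ) : TimeCompat (X.W₀ k) (X.W k) X.cmpW 1 :=
  ⟨one_pos, X.one_le_lam k, X.cmpW_nonneg, fun τ => wt_le_of_comparable (X.W₀ k).hlam (X.W k).hlam
    (X.W k).b_nonneg X.one_le_cmp (X.lam_le k) (X.lam₀_le k) τ⟩

/-- The solution, in the weights of `Z^b`. -/
def undamp : SqSum L2R →L[ℂ] SqSum L2R := timeSeq expMult X.W_b X.compat_W_W₀

lemma val_undamp (x : SqSum L2R) (k : ℤ) {t : ℝ} (ht : t ∈ Icc 0 X.time) :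
    val X.W₀ (X.undamp x) k t = Complex.exp (X.M * t) * val X.W x k t := by
  rw [undamp, val_timeSeq, expMult_eq (X.abs_mul_time_le ht)]
  push_cast; rfl

lemma ev_undamp (x : SqSum L2R) {t : ℝ} (ht : t ∈ Icc 0 X.time) :
    X.ev t (X.undamp x) = Complex.exp (X.M * t) • evSeq X.W X.W_b t x :=
  lp.ext (funext fun k => X.val_undamp x k ht)

lemma norm_exp_le {t : ℝ} (ht : t ∈ Icc 0 X.time) : ‖Complex.exp (X.M * t)‖ ≤ Real.exp 1 := by
  rw [Complex.norm_exp]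
  refine Real.exp_le_exp.2 ?_
  have := (le_abs_self _).trans (X.abs_mul_time_le ht)
  simpa using this

/-! #### Local solutions -/

/-- The constant of the free evolution. -/
def dataConst (b : ℝ) : ℝ := 4 * bracketNorm (b - 2)

variable {X} in
lemma Small.norm_dataOp_le {R : ℝ} (hs : X.Small (dataConst X.b * R)) {u : SqSum ℂ} (hu : ‖u‖ ≤ R) :
    ‖X.dataOp u‖ ≤ hs.quad.r / 2 := by
  refine (X.norm_dataOp_le u).trans ?_
  show _ ≤ dataConst X.b * R / 2
  have : 0 ≤ bracketNorm (X.b - 2) := Real.sqrt_nonneg _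
  rw [dataConst]
  calc _ ≤ 2 * bracketNorm (X.b - 2) * R := by gcongr
    _ = _ := by ring

variable {X} in
/-- Energy bound for a truncated solution. -/
lemma Small.norm_truncated_le {u : SqSum ℂ} {s : Finset ℤ} {y : SqSum L2R} (hy : y ∈ X.realSet)
    (hfy : y = trunc (s : Set ℤ) (evo X.adm_W u (X.theta y) y)) {t : ℝ} (ht : t ∈ Icc 0 X.time) :
    ‖Complex.exp (X.M * t) • evSeq X.W X.W_b t y‖ ≤ ‖u‖ := by
  have hzero : ∀ k ∉ s, ∀ t : ℝ, Complex.exp (X.M * t) * val X.W y k t = 0 := fun k hk t => by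
    rw [val, hfy, trunc_apply_not_mem (by exact_mod_cast hk), map_zero, mul_zero]
  have h := X.energy_le (T := X.time) (u := u)
    (Y := fun k t => Complex.exp (X.M * t) * val X.W y k t) s hzero
    (fun k => (by fun_prop : Continuous fun t : ℝ => Complex.exp (X.M * t)).mul
      (continuous_val X.W y k))
    (fun t ht k => by
      rw [hy.2 k t ht, map_mul, ← Complex.exp_conj]
      simp)
    (fun k hk t ht => X.exp_mul_val_eq hy.1 (by
      conv_lhs => rw [hfy]
      exact trunc_apply_mem (by exact_mod_cast hk) _) ht) ht
  refine le_of_sq_le_sq ?_ (norm_nonneg _)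
  rw [norm_sq_sqSum, norm_sq_sqSum, tsum_eq_sum (s := s)]
  · exact h.trans ((summable_norm_sq u).sum_le_tsum s fun k _ => sq_nonneg _)
  · intro k hk
    have := hzero k hk t
    rw [lp.coeFn_smul, Pi.smul_apply, evSeq_apply, smul_eq_mul, this]
    simp

variable {X} in
/-- Local well-posedness for data of a given size. -/
theorem Small.exists_local {R : ℝ} (hs : X.Small (dataConst X.b * R)) :
    ∃ F : SqSum ℂ → SqSum L2R,
      (∀ u, RealSeq u → ‖u‖ ≤ R → X.Sol X.time u (F u) ∧ ∀ t ∈ Icc 0 X.time,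
        RealSeq (X.ev t (F u)) ∧ ‖X.ev t (F u)‖ ≤ ‖u‖) ∧
      ∀ u v, RealSeq u → RealSeq v → ‖u‖ ≤ R → ‖v‖ ≤ R → ∀ t ∈ Icc 0 X.time,
        ‖X.ev t (F u) - X.ev t (F v)‖ ≤
          Real.exp 1 * evBound X.b * dataConst X.b * ‖u - v‖ := by
  have hex : ∀ u : SqSum ℂ, RealSeq u → ‖u‖ ≤ R → ∃ x ∈ X.realSet, ‖x‖ ≤ hs.quad.r ∧
      x = evo X.adm_W u (X.theta x) x := fun u hu huR => by
    obtain ⟨x, h1, h2, h3⟩ := hs.quad.exists_fixed (P := ContinuousLinearMap.id ℂ _)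
      (fun x => le_rfl) (hs.norm_dataOp_le huR) X.isClosed_realSet X.zero_mem_realSet
      (fun x hx => X.evo_mem_realSet hu hx)
    exact ⟨x, h1, h2, h3⟩
  choose! x hx1 hx2 hx3 using hex
  refine ⟨fun u => X.undamp (x u), fun u hu huR => ⟨⟨?_, fun k t ht => ?_⟩, fun t ht => ⟨⟨?_, ?_⟩, ?_⟩⟩,
    fun u v hu hv huR hvR t ht => ?_⟩
  · exact timeSeq_apply_eq_zero _ _ _ (hx1 u hu huR).1
  · rw [X.val_undamp _ _ ht, X.exp_mul_val_eq (hx1 u hu huR).1 (by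
      conv_lhs => rw [hx3 u hu huR]) ht]
    congr 1
    refine intervalIntegral.integral_congr fun s hs => ?_
    rw [uIcc_of_le ht.1] at hs
    simp only [X.val_undamp _ _ ⟨hs.1, hs.2.trans ht.2⟩]
  · exact val_eq_zero _ (timeSeq_apply_eq_zero _ _ _ (hx1 u hu huR).1) t
  · intro k
    rw [Exps.ev_apply, Exps.ev_apply, X.val_undamp _ _ ht, X.val_undamp _ _ ht,
      (hx1 u hu huR).2 k t ht, map_mul, ← Complex.exp_conj]
    simp
  · rw [X.ev_undamp _ ht]
    -- The energy identity is available for finite sums only. The bound is proved for the fixed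
    -- point `y` of the truncated equation, which is close to `x u` by `dist_projected_le`.
    refine le_of_forall_pos_le_add fun ε hε => ?_
    set c := Real.exp 1 * evBound X.b * 2
    have hc : 0 ≤ c := by have := evBound_nonneg X.b; positivity
    obtain ⟨s, hs1, hs2⟩ := exists_norm_trunc_sub_lt (x u) (ε := ε / (c + 1)) (by positivity)
    obtain ⟨y, hy1, hy2, hy3⟩ := hs.quad.exists_fixed (P := trunc (s : Set ℤ))
      (norm_trunc_le _) (hs.norm_dataOp_le huR) X.isClosed_realSet X.zero_mem_realSet
      (fun x hx => X.trunc_mem_realSet (fun k => by exact_mod_cast hs1 k)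
        (X.evo_mem_realSet hu hx))
    have h1 := hs.quad.dist_projected_le (norm_trunc_le (s : Set ℤ)) (hx2 u hu huR) hy2
      (hx3 u hu huR) hy3
    have h2 := Small.norm_truncated_le hy1 hy3 ht
    have h3 : ‖Complex.exp (X.M * t) • evSeq X.W X.W_b t (x u) -
        Complex.exp (X.M * t) • evSeq X.W X.W_b t y‖ ≤ ε := by
      rw [← smul_sub, ← map_sub, norm_smul]
      calc _ ≤ Real.exp 1 * (evBound X.b * ‖x u - y‖) := by
            refine mul_le_mul (X.norm_exp_le ht) (norm_evSeq_le _ _ _ _) (norm_nonneg _)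
              (Real.exp_pos _).le
        _ ≤ Real.exp 1 * (evBound X.b * (2 * (ε / (c + 1)))) := by
            have := evBound_nonneg X.b
            rw [norm_sub_rev]
            gcongr
            exact h1.trans (by gcongr)
        _ = c / (c + 1) * ε := by simp only [c]; ring
        _ ≤ 1 * ε := by
            gcongr
            exact div_le_one_of_le₀ (by linarith) (by positivity)
        _ = ε := one_mul ε
    have h4 := norm_le_norm_add_norm_sub' (Complex.exp (X.M * t) • evSeq X.W X.W_b t (x u))
      (Complex.exp (X.M * t) • evSeq X.W X.W_b t y)
    linarith
  · rw [X.ev_undamp _ ht, X.ev_undamp _ ht, ← smul_sub, ← map_sub, norm_smul]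
    have h1 := hs.quad.dist_fixed_le (P := ContinuousLinearMap.id ℂ _) (fun x => le_rfl)
      (hx2 u hu huR) (hx2 v hv hvR) (hx3 u hu huR) (hx3 v hv hvR)
    rw [← map_sub] at h1
    have h2 := X.norm_dataOp_le (u - v)
    calc _ ≤ Real.exp 1 * (evBound X.b * ‖x u - x v‖) := by
          refine mul_le_mul (X.norm_exp_le ht) (norm_evSeq_le _ _ _ _) (norm_nonneg _)
            (Real.exp_pos _).le
      _ ≤ Real.exp 1 * (evBound X.b * (2 * (2 * bracketNorm (X.b - 2) * ‖u - v‖))) := by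
          have := evBound_nonneg X.b
          gcongr
          exact h1.trans (by gcongr)
      _ = _ := by rw [dataConst]; ring

end Damped

/-! ### Choice of the damping -/

/-- Strongly damped problems exist. -/
lemma Setting.exists_gain_le (S : Setting) {κ : ℝ} (hκ : 0 < κ) :
    ∃ X : Damped, X.toSetting = S ∧ X.gain ≤ κ := by
  have h1 : Filter.Tendsto (fun M : ℝ => (√S.c)⁻¹ * M ^ (-(S.b - 1 / 2))) Filter.atTop
      (nhds ((√S.c)⁻¹ * 0)) := (tendsto_rpow_neg_atTop (by linarith [S.hb])).const_mul _
  rw [mul_zero] at h1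
  obtain ⟨M, hM1, hM2, hM3⟩ := ((h1.eventually (ge_mem_nhds hκ)).and
    ((Filter.eventually_ge_atTop 1).and (Filter.eventually_ge_atTop S.D))).exists
  exact ⟨⟨S, M, hM2, hM3⟩, rfl, hM1⟩

/-- The gain is a constant times `M^{-(b-1/2)}`, so it tends to zero as the damping grows; the
strict inequality `b > 1/2` is essential. -/
lemma Setting.exists_mul_gain_le (S : Setting) (A B : ℝ) :
    ∃ X : Damped, X.toSetting = S ∧ A * X.gain ≤ 1 / 8 ∧ B * X.gain ≤ 1 / 8 := by
  have hκ : 0 < 1 / (8 * (|A| + |B| + 1)) := by positivity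
  obtain ⟨X, hXS, hX⟩ := S.exists_gain_le hκ
  have hg := X.gain_nonneg
  have h1 : (|A| + |B| + 1) * X.gain ≤ 1 / 8 := by
    calc _ ≤ (|A| + |B| + 1) * (1 / (8 * (|A| + |B| + 1))) := by gcongr
      _ = 1 / 8 := by field_simp
  have h2 := mul_le_mul_of_nonneg_right (le_abs_self A) hg
  have h3 := mul_le_mul_of_nonneg_right (le_abs_self B) hg
  have h4 := mul_nonneg (abs_nonneg A) hg
  have h5 := mul_nonneg (abs_nonneg B) hg
  exact ⟨X, hXS, by linarith, by linarith⟩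

lemma Setting.exists_small (S : Setting) {r : ℝ} (hr : 0 ≤ r) :
    ∃ X : Damped, X.toSetting = S ∧ X.Small r := by
  obtain ⟨X, rfl, h1, h2⟩ := S.exists_mul_gain_le S.linConst
    (S.bilConst * timeBound expMult S.b 1 * r)
  refine ⟨X, rfl, hr, h1.trans (by norm_num), ?_⟩
  calc _ = X.bilConst * timeBound expMult X.b 1 * r * X.gain := by ring
    _ ≤ _ := h2

/-! ### Uniqueness -/

namespace Setting

variable (S : Setting)

lemma summable_conv (y z : SqSum ℂ) (k : ℤ) : Summable fun j => y j * z (k - j) :=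
  (summable_mul_sqSum y z k).of_norm_bounded fun _ => (norm_mul _ _).le

lemma tsum_conv_comm (y z : SqSum ℂ) (k : ℤ) :
    ∑' j, y j * z (k - j) = ∑' j, z j * y (k - j) := by
  rw [← (Equiv.subLeft k).tsum_eq]
  refine tsum_congr fun j => ?_
  simp only [Equiv.subLeft_apply, sub_sub_cancel]
  ring

/-- The difference of two solutions solves a linear equation. -/
lemma rhs_sub_rhs (y z : SqSum ℂ) (k : ℤ) :
    S.rhs y k - S.rhs z k = -(Complex.I * dispSymbol S.α k + S.a k k) * (y - z) k +
      S.src (y + z : SqSum ℂ) (y - z : SqSum ℂ) k := by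
  have hb : ∀ w : SqSum ℂ, ∀ j, ‖w j‖ ≤ ‖w‖ := fun w j => norm_apply_le w j
  rw [S.rhs_eq_src (hb y), S.rhs_eq_src (hb z)]
  have hs : ∀ w : SqSum ℂ, Summable fun j => -S.off k j * w j := fun w => by
    refine ((S.summable_coeff k).mul_right ‖w‖).of_norm_bounded fun j => ?_
    rw [norm_mul, norm_neg]
    exact mul_le_mul (S.norm_off_le k j) (hb w j) (norm_nonneg _) (norm_nonneg _)
  have e1 : ∑' j, -S.off k j * (y - z : SqSum ℂ) j =
      ∑' j, -S.off k j * y j - ∑' j, -S.off k j * z j := by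
    rw [← (hs y).tsum_sub (hs z)]
    refine tsum_congr fun j => ?_
    rw [lp.coeFn_sub, Pi.sub_apply, mul_sub]
  -- The identity `y² - z² = (y + z)(y - z)` for convolutions: the mixed terms cancel by
  -- commutativity.
  have e2 : ∑' j, (y + z : SqSum ℂ) j * (y - z : SqSum ℂ) (k - j) =
      ∑' j, y j * y (k - j) - ∑' j, z j * z (k - j) := by
    have h1 := (summable_conv y y k).tsum_sub (summable_conv y z k)
    have h2 := (summable_conv z y k).tsum_sub (summable_conv z z k)
    have h3 := ((summable_conv y y k).sub (summable_conv y z k)).tsum_add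
      ((summable_conv z y k).sub (summable_conv z z k))
    rw [h1, h2, tsum_conv_comm y z, sub_add_sub_cancel] at h3
    rw [← h3]
    refine tsum_congr fun j => ?_
    rw [lp.coeFn_sub, lp.coeFn_add, Pi.sub_apply, Pi.add_apply]
    ring
  simp only [src, tsum_mul_left, e1, e2]
  rw [lp.coeFn_sub, Pi.sub_apply]
  ring

lemma continuous_src_val₀ (z x : SqSum L2R) (k : ℤ) :
    Continuous fun t => S.src (fun j => val S.W₀ z j t) (fun j => val S.W₀ x j t) k :=
  S.continuous_src (continuous_val _ z) (continuous_val _ x) (evBound_nonneg S.b)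
    (fun k t => norm_val_le S.W₀_b z k t) (fun k t => norm_val_le S.W₀_b x k t) k

lemma continuous_rhs_val (h : SqSum L2R) (k : ℤ) :
    Continuous fun t => S.rhs (fun j => val S.W₀ h j t) k := by
  have e : ∀ t, S.rhs (fun j => val S.W₀ h j t) k = _ := fun t =>
    S.rhs_eq_src (B := evBound S.b * ‖h‖) (fun j => (norm_val_le S.W₀_b h j t).trans
      (mul_le_mul_of_nonneg_left (norm_apply_le h j) (evBound_nonneg _))) k
  simp_rw [e]
  have h1 := continuous_val S.W₀ h k
  exact ((continuous_const.mul h1).sub (continuous_const.mul h1)).add (S.continuous_src_val₀ h h k)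

end Setting

namespace Damped

variable {X : Damped}

lemma norm_evo_zero_le {U : ℤ → Wgt} (hU : X.Adm U) {z : SqSum L2R}
    (h1 : X.linConst * X.gain ≤ 1 / 4) (h2 : X.bilConst * X.gain * ‖z‖ ≤ 1 / 4) (x : SqSum L2R) :
    ‖evo hU 0 z x‖ ≤ 1 / 2 * ‖x‖ := by
  rw [evo, map_zero, zero_add]
  refine (norm_add_le _ _).trans ?_
  have h3 := X.linFam.norm_op_le x
  rw [X.linFam_B_eq] at h3
  have h4 := norm_bilFam_le hU z x
  have h5 := mul_le_mul_of_nonneg_right h1 (norm_nonneg x)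
  have h6 := mul_le_mul_of_nonneg_right h2 (norm_nonneg x)
  linarith

end Damped

/-- Solutions of the Fourier system in `Z^b_T` are unique. -/
theorem Setting.Sol.unique {S : Setting} {T : ℝ} {u : ℤ → ℂ} {h h' : SqSum L2R}
    (H : S.Sol T u h) (H' : S.Sol T u h') :
    ∀ k, ∀ t ∈ Icc 0 T, val S.W₀ h k t = val S.W₀ h' k t := by
  set z := h + h' with hz
  -- The damping is chosen after the two solutions, so that the linear map with coefficient `z` is a
  -- contraction. Hence no smallness of `T` is needed.
  obtain ⟨X, rfl, hX1, hX2⟩ := S.exists_mul_gain_le S.linConst (S.bilConst * ‖z‖)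
  set d := h - h' with hd
  have hz0 : z 0 = 0 := by rw [hz, lp.coeFn_add, Pi.add_apply, H.zero, H'.zero, add_zero]
  have hd0 : d 0 = 0 := by rw [hd, lp.coeFn_sub, Pi.sub_apply, H.zero, H'.zero, sub_zero]
  obtain ⟨K, hK⟩ := exists_timeMult (f := fun t : ℝ => Complex.exp (((-X.M : ℝ) : ℂ) * t))
    (Complex.contDiff_exp.comp (contDiff_const.mul Complex.ofRealCLM.contDiff)) T
  -- the linear equation of the difference
  have hlin : ∀ k, ∀ t ∈ Icc 0 T, val X.W₀ d k t = 0 + ∫ s in (0 : ℝ)..t,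
      (-(Complex.I * dispSymbol X.α k + X.a k k) * val X.W₀ d k s +
        X.src (fun j => val X.W₀ z j s) (fun j => val X.W₀ d j s) k) := by
    intro k t ht
    rw [hd, val_sub, H.solves k t ht, H'.solves k t ht, add_sub_add_left_eq_sub, zero_add,
      ← intervalIntegral.integral_sub ((X.continuous_rhs_val h k).intervalIntegrable _ _)
        ((X.continuous_rhs_val h' k).intervalIntegrable _ _)]
    refine intervalIntegral.integral_congr fun s _ => ?_
    have := X.rhs_sub_rhs (X.ev s h) (X.ev s h') k
    rw [← map_sub, ← map_add] at this
    exact this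
  -- Whatever the extension `x` of the damped difference outside `[0,T]`, the Duhamel map yields
  -- another extension of the same function, since each scalar equation has one solution.
  have step : ∀ x : SqSum L2R, x 0 = 0 →
      (∀ k, ∀ t ∈ Icc 0 T, val X.W x k t = Complex.exp (((-X.M : ℝ) : ℂ) * t) * val X.W₀ d k t) →
      ∀ k, ∀ t ∈ Icc 0 T, val X.W (Damped.evo X.adm_W₀ 0 z x) k t =
        Complex.exp (((-X.M : ℝ) : ℂ) * t) * val X.W₀ d k t := by
    intro x hx0 hx k
    have eμ : (X.W k).μ = Complex.I * dispSymbol X.α k + X.a k k - ((-X.M : ℝ) : ℂ) := by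
      have : X.a k k = ((X.a k k).re : ℂ) := by
        apply Complex.ext <;> simp [X.diag_im k]
      rw [Wgt.μ, this]
      show Complex.I * (dispSymbol X.α k : ℂ) + ((X.M + (X.a k k).re : ℝ) : ℂ) = _
      push_cast
      simp
      ring
    refine eq_of_integral_eq (u := 0) (μ := (X.W k).μ)
      (G := fun s => X.src (fun j => val X.W₀ z j s) (fun j => val X.W x j s) k)
      (G' := fun s => Complex.exp (((-X.M : ℝ) : ℂ) * s) *
        X.src (fun j => val X.W₀ z j s) (fun j => val X.W₀ d j s) k)
      (continuous_val _ _ _) ((by fun_prop : Continuous fun t : ℝ =>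
        Complex.exp (((-X.M : ℝ) : ℂ) * t)).mul (continuous_val _ _ _))
      (Damped.continuous_src_val X.adm_W₀ z x k) ((by fun_prop : Continuous fun t : ℝ =>
        Complex.exp (((-X.M : ℝ) : ℂ) * t)).mul (X.continuous_src_val₀ z d k))
      (fun t ht => ?_) (fun t ht => ?_) (fun t ht => ?_)
    · rw [X.smul_src]
      congr 1
      exact funext fun j => hx j t ht
    · exact Damped.val_evo X.adm_W₀ 0 hz0 hx0 k ht.1
    · rw [eμ]
      exact exp_mul_integral_eq (continuous_val _ _ _) (X.continuous_src_val₀ z d k) _ (hlin k) ht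
  -- Iteration produces extensions of arbitrarily small norm, and the norm controls the values on
  -- `[0,T]`.
  have hn : ∀ n : ℕ, ∃ x : SqSum L2R, x 0 = 0 ∧
      ‖x‖ ≤ (1 / 2) ^ n * ‖timeSeq K X.W₀_b X.compat_W₀_W d‖ ∧
      ∀ k, ∀ t ∈ Icc 0 T, val X.W x k t = Complex.exp (((-X.M : ℝ) : ℂ) * t) * val X.W₀ d k t := by
    intro n
    induction n with
    | zero =>
      refine ⟨timeSeq K X.W₀_b X.compat_W₀_W d, timeSeq_apply_eq_zero _ _ _ hd0, by simp,
        fun k t ht => ?_⟩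
      rw [val_timeSeq, one_mul, hK t (by rw [abs_of_nonneg ht.1]; exact ht.2)]
    | succ n ih =>
      obtain ⟨x, hx0, hxn, hx⟩ := ih
      refine ⟨Damped.evo X.adm_W₀ 0 z x, Damped.evo_zero _ rfl _ _, ?_, step x hx0 hx⟩
      refine (Damped.norm_evo_zero_le X.adm_W₀ (hX1.trans (by norm_num)) ?_ x).trans ?_
      · calc _ = X.bilConst * ‖z‖ * X.gain := by ring
          _ ≤ 1 / 4 := hX2.trans (by norm_num)
      · rw [pow_succ']
        linarith
  intro k t ht
  have hzero : Complex.exp (((-X.M : ℝ) : ℂ) * t) * val X.W₀ d k t = 0 := by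
    have hle : ∀ n : ℕ, ‖Complex.exp (((-X.M : ℝ) : ℂ) * t) * val X.W₀ d k t‖ ≤
        evBound X.b * ((1 / 2) ^ n * ‖timeSeq K X.W₀_b X.compat_W₀_W d‖) := fun n => by
      obtain ⟨x, -, hxn, hx⟩ := hn n
      rw [← hx k t ht]
      exact (X.norm_val_W_le x k t).trans (mul_le_mul_of_nonneg_left
        ((norm_apply_le x k).trans hxn) (evBound_nonneg _))
    have hlim : Filter.Tendsto (fun n : ℕ => evBound X.b *
        ((1 / 2 : ℝ) ^ n * ‖timeSeq K X.W₀_b X.compat_W₀_W d‖)) Filter.atTop (nhds 0) := by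
      have := ((tendsto_pow_atTop_nhds_zero_of_lt_one (r := (1 / 2 : ℝ)) (by norm_num)
        (by norm_num)).mul_const ‖timeSeq K X.W₀_b X.compat_W₀_W d‖).const_mul (evBound X.b)
      simpa using this
    exact norm_le_zero_iff.1 (ge_of_tendsto' hlim hle)
  have := (mul_eq_zero.1 hzero).resolve_left (Complex.exp_ne_zero _)
  rwa [hd, val_sub, sub_eq_zero] at this

/-! ### Continuation of solutions -/

/-- Translation in time, for sequences. -/
def shiftSeq (s : ℝ) : SqSum L2R →L[ℂ] SqSum L2R :=
  diagOp (fun _ => Wgt.shiftOp s) 1 zero_le_one fun _ v =>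
    (Wgt.norm_shiftOp_le s v).trans_eq (one_mul _).symm

lemma val_shiftSeq (U : ℤ → Wgt) (s : ℝ) (h : SqSum L2R) (k : ℤ) (t : ℝ) :
    val U (shiftSeq s h) k t = val U h k (t + s) := (U k).ev_shiftOp s t (h k)

lemma shiftSeq_apply_eq_zero (s : ℝ) {h : SqSum L2R} {k : ℤ} (hk : h k = 0) :
    shiftSeq s h k = 0 := by
  rw [shiftSeq, diagOp_apply, hk, map_zero]

namespace Setting

variable {S : Setting}

namespace Sol

variable {T : ℝ} {u : ℤ → ℂ} {h : SqSum L2R}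

lemma mono (H : S.Sol T u h) {T' : ℝ} (hT : T' ≤ T) : S.Sol T' u h :=
  ⟨H.zero, fun k t ht => H.solves k t ⟨ht.1, ht.2.trans hT⟩⟩

lemma ev_congr {t t' : ℝ} {h' : SqSum L2R} (e : ∀ k, val S.W₀ h k t = val S.W₀ h' k t') :
    S.ev t h = S.ev t' h' :=
  lp.ext (funext e)

lemma ev_zero {u : SqSum ℂ} (H : S.Sol T u h) (hT : 0 ≤ T) : S.ev 0 h = u := by
  refine lp.ext (funext fun k => ?_)
  rw [Exps.ev_apply, H.solves k 0 ⟨le_rfl, hT⟩, intervalIntegral.integral_same, add_zero]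

lemma shift (H : S.Sol T u h) {s : ℝ} (hs : s ∈ Icc 0 T) :
    S.Sol (T - s) (S.ev s h) (shiftSeq s h) := by
  refine ⟨shiftSeq_apply_eq_zero s H.zero, fun k t ht => ?_⟩
  have hi : ∀ a b, IntervalIntegrable (fun t => S.rhs (fun j => val S.W₀ h j t) k) volume a b :=
    fun a b => (S.continuous_rhs_val h k).intervalIntegrable _ _
  have e := intervalIntegral.integral_comp_add_right (a := 0) (b := t)
    (fun t => S.rhs (fun j => val S.W₀ h j t) k) s
  rw [zero_add] at e
  simp_rw [val_shiftSeq]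
  rw [e, Exps.ev_apply, H.solves k s hs, H.solves k (t + s) ⟨by linarith [hs.1, ht.1], by
    linarith [ht.2]⟩, add_assoc, intervalIntegral.integral_add_adjacent_intervals (hi _ _) (hi _ _)]

lemma compat_self (S : Setting) (k : ℤ) : TimeCompat (S.W₀ k) (S.W₀ k) 1 1 :=
  ⟨one_pos, S.one_le_lam k, zero_le_one, fun _ => (one_mul _).ge⟩

/-- Gluing of two solutions on overlapping intervals. -/
lemma glue (H : S.Sol T u h) {s τ : ℝ} (hs : 0 ≤ s) (hsT : s < T) (hτ : T ≤ s + τ)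
    {h' : SqSum L2R} (H' : S.Sol τ (S.ev s h) h') :
    ∃ g, S.Sol (s + τ) u g ∧ (∀ t ∈ Icc 0 T, S.ev t g = S.ev t h) ∧
      ∀ t ∈ Icc s (s + τ), S.ev t g = S.ev (t - s) h' := by
  -- A smooth cutoff, one up to time `s` and zero from time `T` on. The transition takes place on
  -- the overlap of the two intervals.
  set f : ℝ → ℝ := fun t => Real.smoothTransition ((T - t) / (T - s)) with hf
  have hTs : 0 < T - s := sub_pos.2 hsT
  have hfc : ContDiff ℝ ∞ f := Real.smoothTransition.contDiff.comp
    ((contDiff_const.sub contDiff_id).div_const _)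
  have hfC : ContDiff ℝ ∞ fun t => (f t : ℂ) := Complex.ofRealCLM.contDiff.comp hfc
  have f1 : ∀ t ≤ s, f t = 1 := fun t ht => Real.smoothTransition.one_of_one_le (by
    rw [one_le_div hTs]; linarith)
  have f0 : ∀ t, T ≤ t → f t = 0 := fun t ht => Real.smoothTransition.zero_of_nonpos
    (div_nonpos_of_nonpos_of_nonneg (by linarith) hTs.le)
  obtain ⟨K₁, hK₁⟩ := exists_timeMult hfC (s + τ)
  obtain ⟨K₂, hK₂⟩ := exists_timeMult (f := fun t => 1 - (f t : ℂ)) (contDiff_const.sub hfC) (s + τ)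
  set g := timeSeq K₁ S.W₀_b (compat_self S) h +
    timeSeq K₂ S.W₀_b (compat_self S) (shiftSeq (-s) h') with hg
  have hval : ∀ k, ∀ t ∈ Icc 0 (s + τ), val S.W₀ g k t =
      f t * val S.W₀ h k t + (1 - f t) * val S.W₀ h' k (t - s) := by
    intro k t ht
    have habs : |t| ≤ s + τ := by rw [abs_of_nonneg ht.1]; exact ht.2
    rw [hg, val_add, val_timeSeq, val_timeSeq, val_shiftSeq, one_mul, hK₁ t habs, hK₂ t habs,
      sub_eq_add_neg t s]
  -- On the overlap both functions solve the problem with the same data at time `s`; by uniqueness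
  -- they agree, so the combination with weights `f` and `1 - f` equals each of them.
  have hover : ∀ k, ∀ t ∈ Icc s T, val S.W₀ h k t = val S.W₀ h' k (t - s) := by
    intro k t ht
    have := (H.shift ⟨hs, hsT.le⟩).unique (H'.mono (by linarith)) k (t - s)
      ⟨by linarith [ht.1], by linarith [ht.2]⟩
    rwa [val_shiftSeq, sub_add_cancel] at this
  have hA : ∀ k, ∀ t ∈ Icc 0 T, val S.W₀ g k t = val S.W₀ h k t := by
    intro k t ht
    rw [hval k t ⟨ht.1, ht.2.trans hτ⟩]
    rcases le_total t s with h1 | h1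
    · rw [f1 t h1]; simp
    · rw [← hover k t ⟨h1, ht.2⟩]; ring
  have hB : ∀ k, ∀ t ∈ Icc s (s + τ), val S.W₀ g k t = val S.W₀ h' k (t - s) := by
    intro k t ht
    rw [hval k t ⟨hs.trans ht.1, ht.2⟩]
    rcases le_total t T with h1 | h1
    · rw [← hover k t ⟨ht.1, h1⟩]; ring
    · rw [f0 t h1]; simp
  refine ⟨g, ⟨?_, fun k t ht => ?_⟩, fun t ht => ev_congr fun k => hA k t ht,
    fun t ht => ev_congr fun k => hB k t ht⟩
  · rw [hg, lp.coeFn_add, Pi.add_apply, timeSeq_apply_eq_zero _ _ _ H.zero,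
      timeSeq_apply_eq_zero _ _ _ (shiftSeq_apply_eq_zero _ H'.zero), add_zero]
  have hi : ∀ a b, IntervalIntegrable (fun t => S.rhs (fun j => val S.W₀ g j t) k) volume a b :=
    fun a b => (S.continuous_rhs_val g k).intervalIntegrable _ _
  have hC : ∀ t ∈ Icc 0 T, val S.W₀ g k t =
      u k + ∫ s in (0 : ℝ)..t, S.rhs (fun j => val S.W₀ g j s) k := by
    intro t ht
    rw [hA k t ht, H.solves k t ht]
    congr 1
    refine intervalIntegral.integral_congr fun r hr => ?_
    rw [uIcc_of_le ht.1] at hr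
    simp only [fun j => hA j r ⟨hr.1, hr.2.trans ht.2⟩]
  rcases le_total t s with h1 | h1
  · exact hC t ⟨ht.1, h1.trans hsT.le⟩
  · rw [hB k t ⟨h1, ht.2⟩, H'.solves k (t - s) ⟨by linarith, by linarith [ht.2]⟩, Exps.ev_apply,
      ← hA k s ⟨hs, hsT.le⟩, hC s ⟨hs, hsT.le⟩, add_assoc,
      ← intervalIntegral.integral_add_adjacent_intervals (hi 0 s) (hi s t)]
    congr 2
    have e := intervalIntegral.integral_comp_add_right (a := 0) (b := t - s)
      (fun t => S.rhs (fun j => val S.W₀ g j t) k) s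
    rw [zero_add, sub_add_cancel] at e
    rw [← e]
    refine intervalIntegral.integral_congr fun r hr => ?_
    rw [uIcc_of_le (by linarith)] at hr
    simp only [fun j => hB j (r + s) ⟨by linarith [hr.1], by linarith [hr.2, ht.2]⟩,
      add_sub_cancel_right]

end Sol

variable (S)

lemma exists_local {R : ℝ} (hR : 0 ≤ R) :
    ∃ δ : ℝ, 0 < δ ∧ ∃ L : ℝ, 1 ≤ L ∧ ∃ F : SqSum ℂ → SqSum L2R,
      (∀ u, RealSeq u → ‖u‖ ≤ R → S.Sol δ u (F u) ∧ ∀ t ∈ Icc 0 δ,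
        RealSeq (S.ev t (F u)) ∧ ‖S.ev t (F u)‖ ≤ ‖u‖) ∧
      ∀ u v, RealSeq u → RealSeq v → ‖u‖ ≤ R → ‖v‖ ≤ R → ∀ t ∈ Icc 0 δ,
        ‖S.ev t (F u) - S.ev t (F v)‖ ≤ L * ‖u - v‖ := by
  have h0 : 0 ≤ Damped.dataConst S.b * R :=
    mul_nonneg (mul_nonneg (by norm_num) (Real.sqrt_nonneg _)) hR
  obtain ⟨X, rfl, hX⟩ := S.exists_small h0
  obtain ⟨F, hF1, hF2⟩ := hX.exists_local
  refine ⟨X.time, X.time_pos, _, le_max_right _ 1, F, hF1, fun u v hu hv huR hvR t ht =>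
    (hF2 u v hu hv huR hvR t ht).trans (mul_le_mul_of_nonneg_right (le_max_left _ _)
      (norm_nonneg _))⟩

/-- Global solutions. -/
theorem exists_global {u : SqSum ℂ} (hu : RealSeq u) (T : ℝ) :
    ∃ h, S.Sol T u h ∧ ∀ t ∈ Icc 0 T, RealSeq (S.ev t h) ∧ ‖S.ev t h‖ ≤ ‖u‖ := by
  obtain ⟨δ, hδ, L, -, F, hF, -⟩ := S.exists_local (norm_nonneg u)
  -- Each step restarts half a local time before the end, so consecutive intervals overlap by `δ/2`.
  -- The same `δ` serves every time because the norm does not increase.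
  have key : ∀ n : ℕ, ∃ h, S.Sol (δ + n * (δ / 2)) u h ∧
      ∀ t ∈ Icc 0 (δ + n * (δ / 2)), RealSeq (S.ev t h) ∧ ‖S.ev t h‖ ≤ ‖u‖ := by
    intro n
    induction n with
    | zero =>
      simp only [Nat.cast_zero, zero_mul, add_zero]
      exact ⟨F u, hF u hu le_rfl⟩
    | succ n ih =>
      obtain ⟨h, hsol, hreal⟩ := ih
      set T₁ := δ + n * (δ / 2) with hT₁
      have hn : 0 ≤ (n : ℝ) * (δ / 2) := by positivity
      have hs0 : 0 ≤ T₁ - δ / 2 := by rw [hT₁]; linarith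
      obtain ⟨hr1, hr2⟩ := hreal (T₁ - δ / 2) ⟨hs0, by linarith⟩
      obtain ⟨hF1, hF2⟩ := hF _ hr1 hr2
      obtain ⟨g, hg, hgA, hgB⟩ := hsol.glue hs0 (by linarith) (by linarith) hF1
      have e : T₁ - δ / 2 + δ = δ + ((n + 1 : ℕ) : ℝ) * (δ / 2) := by
        rw [hT₁]; push_cast; ring
      rw [e] at hg hgB
      refine ⟨g, hg, fun t ht => ?_⟩
      rcases le_total t T₁ with h1 | h1
      · rw [hgA t ⟨ht.1, h1⟩]
        exact hreal t ⟨ht.1, h1⟩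
      · rw [hgB t ⟨by linarith, ht.2⟩]
        obtain ⟨h3, h4⟩ := hF2 (t - (T₁ - δ / 2)) ⟨by linarith, by linarith [ht.2]⟩
        exact ⟨h3, h4.trans hr2⟩
  obtain ⟨n, hn⟩ := exists_nat_ge (T / (δ / 2))
  rw [div_le_iff₀ (by positivity)] at hn
  obtain ⟨h, h1, h2⟩ := key n
  exact ⟨h, h1.mono (by linarith), fun t ht => h2 t ⟨ht.1, by linarith [ht.2]⟩⟩

/-- By uniqueness every solution coincides with the constructed one, so the energy bound and reality
hold for all of them. -/
lemma Sol.real_and_norm_le {S : Setting} {T : ℝ} {u : SqSum ℂ} (hu : RealSeq u) {h : SqSum L2R}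
    (H : S.Sol T u h) {t : ℝ} (ht : t ∈ Icc 0 T) : RealSeq (S.ev t h) ∧ ‖S.ev t h‖ ≤ ‖u‖ := by
  obtain ⟨g, hg, hr⟩ := S.exists_global hu T
  rw [Sol.ev_congr fun k => H.unique hg k t ht]
  exact hr t ht

/-- The solution map is Lipschitz on bounded sets. -/
theorem exists_lipschitz {R : ℝ} (hR : 0 ≤ R) (T : ℝ) :
    ∃ L : ℝ, 0 < L ∧ ∀ u v : SqSum ℂ, RealSeq u → RealSeq v → ‖u‖ ≤ R → ‖v‖ ≤ R →
      ∀ h h', S.Sol T u h → S.Sol T v h' → ∀ t ∈ Icc 0 T,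
        ‖S.ev t h - S.ev t h'‖ ≤ L * ‖u - v‖ := by
  obtain ⟨δ, hδ, L, hL, F, hF, hFL⟩ := S.exists_local hR
  obtain ⟨N, hN⟩ := exists_nat_ge (T / δ)
  rw [div_le_iff₀ hδ] at hN
  refine ⟨L ^ N, by positivity, fun u v hu hv huR hvR h h' H H' => ?_⟩
  -- Every interval of length `δ` costs one factor `L`. The local solution map can be used at each
  -- restart because reality and the bound `R` persist.
  have key : ∀ n : ℕ, ∀ t ∈ Icc 0 T, t ≤ n * δ → ‖S.ev t h - S.ev t h'‖ ≤ L ^ n * ‖u - v‖ := by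
    intro n
    induction n with
    | zero =>
      intro t ht htn
      have : t = 0 := le_antisymm (by simpa using htn) ht.1
      subst this
      rw [H.ev_zero ht.2, H'.ev_zero ht.2]
      simp
    | succ n ih =>
      intro t ht htn
      rcases le_total t (n * δ) with h1 | h1
      · refine (ih t ht h1).trans (mul_le_mul_of_nonneg_right ?_ (norm_nonneg _))
        exact pow_le_pow_right₀ hL n.le_succ
      set s : ℝ := n * δ
      have hs : s ∈ Icc 0 T := ⟨by positivity, h1.trans ht.2⟩
      have htδ : t - s ≤ δ := by push_cast at htn; linarith
      obtain ⟨a1, a2⟩ := H.real_and_norm_le hu hs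
      obtain ⟨b1, b2⟩ := H'.real_and_norm_le hv hs
      have e : ∀ {w : SqSum ℂ} {g : SqSum L2R}, S.Sol T w g → RealSeq (S.ev s g) →
          ‖S.ev s g‖ ≤ R → S.ev t g = S.ev (t - s) (F (S.ev s g)) := by
        intro w g Hg hr hb
        have hFs := (hF _ hr hb).1
        refine Sol.ev_congr fun k => ?_
        have := ((Hg.shift hs).mono (min_le_left _ δ)).unique (hFs.mono (min_le_right (T - s) _)) k
          (t - s) ⟨by linarith, le_min (by linarith [ht.2]) htδ⟩
        rwa [val_shiftSeq, sub_add_cancel] at this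
      rw [e H a1 (a2.trans huR), e H' b1 (b2.trans hvR)]
      refine (hFL _ _ a1 b1 (a2.trans huR) (b2.trans hvR) _ ⟨by linarith, htδ⟩).trans ?_
      rw [pow_succ', mul_assoc]
      exact mul_le_mul_of_nonneg_left (ih s hs le_rfl) (by linarith)
  exact fun t ht => key N t ht (ht.2.trans hN)

end Setting

/-! ### Fourier coefficients on the torus -/

lemma integral_fourier (n : ℤ) :
    ∫ x : Torus, (fourier n x : ℂ) = if n = 0 then 2 * (Real.pi : ℂ) else 0 := by
  split_ifs with h
  · subst h
    simp only [fourier_zero, integral_const, Measure.real, AddCircle.measure_univ]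
    rw [ENNReal.toReal_ofReal Real.two_pi_pos.le]
    simp
  · exact integral_eq_zero_of_add_right_eq_neg (μ := volume)
      (fourier_add_half_inv_index h Real.two_pi_pos)

/-- The exponential as an element of `L²`. -/
def expT (k : ℤ) : L2T := ContinuousMap.toLp 2 volume ℂ (fourier k : C(Torus, ℂ))

lemma expT_ae (k : ℤ) : expT k =ᵐ[volume] (fourier k : Torus → ℂ) :=
  ContinuousMap.coeFn_toLp volume _

lemma inner_expT (k : ℤ) (f : L2T) : inner ℂ (expT k) f = fc f k := by
  rw [L2.inner_def, fc]
  refine integral_congr_ae ?_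
  filter_upwards [expT_ae k] with x hx
  rw [hx, RCLike.inner_apply, fourier_neg]

lemma fc_congr_ae {f f' : Torus → ℂ} (h : f =ᵐ[volume] f') (k : ℤ) : fc f k = fc f' k := by
  refine integral_congr_ae ?_
  filter_upwards [h] with x hx
  rw [hx]

lemma fc_fourier (j k : ℤ) : fc (fourier j) k = if j = k then 2 * (Real.pi : ℂ) else 0 := by
  rw [fc]
  simp_rw [← fourier_add, integral_fourier]
  congr 1
  exact propext (by constructor <;> intro h <;> linarith)

/-- The square root of the length of the torus. -/
def rootLen : ℝ := √(2 * Real.pi)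

lemma rootLen_pos : 0 < rootLen := Real.sqrt_pos.2 Real.two_pi_pos

lemma rootLen_sq : (rootLen : ℂ) * rootLen = 2 * Real.pi := by
  rw [← Complex.ofReal_mul, rootLen, Real.mul_self_sqrt Real.two_pi_pos.le]
  push_cast; rfl

lemma rootLen_ne : (rootLen : ℂ) ≠ 0 := by exact_mod_cast rootLen_pos.ne'

/-- The normalised exponentials. -/
def unitExp (k : ℤ) : L2T := (rootLen : ℂ)⁻¹ • expT k

lemma inner_unitExp (k : ℤ) (f : L2T) : inner ℂ (unitExp k) f = (rootLen : ℂ)⁻¹ * fc f k := by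
  rw [unitExp, inner_smul_left, inner_expT, map_inv₀, Complex.conj_ofReal]

lemma orthonormal_unitExp : Orthonormal ℂ unitExp := by
  rw [orthonormal_iff_ite]
  intro i j
  rw [inner_unitExp, unitExp]
  have e : fc ((rootLen : ℂ)⁻¹ • expT j : L2T) i = (rootLen : ℂ)⁻¹ * fc (fourier j) i := by
    rw [← inner_expT, inner_smul_right, inner_expT, fc_congr_ae (expT_ae j)]
  rw [e, fc_fourier]
  by_cases h : i = j
  · rw [if_pos h, if_pos h.symm, ← rootLen_sq]
    have := rootLen_ne
    field_simp
  · rw [if_neg h, if_neg (Ne.symm h), mul_zero, mul_zero]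

lemma span_expT : (Submodule.span ℂ (range expT)).topologicalClosure = ⊤ := by
  have h := (ContinuousMap.toLp_denseRange (p := 2) ℂ (volume : Measure Torus) ℂ
    (by simp)).topologicalClosure_map_submodule
      (span_fourier_closure_eq_top (T := 2 * Real.pi))
  rw [Submodule.map_span] at h
  rw [← h]
  congr 2
  ext x
  simp only [mem_range, mem_image, exists_exists_eq_and]
  rfl

/-- The Hilbert basis of normalised exponentials. -/
def torusBasis : HilbertBasis ℤ ℂ L2T :=
  HilbertBasis.mk orthonormal_unitExp (by
    rw [← span_expT]
    refine Submodule.topologicalClosure_mono (Submodule.span_le.2 ?_)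
    rintro _ ⟨k, rfl⟩
    have : expT k = (rootLen : ℂ) • unitExp k := by
      rw [unitExp, smul_smul, mul_inv_cancel₀ rootLen_ne, one_smul]
    rw [this]
    exact Submodule.smul_mem _ _ (Submodule.subset_span ⟨k, rfl⟩))

lemma torusBasis_apply (k : ℤ) : torusBasis k = unitExp k := by
  rw [torusBasis, HilbertBasis.coe_mk]

/-- The sequence of Fourier coefficients. -/
def coef : L2T →L[ℂ] SqSum ℂ :=
  (rootLen : ℂ) • (torusBasis.repr.toContinuousLinearEquiv : L2T →L[ℂ] SqSum ℂ)

lemma coef_eq (f : L2T) : coef f = (rootLen : ℂ) • torusBasis.repr f := rfl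

lemma coef_apply (f : L2T) (k : ℤ) : coef f k = fc f k := by
  rw [coef_eq, lp.coeFn_smul, Pi.smul_apply, torusBasis.repr_apply_apply, torusBasis_apply,
    inner_unitExp, smul_eq_mul, mul_inv_cancel_left₀ rootLen_ne]

lemma norm_coef (f : L2T) : ‖coef f‖ = rootLen * ‖f‖ := by
  rw [coef_eq, norm_smul, LinearIsometryEquiv.norm_map, Complex.norm_real,
    Real.norm_of_nonneg rootLen_pos.le]

/-- The function with given Fourier coefficients. -/
def synth : SqSum ℂ →L[ℂ] L2T :=
  (rootLen : ℂ)⁻¹ • (torusBasis.repr.symm.toContinuousLinearEquiv : SqSum ℂ →L[ℂ] L2T)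

lemma synth_eq (a : SqSum ℂ) : synth a = (rootLen : ℂ)⁻¹ • torusBasis.repr.symm a := rfl

lemma coef_synth (a : SqSum ℂ) : coef (synth a) = a := by
  rw [synth_eq, map_smul, coef_eq, LinearIsometryEquiv.apply_symm_apply, smul_smul,
    inv_mul_cancel₀ rootLen_ne, one_smul]

lemma norm_synth (a : SqSum ℂ) : ‖synth a‖ = rootLen⁻¹ * ‖a‖ := by
  rw [synth_eq, norm_smul, LinearIsometryEquiv.norm_map, norm_inv, Complex.norm_real,
    Real.norm_of_nonneg rootLen_pos.le]

lemma coef_injective : Function.Injective coef := fun f f' h => by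
  rw [← sub_eq_zero, ← map_sub, ← norm_eq_zero, norm_coef] at h
  exact sub_eq_zero.1 (norm_eq_zero.1 ((mul_eq_zero.1 h).resolve_left rootLen_pos.ne'))

lemma synth_coef (f : L2T) : synth (coef f) = f := coef_injective (coef_synth _)

lemma integrable_L2T (f : L2T) : Integrable f volume := (Lp.memLp f).integrable one_le_two

lemma integrable_sq_L2T (f : L2T) : Integrable (fun x => f x ^ 2) volume := by
  have := (Lp.memLp f).integrable_mul (Lp.memLp f)
  refine this.congr (ae_of_all _ fun x => ?_)
  simp [sq]

lemma norm_fourier_apply (k : ℤ) (x : Torus) : ‖(fourier k x : ℂ)‖ = 1 := by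
  rw [fourier_apply, Circle.norm_coe]

/-- The Fourier coefficients of a square. -/
lemma fc_sq (f : L2T) (k : ℤ) :
    fc (fun x => f x ^ 2) k = (2 * Real.pi : ℂ)⁻¹ * ∑' j, fc f j * fc f (k - j) := by
  -- Parseval's identity is applied to `f` and `f̄ e_k`, both square integrable; their inner product
  -- is the `k`-th coefficient of `f²`.
  have hg : MemLp (fun x => starRingEnd ℂ (f x) * fourier k x) 2 volume := by
    refine (Lp.memLp f).of_le ?_ (ae_of_all _ fun x => ?_)
    · exact (Complex.continuous_conj.comp_aestronglyMeasurable (Lp.aestronglyMeasurable f)).mul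
        (map_continuous (fourier k)).aestronglyMeasurable
    · rw [norm_mul, norm_fourier_apply, mul_one, RCLike.norm_conj]
  have h1 : fc (fun x => f x ^ 2) k = inner ℂ (hg.toLp _) f := by
    rw [L2.inner_def, fc]
    refine integral_congr_ae ?_
    filter_upwards [hg.coeFn_toLp] with x hx
    rw [hx, RCLike.inner_apply, fourier_neg, map_mul, Complex.conj_conj]
    ring
  have h2 : ∀ j, inner ℂ (hg.toLp _) (unitExp j) = (rootLen : ℂ)⁻¹ * fc f (k - j) := by
    intro j
    rw [unitExp, inner_smul_right, L2.inner_def, fc]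
    congr 1
    refine integral_congr_ae ?_
    filter_upwards [hg.coeFn_toLp, expT_ae j] with x hx hj
    rw [hx, hj, RCLike.inner_apply, map_mul, Complex.conj_conj, ← fourier_neg, neg_sub, sub_eq_add_neg,
      fourier_add]
    ring
  rw [h1, ← torusBasis.tsum_inner_mul_inner, ← tsum_mul_left]
  refine tsum_congr fun j => ?_
  rw [torusBasis_apply, h2, inner_unitExp, ← rootLen_sq, mul_inv]
  ring

lemma fc_zero (f : Torus → ℂ) : fc f 0 = ∫ x, f x := by
  simp [fc]

lemma isMeanZero_iff (f : L2T) : IsMeanZero f ↔ coef f 0 = 0 := by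
  rw [coef_apply, fc_zero]; rfl

lemma fc_conj (f : Torus → ℂ) (k : ℤ) :
    fc (fun x => starRingEnd ℂ (f x)) k = starRingEnd ℂ (fc f (-k)) := by
  rw [fc, fc, ← integral_conj]
  refine integral_congr_ae (ae_of_all _ fun x => ?_)
  simp only [map_mul, ← fourier_neg, neg_neg]

lemma isRealValued_iff (f : L2T) :
    IsRealValued f ↔ ∀ k, coef f (-k) = starRingEnd ℂ (coef f k) := by
  simp only [coef_apply]
  constructor
  · intro h k
    have e := fc_conj f k
    rw [fc_congr_ae (f := fun x => starRingEnd ℂ (f x)) (f' := f)] at e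
    · rw [e, Complex.conj_conj]
    · filter_upwards [h] with x hx
      exact Complex.conj_eq_iff_im.2 hx
  · intro h
    have e : star f = f := by
      refine coef_injective (lp.ext (funext fun k => ?_))
      rw [coef_apply, coef_apply, fc_congr_ae (Lp.coeFn_star f)]
      have := fc_conj f k
      rw [h k, Complex.conj_conj] at this
      exact this
    have e2 := Lp.coeFn_star f
    rw [e] at e2
    filter_upwards [e2] with x hx
    exact Complex.conj_eq_iff_im.1 hx.symm

lemma realSeq_coef {f : L2T} (h1 : IsRealValued f) (h2 : IsMeanZero f) : RealSeq (coef f) :=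
  ⟨(isMeanZero_iff f).1 h2, (isRealValued_iff f).1 h1⟩

/-! ### Smooth functions on the torus -/

lemma hasDerivAt_fourier_torus (n : ℤ) (x : ℝ) :
    HasDerivAt (fun y : ℝ => (fourier n (y : Torus) : ℂ))
      (Complex.I * n * fourier n (x : Torus)) x := by
  refine (hasDerivAt_fourier (2 * Real.pi) n x).congr_deriv ?_
  have : (Real.pi : ℂ) ≠ 0 := by exact_mod_cast Real.pi_ne_zero
  push_cast
  field_simp

lemma smoothT_fourier (n : ℤ) : SmoothT (fun x : Torus => (fourier n x : ℂ)) := by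
  unfold SmoothT
  simp_rw [fourier_coe_apply]
  exact Complex.contDiff_exp.comp
    ((contDiff_const.mul Complex.ofRealCLM.contDiff).div_const _)

namespace SmoothT

variable {E : Type*} [NormedAddCommGroup E] [NormedSpace ℝ E]

lemma continuous {φ : Torus → E} (h : SmoothT φ) : Continuous φ :=
  isQuotientMap_quotient_mk'.continuous_iff.2 (ContDiff.continuous h)

lemma mul {φ ψ : Torus → ℂ} (h : SmoothT φ) (h' : SmoothT ψ) : SmoothT fun x => φ x * ψ x :=
  ContDiff.mul h h'

lemma ofReal {g : Torus → ℝ} (h : SmoothT g) : SmoothT fun x => (g x : ℂ) :=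
  Complex.ofRealCLM.contDiff.comp h

lemma integrable {φ : Torus → ℂ} (h : SmoothT φ) : Integrable φ volume :=
  h.continuous.integrable_of_hasCompactSupport (HasCompactSupport.of_compactSpace φ)

/-- The derivative of a smooth function. -/
lemma exists_deriv {φ : Torus → ℂ} (h : SmoothT φ) :
    ∃ ψ : Torus → ℂ, SmoothT ψ ∧ ∀ k : ℤ, fc ψ k = Complex.I * k * fc φ k := by
  set f : ℝ → ℂ := fun x => φ (x : Torus) with hf
  have hfs : ContDiff ℝ ∞ f := h
  have hp : Function.Periodic (deriv f) (2 * Real.pi) := fun x => by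
    have e : (fun y => f (y + 2 * Real.pi)) = f := by
      ext y
      simp only [hf]
      rw [AddCircle.coe_add_period]
    rw [← deriv_comp_add_const, e]
  have hd : ContDiff ℝ ∞ (deriv f) := (contDiff_infty_iff_deriv.1 hfs).2
  refine ⟨hp.lift, hd, fun k => ?_⟩
  have h1 : ∀ F : Torus → ℂ, fc F k = ∫ x in (0 : ℝ)..0 + 2 * Real.pi, F x * fourier (-k) (x : Torus) :=
    fun F => (AddCircle.intervalIntegral_preimage (2 * Real.pi) 0
      (fun x => F x * fourier (-k) x)).symm
  have hfd : ∀ x, HasDerivAt f (deriv f x) x := fun x =>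
    (hfs.differentiable (by simp) x).hasDerivAt
  have hc : Continuous fun x : ℝ => (fourier (-k) (x : Torus) : ℂ) :=
    (map_continuous (fourier (-k))).comp (AddCircle.continuous_mk' _)
  have h2 := intervalIntegral.integral_eq_sub_of_hasDerivAt (a := 0) (b := 0 + 2 * Real.pi)
    (fun x _ => (hfd x).mul (hasDerivAt_fourier_torus (-k) x))
    (Continuous.intervalIntegrable (by
      have := hfs.continuous
      have := hd.continuous
      fun_prop) _ _)
  have e0 : ((fun y : ℝ => f y * fourier (-k) (y : Torus)) (0 + 2 * Real.pi)) =
      (fun y : ℝ => f y * fourier (-k) (y : Torus)) 0 := by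
    simp only [hf]
    rw [AddCircle.coe_add_period]
  have e3 : ∀ F G : ℝ → ℂ, F * G = fun x => F x * G x := fun _ _ => rfl
  rw [e3, e0, sub_self, intervalIntegral.integral_add] at h2
  · rw [h1, h1, ← intervalIntegral.integral_const_mul]
    have h4 : ∫ x in (0 : ℝ)..0 + 2 * Real.pi, hp.lift (x : Torus) * fourier (-k) (x : Torus) =
        ∫ x in (0 : ℝ)..0 + 2 * Real.pi, deriv f x * fourier (-k) (x : Torus) := rfl
    rw [h4, eq_neg_of_add_eq_zero_left h2, ← intervalIntegral.integral_neg]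
    refine intervalIntegral.integral_congr fun x _ => ?_
    simp only [hf]
    push_cast
    ring
  · exact Continuous.intervalIntegrable (hd.continuous.mul hc) _ _
  · exact Continuous.intervalIntegrable (hfs.continuous.mul (continuous_const.mul hc)) _ _

lemma exists_pow_bound {φ : Torus → ℂ} (h : SmoothT φ) (N : ℕ) :
    ∃ C, ∀ k : ℤ, |(k : ℝ)| ^ N * ‖fc φ k‖ ≤ C := by
  induction N generalizing φ with
  | zero =>
    refine ⟨∫ x, ‖φ x‖, fun k => ?_⟩
    rw [pow_zero, one_mul]
    refine (norm_integral_le_integral_norm _).trans (le_of_eq ?_)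
    simp_rw [norm_mul, norm_fourier_apply, mul_one]
  | succ N ih =>
    obtain ⟨ψ, hψ, hk⟩ := h.exists_deriv
    obtain ⟨C, hC⟩ := ih hψ
    refine ⟨C, fun k => ?_⟩
    have := hC k
    rw [hk, norm_mul, norm_mul, Complex.norm_I, one_mul, Complex.norm_intCast] at this
    rw [pow_succ, mul_assoc]
    exact this

/-- The rapid decay of the Fourier coefficients. -/
lemma exists_decay {φ : Torus → ℂ} (h : SmoothT φ) (N : ℕ) :
    ∃ C, 0 ≤ C ∧ ∀ k : ℤ, ‖fc φ k‖ ≤ C * ((1 + |(k : ℝ)|) ^ N)⁻¹ := by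
  obtain ⟨C₀, h0⟩ := h.exists_pow_bound 0
  obtain ⟨C, hC⟩ := h.exists_pow_bound N
  have hC0 : 0 ≤ C₀ := le_trans (by positivity) (h0 0)
  have hC1 : 0 ≤ C := le_trans (by positivity) (hC 0)
  refine ⟨2 ^ N * (C₀ + C), by positivity, fun k => ?_⟩
  rw [← div_eq_mul_inv, le_div_iff₀ (by positivity)]
  have h1 : (1 + |(k : ℝ)|) ^ N ≤ 2 ^ N * (1 + |(k : ℝ)| ^ N) := by
    have hk : 0 ≤ |(k : ℝ)| := abs_nonneg _
    rcases le_total |(k : ℝ)| 1 with h | h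
    · calc (1 + |(k : ℝ)|) ^ N ≤ 2 ^ N * 1 := by
            rw [mul_one]; exact pow_le_pow_left₀ (by positivity) (by linarith) N
        _ ≤ _ := by gcongr; linarith [pow_nonneg hk N]
    · calc (1 + |(k : ℝ)|) ^ N ≤ (2 * |(k : ℝ)|) ^ N :=
            pow_le_pow_left₀ (by positivity) (by linarith) N
        _ = 2 ^ N * |(k : ℝ)| ^ N := mul_pow _ _ _
        _ ≤ _ := by gcongr; linarith
  have h2 := h0 k
  have h3 := hC k
  rw [pow_zero, one_mul] at h2
  calc ‖fc φ k‖ * (1 + |(k : ℝ)|) ^ N ≤ ‖fc φ k‖ * (2 ^ N * (1 + |(k : ℝ)| ^ N)) := by gcongr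
    _ = 2 ^ N * (‖fc φ k‖ + |(k : ℝ)| ^ N * ‖fc φ k‖) := by ring
    _ ≤ _ := by gcongr

end SmoothT

lemma summable_inv_pow {N : ℕ} (hN : 2 ≤ N) : Summable fun n : ℤ => ((1 + |(n : ℝ)|) ^ N)⁻¹ := by
  have h := summable_one_add_abs_rpow (r := N) (by exact_mod_cast hN)
  refine h.congr fun n => ?_
  rw [Real.rpow_neg (by positivity), Real.rpow_natCast]

/-- Symbols of polynomial growth. -/
def PolyGrowth (m : ℤ → ℂ) : Prop := ∃ A, 0 ≤ A ∧ ∀ k : ℤ, ‖m k‖ ≤ A * (1 + |(k : ℝ)|) ^ 4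

lemma polyGrowth_of_le {m : ℤ → ℂ} (h : ∀ k : ℤ, ‖m k‖ ≤ (1 + |(k : ℝ)|) ^ 4) : PolyGrowth m :=
  ⟨1, zero_le_one, fun k => (h k).trans_eq (one_mul _).symm⟩

lemma norm_absSymbol_le {s : ℝ} (hs0 : 0 ≤ s) (hs : s ≤ 2) (k : ℤ) :
    ‖absSymbol s k‖ ≤ (1 + |(k : ℝ)|) ^ 2 := by
  rw [absSymbol, Complex.norm_real, Real.norm_of_nonneg (by positivity)]
  calc |(k : ℝ)| ^ s ≤ (1 + |(k : ℝ)|) ^ s :=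
        Real.rpow_le_rpow (abs_nonneg _) (by linarith) hs0
    _ ≤ (1 + |(k : ℝ)|) ^ (2 : ℝ) :=
        Real.rpow_le_rpow_of_exponent_le (by linarith [abs_nonneg (k : ℝ)]) hs
    _ = _ := by norm_cast

lemma norm_derivSymbol_le (k : ℤ) : ‖derivSymbol k‖ ≤ 1 + |(k : ℝ)| := by
  rw [derivSymbol, norm_mul, Complex.norm_I, one_mul, Complex.norm_intCast]
  linarith

lemma one_le_one_add_abs (k : ℤ) : 1 ≤ 1 + |(k : ℝ)| := le_add_of_nonneg_right (abs_nonneg _)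

lemma polyGrowth_abs {s : ℝ} (hs0 : 0 ≤ s) (hs : s ≤ 2) : PolyGrowth (absSymbol s) :=
  polyGrowth_of_le fun k => (norm_absSymbol_le hs0 hs k).trans
    (pow_le_pow_right₀ (one_le_one_add_abs k) (by norm_num))

lemma polyGrowth_deriv : PolyGrowth derivSymbol :=
  polyGrowth_of_le fun k => (norm_derivSymbol_le k).trans
    (le_self_pow₀ (one_le_one_add_abs k) (by norm_num))

lemma polyGrowth_abs_deriv {s : ℝ} (hs0 : 0 ≤ s) (hs : s ≤ 2) :
    PolyGrowth fun k => absSymbol s k * derivSymbol k :=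
  polyGrowth_of_le fun k => by
    rw [norm_mul]
    have h := one_le_one_add_abs k
    calc _ ≤ (1 + |(k : ℝ)|) ^ 2 * (1 + |(k : ℝ)|) :=
          mul_le_mul (norm_absSymbol_le hs0 hs k) (norm_derivSymbol_le k) (norm_nonneg _)
            (by positivity)
      _ = (1 + |(k : ℝ)|) ^ 3 := by ring
      _ ≤ _ := pow_le_pow_right₀ h (by norm_num)

lemma polyGrowth_one : PolyGrowth fun _ => 1 :=
  polyGrowth_of_le fun k => by
    rw [norm_one]
    exact one_le_pow₀ (one_le_one_add_abs k)

lemma norm_fc_le (f : Torus → ℂ) (k : ℤ) : ‖fc f k‖ ≤ ∫ x, ‖f x‖ := by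
  refine (norm_integral_le_integral_norm _).trans (le_of_eq ?_)
  simp_rw [norm_mul, norm_fourier_apply, mul_one]

namespace SmoothT

variable {φ : Torus → ℂ}

lemma summable_mult (h : SmoothT φ) {m : ℤ → ℂ} (hm : PolyGrowth m) :
    Summable fun k => ‖m k * fc φ k‖ := by
  obtain ⟨A, hA, hmA⟩ := hm
  -- Six powers of decay: four against the growth of the symbol and two for summability.
  obtain ⟨C, hC, hd⟩ := h.exists_decay 6
  refine ((summable_inv_pow le_rfl).mul_left (A * C)).of_nonneg_of_le (fun k => norm_nonneg _)
    fun k => ?_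
  have h1 : 0 < 1 + |(k : ℝ)| := by positivity
  rw [norm_mul]
  calc ‖m k‖ * ‖fc φ k‖ ≤ (A * (1 + |(k : ℝ)|) ^ 4) * (C * ((1 + |(k : ℝ)|) ^ 6)⁻¹) :=
        mul_le_mul (hmA k) (hd k) (norm_nonneg _) (by positivity)
    _ = _ := by field_simp

lemma continuous_fourierMult (h : SmoothT φ) {m : ℤ → ℂ} (hm : PolyGrowth m) :
    Continuous (fourierMult m φ) := by
  refine continuous_const.mul (continuous_tsum (fun k => continuous_const.mul
    (map_continuous (fourier k))) (h.summable_mult hm) fun k x => ?_)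
  rw [norm_mul, norm_fourier_apply, mul_one]

/-- The pairing with a Fourier multiplier. -/
lemma integral_mul_fourierMult (h : SmoothT φ) {m : ℤ → ℂ} (hm : PolyGrowth m) {f : Torus → ℂ}
    (hf : Integrable f volume) :
    ∫ x, f x * fourierMult m φ x = (2 * Real.pi : ℂ)⁻¹ * ∑' k, m k * fc φ k * fc f (-k) := by
  have hint : ∀ k, Integrable (fun x : Torus => m k * fc φ k * (f x * fourier k x)) volume :=
    fun k => (hf.mul_bdd (c := 1) (map_continuous (fourier k)).aestronglyMeasurable
      (ae_of_all _ fun x => (norm_fourier_apply k x).le)).const_mul _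
  have hs := hasSum_integral_of_summable_integral_norm hint (by
    have : ∀ k, ∫ x : Torus, ‖m k * fc φ k * (f x * fourier k x)‖ =
        ‖m k * fc φ k‖ * ∫ x, ‖f x‖ := fun k => by
      rw [← integral_const_mul]
      congr 1 with x
      rw [norm_mul, norm_mul (f x), norm_fourier_apply, mul_one]
    simp_rw [this]
    exact (h.summable_mult hm).mul_right _)
  have e : ∀ x, f x * fourierMult m φ x =
      (2 * Real.pi : ℂ)⁻¹ * ∑' k, m k * fc φ k * (f x * fourier k x) := fun x => by
    rw [fourierMult, mul_left_comm, ← tsum_mul_left]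
    congr 1
    exact tsum_congr fun k => by ring
  simp_rw [e]
  rw [integral_const_mul, ← hs.tsum_eq]
  congr 1
  refine tsum_congr fun k => ?_
  rw [integral_const_mul, fc.eq_def f, neg_neg]

lemma fourierMult_one (h : SmoothT φ) : fourierMult (fun _ => 1) φ = φ := by
  have e : ∀ k, fourierCoeff φ k = (2 * Real.pi : ℂ)⁻¹ * fc φ k := fun k => by
    rw [fourierCoeff, AddCircle.integral_haarAddCircle, fc, Complex.real_smul]
    push_cast
    congr 1
    refine integral_congr_ae (ae_of_all _ fun x => ?_)
    simp only [smul_eq_mul, mul_comm]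
  have hs : Summable (fourierCoeff φ) := by
    simp_rw [funext e]
    have := (h.summable_mult polyGrowth_one).of_norm
    simp only [one_mul] at this
    exact this.mul_left _
  ext x
  have := has_pointwise_sum_fourier_series_of_summable (f := ⟨φ, h.continuous⟩) hs x
  rw [fourierMult, ← tsum_mul_left]
  refine Eq.trans (tsum_congr fun k => ?_) this.tsum_eq
  show _ = fourierCoeff φ k • (fourier k x : ℂ)
  rw [e, smul_eq_mul]
  ring

lemma integral_mul (h : SmoothT φ) {f : Torus → ℂ} (hf : Integrable f volume) :
    ∫ x, f x * φ x = (2 * Real.pi : ℂ)⁻¹ * ∑' k, fc φ k * fc f (-k) := by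
  have := h.integral_mul_fourierMult polyGrowth_one hf
  rw [h.fourierMult_one] at this
  simpa using this

end SmoothT

/-! ### The matrix of the dissipation -/

/-- The Fourier coefficients of a real function. -/
def realFc (g : Torus → ℝ) (k : ℤ) : ℂ := fc (fun x => (g x : ℂ)) k

/-- The matrix of the localisation operator. -/
def locMat (g : Torus → ℝ) (l n : ℤ) : ℂ :=
  (2 * Real.pi : ℂ)⁻¹ * (realFc g (l - n) - realFc g l * realFc g (-n))

/-- The matrix of the dissipation. -/
def dissMat (g : Torus → ℝ) (β : ℝ) (k j : ℤ) : ℂ :=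
  ∑' l, locMat g k l * absSymbol β l * locMat g l j

lemma conj_realFc (g : Torus → ℝ) (k : ℤ) : starRingEnd ℂ (realFc g k) = realFc g (-k) := by
  have := fc_conj (fun x => (g x : ℂ)) (-k)
  simp only [Complex.conj_ofReal, neg_neg] at this
  exact this.symm

lemma conj_two_pi_inv : starRingEnd ℂ (2 * Real.pi : ℂ)⁻¹ = (2 * Real.pi : ℂ)⁻¹ := by
  rw [map_inv₀, map_mul, Complex.conj_ofReal, map_ofNat]

lemma conj_locMat (g : Torus → ℝ) (l n : ℤ) : starRingEnd ℂ (locMat g l n) = locMat g n l := by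
  simp only [locMat, map_mul, map_sub, conj_realFc, conj_two_pi_inv, neg_neg, neg_sub]
  ring

lemma locMat_neg (g : Torus → ℝ) (l n : ℤ) : locMat g (-l) (-n) = locMat g n l := by
  simp only [locMat, neg_neg]
  rw [show -l - -n = n - l by ring]
  ring

lemma conj_absSymbol (s : ℝ) (k : ℤ) : starRingEnd ℂ (absSymbol s k) = absSymbol s k :=
  Complex.conj_ofReal _

lemma absSymbol_neg (s : ℝ) (k : ℤ) : absSymbol s (-k) = absSymbol s k := by
  simp [absSymbol]

lemma dissMat_neg (g : Torus → ℝ) (β : ℝ) (k j : ℤ) :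
    dissMat g β (-k) (-j) = starRingEnd ℂ (dissMat g β k j) := by
  rw [dissMat, dissMat, Complex.conj_tsum, ← (Equiv.neg ℤ).tsum_eq]
  refine tsum_congr fun l => ?_
  simp only [Equiv.neg_apply, locMat_neg, absSymbol_neg, map_mul, conj_locMat, conj_absSymbol]

lemma norm_two_pi_inv : ‖(2 * Real.pi : ℂ)⁻¹‖ = (2 * Real.pi)⁻¹ := by
  rw [norm_inv, norm_mul, Complex.norm_real, Real.norm_of_nonneg Real.pi_pos.le, Complex.norm_ofNat]

lemma two_pi_inv_le_one : (2 * Real.pi)⁻¹ ≤ 1 :=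
  inv_le_one_of_one_le₀ (by linarith [Real.pi_gt_three])

lemma one_add_abs_sub_le (k l j : ℤ) :
    1 + |(k : ℝ) - j| ≤ (1 + |(k : ℝ) - l|) * (1 + |(l : ℝ) - j|) := by
  have h := abs_sub_le (k : ℝ) l j
  nlinarith [abs_nonneg ((k : ℝ) - l), abs_nonneg ((l : ℝ) - j)]

lemma abs_le_abs_mul {k l : ℤ} (hk : k ≠ 0) : |(l : ℝ)| ≤ |(k : ℝ)| * (1 + |(k : ℝ) - l|) := by
  have h1 : (1 : ℝ) ≤ |(k : ℝ)| := by
    rw [← Int.cast_abs]; exact_mod_cast Int.one_le_abs hk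
  have h2 : |(l : ℝ)| ≤ |(k : ℝ)| + |(k : ℝ) - l| := by
    have := abs_sub (k : ℝ) ((k : ℝ) - l)
    rwa [sub_sub_cancel] at this
  nlinarith [abs_nonneg ((k : ℝ) - l)]

lemma abs_rpow_le_mul {β : ℝ} (h0 : 0 ≤ β) (h2 : β ≤ 2) {k l : ℤ} (hk : k ≠ 0) :
    |(l : ℝ)| ^ β ≤ |(k : ℝ)| ^ β * (1 + |(k : ℝ) - l|) ^ 2 := by
  have h1 : (1 : ℝ) ≤ 1 + |(k : ℝ) - l| := by linarith [abs_nonneg ((k : ℝ) - l)]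
  calc |(l : ℝ)| ^ β ≤ (|(k : ℝ)| * (1 + |(k : ℝ) - l|)) ^ β :=
        Real.rpow_le_rpow (abs_nonneg _) (abs_le_abs_mul hk) h0
    _ = |(k : ℝ)| ^ β * (1 + |(k : ℝ) - l|) ^ β := Real.mul_rpow (abs_nonneg _) (by positivity)
    _ ≤ |(k : ℝ)| ^ β * (1 + |(k : ℝ) - l|) ^ (2 : ℝ) := by gcongr
    _ = _ := by norm_cast

section Matrix

variable {g : Torus → ℝ} (hg : SmoothT g)
include hg

/-- The first term of the matrix depends on `l - n` only; the second decays in `l` and in `n`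
separately, and the product of the two decays dominates the one in `l - n`. Of the eight powers two
will be spent on `|l|^β`, two on the sum over the middle index, and four survive in `dissMat`. -/
lemma exists_locMat_decay :
    ∃ B, 0 ≤ B ∧ ∀ l n : ℤ, ‖locMat g l n‖ ≤ B * ((1 + |(l : ℝ) - n|) ^ 8)⁻¹ := by
  obtain ⟨C, hC, h⟩ := hg.ofReal.exists_decay 8
  refine ⟨C + C ^ 2, by positivity, fun l n => ?_⟩
  have h1 := h (l - n)
  have h2 := h l
  have h3 := h (-n)
  push_cast at h1 h2 h3
  rw [abs_neg] at h3
  have h4 := one_add_abs_sub_le l 0 n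
  simp only [Int.cast_zero, sub_zero, zero_sub, abs_neg] at h4
  rw [locMat, norm_mul, norm_two_pi_inv]
  calc _ ≤ 1 * ‖realFc g (l - n) - realFc g l * realFc g (-n)‖ := by
        gcongr; exact two_pi_inv_le_one
    _ ≤ ‖realFc g (l - n)‖ + ‖realFc g l‖ * ‖realFc g (-n)‖ := by
        rw [one_mul, ← norm_mul]; exact norm_sub_le _ _
    _ ≤ C * ((1 + |(l : ℝ) - n|) ^ 8)⁻¹ +
        (C * ((1 + |(l : ℝ)|) ^ 8)⁻¹) * (C * ((1 + |(n : ℝ)|) ^ 8)⁻¹) :=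
        add_le_add h1 (mul_le_mul h2 h3 (norm_nonneg _) (by positivity))
    _ = C * ((1 + |(l : ℝ) - n|) ^ 8)⁻¹ +
        C ^ 2 * (((1 + |(l : ℝ)|) * (1 + |(n : ℝ)|)) ^ 8)⁻¹ := by
        rw [mul_pow, mul_inv]; ring
    _ ≤ C * ((1 + |(l : ℝ) - n|) ^ 8)⁻¹ + C ^ 2 * ((1 + |(l : ℝ) - n|) ^ 8)⁻¹ := by gcongr
    _ = _ := by ring

omit hg in
lemma realFc_zero (h1 : ∫ x, g x = 1) : realFc g 0 = 1 := by
  rw [realFc, fc_zero, integral_complex_ofReal, h1, Complex.ofReal_one]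

-- Because `∫ g = 1`, the operator `G` annihilates constants; in the same way its range has zero
-- mean. So the zero frequency decouples.
omit hg in
lemma locMat_zero_right (h1 : ∫ x, g x = 1) (l : ℤ) : locMat g l 0 = 0 := by
  simp [locMat, realFc_zero h1]

omit hg in
lemma locMat_zero_left (h1 : ∫ x, g x = 1) (n : ℤ) : locMat g 0 n = 0 := by
  simp [locMat, realFc_zero h1]

omit hg in
lemma norm_absSymbol (s : ℝ) (k : ℤ) : ‖absSymbol s k‖ = |(k : ℝ)| ^ s := by
  rw [absSymbol, Complex.norm_real, Real.norm_of_nonneg (by positivity)]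

variable (h1 : ∫ x, g x = 1) {β : ℝ} (hβ0 : 0 < β) (hβ2 : β ≤ 2)
include h1 hβ0 hβ2

lemma exists_locMat_absSymbol_le : ∃ B, 0 ≤ B ∧ ∀ k l : ℤ,
    ‖locMat g k l * absSymbol β l‖ ≤ B * |(k : ℝ)| ^ β * ((1 + |(k : ℝ) - l|) ^ 6)⁻¹ := by
  obtain ⟨B, hB, h⟩ := exists_locMat_decay hg
  refine ⟨B, hB, fun k l => ?_⟩
  rcases eq_or_ne k 0 with rfl | hk
  · rw [locMat_zero_left h1, zero_mul, norm_zero]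
    positivity
  · have h2 := abs_rpow_le_mul hβ0.le hβ2 (l := l) hk
    have h3 : 0 < 1 + |(k : ℝ) - l| := by positivity
    rw [norm_mul, norm_absSymbol]
    calc _ ≤ (B * ((1 + |(k : ℝ) - l|) ^ 8)⁻¹) * (|(k : ℝ)| ^ β * (1 + |(k : ℝ) - l|) ^ 2) :=
          mul_le_mul (h k l) h2 (by positivity) (by positivity)
      _ = _ := by field_simp

lemma exists_term_le : ∃ B, 0 ≤ B ∧ ∀ k l j : ℤ,
    ‖locMat g k l * absSymbol β l * locMat g l j‖ ≤
      B * |(k : ℝ)| ^ β * ((1 + |(k : ℝ) - j|) ^ 4)⁻¹ * ((1 + |(k : ℝ) - l|) ^ 2)⁻¹ := by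
  obtain ⟨B, hB, h⟩ := exists_locMat_absSymbol_le hg h1 hβ0 hβ2
  obtain ⟨B', hB', h'⟩ := exists_locMat_decay hg
  refine ⟨B * B', by positivity, fun k l j => ?_⟩
  have h3 : 0 < 1 + |(k : ℝ) - l| := by positivity
  have h4 : 1 ≤ 1 + |(l : ℝ) - j| := by linarith [abs_nonneg ((l : ℝ) - j)]
  have h5 := one_add_abs_sub_le k l j
  rw [norm_mul]
  calc _ ≤ (B * |(k : ℝ)| ^ β * ((1 + |(k : ℝ) - l|) ^ 6)⁻¹) *
        (B' * ((1 + |(l : ℝ) - j|) ^ 8)⁻¹) :=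
        mul_le_mul (h k l) (h' l j) (norm_nonneg _) (by positivity)
    _ ≤ (B * |(k : ℝ)| ^ β * ((1 + |(k : ℝ) - l|) ^ 6)⁻¹) *
        (B' * ((1 + |(l : ℝ) - j|) ^ 4)⁻¹) := by
        gcongr
        norm_num
    _ = B * B' * |(k : ℝ)| ^ β * (((1 + |(k : ℝ) - l|) * (1 + |(l : ℝ) - j|)) ^ 4)⁻¹ *
        ((1 + |(k : ℝ) - l|) ^ 2)⁻¹ := by
        rw [mul_pow]; field_simp
    _ ≤ _ := by gcongr

omit hg h1 hβ0 hβ2 in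
lemma summable_inv_pow_sub {N : ℕ} (hN : 2 ≤ N) (k : ℤ) :
    Summable fun l : ℤ => ((1 + |(k : ℝ) - l|) ^ N)⁻¹ := by
  refine ((Equiv.subLeft k).summable_iff.2 (summable_inv_pow hN)).congr fun l => ?_
  simp

lemma summable_term (k j : ℤ) :
    Summable fun l => ‖locMat g k l * absSymbol β l * locMat g l j‖ := by
  obtain ⟨B, hB, h⟩ := exists_term_le hg h1 hβ0 hβ2
  exact ((summable_inv_pow_sub le_rfl k).mul_left _).of_nonneg_of_le (fun _ => norm_nonneg _)
    fun l => h k l j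

lemma hasSum_dissMat (k j : ℤ) :
    HasSum (fun l => locMat g k l * absSymbol β l * locMat g l j) (dissMat g β k j) :=
  (summable_term hg h1 hβ0 hβ2 k j).of_norm.hasSum

lemma exists_dissMat_le : ∃ C, 0 ≤ C ∧ ∀ k j : ℤ,
    ‖dissMat g β k j‖ ≤ C * |(k : ℝ)| ^ β * (1 + |(k : ℝ) - j|) ^ (-4 : ℝ) := by
  obtain ⟨B, hB, h⟩ := exists_term_le hg h1 hβ0 hβ2
  refine ⟨B * ∑' l : ℤ, ((1 + |(l : ℝ)|) ^ 2)⁻¹,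
    mul_nonneg hB (tsum_nonneg fun l => by positivity), fun k j => ?_⟩
  have hs := ((summable_inv_pow_sub le_rfl k).mul_left
    (B * |(k : ℝ)| ^ β * ((1 + |(k : ℝ) - j|) ^ 4)⁻¹))
  have h2 := tsum_of_norm_bounded hs.hasSum fun l => h k l j
  have e : ∑' l : ℤ, ((1 + |(k : ℝ) - l|) ^ 2)⁻¹ = ∑' l : ℤ, ((1 + |(l : ℝ)|) ^ 2)⁻¹ := by
    rw [← (Equiv.subLeft k).tsum_eq fun l : ℤ => ((1 + |(l : ℝ)|) ^ 2)⁻¹]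
    simp
  rw [tsum_mul_left, e] at h2
  refine h2.trans (le_of_eq ?_)
  rw [show (-4 : ℝ) = -((4 : ℕ) : ℝ) by norm_num, Real.rpow_neg (by positivity), Real.rpow_natCast]
  ring

/-- `G` is self-adjoint, so the diagonal entry is `∑ |l|^β |G_{lk}|²`: it is real, and any single
term bounds it from below. -/
lemma hasSum_diag (k : ℤ) :
    HasSum (fun l : ℤ => ((|(l : ℝ)| ^ β * ‖locMat g l k‖ ^ 2 : ℝ) : ℂ)) (dissMat g β k k) := by
  refine (hasSum_dissMat hg h1 hβ0 hβ2 k k).congr_fun ?_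
  intro l
  rw [← conj_locMat g l k]
  push_cast
  rw [← Complex.conj_mul', absSymbol]
  ring

/-- Since `∫ g = 1`, one has `G_kk = (1 - |g_k|²)/(2π)`. With `x = |g_k|²` and `(1 - x)² ≥ 1 - 2x`,
the defect is at most `2|k|^β x`, which is bounded by the decay of `g_k`. -/
lemma exists_diag_le : ∃ D, 0 ≤ D ∧ ∀ k : ℤ,
    (2 * Real.pi)⁻¹ ^ 2 * |(k : ℝ)| ^ β ≤ |(k : ℝ)| ^ β * ‖locMat g k k‖ ^ 2 + D := by
  obtain ⟨C, hC, h⟩ := hg.ofReal.exists_decay 2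
  refine ⟨2 * C ^ 2, by positivity, fun k => ?_⟩
  set x := ‖realFc g k‖ ^ 2 with hx
  have e : locMat g k k = (((2 * Real.pi)⁻¹ * (1 - x) : ℝ) : ℂ) := by
    rw [locMat, sub_self, realFc_zero h1, ← conj_realFc, Complex.mul_conj', hx]
    push_cast
    ring
  have h2 : |(k : ℝ)| ^ β * x ≤ C ^ 2 := by
    have h3 : |(k : ℝ)| ^ β ≤ (1 + |(k : ℝ)|) ^ 2 := by
      rw [← norm_absSymbol]; exact norm_absSymbol_le hβ0.le hβ2 k
    have h4 : 1 ≤ 1 + |(k : ℝ)| := one_le_one_add_abs k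
    calc |(k : ℝ)| ^ β * x ≤ (1 + |(k : ℝ)|) ^ 2 * (C * ((1 + |(k : ℝ)|) ^ 2)⁻¹) ^ 2 := by
          rw [hx]; gcongr; exact h k
      _ = C ^ 2 * ((1 + |(k : ℝ)|) ^ 2)⁻¹ := by field_simp
      _ ≤ C ^ 2 * 1 := by gcongr; exact inv_le_one_of_one_le₀ (one_le_pow₀ h4)
      _ = C ^ 2 := mul_one _
  have h5 : 0 ≤ |(k : ℝ)| ^ β := by positivity
  have h6 : (2 * Real.pi)⁻¹ ^ 2 ≤ 1 :=
    pow_le_one₀ (by have := Real.pi_pos; positivity) two_pi_inv_le_one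
  have h7 : 0 ≤ (2 * Real.pi)⁻¹ ^ 2 := by positivity
  rw [e, Complex.norm_real, Real.norm_eq_abs, sq_abs, mul_pow]
  have h8 : 0 ≤ |(k : ℝ)| ^ β * x ^ 2 := by positivity
  have h9 : (2 * Real.pi)⁻¹ ^ 2 * (|(k : ℝ)| ^ β * x) ≤ C ^ 2 :=
    (mul_le_of_le_one_left (by positivity) h6).trans h2
  nlinarith [mul_nonneg h7 h8]

theorem exists_setting (E : Exps) (hE : E.β = β) :
    ∃ S : Setting, S.toExps = E ∧ S.a = dissMat g β := by
  subst hE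
  obtain ⟨C, hC, hC'⟩ := exists_dissMat_le hg h1 hβ0 hβ2
  obtain ⟨D, hD, hD'⟩ := exists_diag_le hg h1 hβ0 hβ2
  refine ⟨{ E with
    a := dissMat g E.β
    C := C
    c := (2 * Real.pi)⁻¹ ^ 2
    D := D
    hC := hC
    hc := by have := Real.pi_pos; positivity
    hc1 := pow_le_one₀ (by have := Real.pi_pos; positivity) two_pi_inv_le_one
    zero_left := fun j => by simp [dissMat, locMat_zero_left h1]
    zero_right := fun j => by simp [dissMat, locMat_zero_right h1]
    norm_le := hC'
    conj_neg := dissMat_neg g E.β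
    diag_im := fun k => ?_
    diag_ge := fun k => ?_
    re_nonneg := fun s v => ?_ }, rfl, rfl⟩
  · have := Complex.hasSum_im (hasSum_diag hg h1 hβ0 hβ2 k)
    simp only [Complex.ofReal_im] at this
    exact this.unique hasSum_zero
  · have h := Complex.hasSum_re (hasSum_diag hg h1 hβ0 hβ2 k)
    simp only [Complex.ofReal_re] at h
    have h2 := le_hasSum h k fun l _ => by positivity
    exact (hD' k).trans (by linarith)
  -- The quadratic form of the dissipation is `∑ |l|^β |(G v)_l|²`.
  · have h : HasSum (fun l : ℤ => ((|(l : ℝ)| ^ E.β * ‖∑ j ∈ s, locMat g l j * v j‖ ^ 2 : ℝ) : ℂ))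
        (∑ k ∈ s, ∑ j ∈ s, dissMat g E.β k j * v j * starRingEnd ℂ (v k)) := by
      refine (hasSum_sum fun k _ => hasSum_sum fun j _ =>
        (((hasSum_dissMat hg h1 hβ0 hβ2 k j).mul_right (v j)).mul_right _)).congr_fun ?_
      intro l
      push_cast
      rw [← Complex.conj_mul', map_sum, Finset.sum_mul_sum, Finset.mul_sum]
      refine Finset.sum_congr rfl fun k _ => ?_
      rw [Finset.mul_sum]
      refine Finset.sum_congr rfl fun j _ => ?_
      rw [map_mul, conj_locMat, absSymbol]
      ring
    have h' := Complex.hasSum_re h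
    simp only [Complex.ofReal_re] at h'
    exact h'.nonneg fun l => by positivity

end Matrix

/-! ### The weak formulation in Fourier coefficients -/

lemma integrable_mul_continuous {f h : Torus → ℂ} (hf : Integrable f volume) (hh : Continuous h) :
    Integrable (fun x => f x * h x) volume := by
  obtain ⟨B, hB⟩ := isCompact_univ.exists_bound_of_continuousOn hh.continuousOn
  exact hf.mul_bdd hh.aestronglyMeasurable (ae_of_all _ fun x => hB x (mem_univ x))

section Localisation

variable {g : Torus → ℝ} (hg : SmoothT g)
include hg

lemma smoothT_opG {φ : Torus → ℂ} (hφ : SmoothT φ) : SmoothT (opG g φ) :=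
  hg.ofReal.mul (show ContDiff ℝ ∞ _ from ContDiff.sub hφ contDiff_const)

lemma integrable_real_mul {f : Torus → ℂ} (hf : Integrable f volume) :
    Integrable (fun x => (g x : ℂ) * f x) volume := by
  simp_rw [mul_comm]
  exact integrable_mul_continuous hf hg.ofReal.continuous

lemma integrable_opG {f : Torus → ℂ} (hf : Integrable f volume) :
    Integrable (opG g f) volume :=
  integrable_real_mul hg (hf.sub (integrable_const _))

/-- The localisation operator is symmetric. -/
lemma integral_mul_opG {f h : Torus → ℂ} (hf : Integrable f volume) (hh : Continuous h) :
    ∫ x, f x * opG g h x = ∫ x, opG g f x * h x := by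
  have i1 := integrable_mul_continuous (integrable_real_mul hg hf) hh
  have i2 := integrable_real_mul hg (hh.integrable_of_hasCompactSupport
    (HasCompactSupport.of_compactSpace h))
  have e1 : ∀ x, f x * opG g h x =
      (g x : ℂ) * f x * h x - (g x : ℂ) * f x * ∫ y, (g y : ℂ) * h y := fun x => by
    rw [opG]; ring
  have e2 : ∀ x, opG g f x * h x =
      (g x : ℂ) * f x * h x - (∫ y, (g y : ℂ) * f y) * ((g x : ℂ) * h x) := fun x => by
    rw [opG]; ring
  simp_rw [e1, e2]
  rw [integral_sub i1 ((integrable_real_mul hg hf).mul_const _),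
    integral_sub i1 (i2.const_mul _), integral_mul_const, integral_const_mul]

/-- The coefficient is the pairing of `f` with the smooth function `g e^{-ilx}`, so integrability of
`f` is enough for an absolutely convergent series. -/
lemma fc_real_mul {f : Torus → ℂ} (hf : Integrable f volume) (l : ℤ) :
    HasSum (fun n => (2 * Real.pi : ℂ)⁻¹ * (realFc g (l - n) * fc f n))
      (fc (fun x => (g x : ℂ) * f x) l) := by
  have hs : SmoothT fun x => (g x : ℂ) * (fourier (-l) x : ℂ) :=
    hg.ofReal.mul (smoothT_fourier (-l))
  have e : ∀ k, fc (fun x => (g x : ℂ) * (fourier (-l) x : ℂ)) k = realFc g (l + k) := fun k => by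
    rw [fc, realFc, fc]
    refine integral_congr_ae (ae_of_all _ fun x => ?_)
    simp only [mul_assoc, ← fourier_add]
    rw [neg_add]
  have h := hs.integral_mul hf
  have hsum : Summable fun k => fc (fun x => (g x : ℂ) * (fourier (-l) x : ℂ)) k * fc f (-k) := by
    refine Summable.of_norm (((hs.summable_mult polyGrowth_one).mul_right (∫ x, ‖f x‖)).of_nonneg_of_le
      (fun _ => norm_nonneg _) fun k => ?_)
    rw [norm_mul, one_mul]
    gcongr
    exact norm_fc_le f _
  have h2 := hsum.hasSum.mul_left (2 * Real.pi : ℂ)⁻¹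
  rw [← h] at h2
  have e2 : fc (fun x => (g x : ℂ) * f x) l =
      ∫ x, f x * ((g x : ℂ) * (fourier (-l) x : ℂ)) := by
    unfold fc
    refine integral_congr_ae (ae_of_all _ fun x => ?_)
    simp only
    ring
  rw [e2]
  refine (Equiv.neg ℤ).hasSum_iff.1 (h2.congr_fun fun k => ?_)
  simp only [Function.comp_apply, Equiv.neg_apply, e, sub_neg_eq_add]

lemma hasSum_fc_opG {f : Torus → ℂ} (hf : Integrable f volume) (l : ℤ) :
    HasSum (fun n => locMat g l n * fc f n) (fc (opG g f) l) := by
  have h0 := fc_real_mul hg hf 0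
  rw [fc_zero] at h0
  have e : fc (opG g f) l = fc (fun x => (g x : ℂ) * f x) l -
      realFc g l * ∫ y, (g y : ℂ) * f y := by
    rw [realFc, fc, fc, fc, ← integral_mul_const, ← integral_sub]
    · refine integral_congr_ae (ae_of_all _ fun x => ?_)
      simp only [opG]
      ring
    · exact integrable_mul_continuous (integrable_real_mul hg hf) (map_continuous (fourier (-l)))
    · exact (integrable_mul_continuous hg.ofReal.integrable
        (map_continuous (fourier (-l)))).mul_const _
  rw [e]
  refine ((fc_real_mul hg hf l).sub (h0.mul_left (realFc g l))).congr_fun fun n => ?_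
  rw [locMat, zero_sub]
  ring

variable (h1 : ∫ x, g x = 1) {β : ℝ} (hβ0 : 0 < β) (hβ2 : β ≤ 2)
include h1 hβ0 hβ2

/-- Exchange of the two summations; the bound of `exists_term_le` decays in both indices, and the
coefficients of `f` are bounded. -/
lemma tsum_locMat_fc_opG {f : Torus → ℂ} (hf : Integrable f volume) (k : ℤ) :
    ∑' l, locMat g k l * absSymbol β l * fc (opG g f) l = ∑' n, dissMat g β k n * fc f n := by
  obtain ⟨B, hB, h⟩ := exists_term_le hg h1 hβ0 hβ2
  have hs : Summable (Function.uncurry fun l n : ℤ =>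
      locMat g k l * absSymbol β l * locMat g l n * fc f n) := by
    have hs := (summable_inv_pow_sub (N := 2) le_rfl k).mul_of_nonneg
      (summable_inv_pow_sub (N := 4) (by norm_num) k) (fun _ => by positivity)
      (fun _ => by positivity)
    refine Summable.of_norm ((hs.mul_left (B * |(k : ℝ)| ^ β * ∫ x, ‖f x‖)).of_nonneg_of_le
      (fun _ => norm_nonneg _) fun p => ?_)
    simp only [Function.uncurry, norm_mul _ (fc f _)]
    calc _ ≤ (B * |(k : ℝ)| ^ β * ((1 + |(k : ℝ) - p.2|) ^ 4)⁻¹ *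
          ((1 + |(k : ℝ) - p.1|) ^ 2)⁻¹) * ∫ x, ‖f x‖ :=
          mul_le_mul (h k p.1 p.2) (norm_fc_le f _) (norm_nonneg _) (by positivity)
      _ = _ := by ring
  have e := hs.tsum_comm
  calc _ = ∑' l, ∑' n, locMat g k l * absSymbol β l * locMat g l n * fc f n := by
        refine tsum_congr fun l => ?_
        rw [← (hasSum_fc_opG hg hf l).tsum_eq, ← tsum_mul_left]
        exact tsum_congr fun n => by ring
    _ = ∑' n, ∑' l, locMat g k l * absSymbol β l * locMat g l n * fc f n := e.symm
    _ = _ := by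
        refine tsum_congr fun n => ?_
        rw [tsum_mul_right, (hasSum_dissMat hg h1 hβ0 hβ2 k n).tsum_eq]

/-- The dissipative part of the weak formulation. -/
lemma integral_mul_dissipation {f φ : Torus → ℂ} (hf : Integrable f volume) (hφ : SmoothT φ) :
    ∫ x, f x * opG g (fracD β (opG g φ)) x =
      (2 * Real.pi : ℂ)⁻¹ * ∑' k, fc φ (-k) * ∑' n, dissMat g β k n * fc f n := by
  have hG := smoothT_opG hg hφ
  have hp := polyGrowth_abs hβ0.le hβ2
  -- The outer `G` is moved onto `f`, which leaves a Fourier multiplier acting on the smooth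
  -- function `G φ`.
  rw [integral_mul_opG hg hf (h := fracD β (opG g φ)) (hG.continuous_fourierMult hp), fracD,
    hG.integral_mul_fourierMult hp (integrable_opG hg hf)]
  congr 1
  obtain ⟨B, hB, h⟩ := exists_locMat_absSymbol_le hg h1 hβ0 hβ2
  set K := ∫ x, ‖opG g f x‖
  have hs : Summable (Function.uncurry fun k l : ℤ =>
      fc φ (-k) * (locMat g k l * absSymbol β l * fc (opG g f) l)) := by
    have hs1 : Summable fun p : ℤ × ℤ =>
        B * K * (‖absSymbol β p.1 * fc φ (-p.1)‖ * ((1 + |(p.1 : ℝ) - p.2|) ^ 6)⁻¹) := by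
      refine Summable.mul_left _ ?_
      have h2 : Summable fun k => ‖absSymbol β k * fc φ (-k)‖ := by
        refine ((Equiv.neg ℤ).summable_iff.2 (hφ.summable_mult hp)).congr fun k => ?_
        simp [absSymbol_neg]
      have h3 := h2.mul_of_nonneg (summable_inv_pow (N := 6) (by norm_num))
        (fun _ => norm_nonneg _) (fun _ => by positivity)
      have h4 := (Equiv.summable_iff ((Equiv.refl ℤ).prodShear fun k => Equiv.subLeft k)).2 h3
      refine h4.congr fun p => ?_
      simp
    refine Summable.of_norm (hs1.of_nonneg_of_le (fun _ => norm_nonneg _) fun p => ?_)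
    simp only [Function.uncurry]
    rw [norm_mul, norm_mul _ (fc (opG g f) _), norm_mul (absSymbol β p.1), norm_absSymbol]
    calc _ ≤ ‖fc φ (-p.1)‖ * ((B * |(p.1 : ℝ)| ^ β * ((1 + |(p.1 : ℝ) - p.2|) ^ 6)⁻¹) * K) := by
          gcongr
          · exact h p.1 p.2
          · exact norm_fc_le _ _
      _ = _ := by ring
  calc _ = ∑' l, absSymbol β l * fc (opG g φ) (-l) * fc (opG g f) l := by
        rw [← (Equiv.neg ℤ).tsum_eq]
        refine tsum_congr fun l => ?_
        rw [Equiv.neg_apply, neg_neg, absSymbol_neg]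
    _ = ∑' l, ∑' k, fc φ (-k) * (locMat g k l * absSymbol β l * fc (opG g f) l) := by
        refine tsum_congr fun l => ?_
        rw [← (hasSum_fc_opG hg hφ.integrable (-l)).tsum_eq, ← (Equiv.neg ℤ).tsum_eq,
          ← tsum_mul_left, ← tsum_mul_right]
        refine tsum_congr fun k => ?_
        rw [Equiv.neg_apply, locMat_neg]
        ring
    _ = ∑' k, ∑' l, fc φ (-k) * (locMat g k l * absSymbol β l * fc (opG g f) l) := hs.tsum_comm
    _ = _ := by
        refine tsum_congr fun k => ?_
        rw [tsum_mul_left, tsum_locMat_fc_opG hg h1 hβ0 hβ2 hf]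

end Localisation

namespace Setting

variable (S : Setting)

/-- Polynomial growth in `k`, uniform on bounded sets of `ℓ²`, is all that is needed against the
rapidly decaying coefficients of a test function: it justifies exchanging sums and time integrals.
-/
lemma exists_rhs_le : ∃ A, 0 ≤ A ∧ ∀ (y : SqSum ℂ) (k : ℤ),
    ‖S.rhs y k‖ ≤ A * (‖y‖ + ‖y‖ ^ 2) * (1 + |(k : ℝ)|) ^ 4 := by
  have hs := summable_one_add_abs_rpow (r := 4) (by norm_num)
  set K := ∑' n : ℤ, (1 + |(n : ℝ)|) ^ (-4 : ℝ) with hK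
  have hK0 : 0 ≤ K := tsum_nonneg fun n => by positivity
  have hC := S.hC
  refine ⟨1 + S.C * K, by positivity, fun y k => ?_⟩
  have h1 := one_le_one_add_abs k
  have hy := norm_nonneg y
  have b1 : ‖-(Complex.I * dispSymbol S.α k) * y k‖ ≤ (1 + |(k : ℝ)|) ^ 4 * ‖y‖ := by
    have hd := norm_absSymbol_le (by linarith [S.hα1]) S.hα2 k
    rw [norm_absSymbol] at hd
    rw [norm_mul, norm_neg, norm_mul, Complex.norm_I, one_mul, Complex.norm_real, dispSymbol,
      norm_mul, Real.norm_eq_abs, Real.norm_of_nonneg (by positivity)]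
    refine mul_le_mul ?_ (norm_apply_le y k) (norm_nonneg _) (by positivity)
    calc |(k : ℝ)| * |(k : ℝ)| ^ S.α ≤ (1 + |(k : ℝ)|) * (1 + |(k : ℝ)|) ^ 2 := by
          gcongr; linarith
      _ = (1 + |(k : ℝ)|) ^ 3 := by ring
      _ ≤ _ := pow_le_pow_right₀ h1 (by norm_num)
  have b2 : ‖∑' j, S.a k j * y j‖ ≤ S.C * K * (1 + |(k : ℝ)|) ^ 4 * ‖y‖ := by
    have hsk := ((Equiv.subLeft k).summable_iff.2 hs).mul_left (S.C * |(k : ℝ)| ^ S.β * ‖y‖)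
    have h2 := tsum_of_norm_bounded hsk.hasSum (f := fun j => S.a k j * y j) fun j => by
      rw [norm_mul]
      calc _ ≤ (S.C * |(k : ℝ)| ^ S.β * (1 + |(k : ℝ) - j|) ^ (-4 : ℝ)) * ‖y‖ :=
            mul_le_mul (S.norm_le k j) (norm_apply_le y j) (norm_nonneg _) (by positivity)
        _ = _ := by
            simp only [Function.comp_apply, Equiv.subLeft_apply, Int.cast_sub]
            ring
    have eK : ∑' j, ((fun n : ℤ => (1 + |(n : ℝ)|) ^ (-4 : ℝ)) ∘ Equiv.subLeft k) j = K :=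
      (Equiv.subLeft k).tsum_eq fun n : ℤ => (1 + |(n : ℝ)|) ^ (-4 : ℝ)
    rw [tsum_mul_left, eK] at h2
    have h3 := norm_absSymbol_le S.β_pos.le (by linarith [S.hβ2, S.hα2] : S.β ≤ 2) k
    rw [norm_absSymbol] at h3
    calc _ ≤ S.C * |(k : ℝ)| ^ S.β * ‖y‖ * K := h2
      _ ≤ S.C * (1 + |(k : ℝ)|) ^ 4 * ‖y‖ * K := by
          gcongr
          exact h3.trans (pow_le_pow_right₀ h1 (by norm_num))
      _ = _ := by ring
  have b3 : ‖Complex.I * k * (2 * Real.pi : ℂ)⁻¹ * ∑' j, y j * y (k - j)‖ ≤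
      (1 + |(k : ℝ)|) ^ 4 * ‖y‖ ^ 2 := by
    have h2 := summable_mul_sqSum y y k
    have h3 := tsum_of_norm_bounded h2.hasSum (f := fun j => y j * y (k - j))
      fun j => (norm_mul _ _).le
    have h4 : ∑' j, ‖y j‖ * ‖y (k - j)‖ ≤ ‖y‖ ^ 2 := by
      have s1 := summable_norm_sq y
      have s2 := (Equiv.subLeft k).summable_iff.2 s1
      have e2 : ∑' j, ((fun j => ‖y j‖ ^ 2) ∘ Equiv.subLeft k) j = ∑' j, ‖y j‖ ^ 2 :=
        (Equiv.subLeft k).tsum_eq fun j => ‖y j‖ ^ 2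
      have := h2.tsum_le_tsum (fun j => ?_) ((s1.add s2).mul_left (1 / 2))
      · rw [tsum_mul_left, s1.tsum_add s2, e2, ← norm_sq_sqSum] at this
        linarith
      · simp only [Function.comp_apply, Equiv.subLeft_apply]
        nlinarith [sq_nonneg (‖y j‖ - ‖y (k - j)‖)]
    rw [norm_mul, norm_mul, norm_mul, Complex.norm_I, one_mul, Complex.norm_intCast,
      norm_two_pi_inv]
    refine mul_le_mul ?_ (h3.trans h4) (norm_nonneg _) (by positivity)
    calc |(k : ℝ)| * (2 * Real.pi)⁻¹ ≤ |(k : ℝ)| * 1 := by gcongr; exact two_pi_inv_le_one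
      _ ≤ 1 + |(k : ℝ)| := by linarith
      _ ≤ _ := le_self_pow₀ h1 (by norm_num)
  rw [rhs]
  refine (norm_add_le _ _).trans ((add_le_add ((norm_sub_le _ _).trans (add_le_add b1 b2)) b3).trans ?_)
  have h5 : 0 ≤ S.C * K * (1 + |(k : ℝ)|) ^ 4 * ‖y‖ ^ 2 := by positivity
  linarith

lemma summable_fc_mul_rhs {φ : Torus → ℂ} (hφ : SmoothT φ) :
    Summable fun k : ℤ => ‖fc φ (-k)‖ * (1 + |(k : ℝ)|) ^ 4 := by
  have hp : PolyGrowth fun k => (((1 + |(k : ℝ)|) ^ 4 : ℝ) : ℂ) := polyGrowth_of_le fun k => by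
    rw [Complex.norm_real, Real.norm_of_nonneg (by positivity)]
  refine ((Equiv.neg ℤ).summable_iff.2 (hφ.summable_mult hp)).congr fun k => ?_
  simp only [Function.comp_apply, Equiv.neg_apply, norm_mul, Complex.norm_real]
  rw [Real.norm_of_nonneg (by positivity), Int.cast_neg, abs_neg, mul_comm]

/-- The integrand of the weak formulation. -/
lemma weak_integrand {g : Torus → ℝ} (hg : SmoothT g) (h1 : ∫ x, g x = 1)
    (hS : S.a = dissMat g S.β) (f : L2T) {φ : Torus → ℂ} (hφ : SmoothT φ) :
    (∫ x, f x * fracDdx S.α φ x) - (∫ x, f x * opG g (fracD S.β (opG g φ)) x) -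
      (∫ x, f x ^ 2 * dx φ x) = (2 * Real.pi : ℂ)⁻¹ * ∑' k, fc φ (-k) * S.rhs (coef f) k := by
  have hα0 : 0 ≤ S.α := by linarith [S.hα1]
  have p1 := polyGrowth_abs_deriv hα0 S.hα2
  have i1 := integrable_L2T f
  have i2 := integrable_sq_L2T f
  rw [fracDdx, hφ.integral_mul_fourierMult p1 i1, dx,
    hφ.integral_mul_fourierMult polyGrowth_deriv i2,
    integral_mul_dissipation hg h1 S.β_pos (by linarith [S.hβ2, S.hα2]) i1 hφ, ← mul_sub, ← mul_sub]
  congr 1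
  have s1 : ∀ {m : ℤ → ℂ} (_ : PolyGrowth m) {F : Torus → ℂ},
      Summable fun k => m (-k) * fc φ (-k) * fc F k := fun {m} hm {F} => by
    refine (((Equiv.neg ℤ).summable_iff.2 (hφ.summable_mult hm)).mul_right
      (∫ x, ‖F x‖)).of_norm_bounded fun k => ?_
    rw [norm_mul]
    exact mul_le_mul_of_nonneg_left (norm_fc_le F k) (norm_nonneg _)
  have e1 : ∀ (m : ℤ → ℂ) (F : Torus → ℂ), ∑' k, m k * fc φ k * fc F (-k) =
      ∑' k, m (-k) * fc φ (-k) * fc F k := fun m F => by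
    rw [← (Equiv.neg ℤ).tsum_eq]
    exact tsum_congr fun k => by simp only [Equiv.neg_apply, neg_neg]
  obtain ⟨A, hA, hb⟩ := S.exists_rhs_le
  have s0 : Summable fun k => fc φ (-k) * S.rhs (coef f) k := by
    refine ((summable_fc_mul_rhs hφ).mul_right (A * (‖coef f‖ + ‖coef f‖ ^ 2))).of_norm_bounded
      fun k => ?_
    rw [norm_mul, mul_assoc]
    gcongr
    exact (hb _ k).trans_eq (by ring)
  have e2 : ∀ k, fc φ (-k) * ∑' n, dissMat g S.β k n * fc f n =
      absSymbol S.α (-k) * derivSymbol (-k) * fc φ (-k) * fc f k -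
      derivSymbol (-k) * fc φ (-k) * fc (fun x => f x ^ 2) k - fc φ (-k) * S.rhs (coef f) k := by
    intro k
    simp only [rhs, hS, coef_apply, fc_sq, absSymbol, derivSymbol, dispSymbol]
    push_cast
    rw [abs_neg]
    ring
  have q1 := s1 p1 (F := f)
  have q2 := s1 polyGrowth_deriv (F := fun x => f x ^ 2)
  rw [e1, e1, tsum_congr e2, (q1.sub q2).tsum_sub s0, q1.tsum_sub q2]
  ring

end Setting

/-! ### The Fourier transform in time -/

/-- The Fourier transform on `L²(ℝ)` commutes with bounded operators on the values. -/
lemma fourier_compLp {F G : Type*} [NormedAddCommGroup F] [InnerProductSpace ℂ F] [CompleteSpace F]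
    [NormedAddCommGroup G] [InnerProductSpace ℂ G] [CompleteSpace G] (A : F →L[ℂ] G)
    (u : Lp F 2 (volume : Measure ℝ)) : 𝓕 (A.compLp u) = A.compLp (𝓕 u) := by
  refine DenseRange.induction_on (p := fun u => 𝓕 (A.compLp u) = A.compLp (𝓕 u))
    (SchwartzMap.denseRange_toLpCLM (E := ℝ) (F := F) (p := 2) ENNReal.ofNat_ne_top) u ?_ fun f => ?_
  · exact isClosed_eq ((Lp.fourierTransformₗᵢ ℝ G).continuous.comp (A.compLpL 2 volume).continuous)
      ((A.compLpL 2 volume).continuous.comp (Lp.fourierTransformₗᵢ ℝ F).continuous)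
  · have e : ∀ f : SchwartzMap ℝ F, A.compLp (f.toLp 2) = (f.postcompCLM A).toLp 2 := fun f => by
      refine Lp.ext ?_
      filter_upwards [A.coeFn_compLp (f.toLp 2), f.coeFn_toLp 2, (f.postcompCLM A).coeFn_toLp 2]
        with x h1 h2 h3
      rw [h1, h2, h3, SchwartzMap.postcompCLM_apply]
    rw [SchwartzMap.toLpCLM_apply, e, SchwartzMap.toLp_fourier_eq, SchwartzMap.toLp_fourier_eq, e]
    congr 1
    ext x
    rw [SchwartzMap.postcompCLM_apply, SchwartzMap.fourier_coe, SchwartzMap.fourier_coe,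
      Real.fourier_eq, Real.fourier_eq, ← A.integral_comp_comm]
    · refine integral_congr_ae (ae_of_all _ fun v => ?_)
      simp only [SchwartzMap.postcompCLM_apply, Circle.smul_def, map_smul]
    · exact (Real.fourierIntegral_convergent_iff x).2 f.integrable

/-- The inversion formula for functions in `L²(ℝ)` with integrable Fourier transform. -/
lemma ae_eq_fourierInv (U : L2R) (hV : Integrable (𝓕 U : L2R)) :
    ∀ᵐ t, U t = (𝓕⁻ ((𝓕 U : L2R) : ℝ → ℂ) : ℝ → ℂ) t := by
  refine ae_eq_of_integral_contDiff_smul_eq ((Lp.memLp U).locallyIntegrable one_le_two)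
    (Continuous.locallyIntegrable ?_) fun g hg hgc => ?_
  · exact VectorFourier.fourierIntegral_continuous Real.continuous_fourierChar
      (by exact (continuous_inner.neg)) hV
  · have hg₁ : HasCompactSupport (Complex.ofRealCLM ∘ g) := hgc.comp_left rfl
    have hg₂ : ContDiff ℝ ∞ (Complex.ofRealCLM ∘ g) := by fun_prop
    set φ := hg₁.toSchwartzMap hg₂ with hφ
    have hφx : ∀ x, φ x = g x := fun x => rfl
    -- As a tempered distribution `U` is the inverse transform of `𝓕 U`. Since `𝓕 U` is integrable,
    -- the transform can be moved back from the test function by Fubini, and this identifies `U`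
    -- with the pointwise inverse transform.
    have h1 := Lp.fourierInv_toTemperedDistribution_eq (𝓕 U : L2R)
    rw [show 𝓕⁻ (𝓕 U : L2R) = U from Lp.instFourierPair.fourierInv_fourier_eq U] at h1
    have h2 := DFunLike.congr_fun h1 φ
    rw [TemperedDistribution.fourierInv_apply, Lp.toTemperedDistribution_apply,
      Lp.toTemperedDistribution_apply] at h2
    have h3 := VectorFourier.integral_fourierIntegral_smul_eq_flip (μ := volume) (ν := volume)
      (L := -innerₗ ℝ) Real.continuous_fourierChar (by exact continuous_inner.neg)
      φ.integrable hV
    have e4 : (-innerₗ ℝ).flip = -innerₗ ℝ := by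
      ext
      simp
    rw [e4] at h3
    have e5 : ∀ x, (𝓕⁻ φ : SchwartzMap ℝ ℂ) x = (𝓕⁻ (φ : ℝ → ℂ) : ℝ → ℂ) x := fun x => by
      rw [SchwartzMap.fourierInv_coe]
    simp_rw [e5] at h2
    have h4 := h2.symm.trans h3
    simp only [hφx, ← Complex.coe_smul] at h4 ⊢
    exact h4

lemma ae_div {p : ℝ → Prop} (h : ∀ᵐ ξ, p ξ) : ∀ᵐ τ : ℝ, p (τ / (2 * Real.pi)) := by
  have hq : Measure.QuasiMeasurePreserving (fun τ : ℝ => τ * (2 * Real.pi)⁻¹) volume volume := by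
    refine ⟨by fun_prop, ?_⟩
    rw [Real.map_volume_mul_right (inv_ne_zero Real.two_pi_pos.ne')]
    exact Measure.smul_absolutelyContinuous
  simpa only [div_eq_mul_inv] using hq.ae h

lemma lintegral_comp_two_pi_mul_le {F : ℝ → ENNReal} (hF : Measurable F) :
    ∫⁻ ξ, F (2 * Real.pi * ξ) ≤ ∫⁻ τ, F τ := by
  have h := lintegral_map (μ := volume) hF (measurable_const_mul (2 * Real.pi))
  rw [← h, Real.map_volume_mul_left Real.two_pi_pos.ne', lintegral_smul_measure]
  refine mul_le_of_le_one_left zero_le ?_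
  rw [ENNReal.ofReal_le_one, abs_of_pos (inv_pos.2 Real.two_pi_pos)]
  exact two_pi_inv_le_one

lemma ift_comp_div (V : ℝ → ℂ) (t : ℝ) :
    ift (fun τ => V (τ / (2 * Real.pi))) t = (𝓕⁻ V : ℝ → ℂ) t := by
  have h := Measure.integral_comp_div
    (fun ξ : ℝ => Complex.exp ((2 * Real.pi * (ξ * t) : ℝ) * Complex.I) * V ξ) (2 * Real.pi)
  rw [Real.fourierInv_eq', ift]
  have e : ∀ τ : ℝ, Complex.exp ((2 * Real.pi * (τ / (2 * Real.pi) * t) : ℝ) * Complex.I) =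
      Complex.exp ((t * τ : ℝ) * Complex.I) := fun τ => by
    congr 3
    have := Real.pi_ne_zero
    field_simp
  simp_rw [e] at h
  rw [h, abs_of_pos Real.two_pi_pos, Complex.real_smul, ← mul_assoc]
  push_cast
  rw [inv_mul_cancel₀ (by exact_mod_cast Real.two_pi_pos.ne'), one_mul]
  refine integral_congr_ae (ae_of_all _ fun ξ => ?_)
  simp only [RCLike.inner_apply, conj_trivial, smul_eq_mul]
  push_cast
  ring_nf

/-! ### Fourier coefficients of functions of space and time -/

/-- The Fourier coefficient as a functional. -/
def coefAt (k : ℤ) : L2T →L[ℂ] ℂ := innerSL ℂ (expT k)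

lemma coefAt_apply (k : ℤ) (f : L2T) : coefAt k f = fc f k := inner_expT k f

/-- One Fourier coefficient of a function of space and time. -/
def slice (k : ℤ) : L2L2 →L[ℂ] L2R := (coefAt k).compLpL 2 volume

lemma slice_ae (k : ℤ) (u : L2L2) : ∀ᵐ t, slice k u t = fc (u t) k := by
  filter_upwards [(coefAt k).coeFn_compLpL u] with t ht
  rw [← coefAt_apply]
  exact ht

lemma slice_fourier (k : ℤ) (u : L2L2) : slice k (𝓕 u) = 𝓕 (slice k u) :=
  (fourier_compLp (coefAt k) u).symm

lemma stFourier_ae (k : ℤ) (u : L2L2) :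
    ∀ᵐ τ, stFourier u k τ = slice k (𝓕 u) (τ / (2 * Real.pi)) := by
  filter_upwards [ae_div (slice_ae k (𝓕 u))] with τ hτ
  rw [hτ, stFourier]

lemma fc_ae_eq_ift {k : ℤ} {u : L2L2} (h : Integrable (stFourier u k)) :
    ∀ᵐ t, fc (u t) k = ift (stFourier u k) t := by
  have h1 : Integrable (slice k (𝓕 u) : L2R) :=
    (integrable_comp_div_iff _ Real.two_pi_pos.ne').1 (h.congr (stFourier_ae k u))
  have h2 := ae_eq_fourierInv (slice k u) (by rw [← slice_fourier]; exact h1)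
  filter_upwards [slice_ae k u, h2] with t h3 h4
  rw [← h3, h4, ift_congr_ae (stFourier_ae k u), ← slice_fourier, ← ift_comp_div]

lemma Exps.zWeight_eq (E : Exps) (k : ℤ) (τ : ℝ) : zWeight E.α E.β E.b k τ = (E.W₀ k).w τ := by
  have hb := E.hb
  have h1 : ¬|E.b| < 1 / 2 := by
    rw [abs_of_pos (by linarith)]
    linarith
  rw [zWeight, if_neg h1, Real.sign_of_pos (by linarith), one_mul]
  show _ = √(bracket k ^ E.β) * bracket ((τ + dispSymbol E.α k) / bracket k ^ E.β) ^ E.b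
  rw [Real.sqrt_eq_rpow, ← Real.rpow_mul (bracket_pos _).le]
  congr 2
  ring

section Representation

variable {E : Exps} {u : L2L2} {h : SqSum L2R}

lemma zNorm_eq (h0 : h 0 = 0)
    (hh : ∀ k ≠ 0, h k =ᵐ[volume] fun τ => ((E.W₀ k).w τ : ℂ) * stFourier u k τ) :
    zNorm E.α E.β E.b u = ‖h‖ₑ := by
  have e1 : ∀ k : {k : ℤ // k ≠ 0}, ∫⁻ τ : ℝ,
      (ENNReal.ofReal (zWeight E.α E.β E.b k τ) * ‖stFourier u k τ‖ₑ) ^ 2 = ‖h k‖ₑ ^ 2 := by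
    intro k
    rw [enorm_sq_L2R]
    refine lintegral_congr_ae ?_
    filter_upwards [hh k k.2] with τ hτ
    rw [hτ, enorm_mul, enorm_ofReal, Real.enorm_of_nonneg ((E.W₀ k).w_pos τ).le, E.zWeight_eq]
  have e2 : ∑' k : {k : ℤ // k ≠ 0}, ‖h k‖ₑ ^ 2 = ‖h‖ₑ ^ 2 := by
    rw [enorm_sq_sqSum]
    refine (tsum_subtype {k : ℤ | k ≠ 0} fun k => ‖h k‖ₑ ^ 2).trans (tsum_congr fun k => ?_)
    rcases eq_or_ne k 0 with rfl | hk
    · simp [h0]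
    · rw [indicator_of_mem (by exact hk)]
  rw [zNorm, tsum_congr e1, e2, ← ENNReal.rpow_natCast, ← ENNReal.rpow_mul]
  norm_num

lemma ae_eq_synth (h0 : h 0 = 0) (hu : MeanZeroAE u)
    (hh : ∀ k ≠ 0, h k =ᵐ[volume] fun τ => ((E.W₀ k).w τ : ℂ) * stFourier u k τ) :
    ∀ᵐ t, u t = synth (E.ev t h) := by
  have hk : ∀ k, ∀ᵐ t, fc (u t) k = val E.W₀ h k t := by
    intro k
    rcases eq_or_ne k 0 with rfl | hk
    · filter_upwards [hu] with t ht
      rw [ht, val_eq_zero _ h0]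
    · have hr := (E.W₀ k).raw_eq_of_ae (hh k hk)
      filter_upwards [fc_ae_eq_ift (((E.W₀ k).integrable_raw (h k)).congr hr)] with t ht
      rw [ht, ← ift_congr_ae hr, ← (E.W₀ k).ev_eq]
      rfl
  filter_upwards [ae_all_iff.2 hk] with t ht
  refine coef_injective (lp.ext (funext fun k => ?_))
  rw [coef_synth, coef_apply, ht, E.ev_apply]

/-- The weighted transforms are the representing sequence. The norm does not see the frequency zero,
so that entry is set to zero; this is consistent because `u` has zero mean. -/
lemma Exps.exists_of_zNorm_lt (E : Exps) {u : L2L2} (hu : MeanZeroAE u)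
    (hz : zNorm E.α E.β E.b u < ⊤) :
    ∃ h : SqSum L2R, h 0 = 0 ∧ ‖h‖ₑ = zNorm E.α E.β E.b u ∧ ∀ᵐ t, u t = synth (E.ev t h) := by
  have hz2 : ∑' k : {k : ℤ // k ≠ 0}, ∫⁻ τ : ℝ,
      (ENNReal.ofReal (zWeight E.α E.β E.b k τ) * ‖stFourier u k τ‖ₑ) ^ 2 < ⊤ := by
    rw [zNorm] at hz
    exact (ENNReal.rpow_lt_top_iff_of_pos (by norm_num)).1 hz
  have e1 : ∀ (k : ℤ) (τ : ℝ), ‖((E.W₀ k).w τ : ℂ) * stFourier u k τ‖ₑ =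
      ENNReal.ofReal (zWeight E.α E.β E.b k τ) * ‖stFourier u k τ‖ₑ := fun k τ => by
    rw [enorm_mul, enorm_ofReal, Real.enorm_of_nonneg ((E.W₀ k).w_pos τ).le, E.zWeight_eq]
  have hm : ∀ k : {k : ℤ // k ≠ 0},
      MemLp (fun τ => ((E.W₀ k).w τ : ℂ) * stFourier u k τ) 2 := by
    intro k
    refine memLp_two_of_lintegral ?_ ?_
    · refine (Complex.continuous_ofReal.comp (E.W₀ k).continuous_w).aestronglyMeasurable.mul ?_
      refine AEStronglyMeasurable.congr ?_ ((stFourier_ae k u).mono fun τ h => h.symm)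
      exact ((measurable_L2R _).comp (measurable_id.div_const _)).aestronglyMeasurable
    · simp_rw [e1]
      exact (ENNReal.le_tsum k).trans_lt hz2
  set f : ℤ → L2R := fun k => if hk : k ≠ 0 then (hm ⟨k, hk⟩).toLp _ else 0 with hf
  have f0 : f 0 = 0 := by simp [hf]
  have fk : ∀ k (hk : k ≠ 0), f k = (hm ⟨k, hk⟩).toLp _ := fun k hk => by simp only [hf, dif_pos hk]
  have hs : ∑' k, ‖f k‖ₑ ^ 2 < ⊤ := by
    refine lt_of_eq_of_lt ?_ hz2
    have : ∀ k : {k : ℤ // k ≠ 0}, ∫⁻ τ : ℝ,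
        (ENNReal.ofReal (zWeight E.α E.β E.b k τ) * ‖stFourier u k τ‖ₑ) ^ 2 = ‖f k‖ₑ ^ 2 := by
      intro k
      rw [fk k k.2, enorm_toLp_sq]
      simp_rw [e1]
    rw [tsum_congr this]
    refine Eq.trans (tsum_congr fun k => ?_) (tsum_subtype {k : ℤ | k ≠ 0} fun k => ‖f k‖ₑ ^ 2).symm
    rcases eq_or_ne k 0 with rfl | hk
    · simp [f0]
    · rw [indicator_of_mem (by exact hk)]
  have hh : ∀ k ≠ 0, (⟨f, memℓp_two_of_tsum hs⟩ : SqSum L2R) k =ᵐ[volume]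
      fun τ => ((E.W₀ k).w τ : ℂ) * stFourier u k τ := fun k hk => by
    show f k =ᵐ[volume] _
    rw [fk k hk]
    exact (hm ⟨k, hk⟩).coeFn_toLp
  exact ⟨⟨f, memℓp_two_of_tsum hs⟩, f0, (zNorm_eq f0 hh).symm, ae_eq_synth f0 hu hh⟩

end Representation

/-! ### Synthesis of functions of space and time -/

/-- The inclusion of functions of time as multiples of one exponential. -/
def slot (k : ℤ) : L2R →ₗᵢ[ℂ] L2L2 where
  toLinearMap := ((ContinuousLinearMap.toSpanSingleton ℂ (unitExp k)).compLpL 2 volume).toLinearMap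
  norm_map' V := by
    have h := (ContinuousLinearMap.toSpanSingleton ℂ (unitExp k)).coeFn_compLpL V
    have hn : ∀ᵐ t, ‖(ContinuousLinearMap.toSpanSingleton ℂ (unitExp k)).compLpL 2 volume V t‖ =
        ‖V t‖ := by
      filter_upwards [h] with t ht
      rw [ht, ContinuousLinearMap.toSpanSingleton_apply, norm_smul, orthonormal_unitExp.1 k, mul_one]
    exact le_antisymm (Lp.norm_le_norm_of_ae_le (hn.mono fun _ h => h.le))
      (Lp.norm_le_norm_of_ae_le (hn.mono fun _ h => h.ge))

lemma slot_ae (k : ℤ) (V : L2R) : ∀ᵐ t, slot k V t = V t • unitExp k :=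
  (ContinuousLinearMap.toSpanSingleton ℂ (unitExp k)).coeFn_compLpL V

lemma orthogonalFamily_slot : OrthogonalFamily ℂ (fun _ : ℤ => L2R) slot := by
  intro i j hij V W
  rw [L2.inner_def]
  refine integral_eq_zero_of_ae ?_
  filter_upwards [slot_ae i V, slot_ae j W] with t h1 h2
  rw [h1, h2, inner_smul_left, inner_smul_right, orthonormal_unitExp.2 hij, mul_zero, mul_zero]
  rfl

lemma slice_slot (j k : ℤ) (V : L2R) : slice j (slot k V) = if j = k then (rootLen : ℂ) • V else 0 := by
  have h0 : ∀ z : ℂ, coefAt j (z • unitExp k) = if j = k then (rootLen : ℂ) * z else 0 := by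
    intro z
    have h1 := orthonormal_iff_ite.1 orthonormal_unitExp j k
    rw [inner_unitExp] at h1
    rw [map_smul, coefAt_apply, (inv_mul_eq_iff_eq_mul₀ rootLen_ne).1 h1, smul_eq_mul]
    split_ifs <;> ring
  refine Lp.ext ?_
  filter_upwards [(coefAt j).coeFn_compLpL (slot k V), slot_ae k V,
    Lp.coeFn_smul (rootLen : ℂ) V, Lp.coeFn_zero ℂ 2 (volume : Measure ℝ)] with t h1 h2 h3 h4
  rw [slice, h1, h2, h0]
  split_ifs
  · rw [h3]; rfl
  · rw [h4]; rfl

/-- A function with given square-summable Fourier coefficients. -/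
lemma exists_slice_eq {V : ℤ → L2R} (hV : Summable fun k => ‖V k‖ ^ 2) :
    ∃ u : L2L2, ∀ k, slice k u = V k := by
  have hs : Summable fun k => slot k ((rootLen : ℂ)⁻¹ • V k) := by
    rw [orthogonalFamily_slot.summable_iff_norm_sq_summable]
    refine (hV.mul_left (‖(rootLen : ℂ)⁻¹‖ ^ 2)).congr fun k => ?_
    rw [norm_smul, mul_pow]
  refine ⟨∑' k, slot k ((rootLen : ℂ)⁻¹ • V k), fun j => ?_⟩
  have h1 := hs.hasSum.mapL (slice j)
  have h2 : HasSum (fun k => slice j (slot k ((rootLen : ℂ)⁻¹ • V k))) (V j) := by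
    convert hasSum_single j fun k hk => ?_ using 1
    · rw [slice_slot, if_pos rfl, smul_inv_smul₀ rootLen_ne]
    · rw [slice_slot, if_neg hk.symm]
  exact h1.unique h2

/-- The function of the frequency that a weighted function stands for, in the normalisation of
`𝓕`. -/
lemma Wgt.exists_rescaled (W : Wgt) (hl : 1 ≤ W.lam) (h : L2R) :
    ∃ V : L2R, ‖V‖ ≤ ‖h‖ ∧ ∀ᵐ τ, V (τ / (2 * Real.pi)) = W.raw h τ := by
  have hw : ∀ τ, (W.w τ)⁻¹ ≤ 1 := fun τ => inv_le_one_of_one_le₀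
    ((Real.one_le_sqrt.2 hl).trans (sqrt_le_wt W.b_nonneg τ))
  have hm : Measurable (W.raw h) :=
    (Complex.measurable_ofReal.comp W.continuous_inv_w.measurable).mul (measurable_L2R h)
  have hle : ∫⁻ ξ, ‖W.raw h (2 * Real.pi * ξ)‖ₑ ^ 2 ≤ ‖h‖ₑ ^ 2 := by
    rw [enorm_sq_L2R]
    refine (lintegral_comp_two_pi_mul_le (hm.enorm.pow_const 2)).trans (lintegral_mono fun τ => ?_)
    gcongr
    rw [Wgt.raw, ← ofReal_norm, ← ofReal_norm, norm_mul, Complex.norm_real,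
      Real.norm_of_nonneg (inv_pos.2 (W.w_pos τ)).le]
    exact ENNReal.ofReal_le_ofReal (mul_le_of_le_one_left (norm_nonneg _) (hw τ))
  have hM : MemLp (fun ξ => W.raw h (2 * Real.pi * ξ)) 2 :=
    memLp_two_of_lintegral (hm.comp (measurable_const_mul _)).aestronglyMeasurable
      (hle.trans_lt (by simp))
  refine ⟨hM.toLp _, ?_, ?_⟩
  · rw [← enorm_toLp_sq hM] at hle
    rw [← toReal_enorm, ← toReal_enorm]
    exact ENNReal.toReal_mono (by simp) ((ENNReal.pow_le_pow_left_iff two_ne_zero).1 hle)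
  · filter_upwards [ae_div hM.coeFn_toLp] with τ hτ
    rw [hτ, mul_div_cancel₀ _ Real.two_pi_pos.ne']

namespace Exps

variable (E : Exps)

/-- The converse representation. The weights are at least one, so the unweighted transforms are
square summable; the function is assembled on the side of the time frequency and then transformed
back. -/
lemma exists_zNorm_lt (h : SqSum L2R) (h0 : h 0 = 0) :
    ∃ u : L2L2, MeanZeroAE u ∧ zNorm E.α E.β E.b u < ⊤ ∧ ∀ᵐ t, u t = synth (E.ev t h) := by
  choose V hV1 hV2 using fun k => (E.W₀ k).exists_rescaled (E.one_le_lam k) (h k)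
  obtain ⟨v, hv⟩ := exists_slice_eq (V := V) ((summable_norm_sq h).of_nonneg_of_le
    (fun k => by positivity) fun k => by gcongr; exact hV1 k)
  set u : L2L2 := 𝓕⁻ v with hu
  have hFu : 𝓕 u = v := Lp.instFourierPairInv.fourier_fourierInv_eq v
  have hst : ∀ k, stFourier u k =ᵐ[volume] (E.W₀ k).raw (h k) := fun k => by
    filter_upwards [stFourier_ae k u, hV2 k] with τ h1 h2
    rw [h1, hFu, hv, h2]
  have hh : ∀ k ≠ 0, h k =ᵐ[volume] fun τ => ((E.W₀ k).w τ : ℂ) * stFourier u k τ := by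
    intro k _
    filter_upwards [hst k] with τ hτ
    have hw := ((E.W₀ k).w_pos τ).ne'
    rw [hτ, Wgt.raw, ← mul_assoc, ← Complex.ofReal_mul, mul_inv_cancel₀ hw, Complex.ofReal_one,
      one_mul]
  have hz : MeanZeroAE u := by
    have h1 : V 0 = 0 := norm_le_zero_iff.1 ((hV1 0).trans (by rw [h0, norm_zero]))
    have h2 : slice 0 u = 0 := by
      refine (Lp.fourierTransformₗᵢ ℝ ℂ).map_eq_zero_iff.1 ?_
      show 𝓕 (slice 0 u) = 0
      rw [← slice_fourier, hFu, hv, h1]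
    filter_upwards [slice_ae 0 u, Lp.coeFn_zero ℂ 2 (volume : Measure ℝ)] with t h3 h4
    rw [← h3, h2, h4]
    rfl
  exact ⟨u, hz, by rw [zNorm_eq h0 hh]; simp, ae_eq_synth h0 hz hh⟩

lemma norm_ev_le (t : ℝ) (h : SqSum L2R) : ‖E.ev t h‖ ≤ evBound E.b * ‖h‖ :=
  norm_evSeq_le _ _ _ _

/-- The evaluations are bounded uniformly in `t`, so finite truncations of `h` give a uniform
approximation by continuous functions. -/
lemma continuous_ev (h : SqSum L2R) : Continuous fun t => E.ev t h := by
  refine continuous_of_uniform_approx_of_continuous fun U hU => ?_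
  obtain ⟨ε, hε, hεU⟩ := Metric.mem_uniformity_dist.1 hU
  have hB := evBound_nonneg E.b
  have hs := lp.hasSum_single (p := 2) (by norm_num) h
  obtain ⟨s, hs⟩ := ((Metric.tendsto_nhds.1 hs) (ε / (evBound E.b + 1)) (by positivity)).exists
  refine ⟨fun t => E.ev t (∑ k ∈ s, lp.single 2 k (h k)), ?_, fun t => hεU ?_⟩
  · simp_rw [map_sum]
    refine continuous_finsetSum _ fun k _ => ?_
    have e : ∀ t, E.ev t (lp.single 2 k (h k)) = lp.single 2 k (val E.W₀ h k t) := by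
      intro t
      refine lp.ext (funext fun j => ?_)
      rw [E.ev_apply, val, lp.single_apply, lp.single_apply]
      rcases eq_or_ne j k with rfl | hj
      · simp [val]
      · simp [Pi.single_eq_of_ne hj]
    simp_rw [e]
    exact (lp.isometry_single k).continuous.comp (continuous_val E.W₀ h k)
  · rw [dist_comm, dist_eq_norm] at hs
    rw [dist_eq_norm, ← map_sub]
    calc _ ≤ evBound E.b * ‖h - ∑ k ∈ s, lp.single 2 k (h k)‖ := E.norm_ev_le _ _
      _ ≤ evBound E.b * (ε / (evBound E.b + 1)) := by gcongr
      _ < (evBound E.b + 1) * (ε / (evBound E.b + 1)) := by gcongr; linarith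
      _ = ε := by field_simp

lemma continuous_synth_ev (h : SqSum L2R) : Continuous fun t => synth (E.ev t h) :=
  synth.continuous.comp (E.continuous_ev h)

lemma memZT {T : ℝ} {v : ℝ → L2T} (h : SqSum L2R) (h0 : h 0 = 0)
    (hv : ∀ t ∈ Icc 0 T, v t = synth (E.ev t h)) : MemZT E.α E.β E.b T v := by
  obtain ⟨u, h1, h2, h3⟩ := E.exists_zNorm_lt h h0
  refine lt_of_le_of_lt (iInf₂_le u ⟨h1, ?_⟩) h2
  filter_upwards [ae_restrict_of_ae h3, ae_restrict_mem measurableSet_Icc] with t h4 h5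
  rw [h4, hv t h5]

lemma eqOn_of_ae_eq {T : ℝ} (hT : 0 < T) {v w : ℝ → L2T} (hv : ContinuousOn v (Icc 0 T))
    (hw : ContinuousOn w (Icc 0 T)) (h : ∀ᵐ t ∂(volume.restrict (Icc 0 T)), v t = w t) :
    ∀ t ∈ Icc 0 T, v t = w t :=
  Measure.eqOn_Icc_of_ae_eq volume hT.ne h hv hw

lemma exists_of_memZT {T : ℝ} (hT : 0 < T) {v : ℝ → L2T} (hv : MemZT E.α E.β E.b T v)
    (hc : ContinuousOn v (Icc 0 T)) :
    ∃ h : SqSum L2R, h 0 = 0 ∧ ∀ t ∈ Icc 0 T, v t = synth (E.ev t h) := by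
  obtain ⟨u, ⟨h1, h2⟩, h3⟩ := by
    simpa only [MemZT, zTNorm, iInf_lt_iff, exists_prop] using hv
  obtain ⟨h, h4, _, h5⟩ := E.exists_of_zNorm_lt h1 h3
  refine ⟨h, h4, eqOn_of_ae_eq hT hc (E.continuous_synth_ev h).continuousOn ?_⟩
  filter_upwards [h2, ae_restrict_of_ae h5] with t h6 h7
  rw [← h6, h7]

/-- The embedding into the continuous functions. -/
lemma exists_continuous {T : ℝ} (hT : 0 < T) {v : ℝ → L2T} (hv : MemZT E.α E.β E.b T v) :
    ∃ w : ℝ → L2T, ContinuousOn w (Icc 0 T) ∧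
      (∀ᵐ t ∂(volume.restrict (Icc 0 T)), w t = v t) ∧
      ∀ t ∈ Icc 0 T, ‖w t‖ₑ ≤
        ENNReal.ofReal (rootLen⁻¹ * evBound E.b + 1) * zTNorm E.α E.β E.b T v := by
  have hC : 0 ≤ rootLen⁻¹ * evBound E.b :=
    mul_nonneg (inv_nonneg.2 rootLen_pos.le) (evBound_nonneg _)
  have key : ∀ u : L2L2, MeanZeroAE u → (∀ᵐ t ∂(volume.restrict (Icc 0 T)), u t = v t) →
      zNorm E.α E.β E.b u < ⊤ → ∃ w : ℝ → L2T, ContinuousOn w (Icc 0 T) ∧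
        (∀ᵐ t ∂(volume.restrict (Icc 0 T)), w t = v t) ∧
        ∀ t, ‖w t‖ₑ ≤ ENNReal.ofReal (rootLen⁻¹ * evBound E.b + 1) * zNorm E.α E.β E.b u := by
    intro u h1 h2 h3
    obtain ⟨h, _, h4, h5⟩ := E.exists_of_zNorm_lt h1 h3
    refine ⟨fun t => synth (E.ev t h), (E.continuous_synth_ev h).continuousOn, ?_, fun t => ?_⟩
    · filter_upwards [h2, ae_restrict_of_ae h5] with t h6 h7
      rw [← h6, h7]
    · rw [← h4, ← ofReal_norm, ← ofReal_norm, ← ENNReal.ofReal_mul (by positivity), norm_synth]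
      refine ENNReal.ofReal_le_ofReal ?_
      rw [add_mul, mul_assoc]
      exact le_add_of_le_of_nonneg
        (mul_le_mul_of_nonneg_left (E.norm_ev_le t h) (inv_nonneg.2 rootLen_pos.le)) (by positivity)
  obtain ⟨u, ⟨h1, h2⟩, h3⟩ := by
    simpa only [MemZT, zTNorm, iInf_lt_iff, exists_prop] using hv
  obtain ⟨w, hw1, hw2, -⟩ := key u h1 h2 h3
  refine ⟨w, hw1, hw2, fun t ht => ?_⟩
  -- The summand `1` makes the constant positive, so that one can divide by it and compare with the
  -- infimum.
  have hc0 : ENNReal.ofReal (rootLen⁻¹ * evBound E.b + 1) ≠ 0 :=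
    (ENNReal.ofReal_pos.2 (by positivity)).ne'
  rw [mul_comm (ENNReal.ofReal _), ← ENNReal.div_le_iff_le_mul (Or.inl hc0) (Or.inl ENNReal.ofReal_ne_top), zTNorm]
  -- Each extension has its own continuous representative. On `[0,T]` they agree almost everywhere,
  -- hence everywhere, so the one function `w` obeys the bound of every extension and therefore that
  -- of the infimum.
  refine le_iInf₂ fun u' hu' => ?_
  rw [ENNReal.div_le_iff_le_mul (Or.inl hc0) (Or.inl ENNReal.ofReal_ne_top)]
  rcases eq_or_ne (zNorm E.α E.β E.b u') ⊤ with h | h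
  · rw [h, ENNReal.top_mul hc0]
    exact le_top
  · obtain ⟨w', hw1', hw2', hw3'⟩ := key u' hu'.1 hu'.2 (lt_top_iff_ne_top.2 h)
    have e := eqOn_of_ae_eq hT hw1 hw1' (by
      filter_upwards [hw2, hw2'] with s h1 h2
      rw [h1, h2]) t ht
    rw [e]
    exact (hw3' t).trans_eq (mul_comm _ _)

end Exps

/-! ### Weak solutions -/

namespace Setting

variable {S : Setting} {g : Torus → ℝ} {T : ℝ}

/-- The equations of the Fourier coefficients of a weak solution. -/
lemma solves_of_isSolution (hg : SmoothT g) (h1 : ∫ x, g x = 1) (hS : S.a = dissMat g S.β)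
    {v₀ : L2T} {v : ℝ → L2T} (hv : IsSolution S.α S.β g T v₀ v) :
    S.Solves T (coef v₀) fun k t => coef (v t) k := by
  intro k t ht
  -- Testing with `e^{-ikx}` isolates the `k`-th coefficient.
  have hφ := smoothT_fourier (-k)
  have h := hv.weak _ hφ t ht
  have e : ∀ f : L2T, ∫ x, f x * fourier (-k) x = coef f k := fun f => (coef_apply f k).symm
  have e2 : ∀ f : L2T, (2 * Real.pi : ℂ)⁻¹ * ∑' j, fc (fourier (-k)) (-j) * S.rhs (coef f) j =
      S.rhs (coef f) k := fun f => by
    rw [tsum_eq_single k fun j hj => by rw [fc_fourier, if_neg (by simpa using hj.symm), zero_mul],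
      fc_fourier, if_pos rfl, ← mul_assoc,
      inv_mul_cancel₀ (by exact_mod_cast Real.two_pi_pos.ne'), one_mul]
  simp_rw [S.weak_integrand hg h1 hS _ hφ, e, e2] at h
  exact h

lemma Sol.of_isSolution (hg : SmoothT g) (h1 : ∫ x, g x = 1) (hS : S.a = dissMat g S.β)
    (hT : 0 < T) {v₀ : L2T} {v : ℝ → L2T} (hv : IsSolution S.α S.β g T v₀ v)
    (hZ : MemZT S.α S.β S.b T v) :
    ∃ h, S.Sol T (coef v₀) h ∧ ∀ t ∈ Icc 0 T, v t = synth (S.ev t h) := by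
  obtain ⟨h, h0, hh⟩ := S.exists_of_memZT hT hZ hv.continuousOn
  have e : ∀ t ∈ Icc 0 T, ∀ k, coef (v t) k = val S.W₀ h k t := fun t ht k => by
    rw [hh t ht, coef_synth, S.ev_apply]
  refine ⟨h, ⟨h0, fun k t ht => ?_⟩, hh⟩
  refine (e t ht k).symm.trans ((solves_of_isSolution hg h1 hS hv k t ht).trans ?_)
  refine congrArg (coef v₀ k + ·) ?_
  refine intervalIntegral.integral_congr fun s hs => ?_
  rw [uIcc_of_le ht.1] at hs
  simp only [e s ⟨hs.1, hs.2.trans ht.2⟩]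

/-- A solution of the system of Fourier coefficients is a weak solution. -/
lemma Sol.isSolution (hg : SmoothT g) (h1 : ∫ x, g x = 1) (hS : S.a = dissMat g S.β)
    (hT : 0 < T) {v₀ : L2T} {h : SqSum L2R} (H : S.Sol T (coef v₀) h) :
    IsSolution S.α S.β g T v₀ fun t => synth (S.ev t h) where
  continuousOn := (S.continuous_synth_ev h).continuousOn
  initial := by rw [H.ev_zero hT.le, synth_coef]
  weak φ hφ t ht := by
    obtain ⟨A, hA, hb⟩ := S.exists_rhs_le
    have hB := evBound_nonneg S.b
    set M := evBound S.b * ‖h‖ with hM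
    have hsum : ∀ y : SqSum ℂ, Summable fun k => fc φ (-k) * y k := fun y => by
      refine ((summable_fc_mul_rhs hφ).mul_right ‖y‖).of_norm_bounded fun k => ?_
      rw [norm_mul, mul_assoc]
      gcongr
      refine (norm_apply_le y k).trans (le_mul_of_one_le_left (norm_nonneg _) ?_)
      exact one_le_pow₀ (one_le_one_add_abs k)
    have e1 : ∀ f : L2T, ∫ x, f x * φ x = (2 * Real.pi : ℂ)⁻¹ * ∑' k, fc φ (-k) * coef f k := by
      intro f
      rw [hφ.integral_mul (integrable_L2T f), ← (Equiv.neg ℤ).tsum_eq]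
      simp only [Equiv.neg_apply, neg_neg, coef_apply]
    -- The weak formulation is the sum of the scalar equations against the coefficients of `φ`;
    -- their decay dominates the sum uniformly in time.
    have h3 := intervalIntegral.hasSum_integral_of_dominated_convergence (μ := volume) (a := 0)
      (b := t) (F := fun k s => fc φ (-k) * S.rhs (S.ev s h) k)
      (f := fun s => ∑' k, fc φ (-k) * S.rhs (S.ev s h) k)
      (fun k _ => ‖fc φ (-k)‖ * (1 + |(k : ℝ)|) ^ 4 * (A * (M + M ^ 2)))
      (fun k => (continuous_const.mul (S.continuous_rhs_val h k)).aestronglyMeasurable)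
      (fun k => ae_of_all _ fun s _ => ?_) (ae_of_all _ fun s _ => (summable_fc_mul_rhs hφ).mul_right _)
      intervalIntegrable_const (ae_of_all _ fun s _ => ?_)
    · have h4 : ∀ k, ∫ s in (0 : ℝ)..t, fc φ (-k) * S.rhs (S.ev s h) k =
          fc φ (-k) * S.ev t h k - fc φ (-k) * coef v₀ k := fun k => by
        rw [intervalIntegral.integral_const_mul, ← mul_sub, S.ev_apply, H.solves k t ht,
          add_sub_cancel_left]
        rfl
      simp_rw [S.weak_integrand hg h1 hS _ hφ, e1, coef_synth]
      rw [intervalIntegral.integral_const_mul, ← h3.tsum_eq, tsum_congr h4,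
        (hsum _).tsum_sub (hsum _)]
      ring
    · rw [norm_mul, mul_assoc]
      gcongr
      refine (hb _ k).trans ?_
      have h5 : ‖S.ev s h‖ ≤ M := S.norm_ev_le s h
      calc _ ≤ A * (M + M ^ 2) * (1 + |(k : ℝ)|) ^ 4 := by gcongr
        _ = _ := mul_comm _ _
    · refine Summable.hasSum (((summable_fc_mul_rhs hφ).mul_right (A * (M + M ^ 2))).of_norm_bounded
        fun k => ?_)
      rw [norm_mul, mul_assoc]
      gcongr
      refine (hb _ k).trans ?_
      have h5 : ‖S.ev s h‖ ≤ M := S.norm_ev_le s h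
      calc _ ≤ A * (M + M ^ 2) * (1 + |(k : ℝ)|) ^ 4 := by gcongr
        _ = _ := mul_comm _ _

lemma isRealValued_synth {y : SqSum ℂ} (hy : RealSeq y) : IsRealValued (synth y) := by
  rw [isRealValued_iff, coef_synth]
  exact hy.conj

/-- Existence, uniqueness and reality of the solution. -/
theorem exists_unique_solution (hg : SmoothT g) (h1 : ∫ x, g x = 1) (hS : S.a = dissMat g S.β)
    (hT : 0 < T) {v₀ : L2T} (hr : IsRealValued v₀) (hm : IsMeanZero v₀) :
    ∃ v : ℝ → L2T, MemZT S.α S.β S.b T v ∧ IsSolution S.α S.β g T v₀ v ∧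
      (∀ t ∈ Icc 0 T, IsRealValued (v t)) ∧
      ∀ w : ℝ → L2T, MemZT S.α S.β S.b T w → IsSolution S.α S.β g T v₀ w →
        ∀ t ∈ Icc 0 T, w t = v t := by
  obtain ⟨h, H, hh⟩ := S.exists_global (realSeq_coef hr hm) T
  refine ⟨fun t => synth (S.ev t h), S.memZT h H.zero fun _ _ => rfl,
    H.isSolution hg h1 hS hT, fun t ht => isRealValued_synth (hh t ht).1, fun w hwZ hw t ht => ?_⟩
  obtain ⟨h', H', e⟩ := Sol.of_isSolution hg h1 hS hT hw hwZ
  rw [e t ht, Sol.ev_congr fun k => H'.unique H k t ht]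

/-- The solution map is uniformly continuous on bounded sets. -/
theorem uniformContinuous_solution (hg : SmoothT g) (h1 : ∫ x, g x = 1)
    (hS : S.a = dissMat g S.β) (hT : 0 < T) (R : ℝ) {ε : ℝ} (hε : 0 < ε) :
    ∃ δ : ℝ, 0 < δ ∧ ∀ u₀ v₀ : L2T, IsRealValued u₀ → IsMeanZero u₀ →
      IsRealValued v₀ → IsMeanZero v₀ → ‖u₀‖ ≤ R → ‖v₀‖ ≤ R → ‖u₀ - v₀‖ < δ →
      ∀ u v : ℝ → L2T, MemZT S.α S.β S.b T u → IsSolution S.α S.β g T u₀ u →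
        MemZT S.α S.β S.b T v → IsSolution S.α S.β g T v₀ v →
        ∀ t ∈ Icc 0 T, ‖u t - v t‖ < ε := by
  have hl := rootLen_pos
  -- `R` may be negative, whence the maximum. The factor `rootLen` converts the norm of `L²(𝕋)` into
  -- that of the unnormalised coefficients.
  obtain ⟨L, hL, hLip⟩ := S.exists_lipschitz (R := rootLen * max R 0) (by positivity) T
  refine ⟨ε / L, by positivity, fun u₀ v₀ hu hu' hv hv' huR hvR huv u v huZ hus hvZ hvs t ht => ?_⟩
  obtain ⟨h, H, e⟩ := Sol.of_isSolution hg h1 hS hT hus huZ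
  obtain ⟨h', H', e'⟩ := Sol.of_isSolution hg h1 hS hT hvs hvZ
  have hb : ∀ f : L2T, ‖f‖ ≤ R → ‖coef f‖ ≤ rootLen * max R 0 := fun f hf => by
    rw [norm_coef]
    gcongr
    exact hf.trans (le_max_left _ _)
  have h2 := hLip _ _ (realSeq_coef hu hu') (realSeq_coef hv hv') (hb _ huR) (hb _ hvR) h h' H H' t ht
  rw [← map_sub coef, norm_coef] at h2
  rw [e t ht, e' t ht, ← map_sub, norm_synth]
  calc rootLen⁻¹ * ‖S.ev t h - S.ev t h'‖ ≤ rootLen⁻¹ * (L * (rootLen * ‖u₀ - v₀‖)) := by gcongr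
    _ = L * ‖u₀ - v₀‖ := by field_simp
    _ < L * (ε / L) := by gcongr
    _ = ε := by field_simp

end Setting

end DGBO

end

/-! ### The main theorem -/

theorem theorem1 (α β : ℝ) (hα₁ : 1 < α) (hα₂ : α ≤ 2) (hβ₁ : 2 - α < β) (hβ₂ : β < α) :
    ∃ b₀ : ℝ, 1 / 2 < b₀ ∧ ∀ b : ℝ, 1 / 2 < b → b < b₀ →
      -- the continuous embedding of `Z^b_T` into `C([0,T]; L²)`
      (∃ C : NNReal, ∀ T : ℝ, 0 < T → ∀ v : ℝ → DGBO.L2T, DGBO.MemZT α β b T v →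
        ∃ w : ℝ → DGBO.L2T, ContinuousOn w (Icc 0 T) ∧
          (∀ᵐ t ∂(volume.restrict (Icc 0 T)), w t = v t) ∧
          ∀ t ∈ Icc 0 T, ‖w t‖ₑ ≤ C * DGBO.zTNorm α β b T v) ∧
      ∀ g : DGBO.Torus → ℝ, DGBO.SmoothT g → (∀ x, 0 ≤ g x) → (∫ x, g x = 1) →
        ∀ T : ℝ, 0 < T →
          -- existence and uniqueness
          (∀ v₀ : DGBO.L2T, DGBO.IsRealValued v₀ → DGBO.IsMeanZero v₀ →
            ∃ v : ℝ → DGBO.L2T,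
              DGBO.MemZT α β b T v ∧ DGBO.IsSolution α β g T v₀ v ∧
              (∀ t ∈ Icc 0 T, DGBO.IsRealValued (v t)) ∧
              ∀ w : ℝ → DGBO.L2T, DGBO.MemZT α β b T w → DGBO.IsSolution α β g T v₀ w →
                ∀ t ∈ Icc 0 T, w t = v t) ∧
          -- uniform continuity of the solution map on bounded sets
          (∀ R : ℝ, ∀ ε : ℝ, 0 < ε → ∃ δ : ℝ, 0 < δ ∧
            ∀ u₀ v₀ : DGBO.L2T, DGBO.IsRealValued u₀ → DGBO.IsMeanZero u₀ →
              DGBO.IsRealValued v₀ → DGBO.IsMeanZero v₀ →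
              ‖u₀‖ ≤ R → ‖v₀‖ ≤ R → ‖u₀ - v₀‖ < δ →
              ∀ u v : ℝ → DGBO.L2T,
                DGBO.MemZT α β b T u → DGBO.IsSolution α β g T u₀ u →
                DGBO.MemZT α β b T v → DGBO.IsSolution α β g T v₀ v →
                ∀ t ∈ Icc 0 T, ‖u t - v t‖ < ε) := by
  have hmin : 0 < min (min (((α + β) / 2 - 1) / 6) ((α - β) / 4)) (1 / 2) :=
    lt_min (lt_min (by linarith) (by linarith)) (by norm_num)
  -- The three bounds on `b - 1/2` come from the quadratic estimate, from the off-diagonal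
  -- dissipation, and from the condition `b ≤ 1`.
  refine ⟨1 / 2 + min (min (((α + β) / 2 - 1) / 6) ((α - β) / 4)) (1 / 2), by linarith,
    fun b hb hb₀ => ?_⟩
  have hη : b - 1 / 2 ≤ min (min (((α + β) / 2 - 1) / 6) ((α - β) / 4)) (1 / 2) := by linarith
  obtain ⟨h12, h3⟩ := le_min_iff.1 hη
  obtain ⟨h1, h2⟩ := le_min_iff.1 h12
  let E : DGBO.Exps := ⟨α, β, b, hα₁.le, hα₂, hβ₁, hβ₂, hb, by linarith, h1, h2⟩
  refine ⟨⟨(DGBO.rootLen⁻¹ * DGBO.evBound b + 1).toNNReal, fun T hT v hv =>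
    E.exists_continuous hT hv⟩, fun g hg _ hint T hT => ?_⟩
  obtain ⟨S, hSE, hS⟩ := DGBO.exists_setting hg hint E.β_pos E.β_le E rfl
  obtain ⟨rfl, rfl, rfl⟩ : α = S.α ∧ β = S.β ∧ b = S.b := by
    rw [hSE]
    exact ⟨rfl, rfl, rfl⟩
  exact ⟨fun v₀ hr hm => DGBO.Setting.exists_unique_solution hg hint hS hT hr hm,
    fun R ε hε => DGBO.Setting.uniformContinuous_solution hg hint hS hT R hε⟩
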